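/- **Conventions.** A *pivotal category* is a monoidal category with chosen two-sided duals $X^*$, with duality morphisms $\mathrm{ev}_X:X^*\otimes X\to 1$, $\mathrm{coev}_X:1\to X\otimes X^*$, $\widetilde{\mathrm{ev}}_X:X\otimes X^*\to 1$, $\widetilde{\mathrm{coev}}_X:1\to X^*\otimes X$, such that the left and the right dual functor coincide as monoidal functors. Let $\mathcal C$ be a pivotal fusion category over $\mathbb C$ and let $X\in\mathcal C$ be a $\otimes$-generator: every object is a direct summand of a direct sum of tensor products of copies of $X$ and $X^*$. Write $X^{+1}=X$, $X^{-1}=X^*$, and $X^{\epsilon}=X^{\epsilon_1}\otimes\cdots\otimes X^{\epsilon_r}$ for a finite sequence of signs $\epsilon$. An *oriented planar algebra* is a strict monoidal, strictly pivotal $\mathbb C$-linear category whose objects are the finite sequences of signs, with concatenation as tensor product; its morphisms are the linear strict monoidal functors which are the identity on objects and preserve the duality morphisms, and an *embedding* is a morphism injective on all Hom spaces. $\mathcal P_X$ is the oriented planar algebra with $\mathrm{Hom}(\epsilon,\delta)=\mathrm{Hom}_{\mathcal C}(X^{\epsilon},X^{\delta})$ and the structure of $\mathcal C$. Let $\Gamma$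 be a finite non-empty directed graph with vertex set $V$ (loops and multiple edges allowed), let $\lambda\in(\mathbb C^{\times})^V$, and fix square roots $r_v=\sqrt{\lambda_v}$. For an edge $e$ let $\bar e$ be $e$ reversed, of sign $-1$. An *$\epsilon$-path* is a path of edges and reversed edges with signs $\epsilon$. In $oGPA(\Gamma,\lambda)$, $\mathrm{Hom}(\epsilon,\delta)$ has as basis the pairs $(p,q)$ of an $\epsilon$-path $p$ and a $\delta$-path $q$ with common source and common target; $(p',q')\circ(p,q)=\delta_{q,p'}(p,q')$; $(p,q)\otimes(p',q')$ is $(pp',qq')$ if $p'$ and $q'$ start where $p$ and $q$ end, and $0$ otherwise; $(p,q)^\dagger=(q,p)$, extended antilinearly; and, with $s(e),t(e)$ the source and target of $e$, $$\mathrm{ev}_{(+,-)}=\sum_e\tfrac{r_{t(e)}}{r_{s(e)}}\big((e,\bar e),s(e)\big),\quad \mathrm{coev}_{(+,-)}=\sum_e\tfrac{r_{t(e)}}{r_{s(e)}}\big(s(e),(e,\bar e)\big),$$ $$\mathrm{ev}_{(-,+)}=\sum_e\tfrac{r_{s(e)}}{r_{t(e)}}\big((\bar e,e),t(e)\big),\quad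 \mathrm{coev}_{(-,+)}=\sum_e\tfrac{r_{s(e)}}{r_{t(e)}}\big(t(e),(\bar e,e)\big).$$ Module categories are semisimple $\mathbb C$-linear left module categories $\mathcal M$. Their simple objects $(M_i)_{i\in V}$, one from each isomorphism class, are labelled by the vertices, and $\mathcal M$ *has module fusion graph $\Gamma$ for $X$* if $\dim\mathrm{Hom}(M_i,X\otimes M_j)$ is the number of edges from $i$ to $j$, for all $i,j\in V$. $\mathcal M$ is *pivotal* if it has a module trace: linear maps $\Theta_m:\mathrm{End}(m)\to\mathbb C$, cyclic and non-degenerate, with $\Theta_{c\otimes m}(f)=\Theta_m(\text{partial trace of } f \text{ over } c)$. Its *weights* are $\Theta_{M_i}(\mathrm{id})$. A module category $\mathcal M$ and an embedding $\phi:\mathcal P_X\to oGPA(\Gamma,\lambda)$ *correspond* if for all signs $a$ and vertices $i,j$ there is a basis of $\mathrm{Hom}(M_i,X^a\otimes M_j)$ indexed by the edges of sign $a$ from $i$ to $j$ such that, with $b_p:M_i\to X^{\epsilon}\otimes M_j$ the composite of the basis elements along an $\epsilon$-path $p$ from $i$ to $j$, one has $(f\otimes\mathrm{id}_{M_j})\circ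 b_p=\sum_q\phi(f)_{p,q}\,b_q$ for all $f:X^\epsilon\to X^\delta$ and all $p$, where $\phi(f)=\sum\phi(f)_{p,q}(p,q)$. **Theorem.** (1) *(Pivotal case.)* For every $\lambda\in(\mathbb C^\times)^V$ and every choice of square roots $r_v=\sqrt{\lambda_v}$, the above correspondence induces a bijection between * semisimple pivotal module categories over $\mathcal C$ with module fusion graph $\Gamma$ for $X$ and a module trace of weights $\lambda$, up to equivalence of module categories respecting the labels of the simple objects, and * embeddings of oriented planar algebras $\mathcal P_X\to oGPA(\Gamma,\lambda)$, up to monoidal natural isomorphism. (2) *(Unitary case.)* Suppose that $\mathcal C$ is moreover unitary: it is a $C^*$-category with unitary associators and unitors, $(f\otimes g)^\dagger=f^\dagger\otimes g^\dagger$, and $\mathrm{ev}_X^\dagger=\widetilde{\mathrm{coev}}_X$, $\mathrm{coev}_X^\dagger=\widetilde{\mathrm{ev}}_X$ for all objects $X$. Let $\lambda$ be a positive (Frobenius–Perron) eigenvector of the adjacency matrix of $\Gamma$, with positive square roots. Then the above correspondence, with orthonormal bases, induces a bijection between * semisimple pivotal $C^*$-module categories over $\mathcal C$ with module fusion graph $\Gamma$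 for $X$ (the action is by $\dagger$-functors with unitary structure isomorphisms, and there is a positive module trace, of unspecified weights), up to unitary equivalence of module categories respecting the labels, and * $\dagger$-preserving embeddings $\mathcal P_X\to oGPA(\Gamma,\lambda)$, up to unitary monoidal natural isomorphism. In both cases there is likewise a bijection if module categories are taken up to arbitrary (unitary) equivalence, not necessarily respecting the labels, and embeddings are taken up to (unitary) monoidal natural isomorphism together with the action of the automorphisms of the directed graph $\Gamma$. -/

import Mathlib

open CategoryTheory MonoidalCategory Limits
open scoped MonoidalLeftAction ComplexConjugate

universe v u vD uD x w t

noncomputable section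

namespace OrientedGPA

/-! ### Pivotal categories, fusion categories, tensor generators -/

/-- A monoidal category in which every object `X` has a chosen two-sided dual `dual X`:
`dual X` is a left dual of `X` (by `left X`) and a right dual of `X` (by `right X`). -/
class Duality (C : Type u) [Category.{v} C] [MonoidalCategory C] where
  dual : C → C
  left (X : C) : ExactPairing X (dual X)
  right (X : C) : ExactPairing (dual X) X

section Duality

variable {C : Type u} [Category.{v} C] [MonoidalCategory C] [Duality C]

/-- The chosen dual `X*`. -/
abbrev dual (X : C) : C := Duality.dual X

/-- `X* ⊗ X ⟶ 𝟙`. -/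
def ev (X : C) : dual X ⊗ X ⟶ 𝟙_ C := (Duality.left X).evaluation'

/-- `𝟙 ⟶ X ⊗ X*`. -/
def coev (X : C) : 𝟙_ C ⟶ X ⊗ dual X := (Duality.left X).coevaluation'

/-- `X ⊗ X* ⟶ 𝟙`. -/
def evR (X : C) : X ⊗ dual X ⟶ 𝟙_ C := (Duality.right X).evaluation'

/-- `𝟙 ⟶ X* ⊗ X`. -/
def coevR (X : C) : 𝟙_ C ⟶ dual X ⊗ X := (Duality.right X).coevaluation'

/-- The left dual `f* : Y* ⟶ X*` of a morphism. -/
def leftTranspose {X Y : C} (f : X ⟶ Y) : dual Y ⟶ dual X :=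
  (ρ_ (dual Y)).inv ≫ dual Y ◁ (coev X ≫ f ▷ dual X) ≫ (α_ _ _ _).inv ≫
    ev Y ▷ dual X ≫ (λ_ (dual X)).hom

/-- The right dual of a morphism. -/
def rightTranspose {X Y : C} (f : X ⟶ Y) : dual Y ⟶ dual X :=
  (λ_ (dual Y)).inv ≫ (coevR X ≫ dual X ◁ f) ▷ dual Y ≫ (α_ _ _ _).hom ≫
    dual X ◁ evR Y ≫ (ρ_ (dual X)).hom

/-- The canonical map `(X ⊗ Y)* ⟶ Y* ⊗ X*` between left duals. -/
def leftDualTensor (X Y : C) : dual (X ⊗ Y) ⟶ dual Y ⊗ dual X :=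
  letI := Duality.left X
  letI := Duality.left Y
  (ρ_ (dual (X ⊗ Y))).inv ≫ dual (X ⊗ Y) ◁ η_ (X ⊗ Y) (dual Y ⊗ dual X) ≫ (α_ _ _ _).inv ≫
    ev (X ⊗ Y) ▷ (dual Y ⊗ dual X) ≫ (λ_ _).hom

/-- The canonical map `(X ⊗ Y)* ⟶ Y* ⊗ X*` between right duals. -/
def rightDualTensor (X Y : C) : dual (X ⊗ Y) ⟶ dual Y ⊗ dual X :=
  letI := Duality.right X
  letI := Duality.right Y
  (λ_ (dual (X ⊗ Y))).inv ≫ η_ (dual Y ⊗ dual X) (X ⊗ Y) ▷ dual (X ⊗ Y) ≫ (α_ _ _ _).hom ≫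
    (dual Y ⊗ dual X) ◁ evR (X ⊗ Y) ≫ (ρ_ _).hom

end Duality

/-- A pivotal category: a rigid monoidal category with distinguished two-sided duals for which the
left dual functor and the right dual functor coincide as monoidal functors. -/
class PivotalCategory (C : Type u) [Category.{v} C] [MonoidalCategory C] extends Duality C where
  transpose_eq {X Y : C} (f : X ⟶ Y) : leftTranspose f = rightTranspose f
  dualTensor_eq (X Y : C) : leftDualTensor X Y = rightDualTensor X Y
  dualUnit_eq : (ρ_ (dual (𝟙_ C))).inv ≫ ev (𝟙_ C) = (λ_ (dual (𝟙_ C))).inv ≫ evR (𝟙_ C)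

attribute [local instance] Abelian.hasFiniteBiproducts

/-- A semisimple `ℂ`-linear abelian category: finite-dimensional spaces of morphisms, and every
object is a finite direct sum of simple objects. -/
structure IsSemisimple (D : Type uD) [Category.{vD} D] [Abelian D] [Linear ℂ D] : Prop where
  finiteDimensional (A B : D) : FiniteDimensional ℂ (A ⟶ B)
  semisimple (A : D) : ∃ (n : ℕ) (Y : Fin n → D), (∀ i, Simple (Y i)) ∧ Nonempty (A ≅ ⨁ Y)

/-- A fusion category over `ℂ` (rigidity is part of `PivotalCategory`). -/
structure IsFusion (C : Type u) [Category.{v} C] [Abelian C] [Linear ℂ C] [MonoidalCategory C]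
    [MonoidalPreadditive C] [MonoidalLinear ℂ C] [PivotalCategory C] : Prop
    extends IsSemisimple C where
  simple_unit : Simple (𝟙_ C)
  finite_simples : ∃ (n : ℕ) (Y : Fin n → C), ∀ A : C, Simple A → ∃ i, Nonempty (A ≅ Y i)

section Words

variable {C : Type u} [Category.{v} C] [MonoidalCategory C]

/-- `X ^ (+1) = X` and `X ^ (-1) = X*`; the sign `+1` is `true`, the sign `-1` is `false`. -/
def signed [Duality C] (X : C) : Bool → C
  | true => X
  | false => dual X

/-- `X ^ ε = X ^ ε₁ ⊗ (X ^ ε₂ ⊗ (⋯ ⊗ 𝟙))`. -/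
def word [Duality C] (X : C) : List Bool → C
  | [] => 𝟙_ C
  | a :: l => signed X a ⊗ word X l

/-- The canonical isomorphism `X ^ ε ⊗ X ^ δ ≅ X ^ (ε δ)`. -/
def wordMul [Duality C] (X : C) : ∀ a b : List Bool, word X a ⊗ word X b ≅ word X (a ++ b)
  | [], b => λ_ (word X b)
  | s :: a, b => α_ (signed X s) (word X a) (word X b) ≪≫
      whiskerLeftIso (signed X s) (wordMul X a b)

/-- `X` is a `⊗`-generator: every object is a direct summand of a finite direct sum of tensor
products of copies of `X` and `X*`. -/
def IsTensorGenerator [Abelian C] [Duality C] (X : C) : Prop :=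
  ∀ A : C, ∃ (n : ℕ) (ε : Fin n → List Bool),
    Nonempty (Retract A (⨁ fun i => word X (ε i)))

end Words

/-! ### Oriented planar algebras and their morphisms

An oriented planar algebra is a strict monoidal, strictly pivotal `ℂ`-linear category whose objects
are the finite sequences of signs, with concatenation as tensor product.  `PlanarData` is the data
of such a category on which the notions of morphism and of natural isomorphism depend; the duality
morphisms of a general sequence are composed of those of the sequences of length one. -/

structure PlanarData where
  Hom : List Bool → List Bool → Type t
  [addCommGroup : ∀ a b, AddCommGroup (Hom a b)]
  [module : ∀ a b, Module ℂ (Hom a b)]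
  id (a : List Bool) : Hom a a
  /-- Composition, the first argument being applied first. -/
  comp {a b c : List Bool} : Hom a b → Hom b c → Hom a c
  tens {a b c d : List Bool} : Hom a b → Hom c d → Hom (a ++ c) (b ++ d)
  ev (s : Bool) : Hom [!s, s] []
  coev (s : Bool) : Hom [] [s, !s]

attribute [instance] PlanarData.addCommGroup PlanarData.module

/-- The data of an oriented planar algebra with a `†`-structure. -/
structure StarPlanarData extends PlanarData.{t} where
  dag {a b : List Bool} : Hom a b → Hom b a

/-- Morphisms of oriented planar algebras: `ℂ`-linear strict monoidal functors that are the identity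
on objects and preserve the duality morphisms. -/
structure PlanarMorphism (P : PlanarData.{t}) (Q : PlanarData.{w}) where
  map {a b : List Bool} : P.Hom a b →ₗ[ℂ] Q.Hom a b
  map_id (a : List Bool) : map (P.id a) = Q.id a
  map_comp {a b c : List Bool} (f : P.Hom a b) (g : P.Hom b c) :
    map (P.comp f g) = Q.comp (map f) (map g)
  map_tens {a b c d : List Bool} (f : P.Hom a b) (g : P.Hom c d) :
    map (P.tens f g) = Q.tens (map f) (map g)
  map_ev (s : Bool) : map (P.ev s) = Q.ev s
  map_coev (s : Bool) : map (P.coev s) = Q.coev s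

/-- Embeddings of oriented planar algebras: injective on all spaces of morphisms. -/
structure PlanarEmbedding (P : PlanarData.{t}) (Q : PlanarData.{w}) extends
    PlanarMorphism P Q where
  injective (a b : List Bool) : Function.Injective (map : P.Hom a b →ₗ[ℂ] Q.Hom a b)

/-- Embeddings of oriented unitary planar algebras preserve `†`. -/
structure StarPlanarEmbedding (P : StarPlanarData.{t}) (Q : StarPlanarData.{w}) extends
    PlanarEmbedding P.toPlanarData Q.toPlanarData where
  map_dag {a b : List Bool} (f : P.Hom a b) : map (P.dag f) = Q.dag (map f)

/-- `η` is a monoidal natural transformation `F ⟶ G`; here `F` and `G` are the maps on morphisms of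
functors that are the identity on objects. -/
structure IsMonoidalNat {P : PlanarData.{t}} {Q : PlanarData.{w}}
    (F G : ∀ a b, P.Hom a b → Q.Hom a b) (η : ∀ a, Q.Hom a a) : Prop where
  natural {a b : List Bool} (f : P.Hom a b) : Q.comp (F a b f) (η b) = Q.comp (η a) (G a b f)
  unit : η [] = Q.id []
  tens (a b : List Bool) : η (a ++ b) = Q.tens (η a) (η b)

/-- Existence of a monoidal natural isomorphism `F ≅ G`. -/
def NatIsomorphic {P : PlanarData.{t}} {Q : PlanarData.{w}}
    (F G : ∀ a b, P.Hom a b → Q.Hom a b) : Prop :=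
  ∃ η θ : ∀ a, Q.Hom a a, IsMonoidalNat F G η ∧
    ∀ a, Q.comp (η a) (θ a) = Q.id a ∧ Q.comp (θ a) (η a) = Q.id a

/-- Existence of a unitary monoidal natural isomorphism `F ≅ G`. -/
def UnitarilyNatIsomorphic {P : PlanarData.{t}} {Q : StarPlanarData.{w}}
    (F G : ∀ a b, P.Hom a b → Q.Hom a b) : Prop :=
  ∃ η : ∀ a, Q.Hom a a, IsMonoidalNat (Q := Q.toPlanarData) F G η ∧
    ∀ a, Q.comp (η a) (Q.dag (η a)) = Q.id a ∧ Q.comp (Q.dag (η a)) (η a) = Q.id a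

/-! ### The planar algebra of an object of a pivotal category -/

section PlanarAlgebraOf

variable {C : Type u} [Category.{v} C] [MonoidalCategory C]

/-- The oriented planar algebra generated by `X` and `X*`. -/
def planarAlgebraOf [Preadditive C] [Linear ℂ C] [Duality C] (X : C) : PlanarData.{v} where
  Hom a b := word X a ⟶ word X b
  id a := 𝟙 (word X a)
  comp f g := f ≫ g
  tens {a b c d} f g := (wordMul X a c).inv ≫ (f ⊗ₘ g) ≫ (wordMul X b d).hom
  ev
    | true => dual X ◁ (ρ_ X).hom ≫ ev X
    | false => X ◁ (ρ_ (dual X)).hom ≫ evR X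
  coev
    | true => coev X ≫ X ◁ (ρ_ (dual X)).inv
    | false => coevR X ≫ dual X ◁ (ρ_ X).inv

end PlanarAlgebraOf

/-! ### The oriented graph planar algebra -/

section Graph

variable {V : Type w} [Quiver.{x} V]

/-- Edges of sign `a` from `i` to `j` in the signed graph: the edges of the graph have sign `true`,
the reversed edges have sign `false`. -/
def SEdge (V : Type w) [Quiver.{x} V] : Bool → V → V → Type x
  | true, i, j => (i ⟶ j)
  | false, i, j => (j ⟶ i)

/-- `ε`-paths from `i` to `j`. -/
inductive EPath (V : Type w) [Quiver.{x} V] : List Bool → V → V → Type (max w x)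
  | nil (i : V) : EPath V [] i i
  | cons {a : Bool} {l : List Bool} {i j k : V} (e : SEdge V a i j) (p : EPath V l j k) :
      EPath V (a :: l) i k

/-- Concatenation of paths. -/
def EPath.append : ∀ {a b : List Bool} {i j k : V}, EPath V a i j → EPath V b j k →
    EPath V (a ++ b) i k
  | _, _, _, _, _, .nil _, q => q
  | _, _, _, _, _, .cons e p, q => .cons e (p.append q)

/-- The path `(e, ē)`. -/
def EPath.roundTrip {i j : V} (e : i ⟶ j) : EPath V [true, false] i i :=
  .cons (a := true) (i := i) (j := j) e (.cons (a := false) (i := j) (j := i) e (.nil i))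

/-- The path `(ē, e)`. -/
def EPath.roundTripRev {i j : V} (e : i ⟶ j) : EPath V [false, true] j j :=
  .cons (a := false) (i := j) (j := i) e (.cons (a := true) (i := i) (j := j) e (.nil j))

theorem SEdge.finite [∀ i j : V, Finite (i ⟶ j)] (a : Bool) (i j : V) : Finite (SEdge V a i j) := by
  cases a
  · exact inferInstanceAs (Finite (j ⟶ i))
  · exact inferInstanceAs (Finite (i ⟶ j))

theorem EPath.finite [Finite V] [∀ i j : V, Finite (i ⟶ j)] (l : List Bool) :
    ∀ i j : V, Finite (EPath V l i j) := by
  induction l with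
  | nil =>
    intro i j
    have : Subsingleton (EPath V [] i j) := ⟨by rintro ⟨⟩ ⟨⟩; rfl⟩
    infer_instance
  | cons a l ih =>
    intro i j
    have := fun i k : V => SEdge.finite a i k
    refine Finite.of_surjective
      (fun z : Σ k : V, SEdge V a i k × EPath V l k j => EPath.cons z.2.1 z.2.2) ?_
    rintro ⟨⟩
    exact ⟨⟨_, _, _⟩, rfl⟩

instance [Finite V] [∀ i j : V, Finite (i ⟶ j)] (l : List Bool) (i j : V) :
    Fintype (EPath V l i j) :=
  have := EPath.finite l i j
  Fintype.ofFinite _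

instance [∀ i j : V, Finite (i ⟶ j)] (i j : V) : Fintype (i ⟶ j) := Fintype.ofFinite _

/-- The space with basis the pairs `(p, q)` of an `a`-path `p` and a `b`-path `q` with the same
source and the same target; an element is given by its coefficients. -/
abbrev GHom (V : Type w) [Quiver.{x} V] (a b : List Bool) : Type (max w x) :=
  ∀ i j : V, EPath V a i j → EPath V b i j → ℂ

open Classical in
/-- The basis element `(p, q)`. -/
def GHom.single {a b : List Bool} {i j : V} (p : EPath V a i j) (q : EPath V b i j) : GHom V a b :=
  fun i' j' p' q' =>
    if (⟨i, j, p, q⟩ : Σ i j : V, EPath V a i j × EPath V b i j) = ⟨i', j', p', q'⟩ then 1 else 0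

open Classical in
/-- The oriented graph planar algebra of a finite directed graph with vertex set `V`.  The vector
`r` lists square roots `r v = √(lam v)` of the weights `lam v` of the vertices, so that
`r i / r j = √(lam i / lam j)`. -/
def oGPA (V : Type w) [Quiver.{x} V] [Fintype V] [∀ i j : V, Finite (i ⟶ j)] (r : V → ℂ) :
    StarPlanarData.{max w x} where
  Hom a b := GHom V a b
  id _ := fun _ _ p q => if p = q then 1 else 0
  comp f g := fun i j p q => ∑ m, f i j p m * g i j m q
  tens f g :=
    ∑ i : V, ∑ k : V, ∑ j : V, ∑ p : EPath V _ i k, ∑ q : EPath V _ i k,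
      ∑ p' : EPath V _ k j, ∑ q' : EPath V _ k j,
        (f i k p q * g k j p' q') • GHom.single (p.append p') (q.append q')
  ev
    | true => ∑ i : V, ∑ j : V, ∑ e : i ⟶ j,
        (r i / r j) • GHom.single (EPath.roundTripRev e) (EPath.nil j)
    | false => ∑ i : V, ∑ j : V, ∑ e : i ⟶ j,
        (r j / r i) • GHom.single (EPath.roundTrip e) (EPath.nil i)
  coev
    | true => ∑ i : V, ∑ j : V, ∑ e : i ⟶ j,
        (r j / r i) • GHom.single (EPath.nil i) (EPath.roundTrip e)
    | false => ∑ i : V, ∑ j : V, ∑ e : i ⟶ j,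
        (r i / r j) • GHom.single (EPath.nil j) (EPath.roundTripRev e)
  dag f := fun i j p q => conj (f i j q p)

/-- `lam` is a positive (Frobenius–Perron) eigenvector of the adjacency matrix of the graph. -/
def IsFrobeniusPerron [Fintype V] (lam : V → ℝ) : Prop :=
  (∀ i, 0 < lam i) ∧ ∃ d : ℝ, ∀ i, ∑ j, (Nat.card (i ⟶ j) : ℝ) * lam j = d * lam i

/-- Automorphisms of a directed graph. -/
structure GraphAut (V : Type w) [Quiver.{x} V] where
  vert : V ≃ V
  edge (i j : V) : (i ⟶ j) ≃ (vert i ⟶ vert j)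

/-- The action of a graph automorphism on signed edges. -/
def GraphAut.sedge (σ : GraphAut V) : ∀ {a : Bool} {i j : V}, SEdge V a i j →
    SEdge V a (σ.vert i) (σ.vert j)
  | true, i, j => σ.edge i j
  | false, i, j => σ.edge j i

/-- The action of a graph automorphism on paths. -/
def GraphAut.path (σ : GraphAut V) : ∀ {a : List Bool} {i j : V}, EPath V a i j →
    EPath V a (σ.vert i) (σ.vert j)
  | _, _, _, .nil i => .nil (σ.vert i)
  | _, _, _, .cons e p => .cons (σ.sedge e) (σ.path p)

/-- The action of a graph automorphism on the spaces of morphisms: `(σ p, σ q) ↦ (p, q)`. -/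
def GraphAut.pull (σ : GraphAut V) {a b : List Bool} (f : GHom V a b) : GHom V a b :=
  fun _ _ p q => f _ _ (σ.path p) (σ.path q)

end Graph

/-! ### Module categories -/

section Modules

variable (C : Type u) [Category.{v} C] [Abelian C] [Linear ℂ C] [MonoidalCategory C]

/-- Semisimple (left) `C`-module categories whose simple objects are labelled by `V`: `simple` lists
each simple object exactly once up to isomorphism. -/
structure SemisimpleModule (V : Type w) where
  carrier : Type uD
  [category : Category.{vD} carrier]
  [abelian : Abelian carrier]
  [linear : Linear ℂ carrier]
  [action : MonoidalLeftAction C carrier]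
  isSemisimple : IsSemisimple carrier
  add_act {c c' : C} (f g : c ⟶ c') (m : carrier) : (f + g) ⊵ₗ m = f ⊵ₗ m + g ⊵ₗ m
  smul_act {c c' : C} (z : ℂ) (f : c ⟶ c') (m : carrier) : (z • f) ⊵ₗ m = z • f ⊵ₗ m
  act_add (c : C) {m m' : carrier} (f g : m ⟶ m') : c ⊴ₗ (f + g) = c ⊴ₗ f + c ⊴ₗ g
  act_smul (c : C) {m m' : carrier} (z : ℂ) (f : m ⟶ m') : c ⊴ₗ (z • f) = z • c ⊴ₗ f
  simple : V → carrier
  simple_simple (i : V) : Simple (simple i)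
  simple_inj (i j : V) : Nonempty (simple i ≅ simple j) → i = j
  simple_surj (m : carrier) : Simple m → ∃ i, Nonempty (m ≅ simple i)

attribute [instance] SemisimpleModule.category SemisimpleModule.abelian SemisimpleModule.linear
  SemisimpleModule.action

variable {C}

/-- The module fusion graph for `X` is the given graph: the edges from `i` to `j` number
`dim Hom(Mᵢ, X ⊗ Mⱼ)`, the `(i, j)` entry of the endofunctor `X ⊗ -`. -/
def SemisimpleModule.HasFusionGraph {V : Type w} [Quiver.{x} V]
    (M : SemisimpleModule.{v, u, vD, uD} C V) (X : C) : Prop :=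
  ∀ i j : V, Module.finrank ℂ (M.simple i ⟶ X ⊙ₗ M.simple j) = Nat.card (i ⟶ j)

section Trace

variable {D : Type uD} [Category.{vD} D] [Abelian D] [Linear ℂ D] [MonoidalLeftAction C D]

/-- The partial trace over `c` of an endomorphism of `c ⊗ m`. -/
def partialTrace [Duality C] (c : C) (m : D) (f : c ⊙ₗ m ⟶ c ⊙ₗ m) : m ⟶ m :=
  (λₗ[C] m).inv ≫ coevR c ⊵ₗ m ≫ (αₗ _ _ _).hom ≫ dual c ⊴ₗ f ≫ (αₗ _ _ _).inv ≫
    ev c ⊵ₗ m ≫ (λₗ[C] m).hom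

variable (C) in
/-- A module trace: the structure of a pivotal module category. -/
structure IsModuleTrace [Duality C] (Θ : ∀ m : D, (m ⟶ m) →ₗ[ℂ] ℂ) : Prop where
  cyclic {m n : D} (f : m ⟶ n) (g : n ⟶ m) : Θ m (f ≫ g) = Θ n (g ≫ f)
  nondegenerate {m n : D} (f : m ⟶ n) : (∀ g : n ⟶ m, Θ m (f ≫ g) = 0) → f = 0
  partialTrace (c : C) (m : D) (f : c ⊙ₗ m ⟶ c ⊙ₗ m) :
    Θ (c ⊙ₗ m) f = Θ m (OrientedGPA.partialTrace c m f)

end Trace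

/-- Semisimple pivotal module categories over `C` with module fusion graph `V` for `X`, the simple
object labelled by `i` having trace `lam i`. -/
structure PivotalModule [Duality C] (X : C) (V : Type w) [Quiver.{x} V] (lam : V → ℂ) extends
    SemisimpleModule.{v, u, vD, uD} C V where
  fusionGraph : toSemisimpleModule.HasFusionGraph X
  pivotal : ∃ Θ : ∀ m : carrier, (m ⟶ m) →ₗ[ℂ] ℂ, IsModuleTrace C Θ ∧
    ∀ i, Θ (simple i) (𝟙 (simple i)) = lam i

/-- `F` is an equivalence of module categories (with its structure isomorphisms in the instance
argument). -/
structure IsModuleEquivalence {V : Type w} {M M' : SemisimpleModule.{v, u, vD, uD} C V}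
    (F : M.carrier ⥤ M'.carrier) [F.LeftLinear C] : Prop where
  isEquivalence : F.IsEquivalence
  map_add {m n : M.carrier} (f g : m ⟶ n) : F.map (f + g) = F.map f + F.map g
  map_smul {m n : M.carrier} (z : ℂ) (f : m ⟶ n) : F.map (z • f) = z • F.map f

/-- `F` respects the labels of the simple objects. -/
def RespectsLabels {V : Type w} {M M' : SemisimpleModule.{v, u, vD, uD} C V}
    (F : M.carrier ⥤ M'.carrier) : Prop :=
  ∀ i, Nonempty (F.obj (M.simple i) ≅ M'.simple i)

/-- Equivalence of module categories. -/
def ModuleEquivalent {V : Type w} (M M' : SemisimpleModule.{v, u, vD, uD} C V) : Prop :=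
  ∃ (F : M.carrier ⥤ M'.carrier) (_ : F.LeftLinear C), IsModuleEquivalence F

/-- Equivalence of module categories with labelled simple objects. -/
def LabelledModuleEquivalent {V : Type w} (M M' : SemisimpleModule.{v, u, vD, uD} C V) : Prop :=
  ∃ (F : M.carrier ⥤ M'.carrier) (_ : F.LeftLinear C), IsModuleEquivalence F ∧ RespectsLabels F

/-! ### The correspondence -/

section Correspondence

variable [Duality C] {X : C} {V : Type w} [Quiver.{x} V]

/-- Morphisms `Mᵢ ⟶ X ^ a ⊗ Mⱼ` for all signed edges of sign `a` from `i` to `j`. -/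
abbrev EdgeMorphisms (M : SemisimpleModule.{v, u, vD, uD} C V) (X : C) :=
  ∀ (a : Bool) (i j : V), SEdge V a i j → (M.simple i ⟶ signed X a ⊙ₗ M.simple j)

/-- The signed edges of sign `a` from `i` to `j` index a basis of `Hom(Mᵢ, X ^ a ⊗ Mⱼ)`. -/
def IsEdgeBasis {M : SemisimpleModule.{v, u, vD, uD} C V} (β : EdgeMorphisms M X) : Prop :=
  ∀ (a : Bool) (i j : V), LinearIndependent ℂ (β a i j) ∧
    Submodule.span ℂ (Set.range (β a i j)) = ⊤

/-- The morphism `Mᵢ ⟶ X ^ ε ⊗ Mⱼ` of an `ε`-path from `i` to `j`. -/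
def pathMorphism {M : SemisimpleModule.{v, u, vD, uD} C V} (β : EdgeMorphisms M X) :
    ∀ {a : List Bool} {i j : V}, EPath V a i j → (M.simple i ⟶ word X a ⊙ₗ M.simple j)
  | _, _, _, .nil i => (λₗ[C] (M.simple i)).inv
  | _, _, _, .cons (a := s) (l := l) (i := i) (j := j) (k := k) e p =>
      β s i j e ≫ signed X s ⊴ₗ pathMorphism β p ≫
        (αₗ (signed X s) (word X l) (M.simple k)).inv

variable [Fintype V] [∀ i j : V, Finite (i ⟶ j)]

/-- `φ` records the action on `M` of the morphisms `X ^ ε ⟶ X ^ δ`: the coefficient of `φ f` at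
`(p, q)` is the coefficient at `q` of the image under `f` of the morphism of the path `p`. -/
def IsActionMatrix {M : SemisimpleModule.{v, u, vD, uD} C V} (β : EdgeMorphisms M X)
    (φ : ∀ a b : List Bool, (planarAlgebraOf X).Hom a b → GHom V a b) : Prop :=
  ∀ (a b : List Bool) (f : word X a ⟶ word X b) (i j : V) (p : EPath V a i j),
    pathMorphism β p ≫ f ⊵ₗ M.simple j = ∑ q : EPath V b i j, φ a b f i j p q • pathMorphism β q

/-- The module category `M` and `φ` correspond to each other: in suitable bases indexed by the
edges, `φ` is the action of `C` on `M`. -/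
def Corresponds (M : SemisimpleModule.{v, u, vD, uD} C V)
    (φ : ∀ a b : List Bool, (planarAlgebraOf X).Hom a b → GHom V a b) : Prop :=
  ∃ β : EdgeMorphisms M X, IsEdgeBasis β ∧ IsActionMatrix β φ

end Correspondence

end Modules

/-! ### The unitary setting -/

/-- A `C*`-category (with finite-dimensional spaces of morphisms, as in all the applications below):
a `ℂ`-linear category with an antilinear involution `†`, the identity on objects, such that
`f† f = 0` only for `f = 0` and every `f† f` is a positive element `g† g` of an endomorphism
algebra. -/
class CStarCategory (D : Type uD) [Category.{vD} D] [Preadditive D] [Linear ℂ D] where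
  dag {m n : D} : (m ⟶ n) → (n ⟶ m)
  dag_dag {m n : D} (f : m ⟶ n) : dag (dag f) = f
  dag_id (m : D) : dag (𝟙 m) = 𝟙 m
  dag_comp {m n k : D} (f : m ⟶ n) (g : n ⟶ k) : dag (f ≫ g) = dag g ≫ dag f
  dag_add {m n : D} (f g : m ⟶ n) : dag (f + g) = dag f + dag g
  dag_smul {m n : D} (z : ℂ) (f : m ⟶ n) : dag (z • f) = conj z • dag f
  definite {m n : D} (f : m ⟶ n) : f ≫ dag f = 0 → f = 0
  positive {m n : D} (f : m ⟶ n) : ∃ g : m ⟶ m, f ≫ dag f = g ≫ dag g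

/-- The adjoint of a morphism. -/
abbrev dag {D : Type uD} [Category.{vD} D] [Preadditive D] [Linear ℂ D] [CStarCategory D]
    {m n : D} (f : m ⟶ n) : n ⟶ m := CStarCategory.dag f

section Unitary

variable (C : Type u) [Category.{v} C] [Abelian C] [Linear ℂ C] [MonoidalCategory C]

/-- The monoidal structure and the pivotal structure are compatible with `†`: together with
`IsFusion`, this says that `C` is a unitary pivotal fusion category. -/
structure IsUnitaryPivotal [CStarCategory C] [Duality C] : Prop where
  dag_tensor {c c' d d' : C} (f : c ⟶ c') (g : d ⟶ d') : dag (f ⊗ₘ g) = dag f ⊗ₘ dag g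
  dag_associator (c c' c'' : C) : dag (α_ c c' c'').hom = (α_ c c' c'').inv
  dag_leftUnitor (c : C) : dag (λ_ c).hom = (λ_ c).inv
  dag_rightUnitor (c : C) : dag (ρ_ c).hom = (ρ_ c).inv
  dag_ev (c : C) : dag (ev c) = coevR c
  dag_coev (c : C) : dag (coev c) = evR c

variable {C}

/-- The oriented planar algebra generated by `X` and `X*`, with its `†`-structure. -/
def starPlanarAlgebraOf [CStarCategory C] [Duality C] (X : C) : StarPlanarData.{v} where
  toPlanarData := planarAlgebraOf X
  dag f := CStarCategory.dag f

/-- Semisimple pivotal `C*`-module categories over the unitary category `C` with module fusion graph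
`V` for `X`; the module trace is required to be positive. -/
structure UnitaryModule [CStarCategory C] [Duality C] (X : C) (V : Type w) [Quiver.{x} V] extends
    SemisimpleModule.{v, u, vD, uD} C V where
  [cstar : CStarCategory carrier]
  dag_act {c c' : C} (f : c ⟶ c') (m : carrier) : dag (f ⊵ₗ m) = dag f ⊵ₗ m
  act_dag (c : C) {m m' : carrier} (f : m ⟶ m') : dag (c ⊴ₗ f) = c ⊴ₗ dag f
  dag_assoc (c c' : C) (m : carrier) : dag (αₗ c c' m).hom = (αₗ c c' m).inv
  dag_unit (m : carrier) : dag (λₗ[C] m).hom = (λₗ[C] m).inv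
  fusionGraph : toSemisimpleModule.HasFusionGraph X
  pivotal : ∃ Θ : ∀ m : carrier, (m ⟶ m) →ₗ[ℂ] ℂ, IsModuleTrace C Θ ∧
    ∀ {m n : carrier} (f : m ⟶ n), f ≠ 0 → ∃ z : ℝ, 0 < z ∧ Θ m (f ≫ dag f) = z

attribute [instance] UnitaryModule.cstar

section

variable [CStarCategory C] [Duality C] {X : C} {V : Type w} [Quiver.{x} V]

/-- `F` is a `†`-functor with unitary structure isomorphisms. -/
structure IsUnitaryModuleFunctor {M M' : UnitaryModule.{v, u, vD, uD} X V}
    (F : M.carrier ⥤ M'.carrier) [F.LeftLinear C] : Prop where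
  map_dag {m n : M.carrier} (f : m ⟶ n) : F.map (dag f) = dag (F.map f)
  dag_lineator (c : C) (m : M.carrier) :
    dag (Functor.LaxLeftLinear.μₗ F c m) = Functor.OplaxLeftLinear.δₗ F c m

/-- Unitary equivalence of `C*`-module categories. -/
def UnitaryModuleEquivalent (M M' : UnitaryModule.{v, u, vD, uD} X V) : Prop :=
  ∃ (F : M.carrier ⥤ M'.carrier) (_ : F.LeftLinear C),
    IsModuleEquivalence (M := M.toSemisimpleModule) (M' := M'.toSemisimpleModule) F ∧
      IsUnitaryModuleFunctor F

/-- Unitary equivalence of `C*`-module categories with labelled simple objects. -/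
def LabelledUnitaryModuleEquivalent (M M' : UnitaryModule.{v, u, vD, uD} X V) : Prop :=
  ∃ (F : M.carrier ⥤ M'.carrier) (_ : F.LeftLinear C),
    IsModuleEquivalence (M := M.toSemisimpleModule) (M' := M'.toSemisimpleModule) F ∧
      RespectsLabels (M := M.toSemisimpleModule) (M' := M'.toSemisimpleModule) F ∧
        IsUnitaryModuleFunctor F

open Classical in
/-- The edge morphisms are orthonormal for `⟨f, g⟩ = g† f ∈ End(Mᵢ) = ℂ`. -/
def IsOrthonormal {M : UnitaryModule.{v, u, vD, uD} X V}
    (β : EdgeMorphisms M.toSemisimpleModule X) : Prop :=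
  ∀ (a : Bool) (i j : V) (e e' : SEdge V a i j),
    β a i j e ≫ CStarCategory.dag (D := M.carrier) (β a i j e') =
      if e = e' then 𝟙 (M.simple i) else 0

variable [Fintype V] [∀ i j : V, Finite (i ⟶ j)]

/-- `M` and `φ` correspond to each other through orthonormal bases indexed by the edges. -/
def UnitarilyCorresponds (M : UnitaryModule.{v, u, vD, uD} X V)
    (φ : ∀ a b : List Bool, (planarAlgebraOf X).Hom a b → GHom V a b) : Prop :=
  ∃ β : EdgeMorphisms M.toSemisimpleModule X, IsEdgeBasis β ∧ IsOrthonormal β ∧ IsActionMatrix β φ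

end

end Unitary

/-- `R` induces a bijection between the `r`-classes and the `s`-classes. -/
def InducesBijection {A : Type u} {B : Type v} (r : A → A → Prop) (s : B → B → Prop)
    (R : A → B → Prop) : Prop :=
  Equivalence r ∧ Equivalence s ∧
    ∃ Φ : Quot r ≃ Quot s, ∀ a b, Φ (Quot.mk r a) = Quot.mk s b ↔ R a b

end OrientedGPA

end

open OrientedGPA

noncomputable section

/-! From modules to matrices. Fix edge bases of the spaces Hom(M_i, X^a ⊗ M_j). By semisimplicity
the composites along ε-paths form a basis of Hom(M_i, X^ε ⊗ M_j) (`pathSum_bijective`), so a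
morphism X^ε → X^δ acts by a matrix indexed by pairs of paths, an element of the graph planar
algebra. Composition becomes the matrix product, and the tensor product acts on the two halves of a
concatenated path (`actionMatrix_comp`, `actionMatrix_tens`). The resulting functor is injective
because a fusion category acts faithfully on every simple object (`SemisimpleModule.act_injective`).

Duality morphisms. These go to the prescribed ones exactly when the bases for X and for X* are dual
to each other up to the factors in `IsEdgePairing`. A module trace with weights λ = r² equates the
traces of the two closures of an element of Hom(M_i, X ⊗ M_j) against one of Hom(M_j, X* ⊗ M_i).
Once the basis for X* is scaled so that `ev X` gives r_i/r_j, the identity λ_j r_i/r_j = r_i r_j =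
λ_i r_j/r_i forces the value r_j/r_i for `evR X`, and the zigzag identities force the coevaluations
(`exists_isEdgePairing`, `IsEdgePairing.actionMatrix_coev`). Conversely the same identity shows that
the trace with weights λ is compatible with X; pivotality carries this to tensor products, retracts
and sums, hence to every object, as X generates (`isTraceDual_word`, `isModuleTrace_weightTrace`).

From matrices to modules. A functor φ to the graph planar algebra makes C act on families W of
vector spaces indexed by the vertices: c sends W to the family whose value at i consists of the
natural transformations from Hom(c, X^a) to the W-valued functions on a-paths starting at i
(`natFam`). By Yoneda, words act as functions on paths; since X generates, the action is associative
up to isomorphism (`natFam.assocHom_surjective`). Transporting it to a skeleton of the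
finite-dimensional families gives the module category wanted. Conversely, any M corresponding to φ
maps to these families, fully faithfully and compatibly with the actions, by m ↦ (Hom(M_i, m))_i
(`homFamLinear`), and the objects reached are exactly those of finite dimension. Two module
categories with the same φ are therefore equivalent.

Bijection. The edge bases of one module differ by invertible matrices, which are precisely the
monoidal natural isomorphisms (`Corresponds.natIsomorphic`, `Corresponds.of_natIsomorphic`), and
`inducesBijection_of` assembles these facts. Without labels, an equivalence permutes the simple
objects; a permutation that preserves the numbers of edges extends to a graph automorphism
(`exists_graphAut`).

Unitary case. Every construction is repeated with Hermitian forms: orthonormal bases, isometric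
structure isomorphisms, orthogonal presentations of objects by words. The weights μ of the given
positive trace need not be λ. But μ is a left and a right eigenvector of the adjacency matrix, and a
sum of squares shows that λ and μ are proportional along each edge (`mul_eq_mul_of_eigenvectors`);
the pairing conditions see only such ratios. -/

namespace OrientedGPA

/-! ### Pairings in a pivotal category -/

section PivotalDuality

variable {C : Type u} [Category.{v} C] [MonoidalCategory C]

/-- The evaluation of `c ⊗ c'` against `d' ⊗ d`, built from pairings of `c` with `d` and of `c'`
with `d'`. -/
def evTensor {c d c' d' : C} (ε : d ⊗ c ⟶ 𝟙_ C) (ε' : d' ⊗ c' ⟶ 𝟙_ C) :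
    (d' ⊗ d) ⊗ (c ⊗ c') ⟶ 𝟙_ C :=
  (α_ d' d (c ⊗ c')).hom ≫ d' ◁ ((α_ d c c').inv ≫ ε ▷ c' ≫ (λ_ c').hom) ≫ ε'

section

variable [Duality C]

theorem leftTranspose_ev {X Y : C} (f : X ⟶ Y) :
    leftTranspose f ▷ X ≫ ev X = dual Y ◁ f ≫ ev Y := by
  have := @rightAdjointMate_comp_evaluation C _ _ X Y (@HasRightDual.mk _ _ _ X (dual X) (Duality.left X))
    (@HasRightDual.mk _ _ _ Y (dual Y) (Duality.left Y)) f
  convert! this using 2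
  simp only [leftTranspose, rightAdjointMate, coev, ev, MonoidalCategory.whiskerLeft_comp,
    Category.assoc]
  rfl

theorem rightTranspose_evR {X Y : C} (f : X ⟶ Y) :
    X ◁ rightTranspose f ≫ evR X = f ▷ dual Y ≫ evR Y := by
  have := @leftAdjointMate_comp_evaluation C _ _ X Y (@HasLeftDual.mk _ _ _ X (dual X) (Duality.right X))
    (@HasLeftDual.mk _ _ _ Y (dual Y) (Duality.right Y)) f
  convert! this using 2
  simp only [rightTranspose, leftAdjointMate, coevR, evR, comp_whiskerRight,
    Category.assoc]
  rfl

/-- `leftDualTensor X Y` is the mate of the identity of `X ⊗ Y` for two choices of its dual, the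
chosen one and the product of the chosen duals of the factors; mates intertwine evaluations. -/
theorem leftDualTensor_ev (X Y : C) :
    leftDualTensor X Y ▷ (X ⊗ Y) ≫ evTensor (ev X) (ev Y) = ev (X ⊗ Y) := by
  let _ := Duality.left X
  let _ := Duality.left Y
  have := @rightAdjointMate_comp_evaluation C _ _ (X ⊗ Y) (X ⊗ Y)
    (@HasRightDual.mk _ _ _ (X ⊗ Y) (dual Y ⊗ dual X) ExactPairing.tensor)
    (@HasRightDual.mk _ _ _ (X ⊗ Y) (dual (X ⊗ Y)) (Duality.left _)) (𝟙 _)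
  simp only [MonoidalCategory.whiskerLeft_id, Category.id_comp, rightAdjointMate,
    MonoidalCategory.id_whiskerRight] at this
  refine Eq.trans ?_ this
  congr 1
  rw [ExactPairing.tensor_evaluation, evTensor]
  change _ = 𝟙 _ ⊗≫ dual Y ◁ (ev X ▷ Y) ⊗≫ ev Y
  monoidal

theorem rightDualTensor_evR (X Y : C) :
    (X ⊗ Y) ◁ rightDualTensor X Y ≫ evTensor (evR Y) (evR X) = evR (X ⊗ Y) := by
  let _ := Duality.right X
  let _ := Duality.right Y
  have := @leftAdjointMate_comp_evaluation C _ _ (X ⊗ Y) (X ⊗ Y)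
    (@HasLeftDual.mk _ _ _ (X ⊗ Y) (dual Y ⊗ dual X) ExactPairing.tensor)
    (@HasLeftDual.mk _ _ _ (X ⊗ Y) (dual (X ⊗ Y)) (Duality.right _)) (𝟙 _)
  simp only [MonoidalCategory.whiskerLeft_id, Category.id_comp, leftAdjointMate,
    MonoidalCategory.id_whiskerRight] at this
  refine Eq.trans ?_ this
  congr 1
  rw [ExactPairing.tensor_evaluation, evTensor]
  change _ = 𝟙 _ ⊗≫ X ◁ (evR Y ▷ dual X) ⊗≫ evR X
  monoidal

theorem epi_leftDualTensor (X Y : C) : Epi (leftDualTensor X Y) := by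
  let _ := Duality.left X
  let _ := Duality.left Y
  have : leftDualTensor X Y = (rightDualIso (Duality.left (X ⊗ Y))
      (ExactPairing.tensor : ExactPairing (X ⊗ Y) (dual Y ⊗ dual X))).hom := by
    simp only [leftDualTensor, rightDualIso, rightAdjointMate, MonoidalCategory.whiskerLeft_id,
      Category.id_comp, MonoidalCategory.id_whiskerRight]
    rfl
  rw [this]
  infer_instance

theorem ev_coev_zigzag (X : C) :
    dual X ◁ coev X ≫ (α_ _ _ _).inv ≫ ev X ▷ dual X = (ρ_ (dual X)).hom ≫ (λ_ (dual X)).inv :=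
  (Duality.left X).coevaluation_evaluation'

theorem coev_ev_zigzag (X : C) :
    coev X ▷ X ≫ (α_ _ _ _).hom ≫ X ◁ ev X = (λ_ X).hom ≫ (ρ_ X).inv :=
  (Duality.left X).evaluation_coevaluation'

theorem evR_coevR_zigzag (X : C) :
    X ◁ coevR X ≫ (α_ _ _ _).inv ≫ evR X ▷ X = (ρ_ X).hom ≫ (λ_ X).inv :=
  (Duality.right X).coevaluation_evaluation'

theorem coevR_evR_zigzag (X : C) :
    coevR X ▷ dual X ≫ (α_ _ _ _).hom ≫ dual X ◁ evR X = (λ_ (dual X)).hom ≫ (ρ_ (dual X)).inv :=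
  (Duality.right X).evaluation_coevaluation'

/-- The pairings `ε` and `ε'` of `c` with `d` are induced from the chosen ones by one and the same
morphism `dual c ⟶ d`. -/
def DualCompatible {c d : C} (ε : d ⊗ c ⟶ 𝟙_ C) (ε' : c ⊗ d ⟶ 𝟙_ C) : Prop :=
  ∃ θ : dual c ⟶ d, θ ▷ c ≫ ε = ev c ∧ c ◁ θ ≫ ε' = evR c

theorem dualCompatible_self (X : C) : DualCompatible (ev X) (evR X) :=
  ⟨𝟙 _, by simp, by simp⟩

end

variable [PivotalCategory C]

/-- The axiom `dualUnit_eq` makes one comparison morphism serve both sides. -/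
theorem dualCompatible_unit : DualCompatible (λ_ (𝟙_ C)).hom (λ_ (𝟙_ C)).hom := by
  refine ⟨(ρ_ _).inv ≫ ev _, ?_, ?_⟩
  · rw [unitors_equal, rightUnitor_naturality]; simp
  · rw [PivotalCategory.dualUnit_eq, leftUnitor_naturality]; simp

/-- The comparison morphism is that of the tensor product followed by those of the factors. It works
for both pairings because `dualTensor_eq` identifies the left and the right comparison. -/
theorem dualCompatible_tensor {c d c' d' : C} {ε : d ⊗ c ⟶ 𝟙_ C} {ε₂ : c ⊗ d ⟶ 𝟙_ C}
    {ε' : d' ⊗ c' ⟶ 𝟙_ C} {ε₂' : c' ⊗ d' ⟶ 𝟙_ C}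
    (h : DualCompatible ε ε₂) (h' : DualCompatible ε' ε₂') :
    DualCompatible (evTensor ε ε') (evTensor ε₂' ε₂) := by
  obtain ⟨θ, h1, h2⟩ := h
  obtain ⟨θ', h1', h2'⟩ := h'
  refine ⟨leftDualTensor c c' ≫ (θ' ⊗ₘ θ), ?_, ?_⟩
  · rw [← leftDualTensor_ev, comp_whiskerRight, Category.assoc]
    congr 1
    rw [← h1, ← h1']
    calc _ = 𝟙 _ ⊗≫ dual c' ◁ θ ▷ c ▷ c' ⊗≫ (θ' ▷ ((d ⊗ c) ⊗ c') ≫ d' ◁ (ε ▷ c')) ⊗≫ ε' := by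
          simp only [evTensor, MonoidalCategory.tensorHom_def']; monoidal
      _ = _ := by rw [← whisker_exchange]; simp only [evTensor]; monoidal
  · rw [PivotalCategory.dualTensor_eq, ← rightDualTensor_evR, MonoidalCategory.whiskerLeft_comp,
      Category.assoc]
    congr 1
    rw [← h2, ← h2']
    calc _ = 𝟙 _ ⊗≫ c ◁ c' ◁ θ' ▷ dual c ⊗≫ c ◁ ((c' ⊗ d') ◁ θ ≫ ε₂' ▷ d) ⊗≫ ε₂ := by
          simp only [evTensor, MonoidalCategory.tensorHom_def]; monoidal
      _ = _ := by rw [whisker_exchange]; simp only [evTensor]; monoidal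

/-- This is the pivotal isomorphism X** → X. It is built from `ev (dual X)`, so its first property
is a zigzag; the second one needs the left and the right dual functor to agree on the morphism
`coevR X`. -/
theorem dualCompatible_swap (X : C) : DualCompatible (evR X) (ev X) := by
  let θ : dual (dual X) ⟶ X := (ρ_ _).inv ≫ dual (dual X) ◁ coevR X ≫ (α_ _ _ _).inv ≫
    ev (dual X) ▷ X ≫ (λ_ X).hom
  refine ⟨θ, ?_, ?_⟩
  · calc _ = 𝟙 _ ⊗≫ dual (dual X) ◁ coevR X ▷ dual X ⊗≫ (ev (dual X) ▷ (X ⊗ dual X) ≫ 𝟙_ C ◁ evR X) ⊗≫ 𝟙 _ := by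
          simp only [θ]; monoidal
      _ = 𝟙 _ ⊗≫ dual (dual X) ◁ (coevR X ▷ dual X ≫ (α_ _ _ _).hom ≫ dual X ◁ evR X) ⊗≫ ev (dual X) := by
          rw [← whisker_exchange]; monoidal
      _ = _ := by rw [coevR_evR_zigzag]; monoidal
  · let Z := dual X ⊗ X
    let d := dual X ⊗ dual (dual X)
    let hL : d ⟶ 𝟙_ C := dual X ◁ θ ≫ ev X
    let T := leftDualTensor (dual X) X
    have hu : (ρ_ (dual (𝟙_ C))).inv ≫ ev (𝟙_ C) = (λ_ (dual (𝟙_ C))).inv ≫ evR (𝟙_ C) :=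
      PivotalCategory.dualUnit_eq
    have h1 := leftTranspose_ev (coevR X)
    have h2 := rightTranspose_evR (coevR X)
    rw [← leftDualTensor_ev] at h1
    rw [← PivotalCategory.transpose_eq, ← rightDualTensor_evR, ← PivotalCategory.dualTensor_eq] at h2
    have e1 : d ◁ coevR X ≫ evTensor (ev (dual X)) (ev X) = (ρ_ d).hom ≫ hL := by
      simp only [evTensor, hL, θ, d]; monoidal
    have e2 : coevR X ▷ d ≫ evTensor (evR X) (evR (dual X)) = (λ_ d).hom ≫ evR (dual X) := by
      calc _ = 𝟙 _ ⊗≫ (coevR X ▷ dual X ≫ (α_ _ _ _).hom ≫ dual X ◁ evR X) ▷ dual (dual X) ⊗≫ evR (dual X) := by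
            simp only [evTensor, d]; monoidal
        _ = _ := by rw [coevR_evR_zigzag]; simp only [d]; monoidal
    -- After precomposition with the epimorphism `T`, both pairings become the transpose of `coevR
    -- X` followed by a functional on the dual of the unit; `dualUnit_eq` identifies the two
    -- functionals.
    have h3 : T ≫ hL = leftTranspose (coevR X) ≫ (ρ_ _).inv ≫ ev (𝟙_ C) := by
      have : (ρ_ _).hom ≫ T ≫ hL = leftTranspose (coevR X) ▷ _ ≫ ev (𝟙_ C) := by
        rw [h1, whisker_exchange_assoc, e1]; simp [T]
      rw [← cancel_epi (ρ_ _).hom, this]; simp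
    have h4 : T ≫ evR (dual X) = leftTranspose (coevR X) ≫ (λ_ _).inv ≫ evR (𝟙_ C) := by
      have : (λ_ _).hom ≫ T ≫ evR (dual X) = _ ◁ leftTranspose (coevR X) ≫ evR (𝟙_ C) := by
        rw [h2, ← whisker_exchange_assoc, e2]; simp [T]
      rw [← cancel_epi (λ_ _).hom, this]; simp
    rw [hu, ← h4] at h3
    have := epi_leftDualTensor (dual X) X
    exact (cancel_epi T).1 h3

theorem rightTranspose_evR' {X Y : C} (f : X ⟶ Y) :
    X ◁ leftTranspose f ≫ evR X = f ▷ dual Y ≫ evR Y := by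
  rw [PivotalCategory.transpose_eq, rightTranspose_evR]

end PivotalDuality

attribute [local instance] Abelian.hasFiniteBiproducts

/-! ### Semisimple categories and Schur's lemma -/

section Semisimple

variable {D : Type uD} [Category.{vD} D] [Abelian D] [Linear ℂ D]

theorem IsSemisimple.exists_decomposition (h : IsSemisimple D) (A : D) :
    ∃ (n : ℕ) (Y : Fin n → D) (π : ∀ k, A ⟶ Y k) (ι : ∀ k, Y k ⟶ A),
      (∀ k, Simple (Y k)) ∧ ∑ k, π k ≫ ι k = 𝟙 A := by
  obtain ⟨n, Y, hY, ⟨e⟩⟩ := h.semisimple A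
  refine ⟨n, Y, fun k => e.hom ≫ biproduct.π Y k, fun k => biproduct.ι Y k ≫ e.inv, hY, ?_⟩
  have h2 : ∑ k, (e.hom ≫ biproduct.π Y k) ≫ biproduct.ι Y k ≫ e.inv =
      e.hom ≫ (∑ k, biproduct.π Y k ≫ biproduct.ι Y k) ≫ e.inv := by
    rw [Preadditive.sum_comp, Preadditive.comp_sum]
    exact Finset.sum_congr rfl fun k _ => by simp only [Category.assoc]
  rw [h2, biproduct.total, Category.id_comp, e.hom_inv_id]

/-- `S` lists each simple object of a semisimple category exactly once up to isomorphism. -/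
structure IsSimpleReps {V : Type w} (S : V → D) : Prop where
  semisimple : IsSemisimple D
  simple (i : V) : Simple (S i)
  inj (i j : V) : Nonempty (S i ≅ S j) → i = j
  surj (m : D) : Simple m → ∃ i, Nonempty (m ≅ S i)

namespace IsSimpleReps

variable {V : Type w} {S : V → D}


theorem finite (hS : IsSimpleReps S) (A B : D) : FiniteDimensional ℂ (A ⟶ B) := hS.semisimple.finiteDimensional A B

theorem exists_decomposition (hS : IsSimpleReps S) (A : D) :
    ∃ (n : ℕ) (idx : Fin n → V) (π : ∀ k, A ⟶ S (idx k)) (ι : ∀ k, S (idx k) ⟶ A),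
      ∑ k, π k ≫ ι k = 𝟙 A := by
  obtain ⟨n, Y, π, ι, hY, h⟩ := hS.semisimple.exists_decomposition A
  choose idx e using fun k => hS.surj (Y k) (hY k)
  refine ⟨n, idx, fun k => π k ≫ (e k).some.hom, fun k => (e k).some.inv ≫ ι k, ?_⟩
  simpa using h

/-- Schur's lemma over the algebraically closed field ℂ. -/
theorem exists_scalar (hS : IsSimpleReps S) (i : V) (f : S i ⟶ S i) : ∃ z : ℂ, z • 𝟙 (S i) = f := by
  have := hS.simple i
  have := hS.finite (S i) (S i)
  exact endomorphism_simple_eq_smul_id ℂ f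

theorem id_ne_zero (hS : IsSimpleReps S) (i : V) : 𝟙 (S i) ≠ 0 := by
  have := hS.simple i
  exact id_nonzero (S i)

theorem toSpanSingleton_bijective (hS : IsSimpleReps S) (i : V) :
    Function.Bijective (LinearMap.toSpanSingleton ℂ (S i ⟶ S i) (𝟙 (S i))) :=
  ⟨LinearMap.ker_eq_bot.1 (LinearMap.ker_toSpanSingleton ℂ (hS.id_ne_zero i)),
    fun f => hS.exists_scalar i f⟩

/-- The scalar by which an endomorphism of a simple object acts. -/
def scal (hS : IsSimpleReps S) (i : V) : (S i ⟶ S i) ≃ₗ[ℂ] ℂ :=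
  (LinearEquiv.ofBijective _ (hS.toSpanSingleton_bijective i)).symm

@[simp]
theorem scal_smul_id (hS : IsSimpleReps S) (i : V) (f : S i ⟶ S i) : hS.scal i f • 𝟙 (S i) = f :=
  LinearEquiv.apply_symm_apply (LinearEquiv.ofBijective _ (hS.toSpanSingleton_bijective i)) f

@[simp]
theorem scal_id (hS : IsSimpleReps S) (i : V) : hS.scal i (𝟙 (S i)) = 1 := by
  have := hS.scal_smul_id i (𝟙 (S i))
  have h2 : (hS.scal i (𝟙 (S i)) - 1) • 𝟙 (S i) = 0 := by rw [sub_smul, this]; simp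
  rcases smul_eq_zero.1 h2 with h | h
  · exact sub_eq_zero.1 h
  · exact absurd h (hS.id_ne_zero i)

theorem comp_eq_smul (hS : IsSimpleReps S) (i : V) (f : S i ⟶ S i) {A : D} (g : S i ⟶ A) :
    f ≫ g = hS.scal i f • g := by
  conv_lhs => rw [← hS.scal_smul_id i f]
  simp only [Linear.smul_comp, Linear.comp_smul, Category.id_comp, Category.comp_id]

theorem scal_comp (hS : IsSimpleReps S) (i : V) (f g : S i ⟶ S i) :
    hS.scal i (f ≫ g) = hS.scal i f * hS.scal i g := by
  rw [hS.comp_eq_smul, map_smul, smul_eq_mul]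

theorem hom_eq_zero (hS : IsSimpleReps S) {i j : V} (h : i ≠ j) (f : S i ⟶ S j) : f = 0 := by
  have := hS.simple i
  have := hS.simple j
  by_contra hf
  have := isIso_of_hom_simple hf
  exact h (hS.inj i j ⟨asIso f⟩)

theorem hom_ext (hS : IsSimpleReps S) {A B : D} {f g : A ⟶ B} (h : ∀ i (x : S i ⟶ A), x ≫ f = x ≫ g) : f = g := by
  obtain ⟨n, idx, π, ι, hd⟩ := hS.exists_decomposition A
  rw [← Category.id_comp f, ← Category.id_comp g, ← hd]
  simp [Preadditive.sum_comp, h]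

theorem hom_ext' (hS : IsSimpleReps S) {A B : D} {f g : A ⟶ B} (h : ∀ i (x : B ⟶ S i), f ≫ x = g ≫ x) : f = g := by
  obtain ⟨n, idx, π, ι, hd⟩ := hS.exists_decomposition B
  rw [← Category.comp_id f, ← Category.comp_id g, ← hd]
  simp only [Preadditive.comp_sum, ← Category.assoc, h]

/-- Some morphism from `A` to a simple object detects `f`. By Schur's lemma its target is `S i` and
the composite is a nonzero scalar, which is divided out. -/
theorem exists_retraction (hS : IsSimpleReps S) {i : V} {A : D} (f : S i ⟶ A) (hf : f ≠ 0) :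
    ∃ g : A ⟶ S i, f ≫ g = 𝟙 (S i) := by
  have : ∃ j, ∃ x : A ⟶ S j, f ≫ x ≠ 0 := by
    by_contra! hx
    exact hf (hS.hom_ext' fun j x => by rw [hx, zero_comp])
  obtain ⟨j, x, hx⟩ := this
  obtain rfl : i = j := by
    by_contra hij
    exact hx (hS.hom_eq_zero hij _)
  refine ⟨(hS.scal i (f ≫ x))⁻¹ • x, ?_⟩
  have : hS.scal i (f ≫ x) ≠ 0 := by simpa using hx
  rw [Linear.comp_smul]
  nth_rewrite 2 [← hS.scal_smul_id i (f ≫ x)]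
  rw [smul_smul, inv_mul_cancel₀ this, one_smul]

theorem exists_section (hS : IsSimpleReps S) {i : V} {A : D} (f : A ⟶ S i) (hf : f ≠ 0) :
    ∃ g : S i ⟶ A, g ≫ f = 𝟙 (S i) := by
  have : ∃ j, ∃ x : S j ⟶ A, x ≫ f ≠ 0 := by
    by_contra! hx
    exact hf (hS.hom_ext fun j x => by rw [hx, comp_zero])
  obtain ⟨j, x, hx⟩ := this
  obtain rfl : j = i := by
    by_contra hij
    exact hx (hS.hom_eq_zero hij _)
  refine ⟨(hS.scal j (x ≫ f))⁻¹ • x, ?_⟩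
  have : hS.scal j (x ≫ f) ≠ 0 := by simpa using hx
  rw [Linear.smul_comp]
  nth_rewrite 2 [← hS.scal_smul_id j (x ≫ f)]
  rw [smul_smul, inv_mul_cancel₀ this, one_smul]

/-- Morphisms are the families of linear maps between the multiplicity spaces. -/
theorem exists_hom (hS : IsSimpleReps S) {A B : D} (t : ∀ i, (S i ⟶ A) →ₗ[ℂ] (S i ⟶ B)) :
    ∃ f : A ⟶ B, ∀ i x, x ≫ f = t i x := by
  obtain ⟨n, idx, π, ι, hd⟩ := hS.exists_decomposition A
  refine ⟨∑ k, π k ≫ t _ (ι k), fun i x => ?_⟩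
  have hx : x = ∑ k, (x ≫ π k) ≫ ι k := by
    simp only [Category.assoc, ← Preadditive.comp_sum, hd, Category.comp_id]
  conv_rhs => rw [hx, map_sum]
  rw [Preadditive.comp_sum]
  refine Finset.sum_congr rfl fun k _ => ?_
  rw [← Category.assoc]
  generalize x ≫ π k = y
  generalize ι k = z at *
  -- The decomposition of `A` drops out because the maps `t i` commute with morphisms between the
  -- chosen simple objects: these are scalars or zero.
  by_cases h : i = idx k
  · generalize idx k = j at *
    subst h
    rw [hS.comp_eq_smul, hS.comp_eq_smul, map_smul]
  · rw [hS.hom_eq_zero h y]; simp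

end IsSimpleReps

end Semisimple

/-! ### Faithfulness of the action -/

section ModuleBasics

variable {C : Type u} [Category.{v} C] [Abelian C] [Linear ℂ C] [MonoidalCategory C]
variable {V : Type w} (M : SemisimpleModule.{v, u, vD, uD} C V)

namespace SemisimpleModule

theorem reps : IsSimpleReps M.simple :=
  ⟨M.isSemisimple, M.simple_simple, M.simple_inj, M.simple_surj⟩

/-- The action of an object, as a linear map on morphisms. -/
def actR (c : C) {m m' : M.carrier} : (m ⟶ m') →ₗ[ℂ] (c ⊙ₗ m ⟶ c ⊙ₗ m') where
  toFun f := c ⊴ₗ f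
  map_add' := M.act_add c
  map_smul' z f := M.act_smul c z f

/-- The action on an object, as a linear map on morphisms. -/
def actL {c c' : C} (m : M.carrier) : (c ⟶ c') →ₗ[ℂ] (c ⊙ₗ m ⟶ c' ⊙ₗ m) where
  toFun f := f ⊵ₗ m
  map_add' f g := M.add_act f g m
  map_smul' z f := M.smul_act z f m

theorem act_sum {ι : Type*} (s : Finset ι) (c : C) {m m' : M.carrier} (f : ι → (m ⟶ m')) :
    c ⊴ₗ (∑ k ∈ s, f k) = ∑ k ∈ s, c ⊴ₗ f k := map_sum (M.actR c) f s

theorem sum_act {ι : Type*} (s : Finset ι) {c c' : C} (m : M.carrier) (f : ι → (c ⟶ c')) :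
    (∑ k ∈ s, f k) ⊵ₗ m = ∑ k ∈ s, f k ⊵ₗ m := map_sum (M.actL m) f s

theorem act_zero (c : C) (m m' : M.carrier) : c ⊴ₗ (0 : m ⟶ m') = 0 := map_zero (M.actR c)

/-- A module category over a fusion category is faithful on each simple object. -/
theorem act_injective [MonoidalPreadditive C] [MonoidalLinear ℂ C] [PivotalCategory C]
    (hC : IsFusion C) (i : V) {c c' : C} (f : c ⟶ c') (hf : f ⊵ₗ M.simple i = 0) : f = 0 := by
  by_contra hne
  -- The mate of `f` starts at the simple unit object, so if it is nonzero, one of its components in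
  -- simple summands is an isomorphism.
  let g : 𝟙_ C ⟶ dual c ⊗ c' := coevR c ≫ dual c ◁ f
  have hg : g ≠ 0 := by
    intro h0
    apply hne
    have : f = (ρ_ c).inv ≫ c ◁ g ≫ (α_ _ _ _).inv ≫ evR c ▷ c' ≫ (λ_ c').hom := by
      calc f = (ρ_ c).inv ≫ (c ◁ coevR c ≫ (α_ _ _ _).inv ≫ evR c ▷ c) ≫ (λ_ c).hom ≫ f := by
            rw [evR_coevR_zigzag]; simp
        _ = 𝟙 _ ⊗≫ c ◁ coevR c ⊗≫ (evR c ▷ c ≫ 𝟙_ C ◁ f) ⊗≫ 𝟙 _ := by monoidal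
        _ = _ := by rw [← whisker_exchange]; simp only [g]; monoidal
    rw [this, h0]
    simp
  obtain ⟨n, Y, π, ι, hY, hd⟩ := hC.toIsSemisimple.exists_decomposition (dual c ⊗ c')
  have : ∃ k, g ≫ π k ≠ 0 := by
    by_contra! h0
    apply hg
    rw [← Category.comp_id g, ← hd, Preadditive.comp_sum]
    refine Finset.sum_eq_zero fun k _ => ?_
    rw [← Category.assoc, h0, zero_comp]
  obtain ⟨k, hk⟩ := this
  have := hC.simple_unit
  have := hY k
  have := isIso_of_hom_simple hk
  -- This composite is the identity of the unit object, but it factors through `f` and so would act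
  -- on `M.simple i` by zero.
  have h1 : (g ≫ π k ≫ inv (g ≫ π k)) ⊵ₗ M.simple i = 0 := by
    simp only [g, Category.assoc, MonoidalLeftAction.comp_actionHomLeft,
      MonoidalLeftAction.whiskerLeft_actionHomLeft, hf, M.act_zero, zero_comp, comp_zero]
  rw [← Category.assoc, IsIso.hom_inv_id] at h1
  apply M.reps.id_ne_zero i
  have h2 := MonoidalLeftAction.actionUnitIso_hom_naturality (C := C) (𝟙 (M.simple i))
  have h3 : 𝟙 (M.simple i) = (λₗ[C] _).inv ≫ (𝟙 (𝟙_ C)) ⊵ₗ M.simple i ≫ (λₗ[C] _).hom := by simp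
  rw [h3, h1]; simp

end SemisimpleModule

end ModuleBasics

/-! ### Paths and the operations of the graph planar algebra -/

section Paths

variable {V : Type w} [Quiver.{x} V]

namespace EPath

/-- A path of positive length is an edge followed by a path. -/
def consEquiv (V : Type w) [Quiver.{x} V] (a : Bool) (l : List Bool) (i k : V) :
    (Σ j : V, SEdge V a i j × EPath V l j k) ≃ EPath V (a :: l) i k where
  toFun z := cons z.2.1 z.2.2
  invFun
    | cons (j := j) e p => ⟨j, e, p⟩
  left_inv _ := rfl
  right_inv
    | cons _ _ => rfl

/-- The two sign sequences fix the place of the cut, so the intermediate vertex is determined as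
well. -/
theorem append_inj {a b : List Bool} {i j k k' : V} (p : EPath V a i k) (p' : EPath V b k j)
    (q : EPath V a i k') (q' : EPath V b k' j) (h : p.append p' = q.append q') :
    (⟨k, p, p'⟩ : Σ k : V, EPath V a i k × EPath V b k j) = ⟨k', q, q'⟩ := by
  induction p with
  | nil i => cases q; cases h; rfl
  | cons e p ih =>
    cases q with
    | cons f q =>
      obtain ⟨rfl, h2, h3⟩ := (cons.injEq ..).mp (show cons e (p.append p') = cons f (q.append q') from h)
      cases h2
      have := ih _ _ (eq_of_heq h3)
      cases this
      rfl

theorem exists_append {a b : List Bool} {i j : V} (P : EPath V (a ++ b) i j) :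
    ∃ (k : V) (p : EPath V a i k) (q : EPath V b k j), P = p.append q := by
  induction a generalizing i with
  | nil => exact ⟨i, .nil i, P, rfl⟩
  | cons s a ih =>
    obtain ⟨⟨i', e, P'⟩, rfl⟩ := (consEquiv V s (a ++ b) i j).surjective P
    obtain ⟨k, p, q, rfl⟩ := ih P'
    exact ⟨k, .cons e p, q, rfl⟩

variable [Fintype V] [∀ i j : V, Finite (i ⟶ j)]

instance (a : Bool) (i j : V) : Fintype (SEdge V a i j) :=
  have := SEdge.finite (V := V) a i j
  Fintype.ofFinite _

variable {A : Type*} [AddCommMonoid A]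

theorem sum_nil (i : V) (F : ∀ k, EPath V [] i k → A) : ∑ k, ∑ p, F k p = F i (nil i) := by
  have h1 : ∀ k, k ≠ i → ∑ p, F k p = 0 := fun k hk =>
    Finset.sum_eq_zero fun p _ => by cases p; exact absurd rfl hk
  rw [Finset.sum_eq_single i (fun k _ hk => h1 k hk) (by simp)]
  exact Fintype.sum_eq_single (nil i) fun p hp => by cases p; exact absurd rfl hp

theorem sum_cons_fixed {a : Bool} {l : List Bool} (i k : V) (F : EPath V (a :: l) i k → A) :
    ∑ p, F p = ∑ j, ∑ e : SEdge V a i j, ∑ p : EPath V l j k, F (cons e p) := by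
  rw [← (consEquiv V a l i k).sum_comp, Fintype.sum_sigma]
  exact Finset.sum_congr rfl fun j _ => Fintype.sum_prod_type _

theorem sum_cons {a : Bool} {l : List Bool} (i : V) (F : ∀ k, EPath V (a :: l) i k → A) :
    ∑ k, ∑ p, F k p = ∑ j, ∑ e : SEdge V a i j, ∑ k, ∑ p : EPath V l j k, F k (cons e p) := by
  simp only [sum_cons_fixed]
  rw [Finset.sum_comm]
  exact Finset.sum_congr rfl fun j _ => Finset.sum_comm

theorem sum_append_fixed {a b : List Bool} (i j : V) (F : EPath V (a ++ b) i j → A) :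
    ∑ P, F P = ∑ k, ∑ p : EPath V a i k, ∑ q : EPath V b k j, F (p.append q) := by
  induction a generalizing i with
  | nil => exact (sum_nil i fun k p => ∑ q : EPath V b k j, F (p.append q)).symm
  | cons s a ih =>
    refine (sum_cons_fixed i j F).trans ?_
    rw [sum_cons i fun k p => ∑ q : EPath V b k j, F (p.append q)]
    refine Finset.sum_congr rfl fun i' _ => Finset.sum_congr rfl fun e _ => ?_
    exact ih i' fun P => F (cons e P)

theorem sum_append {a b : List Bool} (i : V) (F : ∀ j, EPath V (a ++ b) i j → A) :
    ∑ j, ∑ P, F j P = ∑ k, ∑ p : EPath V a i k, ∑ j, ∑ q : EPath V b k j, F j (p.append q) := by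
  simp only [sum_append_fixed]
  rw [Finset.sum_comm]
  exact Finset.sum_congr rfl fun j _ => Finset.sum_comm

end EPath

open Classical in
/-- The identity of the graph planar algebra. -/
def GHom.one (V : Type w) [Quiver.{x} V] (a : List Bool) : GHom V a a :=
  fun _ _ p q => if p = q then 1 else 0

theorem GHom.single_self {a b : List Bool} {i j : V} (p p' : EPath V a i j) (q q' : EPath V b i j)
    [Decidable (p = p' ∧ q = q')] :
    GHom.single p q i j p' q' = if p = p' ∧ q = q' then 1 else 0 := by
  unfold GHom.single
  congr 1
  simp

theorem GHom.single_of_ne {a b : List Bool} {i j i' j' : V} (p : EPath V a i j) (p' : EPath V a i' j')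
    (q : EPath V b i j) (q' : EPath V b i' j') (h : ¬ (i = i' ∧ j = j')) :
    GHom.single p q i' j' p' q' = 0 := by
  unfold GHom.single
  rw [if_neg]
  intro h2
  apply h
  cases h2
  exact ⟨rfl, rfl⟩

variable [Fintype V] [∀ i j : V, Finite (i ⟶ j)]

/-- Composition in the graph planar algebra. -/
def GHom.mul {a b c : List Bool} (f : GHom V a b) (g : GHom V b c) : GHom V a c :=
  fun i j p q => ∑ m, f i j p m * g i j m q

/-- The tensor product of the graph planar algebra. -/
def GHom.tensor {a b c d : List Bool} (f : GHom V a b) (g : GHom V c d) :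
    GHom V (a ++ c) (b ++ d) :=
  -- The vertex weights do not enter the tensor product, so the constant family `1` stands for every
  -- choice of square roots.
  (oGPA V 1).tens f g

/-- Unique cutting of paths leaves a single nonzero term in the defining sum. -/
theorem GHom.tensor_append {a b c d : List Bool} (f : GHom V a b) (g : GHom V c d) {i k j : V}
    (p : EPath V a i k) (p' : EPath V c k j) (q : EPath V b i k) (q' : EPath V d k j) :
    GHom.tensor f g i j (p.append p') (q.append q') = f i k p q * g k j p' q' := by
  classical
  simp only [GHom.tensor, oGPA, Finset.sum_apply, Pi.smul_apply, smul_eq_mul]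
  rw [Finset.sum_eq_single i, Finset.sum_eq_single k, Finset.sum_eq_single j,
    Finset.sum_eq_single p, Finset.sum_eq_single q, Finset.sum_eq_single p',
    Finset.sum_eq_single q']
  · rw [GHom.single_self]; simp
  all_goals first
    | (intro h; exact absurd (Finset.mem_univ _) h)
    | skip
  · intro q1 _ h
    rw [GHom.single_self, if_neg, mul_zero]
    rintro ⟨-, h2⟩
    have := EPath.append_inj _ _ _ _ h2
    cases this; exact h rfl
  · intro q1 _ h
    refine Finset.sum_eq_zero fun _ _ => ?_
    rw [GHom.single_self, if_neg, mul_zero]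
    rintro ⟨h2, -⟩
    have := EPath.append_inj _ _ _ _ h2
    cases this; exact h rfl
  · intro q1 _ h
    refine Finset.sum_eq_zero fun _ _ => Finset.sum_eq_zero fun _ _ => ?_
    rw [GHom.single_self, if_neg, mul_zero]
    rintro ⟨-, h2⟩
    have := EPath.append_inj _ _ _ _ h2
    cases this; exact h rfl
  · intro q1 _ h
    refine Finset.sum_eq_zero fun _ _ => Finset.sum_eq_zero fun _ _ => Finset.sum_eq_zero fun _ _ => ?_
    rw [GHom.single_self, if_neg, mul_zero]
    rintro ⟨h2, -⟩
    have := EPath.append_inj _ _ _ _ h2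
    cases this; exact h rfl
  · intro j' _ h
    refine Finset.sum_eq_zero fun _ _ => Finset.sum_eq_zero fun _ _ => Finset.sum_eq_zero fun _ _ =>
      Finset.sum_eq_zero fun _ _ => ?_
    rw [GHom.single_of_ne _ _ _ _ (fun h2 => h h2.2), mul_zero]
  · intro k' _ h
    refine Finset.sum_eq_zero fun j' _ => Finset.sum_eq_zero fun _ _ => Finset.sum_eq_zero fun _ _ =>
      Finset.sum_eq_zero fun _ _ => Finset.sum_eq_zero fun _ _ => ?_
    by_cases hj : j' = j
    · subst hj
      rw [GHom.single_self, if_neg, mul_zero]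
      rintro ⟨h2, -⟩
      have := EPath.append_inj _ _ _ _ h2
      cases this; exact h rfl
    · rw [GHom.single_of_ne _ _ _ _ (fun h2 => hj h2.2), mul_zero]
  · intro i' _ h
    refine Finset.sum_eq_zero fun k' _ => Finset.sum_eq_zero fun j' _ => Finset.sum_eq_zero fun _ _ =>
      Finset.sum_eq_zero fun _ _ => Finset.sum_eq_zero fun _ _ => Finset.sum_eq_zero fun _ _ => ?_
    rw [GHom.single_of_ne _ _ _ _ (fun h2 => h h2.1), mul_zero]

theorem GHom.tensor_append_of_ne {a b c d : List Bool} (f : GHom V a b) (g : GHom V c d)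
    {i k k' j : V} (h : k ≠ k')
    (p : EPath V a i k) (p' : EPath V c k j) (q : EPath V b i k') (q' : EPath V d k' j) :
    GHom.tensor f g i j (p.append p') (q.append q') = 0 := by
  classical
  simp only [GHom.tensor, oGPA, Finset.sum_apply, Pi.smul_apply, smul_eq_mul]
  refine Finset.sum_eq_zero fun i1 _ => Finset.sum_eq_zero fun k1 _ =>
    Finset.sum_eq_zero fun j1 _ => Finset.sum_eq_zero fun _ _ =>
      Finset.sum_eq_zero fun _ _ => Finset.sum_eq_zero fun _ _ => Finset.sum_eq_zero fun _ _ => ?_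
  by_cases hij : i1 = i ∧ j1 = j
  · obtain ⟨rfl, rfl⟩ := hij
    rw [GHom.single_self, if_neg, mul_zero]
    rintro ⟨h1, h2⟩
    have h1 := EPath.append_inj _ _ _ _ h1
    have h2 := EPath.append_inj _ _ _ _ h2
    cases h1; cases h2; exact h rfl
  · rw [GHom.single_of_ne _ _ _ _ hij, mul_zero]

theorem GHom.tensor_sum {a b c d : List Bool} (f : GHom V a b) (g : GHom V c d) {i k j : V}
    (p : EPath V a i k) (p' : EPath V c k j) {A : Type*} [AddCommGroup A] [Module ℂ A]
    (F : EPath V (b ++ d) i j → A) :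
    ∑ Q, GHom.tensor f g i j (p.append p') Q • F Q =
      ∑ q : EPath V b i k, ∑ q' : EPath V d k j, (f i k p q * g k j p' q') • F (q.append q') := by
  rw [EPath.sum_append_fixed, Finset.sum_eq_single k]
  · simp only [GHom.tensor_append]
  · intro k' _ h
    refine Finset.sum_eq_zero fun _ _ => Finset.sum_eq_zero fun _ _ => ?_
    rw [GHom.tensor_append_of_ne f g (Ne.symm h), zero_smul]
  · simp

end Paths

/-! ### Path bases and matrices of the action -/

section PathBases

open MonoidalLeftAction

variable {C : Type u} [Category.{v} C] [Abelian C] [Linear ℂ C] [MonoidalCategory C]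
variable [Duality C] {X : C} {V : Type w} [Quiver.{x} V]
variable {M : SemisimpleModule.{v, u, vD, uD} C V}

omit [Abelian C] [Linear ℂ C] [Duality C] in
theorem act_assoc_inv {D : Type uD} [Category.{vD} D] [MonoidalLeftAction C D] (c c' c'' : C)
    (m : D) : c ⊴ₗ (αₗ c' c'' m).inv ≫ (αₗ c (c' ⊗ c'') m).inv =
      (αₗ c c' (c'' ⊙ₗ m)).inv ≫ (αₗ (c ⊗ c') c'' m).inv ≫ (α_ c c' c'').hom ⊵ₗ m := by
  have h := associator_actionHom c c' c'' m
  rw [← cancel_mono (αₗ c (c' ⊗ c'') m).hom, ← cancel_mono (c ⊴ₗ (αₗ c' c'' m).hom)]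
  simp only [Category.assoc, h]
  simp

omit [Abelian C] [Linear ℂ C] [Duality C] in
-- The inductive step of `pathMorphism_append`, for abstract objects in place of words.
theorem act_comp_append {D : Type uD} [Category.{vD} D] [MonoidalLeftAction C D] {s c c' c'' : C}
    (h : c ⊗ c' ≅ c'') {m₀ m₁ m₂ m₃ : D} (e : m₀ ⟶ s ⊙ₗ m₁) (p : m₁ ⟶ c ⊙ₗ m₂)
    (q : m₂ ⟶ c' ⊙ₗ m₃) :
    e ≫ s ⊴ₗ (p ≫ c ⊴ₗ q ≫ (αₗ c c' m₃).inv ≫ h.hom ⊵ₗ m₃) ≫ (αₗ s c'' m₃).inv =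
      (e ≫ s ⊴ₗ p ≫ (αₗ s c m₂).inv) ≫ (s ⊗ c) ⊴ₗ q ≫ (αₗ (s ⊗ c) c' m₃).inv ≫
        (α_ s c c' ≪≫ whiskerLeftIso s h).hom ⊵ₗ m₃ := by
  simp only [Iso.trans_hom, whiskerLeftIso_hom, comp_actionHomLeft,
    whiskerLeft_actionHomLeft, actionHomRight_comp, Category.assoc, tensor_actionHomRight,
    Iso.inv_hom_id_assoc]
  rw [← reassoc_of% (act_assoc_inv s c c' m₃)]
  simp

omit [Abelian C] [Linear ℂ C] [Duality C] in
theorem act_nil_append {D : Type uD} [Category.{vD} D] [MonoidalLeftAction C D] {c : C}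
    {m₁ m₂ : D} (q : m₁ ⟶ c ⊙ₗ m₂) :
    q = (λₗ[C] m₁).inv ≫ (𝟙_ C) ⊴ₗ q ≫ (αₗ (𝟙_ C) c m₂).inv ≫ (λ_ c).hom ⊵ₗ m₂ := by
  simp

theorem pathMorphism_append (β : EdgeMorphisms M X) {a b : List Bool} {i j k : V}
    (p : EPath V a i j) (q : EPath V b j k) :
    pathMorphism β (p.append q) = pathMorphism β p ≫ word X a ⊴ₗ pathMorphism β q ≫
      (αₗ (word X a) (word X b) (M.simple k)).inv ≫ (wordMul X a b).hom ⊵ₗ M.simple k := by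
  induction p with
  | nil i => exact act_nil_append _
  | cons e p ih =>
    refine Eq.trans ?_ (act_comp_append (wordMul X _ b) (β _ _ _ e) (pathMorphism β p)
      (pathMorphism β q))
    rw [← ih]
    rfl

variable [Fintype V] [∀ i j : V, Finite (i ⟶ j)]

/-- Morphisms into `X ^ a ⊗ n` from their components along the signed edges. -/
def edgeSum (β : EdgeMorphisms M X) (a : Bool) (i : V) (n : M.carrier) :
    (∀ j, SEdge V a i j → (M.simple j ⟶ n)) →ₗ[ℂ] (M.simple i ⟶ signed X a ⊙ₗ n) where
  toFun y := ∑ j, ∑ e, β a i j e ≫ signed X a ⊴ₗ y j e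
  map_add' y z := by
    simp only [Pi.add_apply, M.act_add, Preadditive.comp_add, Finset.sum_add_distrib]
  map_smul' z y := by
    simp only [Pi.smul_apply, M.act_smul, Linear.comp_smul, Finset.smul_sum, RingHom.id_apply]

/-- For injectivity, composing with morphisms from `n` to simple objects turns the components into
scalars, and linear independence applies. For surjectivity, `n` is decomposed into simple objects
and each piece is expanded in the edge basis. -/
theorem edgeSum_bijective {β : EdgeMorphisms M X} (hβ : IsEdgeBasis β) (a : Bool) (i : V)
    (n : M.carrier) : Function.Bijective (edgeSum β a i n) := by
  constructor
  · rw [injective_iff_map_eq_zero]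
    intro y hy
    funext j e
    refine M.reps.hom_ext' fun j' z => ?_
    rw [Pi.zero_apply, Pi.zero_apply, zero_comp]
    by_cases hj : j = j'
    · subst hj
      have h1 : edgeSum β a i n y ≫ signed X a ⊴ₗ z = 0 := by rw [hy, zero_comp]
      simp only [edgeSum, LinearMap.coe_mk, AddHom.coe_mk, Preadditive.sum_comp, Category.assoc,
        ← actionHomRight_comp] at h1
      rw [Finset.sum_eq_single j] at h1
      · have h2 : ∀ e, β a i j e ≫ signed X a ⊴ₗ (y j e ≫ z) =
            M.reps.scal j (y j e ≫ z) • β a i j e := by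
          intro e
          conv_lhs => rw [← M.reps.scal_smul_id j (y j e ≫ z), M.act_smul]
          simp
        simp only [h2] at h1
        have h3 := Fintype.linearIndependent_iff.1 (hβ a i j).1 _ h1 e
        simpa using h3
      · intro j' _ h
        refine Finset.sum_eq_zero fun e _ => ?_
        rw [M.reps.hom_eq_zero h (_ ≫ _), M.act_zero, comp_zero]
      · simp
    · exact M.reps.hom_eq_zero hj _
  · intro f
    obtain ⟨N, idx, π, ι, hd⟩ := M.reps.exists_decomposition n
    have h1 : ∀ k, ∃ c : SEdge V a i (idx k) → ℂ,
        ∑ e, c e • β a i (idx k) e = f ≫ signed X a ⊴ₗ π k := fun k => by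
      have : f ≫ signed X a ⊴ₗ π k ∈ Submodule.span ℂ (Set.range (β a i (idx k))) := by
        rw [(hβ a i (idx k)).2]; trivial
      rwa [Submodule.mem_span_range_iff_exists_fun] at this
    choose c hc using h1
    classical
    let y : Fin N → ∀ j, SEdge V a i j → (M.simple j ⟶ n) := fun k j e =>
      if h : idx k = j then by subst h; exact c k e • ι k else 0
    refine ⟨∑ k, y k, ?_⟩
    rw [map_sum]
    calc ∑ k, edgeSum β a i n (y k) = ∑ k, (f ≫ signed X a ⊴ₗ π k) ≫ signed X a ⊴ₗ ι k := by
          refine Finset.sum_congr rfl fun k _ => ?_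
          rw [← hc]
          simp only [edgeSum, LinearMap.coe_mk, AddHom.coe_mk]
          rw [Finset.sum_eq_single (idx k)]
          · simp [y, M.act_smul, Preadditive.sum_comp]
          · intro j _ hj
            refine Finset.sum_eq_zero fun e _ => ?_
            simp only [y]
            rw [dif_neg (Ne.symm hj), M.act_zero, comp_zero]
          · simp
      _ = f := by
          simp only [Category.assoc, ← actionHomRight_comp]
          rw [← Preadditive.comp_sum, ← M.act_sum, hd]
          simp

/-- Morphisms into `X ^ w ⊗ n` from their components along the paths. -/
def pathSum (β : EdgeMorphisms M X) (w : List Bool) (i : V) (n : M.carrier) :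
    (∀ k, EPath V w i k → (M.simple k ⟶ n)) →ₗ[ℂ] (M.simple i ⟶ word X w ⊙ₗ n) where
  toFun y := ∑ k, ∑ p, pathMorphism β p ≫ word X w ⊴ₗ y k p
  map_add' y z := by
    simp only [Pi.add_apply, M.act_add, Preadditive.comp_add, Finset.sum_add_distrib]
  map_smul' z y := by
    simp only [Pi.smul_apply, M.act_smul, Linear.comp_smul, Finset.smul_sum, RingHom.id_apply]

theorem pathSum_apply (β : EdgeMorphisms M X) (w : List Bool) (i : V) (n : M.carrier)
    (y : ∀ k, EPath V w i k → (M.simple k ⟶ n)) :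
    pathSum β w i n y = ∑ k, ∑ p, pathMorphism β p ≫ word X w ⊴ₗ y k p := rfl

theorem pathSum_nil (β : EdgeMorphisms M X) (i : V) (n : M.carrier)
    (y : ∀ k, EPath V [] i k → (M.simple k ⟶ n)) :
    pathSum β [] i n y = y i (.nil i) ≫ (λₗ[C] n).inv := by
  rw [pathSum_apply, EPath.sum_nil i fun k p => pathMorphism β p ≫ word X [] ⊴ₗ y k p]
  simp [pathMorphism, word]

theorem pathSum_cons (β : EdgeMorphisms M X) (a : Bool) (l : List Bool) (i : V) (n : M.carrier)
    (y : ∀ k, EPath V (a :: l) i k → (M.simple k ⟶ n)) :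
    pathSum β (a :: l) i n y =
      edgeSum β a i (word X l ⊙ₗ n) (fun j e => pathSum β l j n fun k p => y k (.cons e p)) ≫
        (αₗ (signed X a) (word X l) n).inv := by
  rw [pathSum_apply, EPath.sum_cons i fun k p => pathMorphism β p ≫ word X (a :: l) ⊴ₗ y k p]
  simp only [edgeSum, LinearMap.coe_mk, AddHom.coe_mk, pathSum_apply, M.act_sum,
    Preadditive.comp_sum, Preadditive.sum_comp]
  refine Finset.sum_congr rfl fun j _ => Finset.sum_congr rfl fun e _ =>
    Finset.sum_congr rfl fun k _ => Finset.sum_congr rfl fun p _ => ?_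
  simp [pathMorphism, word]

theorem comp_hom_inv_cancel {D : Type uD} [Category.{vD} D] {A B B' : D} (f : A ⟶ B) (e : B ≅ B') :
    (f ≫ e.hom) ≫ e.inv = f := by simp

/-- Induction on the word: a path is an edge followed by a path, and `edgeSum_bijective` is applied
with the non-simple object `word X l ⊙ₗ n`. This is why `n` is arbitrary there. -/
theorem pathSum_bijective {β : EdgeMorphisms M X} (hβ : IsEdgeBasis β) (w : List Bool) (i : V)
    (n : M.carrier) : Function.Bijective (pathSum β w i n) := by
  induction w generalizing i with
  | nil =>
    constructor
    · rw [injective_iff_map_eq_zero]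
      intro y hy
      rw [pathSum_nil] at hy
      funext k p
      cases p
      exact (cancel_mono (λₗ[C] n).inv).1 (hy.trans zero_comp.symm)
    · intro f
      refine ⟨fun k p => by cases p; exact f ≫ (λₗ[C] n).hom, ?_⟩
      rw [pathSum_nil]
      exact comp_hom_inv_cancel f (λₗ[C] n)
  | cons a l ih =>
    constructor
    · rw [injective_iff_map_eq_zero]
      intro y hy
      rw [pathSum_cons] at hy
      have h1 := (cancel_mono (αₗ (signed X a) (word X l) n).inv).1 (hy.trans zero_comp.symm)
      have h2 := (injective_iff_map_eq_zero _).1 (edgeSum_bijective hβ a i _).1 _ h1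
      funext k p
      cases p with
      | cons e p =>
        have h3 := congrFun (congrFun h2 _) e
        have h4 := (injective_iff_map_eq_zero _).1 (ih _).1 _ h3
        exact congrFun (congrFun h4 _) p
    · intro f
      obtain ⟨z, hz⟩ := (edgeSum_bijective hβ a i _).2 (f ≫ (αₗ (signed X a) (word X l) n).hom)
      choose y hy using fun j e => (ih j).2 (z j e)
      refine ⟨fun k p => y _ ((EPath.consEquiv V a l i k).symm p).2.1 k
        ((EPath.consEquiv V a l i k).symm p).2.2, ?_⟩
      rw [pathSum_cons]
      change edgeSum β a i _ (fun j e => pathSum β l j n (y j e)) ≫ _ = f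
      simp only [hy]
      change edgeSum β a i _ z ≫ _ = f
      rw [hz]
      exact comp_hom_inv_cancel f (αₗ (signed X a) (word X l) n)

/-- The components along the paths of a morphism into `X ^ w ⊗ n`. -/
def pathCoord {β : EdgeMorphisms M X} (hβ : IsEdgeBasis β) (w : List Bool) (i : V) (n : M.carrier) :
    (M.simple i ⟶ word X w ⊙ₗ n) ≃ₗ[ℂ] (∀ k, EPath V w i k → (M.simple k ⟶ n)) :=
  (LinearEquiv.ofBijective _ (pathSum_bijective hβ w i n)).symm

theorem pathSum_pathCoord {β : EdgeMorphisms M X} (hβ : IsEdgeBasis β) {w : List Bool} {i : V}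
    {n : M.carrier} (f : M.simple i ⟶ word X w ⊙ₗ n) :
    pathSum β w i n (pathCoord hβ w i n f) = f :=
  (LinearEquiv.ofBijective _ (pathSum_bijective hβ w i n)).apply_symm_apply f

theorem pathCoord_pathSum {β : EdgeMorphisms M X} (hβ : IsEdgeBasis β) {w : List Bool} {i : V}
    {n : M.carrier} (y : ∀ k, EPath V w i k → (M.simple k ⟶ n)) :
    pathCoord hβ w i n (pathSum β w i n y) = y :=
  (LinearEquiv.ofBijective _ (pathSum_bijective hβ w i n)).symm_apply_apply y

/-- The coefficients of a morphism into `X ^ w ⊗ Mⱼ` in the basis of paths. -/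
def pathCoeff {β : EdgeMorphisms M X} (hβ : IsEdgeBasis β) {w : List Bool} {i j : V}
    (f : M.simple i ⟶ word X w ⊙ₗ M.simple j) (q : EPath V w i j) : ℂ :=
  M.reps.scal j (pathCoord hβ w i _ f j q)

theorem sum_pathCoeff {β : EdgeMorphisms M X} (hβ : IsEdgeBasis β) {w : List Bool} {i j : V}
    (f : M.simple i ⟶ word X w ⊙ₗ M.simple j) :
    ∑ q, pathCoeff hβ f q • pathMorphism β q = f := by
  conv_rhs => rw [← pathSum_pathCoord hβ f, pathSum_apply]
  rw [Finset.sum_eq_single j]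
  · refine Finset.sum_congr rfl fun q _ => ?_
    rw [← M.reps.scal_smul_id j (pathCoord hβ w i _ f j q), M.act_smul]
    simp [pathCoeff]
  · intro k _ h
    refine Finset.sum_eq_zero fun e _ => ?_
    rw [M.reps.hom_eq_zero h (pathCoord hβ w i _ f k e), M.act_zero, comp_zero]
  · simp

theorem pathCoeff_sum {β : EdgeMorphisms M X} (hβ : IsEdgeBasis β) {w : List Bool} {i j : V}
    (c : EPath V w i j → ℂ) : pathCoeff hβ (∑ q, c q • pathMorphism β q) = c := by
  classical
  have h1 : ∑ q, c q • pathMorphism β q = pathSum β w i (M.simple j) (fun k q =>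
      if h : k = j then by subst h; exact c q • 𝟙 _ else 0) := by
    rw [pathSum_apply, Finset.sum_eq_single j]
    · simp [M.act_smul]
    · intro k _ h
      refine Finset.sum_eq_zero fun e _ => ?_
      rw [dif_neg h, M.act_zero, comp_zero]
    · simp
  funext q
  rw [pathCoeff, h1, pathCoord_pathSum]
  simp

theorem pathMorphism_sum_inj {β : EdgeMorphisms M X} (hβ : IsEdgeBasis β) {w : List Bool} {i j : V}
    {c d : EPath V w i j → ℂ} (h : ∑ q, c q • pathMorphism β q = ∑ q, d q • pathMorphism β q) :
    c = d := by
  rw [← pathCoeff_sum hβ c, h, pathCoeff_sum]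

/-- The matrix of `f` with respect to the path bases of `β'` (source) and `β` (target). -/
def actionMatrix (β' : EdgeMorphisms M X) {β : EdgeMorphisms M X} (hβ : IsEdgeBasis β)
    {a b : List Bool} (f : word X a ⟶ word X b) : GHom V a b :=
  fun i j p q => pathCoeff hβ (pathMorphism β' p ≫ f ⊵ₗ M.simple j : M.simple i ⟶ _) q

section

variable (β' : EdgeMorphisms M X) {β β₂ : EdgeMorphisms M X} (hβ : IsEdgeBasis β)
  (hβ₂ : IsEdgeBasis β₂)

theorem sum_actionMatrix {a b : List Bool} (f : word X a ⟶ word X b) {i j : V} (p : EPath V a i j) :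
    ∑ q, actionMatrix β' hβ f i j p q • pathMorphism β q = pathMorphism β' p ≫ f ⊵ₗ M.simple j :=
  sum_pathCoeff hβ _

/-- Coefficients in a basis are unique, so matrices are identified by verifying their defining
equation. The computations of action matrices below go through this. -/
theorem eq_actionMatrix {a b : List Bool} (f : word X a ⟶ word X b) (A : GHom V a b)
    (h : ∀ i j (p : EPath V a i j),
      pathMorphism β' p ≫ f ⊵ₗ M.simple j = ∑ q, A i j p q • pathMorphism β q) :
    A = actionMatrix β' hβ f := by
  funext i j p
  exact pathMorphism_sum_inj hβ ((h i j p).symm.trans (sum_actionMatrix β' hβ f p).symm)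

theorem actionMatrix_id (a : List Bool) :
    actionMatrix β hβ (𝟙 (word X a)) = GHom.one V a := by
  classical
  symm
  refine eq_actionMatrix _ _ _ _ fun i j p => ?_
  simp [GHom.one]

/-- Allowing three different bases covers both functoriality of the action and, for identity
morphisms, composition of changes of basis. -/
theorem actionMatrix_comp {a b c : List Bool} (f : word X a ⟶ word X b)
    (g : word X b ⟶ word X c) : actionMatrix β' hβ₂ (f ≫ g) =
      GHom.mul (actionMatrix β' hβ f) (actionMatrix β hβ₂ g) := by
  symm
  refine eq_actionMatrix _ _ _ _ fun i j p => ?_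
  rw [comp_actionHomLeft, ← Category.assoc, ← sum_actionMatrix β' hβ, Preadditive.sum_comp]
  simp only [Linear.smul_comp, ← sum_actionMatrix β hβ₂ g, GHom.mul, Finset.smul_sum, Finset.sum_smul,
    smul_smul]
  rw [Finset.sum_comm]

/-- By the exchange law `f` acts on the first half of a concatenated path and `g` on the second,
with the intermediate vertex unchanged. -/
theorem actionMatrix_tens {a b c d : List Bool} (f : word X a ⟶ word X b)
    (g : word X c ⟶ word X d) :
    actionMatrix β' hβ ((wordMul X a c).inv ≫ (f ⊗ₘ g) ≫ (wordMul X b d).hom) =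
      GHom.tensor (actionMatrix β' hβ f) (actionMatrix β' hβ g) := by
  symm
  refine eq_actionMatrix _ _ _ _ fun i j P => ?_
  obtain ⟨k, p, p', rfl⟩ := EPath.exists_append P
  rw [GHom.tensor_sum, pathMorphism_append]
  have h : (f ⊗ₘ g) ⊵ₗ M.simple j = (αₗ _ _ _).hom ≫ f ⊵ₗ _ ≫ word X b ⊴ₗ g ⊵ₗ M.simple j ≫
      (αₗ _ _ _).inv := by
    simp [MonoidalCategory.tensorHom_def]
  simp only [comp_actionHomLeft, Category.assoc, hom_inv_actionHomLeft_assoc, h,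
    Iso.inv_hom_id_assoc, action_exchange_assoc]
  rw [← Category.assoc, ← sum_actionMatrix β' hβ f p, ← actionHomRight_comp_assoc,
    ← sum_actionMatrix β' hβ g p', M.act_sum]
  simp only [Preadditive.sum_comp, Preadditive.comp_sum, M.act_smul, Linear.smul_comp,
    Linear.comp_smul, pathMorphism_append, Finset.smul_sum, smul_smul]
  rw [Finset.sum_comm]
  exact Finset.sum_congr rfl fun _ _ => Finset.sum_congr rfl fun _ _ => by rw [mul_comm]

theorem actionMatrix_add {a b : List Bool} (f g : word X a ⟶ word X b) :
    actionMatrix β' hβ (f + g) = actionMatrix β' hβ f + actionMatrix β' hβ g := by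
  symm
  refine eq_actionMatrix _ _ _ _ fun i j p => ?_
  simp only [M.add_act, Preadditive.comp_add, ← sum_actionMatrix β' hβ, Pi.add_apply, add_smul,
    Finset.sum_add_distrib]

theorem actionMatrix_smul {a b : List Bool} (z : ℂ) (f : word X a ⟶ word X b) :
    actionMatrix β' hβ (z • f) = z • actionMatrix β' hβ f := by
  symm
  refine eq_actionMatrix _ _ _ _ fun i j p => ?_
  simp only [M.smul_act, Linear.comp_smul, ← sum_actionMatrix β' hβ, Pi.smul_apply, smul_assoc,
    Finset.smul_sum]

end

theorem IsActionMatrix.eq {β : EdgeMorphisms M X} (hβ : IsEdgeBasis β)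
    {φ : ∀ a b : List Bool, (planarAlgebraOf X).Hom a b → GHom V a b} (h : IsActionMatrix β φ)
    {a b : List Bool} (f : word X a ⟶ word X b) : φ a b f = actionMatrix β hβ f :=
  eq_actionMatrix _ hβ f _ fun i j p => h a b f i j p

end PathBases

/-- Under these conditions, being `r`-equivalent means being related by `R` to a common element of
`B`, and symmetrically for `s`; so `r` and `s` are automatically equivalence relations and `R`
descends to the quotients. -/
theorem inducesBijection_of {A : Type u} {B : Type v} {r : A → A → Prop} {s : B → B → Prop}
    {R : A → B → Prop} (h1 : ∀ a, ∃ b, R a b) (h2 : ∀ b, ∃ a, R a b)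
    (h3 : ∀ a b, R a b → ∀ a', r a a' ↔ R a' b) (h4 : ∀ a b, R a b → ∀ b', s b b' ↔ R a b') :
    InducesBijection r s R := by
  have hr : Equivalence r := by
    refine ⟨fun a => ?_, fun {a a'} h => ?_, fun {a a' a''} h h' => ?_⟩
    · obtain ⟨b, hb⟩ := h1 a
      exact (h3 a b hb a).2 hb
    · obtain ⟨b, hb⟩ := h1 a
      exact (h3 a' b ((h3 a b hb a').1 h) a).2 hb
    · obtain ⟨b, hb⟩ := h1 a
      exact (h3 a b hb a'').2 ((h3 a' b ((h3 a b hb a').1 h) a'').1 h')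
  have hs : Equivalence s := by
    refine ⟨fun b => ?_, fun {b b'} h => ?_, fun {b b' b''} h h' => ?_⟩
    · obtain ⟨a, hb⟩ := h2 b
      exact (h4 a b hb b).2 hb
    · obtain ⟨a, hb⟩ := h2 b
      exact (h4 a b' ((h4 a b hb b').1 h) b).2 hb
    · obtain ⟨a, hb⟩ := h2 b
      exact (h4 a b hb b'').2 ((h4 a b' ((h4 a b hb b').1 h) b'').1 h')
  choose f hf using h1
  choose g hg using h2
  refine ⟨hr, hs, ⟨Quot.map f fun a a' h => ?_, Quot.map g fun b b' h => ?_, ?_, ?_⟩, fun a b => ?_⟩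
  · exact (h4 a' _ ((h3 a _ (hf a) a').1 h) _).2 (hf a')
  · exact (h3 _ b' ((h4 _ b (hg b) b').1 h) _).2 (hg b')
  · rintro ⟨a⟩
    exact Quot.sound ((h3 _ _ (hg (f a)) a).2 (hf a))
  · rintro ⟨b⟩
    exact Quot.sound ((h4 _ _ (hf (g b)) b).2 (hg b))
  · refine Iff.trans ?_ (h4 a (f a) (hf a) b)
    exact ⟨fun h => hs.eqvGen_iff.1 (Quot.eqvGen_exact h), fun h => Quot.sound h⟩

/-! ### Interchange laws of the graph planar algebra -/

section GraphPlanarAlgebra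

variable {V : Type w} [Quiver.{x} V] [Fintype V] [∀ i j : V, Finite (i ⟶ j)]

theorem GHom.mul_assoc {a b c d : List Bool} (f : GHom V a b) (g : GHom V b c) (h : GHom V c d) :
    GHom.mul (GHom.mul f g) h = GHom.mul f (GHom.mul g h) := by
  funext i j p q
  simp only [GHom.mul, Finset.sum_mul, Finset.mul_sum]
  rw [Finset.sum_comm]
  simp only [_root_.mul_assoc]

theorem GHom.one_mul {a b : List Bool} (f : GHom V a b) :
    GHom.mul (GHom.one V a) f = f := by
  classical
  funext i j p q
  simp [GHom.one, GHom.mul]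

theorem GHom.mul_one {a b : List Bool} (f : GHom V a b) :
    GHom.mul f (GHom.one V b) = f := by
  classical
  funext i j p q
  simp [GHom.one, GHom.mul]

theorem GHom.tensor_one (a b : List Bool) :
    GHom.tensor (GHom.one V a) (GHom.one V b) = GHom.one V (a ++ b) := by
  classical
  funext i j P Q
  obtain ⟨k, p, p', rfl⟩ := EPath.exists_append P
  obtain ⟨k', q, q', rfl⟩ := EPath.exists_append Q
  by_cases hk : k = k'
  · subst hk
    rw [GHom.tensor_append]
    simp only [GHom.one]
    by_cases h : p = q ∧ p' = q'
    · obtain ⟨rfl, rfl⟩ := h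
      simp
    · rw [if_neg (c := p.append p' = q.append q')]
      · rw [not_and_or] at h
        rcases h with h | h <;> simp [h]
      · intro h'
        have := EPath.append_inj _ _ _ _ h'
        cases this
        exact h ⟨rfl, rfl⟩
  · rw [GHom.tensor_append_of_ne _ _ hk]
    simp only [GHom.one]
    rw [if_neg]
    intro h'
    have := EPath.append_inj _ _ _ _ h'
    cases this
    exact hk rfl

theorem GHom.tensor_mul {a b c a' b' c' : List Bool} (f : GHom V a b) (g : GHom V b c)
    (f' : GHom V a' b') (g' : GHom V b' c') :
    GHom.tensor (GHom.mul f g) (GHom.mul f' g') =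
      GHom.mul (GHom.tensor f f') (GHom.tensor g g') := by
  funext i j P Q
  obtain ⟨k, p, p', rfl⟩ := EPath.exists_append P
  obtain ⟨k', q, q', rfl⟩ := EPath.exists_append Q
  have h1 := GHom.tensor_sum f f' p p' fun R => GHom.tensor g g' i j R (q.append q')
  simp only [smul_eq_mul] at h1
  refine Eq.trans ?_ h1.symm
  by_cases hk : k = k'
  · subst hk
    rw [GHom.tensor_append]
    simp only [GHom.tensor_append]
    simp only [GHom.mul, Finset.sum_mul_sum]
    exact Finset.sum_congr rfl fun _ _ => Finset.sum_congr rfl fun _ _ => by ring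
  · simp only [GHom.tensor_append_of_ne _ _ hk, mul_zero, Finset.sum_const_zero]

/-- The inverse of a monoidal transformation is monoidal. -/
theorem GHom.inverse_tensor {η θ : ∀ a, GHom V a a} {a b : List Bool}
    (hη : η (a ++ b) = GHom.tensor (η a) (η b))
    (h1 : ∀ a, GHom.mul (η a) (θ a) = GHom.one V a)
    (h2 : ∀ a, GHom.mul (θ a) (η a) = GHom.one V a) :
    θ (a ++ b) = GHom.tensor (θ a) (θ b) := by
  calc θ (a ++ b) = GHom.mul (θ (a ++ b)) (GHom.tensor (GHom.mul (η a) (θ a))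
        (GHom.mul (η b) (θ b))) := by rw [h1, h1, GHom.tensor_one, GHom.mul_one]
    _ = _ := by rw [GHom.tensor_mul, ← GHom.mul_assoc, ← hη, h2, GHom.one_mul]

end GraphPlanarAlgebra

/-! ### Change of edge bases and natural isomorphisms -/

section ChangeOfBasis

open MonoidalLeftAction

variable {C : Type u} [Category.{v} C] [Abelian C] [Linear ℂ C] [MonoidalCategory C]
variable [Duality C] {X : C} {V : Type w} [Quiver.{x} V]
variable {M : SemisimpleModule.{v, u, vD, uD} C V}
variable [Fintype V] [∀ i j : V, Finite (i ⟶ j)]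
variable (r : V → ℂ) {φ ψ : ∀ a b : List Bool, (planarAlgebraOf X).Hom a b → GHom V a b}

/-- The components are the change-of-basis matrices, that is, matrices of identities with different
bases at source and target. Naturality is `f` composed with an identity on either side. -/
theorem isMonoidalNat_actionMatrix {β β' : EdgeMorphisms M X} (hβ : IsEdgeBasis β)
    (hφ : IsActionMatrix β φ) (hβ' : IsEdgeBasis β') (hψ : IsActionMatrix β' ψ) :
    IsMonoidalNat (P := planarAlgebraOf X) (Q := (oGPA V r).toPlanarData) φ ψ
      fun a => actionMatrix β hβ' (𝟙 (word X a)) where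
  natural {a b} f := by
    change (word X a ⟶ word X b) at f
    have e1 : φ a b f = actionMatrix β hβ f := hφ.eq hβ f
    have e2 : ψ a b f = actionMatrix β' hβ' f := hψ.eq hβ' f
    refine (congrArg (fun A => GHom.mul A _) e1).trans (Eq.trans ?_
      (congrArg (fun A => GHom.mul _ A) e2).symm)
    rw [← actionMatrix_comp, ← actionMatrix_comp, Category.id_comp, Category.comp_id]
  unit := by
    classical
    symm
    refine eq_actionMatrix _ _ _ _ fun i j p => ?_
    cases p
    simp only [oGPA, id_actionHomLeft, ite_smul, one_smul, zero_smul, Finset.sum_ite_eq,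
      Finset.mem_univ, if_true]
    exact Category.comp_id _
  tens a b := by
    refine Eq.trans ?_ (actionMatrix_tens β hβ' (𝟙 _) (𝟙 _))
    congr 1
    simp

theorem actionMatrix_id_comp_id {β β' : EdgeMorphisms M X} (hβ : IsEdgeBasis β)
    (hβ' : IsEdgeBasis β') (a : List Bool) :
    GHom.mul (actionMatrix β hβ' (𝟙 (word X a))) (actionMatrix β' hβ (𝟙 (word X a))) =
      GHom.one V a := by
  rw [← actionMatrix_comp, Category.id_comp, actionMatrix_id]

theorem Corresponds.natIsomorphic (h : Corresponds M φ) (h' : Corresponds M ψ) :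
    NatIsomorphic (P := planarAlgebraOf X) (Q := (oGPA V r).toPlanarData) φ ψ := by
  obtain ⟨β, hβ, hφ⟩ := h
  obtain ⟨β', hβ', hψ⟩ := h'
  exact ⟨_, fun a => actionMatrix β' hβ (𝟙 (word X a)), isMonoidalNat_actionMatrix r hβ hφ hβ' hψ,
    fun a => ⟨actionMatrix_id_comp_id hβ hβ' a, actionMatrix_id_comp_id hβ' hβ a⟩⟩

/-- The path consisting of a single edge. -/
def EPath.single {a : Bool} {i j : V} (e : SEdge V a i j) : EPath V [a] i j := EPath.cons e (EPath.nil j)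

theorem EPath.sum_single {A : Type*} [AddCommMonoid A] {a : Bool} {i j : V}
    (F : EPath V [a] i j → A) : ∑ p, F p = ∑ e : SEdge V a i j, F (.single e) := by
  rw [EPath.sum_cons_fixed, Finset.sum_eq_single j]
  · refine Finset.sum_congr rfl fun e _ => Fintype.sum_eq_single (EPath.nil j) fun p hp => ?_
    cases p
    exact absurd rfl hp
  · intro k _ hk
    refine Finset.sum_eq_zero fun e _ => Finset.sum_eq_zero fun p _ => ?_
    cases p
    exact absurd rfl hk
  · simp

/-- The edge morphisms transformed by a matrix. -/
def transformEdges (θ : ∀ a, GHom V a a) (β : EdgeMorphisms M X) : EdgeMorphisms M X :=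
  fun a i j e => ∑ e', θ [a] i j (.single e) (.single e') • β a i j e'

omit [Duality C] [Quiver.{x} V] [Fintype V] [∀ i j : V, Finite (i ⟶ j)] in
theorem SemisimpleModule.sum_comp_act_sum {ι κ : Type*} [Fintype ι] [Fintype κ] {c c' : C}
    {m₀ m₁ m₂ : M.carrier} (d : ι → ℂ) (e : ι → (m₀ ⟶ c ⊙ₗ m₁)) (b : κ → ℂ)
    (p : κ → (m₁ ⟶ c' ⊙ₗ m₂)) :
    (∑ k, d k • e k) ≫ c ⊴ₗ (∑ q, b q • p q) ≫ (αₗ c c' m₂).inv =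
      ∑ k, ∑ q, (d k * b q) • (e k ≫ c ⊴ₗ p q ≫ (αₗ c c' m₂).inv) := by
  simp only [M.act_sum, Preadditive.comp_sum, Preadditive.sum_comp, M.act_smul,
      Linear.comp_smul, Linear.smul_comp, Finset.smul_sum, smul_smul, Category.assoc]
  rw [Finset.sum_comm]
  exact Finset.sum_congr rfl fun _ _ => Finset.sum_congr rfl fun _ _ => by rw [mul_comm]

/-- Monoidality of `θ` is what lets its values at words of length one, the only ones used to
transform the edges, govern all paths. -/
theorem pathMorphism_transformEdges {θ : ∀ a, GHom V a a}
    (hu : θ [] = GHom.one V []) (ht : ∀ a b, θ (a ++ b) = GHom.tensor (θ a) (θ b))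
    (β : EdgeMorphisms M X) {a : List Bool} {i j : V} (p : EPath V a i j) :
    pathMorphism (transformEdges θ β) p = ∑ q, θ a i j p q • pathMorphism β q := by
  induction p with
  | nil i =>
    classical
    rw [hu]
    simp only [GHom.one, ite_smul, one_smul, zero_smul, Finset.sum_ite_eq, Finset.mem_univ, if_true]
    rfl
  | @cons s l i k j e p ih =>
    have h1 := GHom.tensor_sum (θ [s]) (θ l) (.single e) p fun q => pathMorphism β q
    rw [← ht [s] l] at h1
    refine Eq.trans ?_ h1.symm
    rw [EPath.sum_single]
    rw [pathMorphism, ih]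
    exact SemisimpleModule.sum_comp_act_sum _ _ _ _

/-- The inverse matrix recovers the old basis, so the new family spans; counting dimensions gives
independence. -/
theorem isEdgeBasis_transformEdges {η θ : ∀ a, GHom V a a}
    (h1 : ∀ a, GHom.mul (η a) (θ a) = GHom.one V a) {β : EdgeMorphisms M X}
    (hβ : IsEdgeBasis β) : IsEdgeBasis (transformEdges θ β) := by
  intro a i j
  have hs : Submodule.span ℂ (Set.range (transformEdges θ β a i j)) = ⊤ := by
    rw [eq_top_iff, ← (hβ a i j).2, Submodule.span_le]
    rintro _ ⟨e, rfl⟩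
    have h2 : β a i j e = ∑ e', η [a] i j (.single e) (.single e') • transformEdges θ β a i j e' := by
      classical
      simp only [transformEdges, Finset.smul_sum, smul_smul]
      rw [Finset.sum_comm]
      have h3 : ∀ e', ∑ m, η [a] i j (.single e) (.single m) * θ [a] i j (.single m) (.single e') =
          if e = e' then 1 else 0 := fun e' => by
        have := congrFun (congrFun (congrFun (congrFun (h1 [a]) i) j) (.single e)) (.single e')
        simp only [GHom.mul, GHom.one, EPath.sum_single] at this
        rw [this]
        simp [EPath.single]
      simp only [← Finset.sum_smul, h3]
      simp
    rw [h2]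
    exact Submodule.sum_mem _ fun e' _ => Submodule.smul_mem _ _ (Submodule.subset_span ⟨e', rfl⟩)
  have := M.isSemisimple.finiteDimensional (M.simple i) (signed X a ⊙ₗ M.simple j)
  refine ⟨linearIndependent_of_top_le_span_of_card_eq_finrank hs.ge ?_, hs⟩
  rw [Module.finrank_eq_card_basis (Module.Basis.mk (hβ a i j).1 (hβ a i j).2.ge)]

/-- The edges are transformed by the inverse `θ` and not by `η`: naturality of `η` from `φ` to `ψ`
amounts to θ φ = ψ θ, the equation `hn` in the proof. -/
theorem isActionMatrix_transformEdges {η θ : ∀ a, GHom V a a}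
    (hη : IsMonoidalNat (P := planarAlgebraOf X) (Q := (oGPA V r).toPlanarData) φ ψ η)
    (h : ∀ a, GHom.mul (η a) (θ a) = GHom.one V a ∧
      GHom.mul (θ a) (η a) = GHom.one V a)
    {β : EdgeMorphisms M X} (hφ : IsActionMatrix β φ) :
    IsActionMatrix (transformEdges θ β) ψ := by
  have ht : ∀ a b, θ (a ++ b) = GHom.tensor (θ a) (θ b) := fun a b =>
    GHom.inverse_tensor (hη.tens a b) (fun a => (h a).1) (fun a => (h a).2)
  have hu : θ [] = GHom.one V [] := by
    have : η [] = GHom.one V [] := hη.unit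
    rw [← (h []).1, this, GHom.one_mul]
  intro a b f i j p
  have hn : GHom.mul (θ a) (φ a b f) = GHom.mul (ψ a b f) (θ b) := by
    have h1 : GHom.mul (φ a b f) (η b) = GHom.mul (η a) (ψ a b f) := hη.natural f
    calc _ = GHom.mul (θ a) (GHom.mul (GHom.mul (φ a b f) (η b)) (θ b)) := by
          rw [GHom.mul_assoc, (h b).1, GHom.mul_one]
      _ = _ := by
          rw [h1, GHom.mul_assoc, ← GHom.mul_assoc, (h a).2, GHom.one_mul]
  simp only [pathMorphism_transformEdges hu ht, Preadditive.sum_comp, Linear.smul_comp,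
    hφ a b f, Finset.smul_sum, smul_smul]
  rw [Finset.sum_comm]
  conv_rhs => rw [Finset.sum_comm]
  refine Finset.sum_congr rfl fun n _ => ?_
  rw [← Finset.sum_smul, ← Finset.sum_smul]
  congr 1
  exact congrFun (congrFun (congrFun (congrFun hn i) j) p) n

theorem Corresponds.of_natIsomorphic (h : Corresponds M φ)
    (h' : NatIsomorphic (P := planarAlgebraOf X) (Q := (oGPA V r).toPlanarData) φ ψ) :
    Corresponds M ψ := by
  obtain ⟨β, hβ, hφ⟩ := h
  obtain ⟨η, θ, hη, hθ⟩ := h'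
  exact ⟨transformEdges θ β, isEdgeBasis_transformEdges (fun a => (hθ a).1) hβ,
    isActionMatrix_transformEdges r hη hθ hφ⟩

end ChangeOfBasis

/-! ### Adjoints and Hermitian forms on multiplicity spaces -/

section UnitaryReps

variable {D : Type uD} [Category.{vD} D] [Abelian D] [Linear ℂ D] [CStarCategory D]

theorem dag_dag {m n : D} (f : m ⟶ n) : dag (dag f) = f := CStarCategory.dag_dag f

theorem dag_id (m : D) : dag (𝟙 m) = 𝟙 m := CStarCategory.dag_id m

theorem dag_comp {m n k : D} (f : m ⟶ n) (g : n ⟶ k) : dag (f ≫ g) = dag g ≫ dag f :=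
  CStarCategory.dag_comp f g

theorem dag_add {m n : D} (f g : m ⟶ n) : dag (f + g) = dag f + dag g := CStarCategory.dag_add f g

theorem dag_smul {m n : D} (z : ℂ) (f : m ⟶ n) : dag (z • f) = conj z • dag f :=
  CStarCategory.dag_smul z f

theorem dag_sum {ι : Type*} (s : Finset ι) {m n : D} (f : ι → (m ⟶ n)) :
    dag (∑ k ∈ s, f k) = ∑ k ∈ s, dag (f k) :=
  map_sum (AddMonoidHom.mk' (fun f : m ⟶ n => dag f) dag_add) f s

namespace IsSimpleReps

variable {V : Type w} {S : V → D}

theorem scal_dag (hS : IsSimpleReps S) (i : V) (f : S i ⟶ S i) :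
    hS.scal i (dag f) = conj (hS.scal i f) := by
  conv_lhs => rw [← hS.scal_smul_id i f, dag_smul, dag_id, map_smul,
    hS.scal_id]
  simp

/-- The Hermitian form on the morphisms from a simple object. -/
def form (hS : IsSimpleReps S) {i : V} {m : D} (f g : S i ⟶ m) : ℂ := hS.scal i (f ≫ dag g)

theorem conj_form (hS : IsSimpleReps S) {i : V} {m : D} (f g : S i ⟶ m) :
    conj (hS.form f g) = hS.form g f := by
  rw [form, ← scal_dag, dag_comp, dag_dag]; rfl

/-- The positivity axiom replaces `f` by an endomorphism `g` of a simple object. This is a scalar,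
so the value of the form is its squared modulus. -/
theorem form_self (hS : IsSimpleReps S) {i : V} {m : D} (f : S i ⟶ m) :
    ∃ t : ℝ, 0 ≤ t ∧ hS.form f f = t ∧ (t = 0 → f = 0) := by
  obtain ⟨g, hg⟩ := CStarCategory.positive f
  refine ⟨Complex.normSq (hS.scal i g), Complex.normSq_nonneg _, ?_, fun h => ?_⟩
  · rw [form, hg, scal_comp, scal_dag, Complex.mul_conj]
  · refine CStarCategory.definite f ?_
    rw [hg, Complex.normSq_eq_zero] at *
    have : g = 0 := by simpa using h
    rw [this, zero_comp]

theorem form_dag_right (hS : IsSimpleReps S) {i : V} {m n : D} (f : S i ⟶ m) (g : S i ⟶ n)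
    (h : m ⟶ n) : hS.form (f ≫ h) g = hS.form f (g ≫ dag h) := by
  rw [form, form, dag_comp, dag_dag, Category.assoc]

theorem form_smul_left (hS : IsSimpleReps S) {i : V} {m : D} (z : ℂ) (f g : S i ⟶ m) :
    hS.form (z • f) g = z * hS.form f g := by
  simp [form]

theorem form_sum_left (hS : IsSimpleReps S) {ι : Type*} (s : Finset ι) {i : V} {m : D}
    (f : ι → (S i ⟶ m)) (g : S i ⟶ m) : hS.form (∑ k ∈ s, f k) g = ∑ k ∈ s, hS.form (f k) g := by
  simp [form, Preadditive.sum_comp]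

theorem form_sum_right (hS : IsSimpleReps S) {ι : Type*} (s : Finset ι) {i : V} {m : D}
    (f : S i ⟶ m) (g : ι → (S i ⟶ m)) : hS.form f (∑ k ∈ s, g k) = ∑ k ∈ s, hS.form f (g k) := by
  simp [form, dag_sum, Preadditive.comp_sum]

theorem form_smul_right (hS : IsSimpleReps S) {i : V} {m : D} (z : ℂ) (f g : S i ⟶ m) :
    hS.form f (z • g) = conj z * hS.form f g := by
  simp [form, dag_smul]

/-- An object isomorphic to a simple object is unitarily isomorphic to it. -/
theorem exists_unitary (hS : IsSimpleReps S) {i : V} {m : D} (e : m ≅ S i) :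
    ∃ e' : m ≅ S i, dag e'.hom = e'.inv := by
  obtain ⟨t, ht, h1, h2⟩ := hS.form_self e.inv
  have hne : t ≠ 0 := fun h => hS.id_ne_zero i (by rw [← e.inv_hom_id, h2 h, zero_comp])
  let s : ℂ := ((Real.sqrt t : ℝ) : ℂ)
  have hs : s * s = t := by simp only [s]; rw [← Complex.ofReal_mul, Real.mul_self_sqrt ht]
  have hs0 : s ≠ 0 := fun h => hne (by rw [h] at hs; simpa using hs.symm)
  have hcs : conj s = s := Complex.conj_ofReal _
  let v : S i ⟶ m := s⁻¹ • e.inv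
  have hv : v ≫ dag v = 𝟙 _ := by
    rw [← hS.scal_smul_id i (v ≫ dag v)]
    have : hS.scal i (v ≫ dag v) = 1 := by
      change hS.form v v = 1
      simp only [v]
      rw [form_smul_left, form_smul_right, h1, map_inv₀, hcs, ← hs]
      field_simp
    rw [this, one_smul]
  -- `v` is an isometry that is also invertible, so its adjoint is its two-sided inverse.
  have hv' : dag v ≫ v = 𝟙 _ := by
    have h3 : (s • e.hom) ≫ v = 𝟙 _ := by simp [v, hs0]
    calc dag v ≫ v = ((s • e.hom) ≫ v) ≫ dag v ≫ v := by rw [h3, Category.id_comp]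
      _ = _ := by rw [Category.assoc, reassoc_of% hv, h3]
  exact ⟨⟨dag v, v, hv', hv⟩, dag_dag v⟩

end IsSimpleReps

end UnitaryReps

/-! ### Transport of the correspondence along module functors -/

section Transport

open MonoidalLeftAction Functor

variable {C : Type u} [Category.{v} C] [Abelian C] [Linear ℂ C] [MonoidalCategory C]
variable {V : Type w} {M M' : SemisimpleModule.{v, u, vD, uD} C V}
variable (F : M.carrier ⥤ M'.carrier) [F.LeftLinear C]
  (e : ∀ i, F.obj (M.simple i) ≅ M'.simple i)

/-- Transport of morphisms `Mᵢ ⟶ c ⊗ Mⱼ` along a module functor. -/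
def transportHom {c : C} {i j : V} (f : M.simple i ⟶ c ⊙ₗ M.simple j) :
    M'.simple i ⟶ c ⊙ₗ M'.simple j :=
  (e i).inv ≫ F.map f ≫ OplaxLeftLinear.δₗ F c (M.simple j) ≫ c ⊴ₗ (e j).hom

theorem transportHom_bijective [F.Full] [F.Faithful] (c : C) (i j : V) :
    Function.Bijective (transportHom F e : (M.simple i ⟶ c ⊙ₗ M.simple j) → _) := by
  constructor
  · intro f g h
    apply F.map_injective
    rw [transportHom, transportHom, cancel_epi] at h
    rw [← cancel_mono (OplaxLeftLinear.δₗ F c (M.simple j) ≫ c ⊴ₗ (e j).hom)]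
    exact h
  · intro g
    refine ⟨F.preimage ((e i).hom ≫ g ≫ c ⊴ₗ (e j).inv ≫ LaxLeftLinear.μₗ F c (M.simple j)), ?_⟩
    simp [transportHom]

theorem transportHom_comp_act {c c' : C} {i j : V} (f : M.simple i ⟶ c ⊙ₗ M.simple j) (g : c ⟶ c') :
    transportHom F e (f ≫ g ⊵ₗ M.simple j) = transportHom F e f ≫ g ⊵ₗ M'.simple j := by
  simp only [transportHom, F.map_comp, Category.assoc, OplaxLeftLinear.δₗ_naturality_left_assoc]
  rw [action_exchange]

theorem transportHom_unit (i : V) :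
    transportHom F e (λₗ[C] (M.simple i)).inv = (λₗ[C] (M'.simple i)).inv := by
  simp only [transportHom]
  rw [← OplaxLeftLinear.δₗ_unitality_inv_assoc, actionUnitIso_inv_naturality]
  simp

theorem transportHom_act {c c' : C} {i j k : V} (f : M.simple i ⟶ c ⊙ₗ M.simple j)
    (g : M.simple j ⟶ c' ⊙ₗ M.simple k) :
    transportHom F e (f ≫ c ⊴ₗ g ≫ (αₗ c c' _).inv) =
      transportHom F e f ≫ c ⊴ₗ transportHom F e g ≫ (αₗ c c' _).inv := by
  simp only [transportHom, F.map_comp, Category.assoc, actionHomRight_comp,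
    actionHomRight_hom_inv_assoc]
  rw [← OplaxLeftLinear.δₗ_naturality_right_assoc, ← OplaxLeftLinear.δₗ_associativity_inv_assoc]
  congr 4
  rw [tensor_actionHomRight]
  simp

section

variable [Duality C] {X : C} [Quiver.{x} V]

/-- Transport of edge morphisms along a module functor. -/
def transportEdges (β : EdgeMorphisms M X) : EdgeMorphisms M' X :=
  fun a i j x => transportHom F e (β a i j x)

theorem transportEdges_surjective [F.Full] [F.Faithful] (β' : EdgeMorphisms M' X) :
    ∃ β, transportEdges F e β = β' := by
  choose β hβ using fun a i j x => (transportHom_bijective F e (signed X a) i j).2 (β' a i j x)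
  exact ⟨β, by funext a i j x; exact hβ a i j x⟩

theorem pathMorphism_transportEdges (β : EdgeMorphisms M X) {a : List Bool} {i j : V}
    (p : EPath V a i j) :
    pathMorphism (transportEdges F e β) p = transportHom F e (pathMorphism β p) := by
  induction p with
  | nil i => exact (transportHom_unit F e i).symm
  | cons x p ih =>
    rw [pathMorphism, ih]
    exact (transportHom_act F e _ _).symm

variable (hF : IsModuleEquivalence F)

/-- Transport of morphisms along a module equivalence, as a linear equivalence. -/
def transportEquiv (c : C) (i j : V) :
    (M.simple i ⟶ c ⊙ₗ M.simple j) ≃ₗ[ℂ] (M'.simple i ⟶ c ⊙ₗ M'.simple j) :=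
  have := hF.isEquivalence
  LinearEquiv.ofBijective
    { toFun := transportHom F e
      map_add' := fun f g => by simp [transportHom, hF.map_add]
      map_smul' := fun z f => by simp [transportHom, hF.map_smul] }
    (transportHom_bijective F e c i j)

theorem transportEquiv_apply {c : C} {i j : V} (f : M.simple i ⟶ c ⊙ₗ M.simple j) :
    transportEquiv F e hF c i j f = transportHom F e f := rfl

include hF in
theorem isEdgeBasis_transportEdges (β : EdgeMorphisms M X) :
    IsEdgeBasis (transportEdges F e β) ↔ IsEdgeBasis β := by
  refine forall_congr' fun a => forall_congr' fun i => forall_congr' fun j => ?_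
  have h1 : transportEdges F e β a i j = transportEquiv F e hF (signed X a) i j ∘ β a i j := rfl
  rw [h1]
  refine and_congr ?_ ?_
  · exact LinearMap.linearIndependent_iff _ (LinearEquiv.ker _)
  · rw [Set.range_comp, ← LinearEquiv.coe_coe, Submodule.span_image]
    constructor
    · intro h
      rw [Submodule.eq_top_iff'] at h ⊢
      intro f
      obtain ⟨g, hg, h2⟩ := h (transportEquiv F e hF (signed X a) i j f)
      rwa [← (transportEquiv F e hF (signed X a) i j).injective h2]
    · intro h
      rw [h, Submodule.map_top, LinearEquiv.range]

include hF in
theorem isActionMatrix_transportEdges [Fintype V] [∀ i j : V, Finite (i ⟶ j)]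
    (β : EdgeMorphisms M X)
    (φ : ∀ a b : List Bool, (planarAlgebraOf X).Hom a b → GHom V a b) :
    IsActionMatrix (transportEdges F e β) φ ↔ IsActionMatrix β φ := by
  refine forall_congr' fun a => forall_congr' fun b => forall_congr' fun f =>
    forall_congr' fun i => forall_congr' fun j => forall_congr' fun p => ?_
  simp only [pathMorphism_transportEdges]
  rw [← transportHom_comp_act, ← transportEquiv_apply F e hF]
  have : ∑ q, φ a b f i j p q • transportHom F e (pathMorphism β q) =
      transportEquiv F e hF _ i j (∑ q, φ a b f i j p q • pathMorphism β q) := by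
    rw [_root_.map_sum]
    refine Finset.sum_congr rfl fun q _ => ?_
    rw [_root_.map_smul, transportEquiv_apply]
  rw [this, (transportEquiv F e hF _ i j).injective.eq_iff]

include hF in
theorem corresponds_iff_of_equivalence [Fintype V] [∀ i j : V, Finite (i ⟶ j)]
    (hL : RespectsLabels F) (φ : ∀ a b : List Bool, (planarAlgebraOf X).Hom a b → GHom V a b) :
    Corresponds M φ ↔ Corresponds M' φ := by
  have := hF.isEquivalence
  let e := fun i => (hL i).some
  constructor
  · rintro ⟨β, h1, h2⟩
    exact ⟨transportEdges F e β, (isEdgeBasis_transportEdges F e hF β).2 h1,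
      (isActionMatrix_transportEdges F e hF β φ).2 h2⟩
  · rintro ⟨β', h1, h2⟩
    obtain ⟨β, rfl⟩ := transportEdges_surjective F e β'
    exact ⟨β, (isEdgeBasis_transportEdges F e hF β).1 h1,
      (isActionMatrix_transportEdges F e hF β φ).1 h2⟩

end

/-- A nonzero morphism `x` from a simple object to the image of `M.simple i` has a retraction. It
also comes, up to isomorphism, from a nonzero morphism into the simple object `M.simple i`, which
has a section; thus `x` is invertible. -/
theorem exists_obj_iso_simple (hF : IsModuleEquivalence F) (i : V) :
    ∃ j, Nonempty (F.obj (M.simple i) ≅ M'.simple j) := by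
  have := hF.isEquivalence
  have hne : 𝟙 (F.obj (M.simple i)) ≠ 0 := by
    intro h
    apply M.reps.id_ne_zero i
    apply F.map_injective
    have h0 : F.map (0 : M.simple i ⟶ M.simple i) = 0 := by
      have := hF.map_smul (0 : ℂ) (0 : M.simple i ⟶ M.simple i)
      simpa using this
    rw [F.map_id, h, h0]
  obtain ⟨j, x, hx⟩ : ∃ j, ∃ x : M'.simple j ⟶ F.obj (M.simple i), x ≠ 0 := by
    by_contra! h
    exact hne (M'.reps.hom_ext fun j x => by rw [h j x]; simp)
  obtain ⟨g, hg⟩ := M'.reps.exists_retraction x hx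
  obtain ⟨n, ⟨u⟩⟩ : ∃ n, Nonempty (F.obj n ≅ M'.simple j) :=
    ⟨F.objPreimage _, ⟨F.objObjPreimageIso _⟩⟩
  have hy : F.preimage (u.hom ≫ x) ≠ 0 := by
    intro h
    have h0 : F.map (0 : n ⟶ M.simple i) = 0 := by
      have := hF.map_smul (0 : ℂ) (0 : n ⟶ M.simple i)
      simpa using this
    have h1 : u.hom ≫ x = 0 := by rw [← F.map_preimage (u.hom ≫ x), h, h0]
    exact hx ((cancel_epi u.hom).1 (h1.trans comp_zero.symm))
  obtain ⟨s, hs⟩ := M.reps.exists_section _ hy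
  have hs' : (F.map s ≫ u.hom) ≫ x = 𝟙 _ := by
    have := congrArg F.map hs
    simpa using this
  have : F.map s ≫ u.hom = g := by
    rw [← Category.comp_id (F.map s ≫ u.hom), ← hg, ← Category.assoc, hs', Category.id_comp]
  exact ⟨j, ⟨⟨g, x, by rw [← this, hs'], hg⟩⟩⟩

end Transport

/-! ### Relabelling simple objects, graph automorphisms -/

section Relabelling

open MonoidalLeftAction Functor

variable {C : Type u} [Category.{v} C] [Abelian C] [Linear ℂ C] [MonoidalCategory C]
variable {V : Type w}

/-- A module category with its simple objects relabelled. -/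
abbrev SemisimpleModule.relabel (M : SemisimpleModule.{v, u, vD, uD} C V) (σ : V ≃ V) :
    SemisimpleModule.{v, u, vD, uD} C V where
  carrier := M.carrier
  isSemisimple := M.isSemisimple
  add_act := M.add_act
  smul_act := M.smul_act
  act_add := M.act_add
  act_smul := M.act_smul
  simple i := M.simple (σ i)
  simple_simple i := M.simple_simple (σ i)
  simple_inj i j h := σ.injective (M.simple_inj _ _ h)
  simple_surj m hm := by
    obtain ⟨i, ⟨e⟩⟩ := M.simple_surj m hm
    exact ⟨σ.symm i, ⟨e ≪≫ eqToIso (by simp)⟩⟩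

/-- The map on labels is injective by full faithfulness, hence bijective since there are finitely
many labels. -/
theorem exists_respectsLabels_relabel [Finite V] {M M' : SemisimpleModule.{v, u, vD, uD} C V}
    (F : M.carrier ⥤ M'.carrier) [F.LeftLinear C] (hF : IsModuleEquivalence F) :
    ∃ σ : V ≃ V, RespectsLabels (M := M) (M' := M'.relabel σ) F := by
  have := hF.isEquivalence
  choose σ hσ using exists_obj_iso_simple F hF
  have hinj : Function.Injective σ := fun i j h => by
    obtain ⟨e⟩ := hσ i
    obtain ⟨e'⟩ := hσ j
    exact M.simple_inj i j ⟨F.preimageIso (e ≪≫ eqToIso (by rw [h]) ≪≫ e'.symm)⟩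
  exact ⟨Equiv.ofBijective σ (Finite.injective_iff_bijective.1 hinj), hσ⟩

variable [Quiver.{x} V]

theorem GraphAut.sedge_bijective (ρ : GraphAut V) (a : Bool) (i j : V) :
    Function.Bijective (ρ.sedge : SEdge V a i j → SEdge V a (ρ.vert i) (ρ.vert j)) := by
  cases a
  · exact (ρ.edge j i).bijective
  · exact (ρ.edge i j).bijective

theorem GraphAut.path_bijective (ρ : GraphAut V) (a : List Bool) (i j : V) :
    Function.Bijective (ρ.path : EPath V a i j → EPath V a (ρ.vert i) (ρ.vert j)) := by
  constructor
  · intro p q h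
    induction p with
    | nil i => cases q; rfl
    | cons e p ih =>
      cases q with
      | cons f q =>
        simp only [GraphAut.path] at h
        obtain ⟨h1, h2, h3⟩ := (EPath.cons.injEq ..).mp h
        have h1 := ρ.vert.injective h1
        subst h1
        rw [(ρ.sedge_bijective _ _ _).1 (eq_of_heq h2), ih (eq_of_heq h3)]
  · intro q
    induction a generalizing i with
    | nil =>
      obtain rfl : i = j := by
        generalize hi : ρ.vert i = i' at q
        generalize hj : ρ.vert j = j' at q
        cases q
        exact ρ.vert.injective (hi.trans hj.symm)
      have : Subsingleton (EPath V [] (ρ.vert i) (ρ.vert i)) := ⟨by rintro ⟨⟩ ⟨⟩; rfl⟩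
      exact ⟨.nil i, Subsingleton.elim _ _⟩
    | cons s a ih =>
      obtain ⟨⟨k, e, q⟩, rfl⟩ := (EPath.consEquiv V s a _ _).surjective q
      obtain ⟨k, rfl⟩ := ρ.vert.surjective k
      obtain ⟨e, rfl⟩ := (ρ.sedge_bijective s i k).2 e
      obtain ⟨q, rfl⟩ := ih k q
      exact ⟨.cons e q, rfl⟩

theorem GraphAut.exists_of_card [∀ i j : V, Finite (i ⟶ j)] (σ : V ≃ V)
    (h : ∀ i j, Nat.card (i ⟶ j) = Nat.card (σ i ⟶ σ j)) : ∃ ρ : GraphAut V, ρ.vert = σ :=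
  ⟨⟨σ, fun i j => (Finite.card_eq.1 (h i j)).some⟩, rfl⟩

variable [Duality C] {X : C}

/-- Relabelling of edge morphisms by a graph automorphism. -/
def relabelEdges {M : SemisimpleModule.{v, u, vD, uD} C V} {σ : V ≃ V}
    (β : EdgeMorphisms (M.relabel σ) X) (ρ : GraphAut V) :
    EdgeMorphisms (M.relabel (ρ.vert.trans σ)) X :=
  fun a i j e => β a (ρ.vert i) (ρ.vert j) (ρ.sedge e)

theorem pathMorphism_relabelEdges {M : SemisimpleModule.{v, u, vD, uD} C V} {σ : V ≃ V}
    (β : EdgeMorphisms (M.relabel σ) X) (ρ : GraphAut V) {a : List Bool} {i j : V}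
    (p : EPath V a i j) : pathMorphism (relabelEdges β ρ) p = pathMorphism β (ρ.path p) := by
  induction p with
  | nil i => rfl
  | cons e p ih =>
    rw [pathMorphism, ih]
    rfl

theorem isEdgeBasis_relabelEdges {M : SemisimpleModule.{v, u, vD, uD} C V} {σ : V ≃ V}
    {β : EdgeMorphisms (M.relabel σ) X} (hβ : IsEdgeBasis β) (ρ : GraphAut V) :
    IsEdgeBasis (relabelEdges β ρ) := by
  intro a i j
  have h := hβ a (ρ.vert i) (ρ.vert j)
  have e : relabelEdges β ρ a i j = β a (ρ.vert i) (ρ.vert j) ∘ ρ.sedge := rfl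
  refine ⟨?_, ?_⟩
  · rw [e]
    exact h.1.comp _ (ρ.sedge_bijective a i j).1
  · have : Set.range (relabelEdges β ρ a i j) = Set.range (β a (ρ.vert i) (ρ.vert j)) :=
      (ρ.sedge_bijective a i j).2.range_comp _
    exact (congrArg (Submodule.span ℂ) this).trans h.2

theorem isActionMatrix_relabelEdges [Fintype V] [∀ i j : V, Finite (i ⟶ j)]
    {M : SemisimpleModule.{v, u, vD, uD} C V} {σ : V ≃ V}
    {β : EdgeMorphisms (M.relabel σ) X} (ρ : GraphAut V)
    {φ : ∀ a b : List Bool, (planarAlgebraOf X).Hom a b → GHom V a b}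
    (hφ : IsActionMatrix β φ) :
    IsActionMatrix (relabelEdges β ρ) fun a b f => ρ.pull (φ a b f) := by
  intro a b f i j p
  simp only [pathMorphism_relabelEdges]
  refine (hφ a b f _ _ (ρ.path p)).trans ?_
  exact ((Equiv.ofBijective _ (ρ.path_bijective b i j)).sum_comp
    fun q => φ a b f _ _ (ρ.path p) q • pathMorphism β q).symm

theorem Corresponds.relabel [Fintype V] [∀ i j : V, Finite (i ⟶ j)]
    {M : SemisimpleModule.{v, u, vD, uD} C V} {σ τ : V ≃ V}
    {φ : ∀ a b : List Bool, (planarAlgebraOf X).Hom a b → GHom V a b}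
    (h : Corresponds (M.relabel σ) φ) (ρ : GraphAut V) (hτ : τ = ρ.vert.trans σ) :
    Corresponds (M.relabel τ) fun a b f => ρ.pull (φ a b f) := by
  subst hτ
  obtain ⟨β, h1, h2⟩ := h
  exact ⟨relabelEdges β ρ, isEdgeBasis_relabelEdges h1 ρ, isActionMatrix_relabelEdges ρ h2⟩

theorem SemisimpleModule.hasFusionGraph_of_isEdgeBasis [∀ i j : V, Finite (i ⟶ j)]
    {M : SemisimpleModule.{v, u, vD, uD} C V} {β : EdgeMorphisms M X} (hβ : IsEdgeBasis β) :
    M.HasFusionGraph X := fun i j => by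
  rw [Nat.card_eq_fintype_card]
  exact Module.finrank_eq_card_basis
    (Module.Basis.mk (ι := (i ⟶ j)) (hβ true i j).1 (hβ true i j).2.ge)

/-- Both labellings have their multiplicities counted by the same graph, so the permutation between
them preserves numbers of edges. The bijections between parallel edges can then be chosen at will.
-/
theorem exists_graphAut [∀ i j : V, Finite (i ⟶ j)]
    {M : SemisimpleModule.{v, u, vD, uD} C V} {σ τ : V ≃ V}
    (hσ : (M.relabel σ).HasFusionGraph X) (hτ : (M.relabel τ).HasFusionGraph X) :
    ∃ ρ : GraphAut V, τ = ρ.vert.trans σ := by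
  obtain ⟨ρ, hρ⟩ := GraphAut.exists_of_card (τ.trans σ.symm) fun i j => by
    have h1 := hτ i j
    have h2 := hσ (σ.symm (τ i)) (σ.symm (τ j))
    rw [← h1]
    refine Eq.trans ?_ h2
    change Module.finrank ℂ (M.simple (τ i) ⟶ X ⊙ₗ M.simple (τ j)) =
      Module.finrank ℂ (M.simple (σ (σ.symm (τ i))) ⟶ X ⊙ₗ M.simple (σ (σ.symm (τ j))))
    rw [Equiv.apply_symm_apply, Equiv.apply_symm_apply]
  refine ⟨ρ, ?_⟩
  rw [hρ]
  ext i
  simp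

end Relabelling

/-! ### Contraction against the action -/

section Contraction

open MonoidalLeftAction

variable {C : Type u} [Category.{v} C] [MonoidalCategory C]
variable {D : Type uD} [Category.{vD} D] [MonoidalLeftAction C D]

theorem assoc_inv_associator_hom (a b c : C) (m : D) :
    (αₗ (a ⊗ b) c m).inv ≫ (α_ a b c).hom ⊵ₗ m =
      (αₗ a b (c ⊙ₗ m)).hom ≫ a ⊴ₗ (αₗ b c m).inv ≫ (αₗ a (b ⊗ c) m).inv := by
  rw [act_assoc_inv, Iso.hom_inv_id_assoc]

theorem assoc_inv_associator_inv (a b c : C) (m : D) :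
    (αₗ a (b ⊗ c) m).inv ≫ (α_ a b c).inv ⊵ₗ m =
      a ⊴ₗ (αₗ b c m).hom ≫ (αₗ a b (c ⊙ₗ m)).inv ≫ (αₗ (a ⊗ b) c m).inv := by
  rw [← cancel_epi (a ⊴ₗ (αₗ b c m).inv), reassoc_of% act_assoc_inv a b c m]
  simp

theorem act_act_assoc_inv (a b : C) {m n : D} (h : m ⟶ n) :
    a ⊴ₗ b ⊴ₗ h ≫ (αₗ a b n).inv = (αₗ a b m).inv ≫ (a ⊗ b) ⊴ₗ h := by
  simp

theorem left_act_assoc_inv {a a' : C} (θ : a ⟶ a') (b : C) (m : D) :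
    θ ⊵ₗ (b ⊙ₗ m) ≫ (αₗ a' b m).inv = (αₗ a b m).inv ≫ (θ ▷ b) ⊵ₗ m := by
  simp

theorem rightUnitor_inv_act (c : C) (m : D) :
    (ρ_ c).inv ⊵ₗ m = c ⊴ₗ (λₗ[C] m).inv ≫ (αₗ _ _ _).inv := by
  rw [← cancel_epi ((ρ_ c).hom ⊵ₗ m), ← comp_actionHomLeft]
  simp

theorem leftUnitor_inv_act (c : C) (m : D) :
    (λ_ c).inv ⊵ₗ m = (λₗ[C] (c ⊙ₗ m)).inv ≫ (αₗ _ _ _).inv := by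
  rw [← cancel_epi ((λ_ c).hom ⊵ₗ m), ← comp_actionHomLeft]
  simp

/-- Contraction of `g : n' ⟶ d ⊗ m` with `f : m ⟶ c ⊗ n` along a pairing of `d` with `c`. -/
def contract {c d : C} (ε : d ⊗ c ⟶ 𝟙_ C) {m n n' : D} (g : n' ⟶ d ⊙ₗ m) (f : m ⟶ c ⊙ₗ n) :
    n' ⟶ n :=
  g ≫ d ⊴ₗ f ≫ (αₗ d c n).inv ≫ ε ⊵ₗ n ≫ (λₗ[C] n).hom

section

variable {c d : C} (ε : d ⊗ c ⟶ 𝟙_ C) {m m' n n' n'' : D}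

theorem contract_comp_left (h : n'' ⟶ n') (g : n' ⟶ d ⊙ₗ m) (f : m ⟶ c ⊙ₗ n) :
    contract ε (h ≫ g) f = h ≫ contract ε g f := by
  simp [contract]

theorem contract_comp_right (g : n' ⟶ d ⊙ₗ m) (f : m ⟶ c ⊙ₗ n) (h : n ⟶ n'') :
    contract ε g (f ≫ c ⊴ₗ h) = contract ε g f ≫ h := by
  simp only [contract, Category.assoc, actionHomRight_comp]
  rw [reassoc_of% act_act_assoc_inv d c h, action_exchange_assoc, actionUnitIso_hom_naturality]

theorem contract_comp_middle (g : n' ⟶ d ⊙ₗ m) (h : m ⟶ m') (f : m' ⟶ c ⊙ₗ n) :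
    contract ε (g ≫ d ⊴ₗ h) f = contract ε g (h ≫ f) := by
  simp [contract]

theorem contract_act_left {d' : C} (θ : d' ⟶ d) (g : n' ⟶ d' ⊙ₗ m) (f : m ⟶ c ⊙ₗ n) :
    contract ε (g ≫ θ ⊵ₗ m) f = contract (θ ▷ c ≫ ε) g f := by
  simp only [contract, Category.assoc, comp_actionHomLeft]
  rw [← action_exchange_assoc, reassoc_of% left_act_assoc_inv θ c n]

theorem contract_act_right {c' : C} (θ : c' ⟶ c) (g : n' ⟶ d ⊙ₗ m) (f : m ⟶ c' ⊙ₗ n) :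
    contract ε g (f ≫ θ ⊵ₗ n) = contract (d ◁ θ ≫ ε) g f := by
  simp only [contract, Category.assoc, comp_actionHomLeft, whiskerLeft_actionHomLeft,
    Iso.inv_hom_id_assoc, actionHomRight_comp]

theorem contract_eq (g : n' ⟶ d ⊙ₗ m) (f : m ⟶ c ⊙ₗ n) :
    contract ε g f = g ≫ contract ε (𝟙 _) f := by
  rw [← contract_comp_left, Category.comp_id]

/-- The pairings are nested: `ε` contracts the inner factors, then `ε'` the outer ones. -/
theorem contract_evTensor {c' d' : C} (ε' : d' ⊗ c' ⟶ 𝟙_ C) (g : n' ⟶ (d' ⊗ d) ⊙ₗ m)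
    (f : m ⟶ (c ⊗ c') ⊙ₗ n) : contract (evTensor ε ε') g f =
      contract ε' (g ≫ (αₗ d' d m).hom) (contract ε (𝟙 _) (f ≫ (αₗ c c' n).hom)) := by
  simp only [contract, evTensor, Category.assoc, comp_actionHomLeft, Category.id_comp,
    actionHomRight_comp]
  rw [reassoc_of% assoc_inv_associator_hom d' d (c ⊗ c') n]
  simp only [whiskerLeft_actionHomLeft, Iso.inv_hom_id_assoc, comp_actionHomLeft,
    actionHomRight_comp, Category.assoc, tensor_actionHomRight]
  rw [← actionHomRight_comp_assoc d' (αₗ d (c ⊗ c') n).inv, assoc_inv_associator_inv]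
  simp only [whiskerRight_actionHomLeft, leftUnitor_actionHom, Category.assoc, actionHomRight_comp]
  simp only [← actionHomRight_comp_assoc, Iso.inv_hom_id_assoc, Category.assoc]

theorem contract_leftUnitor (g : n' ⟶ 𝟙_ C ⊙ₗ m) (f : m ⟶ 𝟙_ C ⊙ₗ n) :
    contract (λ_ (𝟙_ C)).hom g f = (g ≫ (λₗ[C] m).hom) ≫ f ≫ (λₗ[C] n).hom := by
  simp [contract]

end

/-- Insertion of a copairing. -/
def insertPair {a b : C} (η : 𝟙_ C ⟶ b ⊗ a) (m : D) : m ⟶ b ⊙ₗ a ⊙ₗ m :=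
  (λₗ[C] m).inv ≫ η ⊵ₗ m ≫ (αₗ _ _ _).hom

theorem contract_insertPair {a b : C} {ε : a ⊗ b ⟶ 𝟙_ C} {η : 𝟙_ C ⟶ b ⊗ a}
    (hε : a ◁ η ≫ (α_ _ _ _).inv ≫ ε ▷ a = (ρ_ a).hom ≫ (λ_ a).inv) {m n : D} (f : n ⟶ a ⊙ₗ m) :
    contract ε f (insertPair η m) = f := by
  have h := congrArg (fun θ => (ρ_ a).inv ⊵ₗ m ≫ θ ⊵ₗ m ≫ (λ_ a).hom ⊵ₗ m) hε
  simp only [comp_actionHomLeft, Category.assoc, rightUnitor_inv_act, whiskerLeft_actionHomLeft,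
    Iso.inv_hom_id_assoc, reassoc_of% assoc_inv_associator_inv a b a m,
    whiskerRight_actionHomLeft, leftUnitor_actionHom, leftUnitor_inv_act,
    rightUnitor_actionHom, Iso.inv_hom_id, Category.comp_id, actionHomRight_inv_hom] at h
  simp only [contract, insertPair, actionHomRight_comp, Category.assoc]
  rw [h, Category.comp_id]

/-- A zigzag in the acting category. It shows that a morphism into `b ⊙ₗ m` is determined by its
contraction, which is how vanishing and equality of such morphisms are detected below. -/
theorem insertPair_contract {a b : C} {ε : a ⊗ b ⟶ 𝟙_ C} {η : 𝟙_ C ⟶ b ⊗ a}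
    (hε : η ▷ b ≫ (α_ _ _ _).hom ≫ b ◁ ε = (λ_ b).hom ≫ (ρ_ b).inv) {m n : D} (g : n ⟶ b ⊙ₗ m) :
    insertPair η n ≫ b ⊴ₗ contract ε (𝟙 _) g = g := by
  have h := congrArg (fun θ => (λ_ b).inv ⊵ₗ m ≫ θ ⊵ₗ m ≫ (ρ_ b).hom ⊵ₗ m) hε
  simp only [comp_actionHomLeft, Category.assoc, rightUnitor_inv_act, whiskerLeft_actionHomLeft,
    Iso.inv_hom_id_assoc, reassoc_of% assoc_inv_associator_hom b a b m,
    whiskerRight_actionHomLeft, leftUnitor_actionHom, leftUnitor_inv_act,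
    rightUnitor_actionHom, Iso.inv_hom_id, Category.comp_id, actionHomRight_inv_hom] at h
  have h2 : (αₗ b a n).hom ≫ b ⊴ₗ a ⊴ₗ g = (b ⊗ a) ⊴ₗ g ≫ (αₗ b a _).hom := by simp
  simp only [contract, insertPair, actionHomRight_comp, Category.assoc, Category.id_comp]
  rw [reassoc_of% h2, ← action_exchange_assoc, ← Category.assoc, actionUnitIso_inv_naturality,
    Category.assoc, h, Category.comp_id]

theorem partialTrace_eq [Duality C] (c : C) (m : D) (F : c ⊙ₗ m ⟶ c ⊙ₗ m) :
    partialTrace c m F = contract (ev c) (insertPair (coevR c) m) F := by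
  simp [contract, insertPair, partialTrace]

end Contraction

/-! ### Traces compatible with pairings -/

section Traces

open MonoidalLeftAction

variable {C : Type u} [Category.{v} C] [Abelian C] [Linear ℂ C] [MonoidalCategory C]
variable {V : Type w} {M : SemisimpleModule.{v, u, vD, uD} C V}

theorem sum_contract {ι : Type*} (s : Finset ι) {c d : C} (ε : d ⊗ c ⟶ 𝟙_ C) {m n n' : M.carrier}
    (g : ι → (n' ⟶ d ⊙ₗ m)) (f : m ⟶ c ⊙ₗ n) :
    contract ε (∑ k ∈ s, g k) f = ∑ k ∈ s, contract ε (g k) f := by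
  simp [contract, Preadditive.sum_comp]

theorem contract_sum {ι : Type*} (s : Finset ι) {c d : C} (ε : d ⊗ c ⟶ 𝟙_ C) {m n n' : M.carrier}
    (g : n' ⟶ d ⊙ₗ m) (f : ι → (m ⟶ c ⊙ₗ n)) :
    contract ε g (∑ k ∈ s, f k) = ∑ k ∈ s, contract ε g (f k) := by
  simp [contract, M.act_sum, Preadditive.sum_comp, Preadditive.comp_sum]

theorem smul_contract {c d : C} (ε : d ⊗ c ⟶ 𝟙_ C) {m n n' : M.carrier} (z : ℂ)
    (g : n' ⟶ d ⊙ₗ m) (f : m ⟶ c ⊙ₗ n) : contract ε (z • g) f = z • contract ε g f := by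
  simp [contract]

theorem contract_smul {c d : C} (ε : d ⊗ c ⟶ 𝟙_ C) {m n n' : M.carrier} (z : ℂ)
    (g : n' ⟶ d ⊙ₗ m) (f : m ⟶ c ⊙ₗ n) : contract ε g (z • f) = z • contract ε g f := by
  simp [contract, M.act_smul]

/-- The two closures of the pairings `ε` and `ε'` of `c` with `d` have the same trace. -/
def IsTraceDual (Θ : ∀ m : M.carrier, (m ⟶ m) →ₗ[ℂ] ℂ) {c d : C} (ε : d ⊗ c ⟶ 𝟙_ C)
    (ε' : c ⊗ d ⟶ 𝟙_ C) : Prop :=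
  ∀ (m n : M.carrier) (f : m ⟶ c ⊙ₗ n) (g : n ⟶ d ⊙ₗ m),
    Θ n (contract ε g f) = Θ m (contract ε' f g)

variable {Θ : ∀ m : M.carrier, (m ⟶ m) →ₗ[ℂ] ℂ}

theorem IsTraceDual.swap {c d : C} {ε : d ⊗ c ⟶ 𝟙_ C} {ε' : c ⊗ d ⟶ 𝟙_ C}
    (h : IsTraceDual Θ ε ε') : IsTraceDual Θ ε' ε := fun _ _ f g => (h _ _ g f).symm

section

variable (hΘ : ∀ {m n : M.carrier} (f : m ⟶ n) (g : n ⟶ m), Θ m (f ≫ g) = Θ n (g ≫ f))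

include hΘ in
-- Both sides are additive, and cyclicity moves the projections and inclusions of a decomposition of
-- `m` and `n` around the closure.
theorem isTraceDual_of_simple {c d : C} {ε : d ⊗ c ⟶ 𝟙_ C} {ε' : c ⊗ d ⟶ 𝟙_ C}
    (h : ∀ (i j : V) (f : M.simple i ⟶ c ⊙ₗ M.simple j) (g : M.simple j ⟶ d ⊙ₗ M.simple i),
      Θ _ (contract ε g f) = Θ _ (contract ε' f g)) : IsTraceDual Θ ε ε' := by
  intro m n f g
  obtain ⟨N, idx, π, ι, hd⟩ := M.reps.exists_decomposition m
  obtain ⟨N', idx', π', ι', hd'⟩ := M.reps.exists_decomposition n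
  have hf : f = ∑ k, ∑ l, π k ≫ (ι k ≫ f ≫ c ⊴ₗ π' l) ≫ c ⊴ₗ ι' l := by
    simp only [Category.assoc, ← actionHomRight_comp, ← Preadditive.comp_sum, ← M.act_sum, hd']
    simp only [← Category.assoc, ← Preadditive.sum_comp, hd]
    simp
  have h1 : ∀ k l, contract ε g (π k ≫ (ι k ≫ f ≫ c ⊴ₗ π' l) ≫ c ⊴ₗ ι' l) =
      contract ε (g ≫ d ⊴ₗ π k) (ι k ≫ f ≫ c ⊴ₗ π' l) ≫ ι' l := fun k l => by
    rw [← contract_comp_right, contract_comp_middle]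
  have h2 : ∀ k l, contract ε' (π k ≫ (ι k ≫ f ≫ c ⊴ₗ π' l) ≫ c ⊴ₗ ι' l) g =
      π k ≫ contract ε' (ι k ≫ f ≫ c ⊴ₗ π' l) (ι' l ≫ g) := fun k l => by
    rw [contract_comp_left, contract_comp_middle]
  rw [hf, contract_sum, sum_contract, map_sum, map_sum]
  refine Finset.sum_congr rfl fun k _ => ?_
  rw [contract_sum, sum_contract, map_sum, map_sum]
  refine Finset.sum_congr rfl fun l _ => ?_
  rw [h1, h2, hΘ, ← contract_comp_left, hΘ, ← contract_comp_right, Category.assoc]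
  exact h _ _ _ _

include hΘ in
theorem isTraceDual_leftUnitor : IsTraceDual Θ (λ_ (𝟙_ C)).hom (λ_ (𝟙_ C)).hom := by
  intro m n f g
  rw [contract_leftUnitor, contract_leftUnitor, hΘ]

/-- The outer pair is moved to the other side first, which exposes the inner pair as the next
outermost closure. -/
theorem IsTraceDual.evTensor {c d c' d' : C} {ε : d ⊗ c ⟶ 𝟙_ C} {ε₂ : c ⊗ d ⟶ 𝟙_ C}
    {ε' : d' ⊗ c' ⟶ 𝟙_ C} {ε₂' : c' ⊗ d' ⟶ 𝟙_ C} (h : IsTraceDual Θ ε ε₂)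
    (h' : IsTraceDual Θ ε' ε₂') : IsTraceDual Θ (evTensor ε ε') (evTensor ε₂' ε₂) := by
  intro m n f g
  rw [contract_evTensor, contract_evTensor, h', contract_eq ε₂', ← contract_comp_right, h,
    contract_comp_middle, Category.comp_id]

theorem IsTraceDual.of_dualCompatible [Duality C] {c d : C} {ε : d ⊗ c ⟶ 𝟙_ C}
    {ε' : c ⊗ d ⟶ 𝟙_ C} (h : IsTraceDual Θ ε ε') (hd : DualCompatible ε ε') :
    IsTraceDual Θ (ev c) (evR c) := by
  obtain ⟨θ, h1, h2⟩ := hd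
  intro m n f g
  rw [← h1, ← h2, ← contract_act_left, ← contract_act_right, h]

/-- The identity of `c` is split through the objects `y k`. Moving `a k` and `b k` across the two
pairings produces the left and the right transpose, and these agree by pivotality. -/
theorem IsTraceDual.of_sum [PivotalCategory C] {ι : Type*} (s : Finset ι) {c : C} (y : ι → C)
    (a : ∀ k, c ⟶ y k) (b : ∀ k, y k ⟶ c) (hab : ∑ k ∈ s, a k ≫ b k = 𝟙 c)
    (h : ∀ k, IsTraceDual Θ (ev (y k)) (evR (y k))) : IsTraceDual Θ (ev c) (evR c) := by
  intro m n f g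
  have hf : f = ∑ k ∈ s, (f ≫ a k ⊵ₗ n) ≫ b k ⊵ₗ n := by
    simp only [Category.assoc, ← comp_actionHomLeft, ← Preadditive.comp_sum, ← M.sum_act, hab]
    simp
  rw [hf, contract_sum, sum_contract, map_sum, map_sum]
  refine Finset.sum_congr rfl fun k _ => ?_
  rw [contract_act_right, contract_act_left, ← leftTranspose_ev, ← rightTranspose_evR',
    ← contract_act_left, h, contract_act_right]

theorem IsTraceDual.partialTrace [Duality C] {c : C} (h : IsTraceDual Θ (ev c) (evR c))
    (m : M.carrier) (F : c ⊙ₗ m ⟶ c ⊙ₗ m) : Θ _ F = Θ m (partialTrace c m F) := by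
  rw [partialTrace_eq, h, contract_insertPair (evR_coevR_zigzag c)]

end

/-- By cyclicity the closure with `evR c` is the trace of an endomorphism of `c ⊙ₗ n`. A zigzag
identifies its partial trace with the closure with `ev c`. -/
theorem IsModuleTrace.isTraceDual [Duality C] (hΘ : IsModuleTrace C Θ) (c : C) :
    IsTraceDual Θ (ev c) (evR c) := by
  intro m n f g
  rw [contract_eq (evR c), hΘ.cyclic, hΘ.partialTrace, partialTrace_eq, ← contract_comp_middle,
    insertPair_contract (coevR_evR_zigzag c)]

end Traces

/-! ### The trace with given weights, dual edge bases -/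

section WeightTrace

open MonoidalLeftAction

attribute [local instance] Abelian.hasFiniteBiproducts

theorem IsTensorGenerator.exists_sum {C : Type u} [Category.{v} C] [Abelian C]
    [MonoidalCategory C] [Duality C] {X : C} (hX : IsTensorGenerator X) (c : C) :
    ∃ (n : ℕ) (y : Fin n → List Bool) (a : ∀ k, c ⟶ word X (y k)) (b : ∀ k, word X (y k) ⟶ c),
      ∑ k, a k ≫ b k = 𝟙 c := by
  obtain ⟨n, y, ⟨R⟩⟩ := hX c
  let Y : Fin n → C := fun i => word X (y i)
  refine ⟨n, y, fun k => R.i ≫ biproduct.π Y k, fun k => biproduct.ι Y k ≫ R.r, ?_⟩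
  have h2 : ∑ k, (R.i ≫ biproduct.π Y k) ≫ biproduct.ι Y k ≫ R.r =
      R.i ≫ (∑ k, biproduct.π Y k ≫ biproduct.ι Y k) ≫ R.r := by
    rw [Preadditive.sum_comp, Preadditive.comp_sum]
    exact Finset.sum_congr rfl fun k _ => by simp only [Category.assoc]
  refine h2.trans ?_
  rw [biproduct.total, Category.id_comp, R.retract]

variable {C : Type u} [Category.{v} C] [Abelian C] [Linear ℂ C] [MonoidalCategory C]
variable {V : Type w}

/-- The trace with weights `lam` on a semisimple module category. -/
def weightTrace [Fintype V] (M : SemisimpleModule.{v, u, vD, uD} C V) (lam : V → ℂ)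
    (m : M.carrier) : (m ⟶ m) →ₗ[ℂ] ℂ :=
  ∑ i, lam i • (LinearMap.trace ℂ (M.simple i ⟶ m)).comp (Linear.comp (M.simple i) m m).flip

theorem weightTrace_apply [Fintype V] (M : SemisimpleModule.{v, u, vD, uD} C V) (lam : V → ℂ)
    {m : M.carrier} (f : m ⟶ m) : weightTrace M lam m f =
      ∑ i, lam i * LinearMap.trace ℂ _ (Linear.rightComp ℂ (M.simple i) f) := by
  simp only [weightTrace, LinearMap.sum_apply, LinearMap.smul_apply, smul_eq_mul]
  rfl

variable {M : SemisimpleModule.{v, u, vD, uD} C V} {lam : V → ℂ}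

theorem weightTrace_cyclic [Fintype V] {m n : M.carrier} (f : m ⟶ n) (g : n ⟶ m) :
    weightTrace M lam m (f ≫ g) = weightTrace M lam n (g ≫ f) := by
  rw [weightTrace_apply, weightTrace_apply]
  refine Finset.sum_congr rfl fun i _ => ?_
  congr 1
  have := M.reps.finite (M.simple i) m
  have := M.reps.finite (M.simple i) n
  have h1 : Linear.rightComp ℂ (M.simple i) (f ≫ g) =
      Linear.rightComp ℂ (M.simple i) g ∘ₗ Linear.rightComp ℂ (M.simple i) f := by
    ext x; simp
  have h2 : Linear.rightComp ℂ (M.simple i) (g ≫ f) =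
      Linear.rightComp ℂ (M.simple i) f ∘ₗ Linear.rightComp ℂ (M.simple i) g := by
    ext x; simp
  rw [h1, h2, LinearMap.trace_comp_comm']

theorem weightTrace_simple [Fintype V] (i : V) (f : M.simple i ⟶ M.simple i) :
    weightTrace M lam _ f = lam i * M.reps.scal i f := by
  rw [← M.reps.scal_smul_id i f, map_smul, map_smul, M.reps.scal_id, weightTrace_apply,
    Finset.sum_eq_single i]
  · have h : Linear.rightComp ℂ (M.simple i) (𝟙 (M.simple i)) = LinearMap.id := by ext x; simp
    have := M.reps.finite (M.simple i) (M.simple i)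
    rw [h, LinearMap.trace_id, (M.reps.scal i).finrank_eq, Module.finrank_self]
    simp only [Nat.cast_one, smul_eq_mul]
    ring
  · intro j _ hj
    have : Linear.rightComp ℂ (M.simple j) (𝟙 (M.simple i)) = 0 := by
      ext x; exact M.reps.hom_eq_zero hj _
    rw [this, map_zero, mul_zero]
  · simp

theorem weightTrace_id [Fintype V] (i : V) : weightTrace M lam _ (𝟙 (M.simple i)) = lam i := by
  rw [weightTrace_simple, M.reps.scal_id, mul_one]

/-- If `f` is nonzero, its restriction along some morphism from `M.simple i` has a retraction;
closing up with it gives the trace `lam i`. -/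
theorem weightTrace_nondegenerate [Fintype V] (hlam : ∀ i, lam i ≠ 0) {m n : M.carrier} (f : m ⟶ n)
    (h : ∀ g : n ⟶ m, weightTrace M lam m (f ≫ g) = 0) : f = 0 := by
  refine M.reps.hom_ext fun i x => ?_
  by_contra hne
  rw [comp_zero] at hne
  obtain ⟨g, hg⟩ := M.reps.exists_retraction _ hne
  apply hlam i
  rw [← weightTrace_id (M := M) (lam := lam) i, ← hg, Category.assoc, weightTrace_cyclic, Category.assoc, h]

section

variable [PivotalCategory C] {X : C}

/-- The chosen dual of a word need not be the product of the duals of its letters. The induction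
therefore runs over nested pairings with some object `d` and keeps track of their compatibility with
the chosen dual, for which the letter `X*` requires `dualCompatible_swap`. -/
theorem isTraceDual_word {Θ : ∀ m : M.carrier, (m ⟶ m) →ₗ[ℂ] ℂ}
    (hΘ : ∀ {m n : M.carrier} (f : m ⟶ n) (g : n ⟶ m), Θ m (f ≫ g) = Θ n (g ≫ f))
    (hX : IsTraceDual Θ (ev X) (evR X)) (a : List Bool) :
    IsTraceDual Θ (ev (word X a)) (evR (word X a)) := by
  suffices h : ∃ (d : C) (ε : d ⊗ word X a ⟶ 𝟙_ C) (ε' : word X a ⊗ d ⟶ 𝟙_ C),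
      DualCompatible ε ε' ∧ IsTraceDual Θ ε ε' by
    obtain ⟨d, ε, ε', h1, h2⟩ := h
    exact h2.of_dualCompatible h1
  induction a with
  | nil => exact ⟨_, _, _, dualCompatible_unit, isTraceDual_leftUnitor hΘ⟩
  | cons s a ih =>
    obtain ⟨d, ε, ε', h1, h2⟩ := ih
    cases s
    · exact ⟨_, _, _, dualCompatible_tensor (dualCompatible_swap X) h1, hX.swap.evTensor h2⟩
    · exact ⟨_, _, _, dualCompatible_tensor (dualCompatible_self X) h1, hX.evTensor h2⟩

theorem isModuleTrace_weightTrace [Fintype V] (hlam : ∀ i, lam i ≠ 0) (hX : IsTensorGenerator X)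
    (h : IsTraceDual (weightTrace M lam) (ev X) (evR X)) : IsModuleTrace C (weightTrace M lam) where
  cyclic := weightTrace_cyclic
  nondegenerate := weightTrace_nondegenerate hlam
  partialTrace c m f := by
    obtain ⟨n, y, a, b, hab⟩ := hX.exists_sum c
    exact (IsTraceDual.of_sum Finset.univ _ a b hab
      fun k => isTraceDual_word weightTrace_cyclic h (y k)).partialTrace m f

end

theorem contract_trace_eq_of_span {Θ : ∀ m : M.carrier, (m ⟶ m) →ₗ[ℂ] ℂ} {c d : C}
    {ε : d ⊗ c ⟶ 𝟙_ C} {ε' : c ⊗ d ⟶ 𝟙_ C} {m n : M.carrier} {ι κ : Type*} [Fintype ι] [Fintype κ]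
    {F : ι → (m ⟶ c ⊙ₗ n)} {G : κ → (n ⟶ d ⊙ₗ m)} (hF : Submodule.span ℂ (Set.range F) = ⊤)
    (hG : Submodule.span ℂ (Set.range G) = ⊤)
    (h : ∀ k l, Θ n (contract ε (G l) (F k)) = Θ m (contract ε' (F k) (G l)))
    (f : m ⟶ c ⊙ₗ n) (g : n ⟶ d ⊙ₗ m) : Θ n (contract ε g f) = Θ m (contract ε' f g) := by
  obtain ⟨y, rfl⟩ : ∃ y : ι → ℂ, ∑ e, y e • F e = f := by
    have : f ∈ Submodule.span ℂ (Set.range F) := by rw [hF]; trivial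
    exact (Submodule.mem_span_range_iff_exists_fun ℂ).1 this
  obtain ⟨z, rfl⟩ : ∃ z : κ → ℂ, ∑ e, z e • G e = g := by
    have : g ∈ Submodule.span ℂ (Set.range G) := by rw [hG]; trivial
    exact (Submodule.mem_span_range_iff_exists_fun ℂ).1 this
  simp only [contract_sum, sum_contract, smul_contract, contract_smul, map_sum, map_smul, h]
  simp only [Finset.smul_sum]
  rw [Finset.sum_comm]
  refine Finset.sum_congr rfl fun _ _ => Finset.sum_congr rfl fun _ _ => ?_
  exact smul_comm _ _ _

section EdgePairing

variable [Duality C] {X : C} [Quiver.{x} V]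

open Classical in
/-- The edge morphisms of `e` and of `ē` are dual to each other up to the factors prescribed by
`r`. -/
structure IsEdgePairing (β : EdgeMorphisms M X) (r : V → ℂ) : Prop where
  ev_eq {i j : V} (e e' : i ⟶ j) : contract (ev X) (β false j i e') (β true i j e) =
    if e = e' then (r i / r j) • 𝟙 (M.simple j) else 0
  evR_eq {i j : V} (e e' : i ⟶ j) : contract (evR X) (β true i j e) (β false j i e') =
    if e = e' then (r j / r i) • 𝟙 (M.simple i) else 0

/-- On a pair of dual basis elements both traces are r_i r_j: λ_j r_i/r_j on one side and λ_i
r_j/r_i on the other, with λ = r². -/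
theorem IsEdgePairing.isTraceDual [Fintype V] [∀ i j : V, Finite (i ⟶ j)] {β : EdgeMorphisms M X}
    {r : V → ℂ} (h : IsEdgePairing β r) (hβ : IsEdgeBasis β) (hlam : ∀ i, lam i ≠ 0)
    (hr : ∀ i, r i ^ 2 = lam i) : IsTraceDual (weightTrace M lam) (ev X) (evR X) := by
  have hr0 : ∀ i, r i ≠ 0 := fun i h0 => hlam i (by rw [← hr, h0]; simp)
  refine isTraceDual_of_simple weightTrace_cyclic fun i j f g => ?_
  refine contract_trace_eq_of_span (F := fun e : SEdge V true i j => β true i j e)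
    (G := fun e : SEdge V false j i => β false j i e) (hβ true i j).2 (hβ false j i).2
    (fun e e' => ?_) f g
  refine (congrArg _ (h.ev_eq e e')).trans (Eq.trans ?_ (congrArg _ (h.evR_eq e e')).symm)
  split_ifs
  · rw [map_smul, map_smul, weightTrace_id, weightTrace_id, ← hr, ← hr, smul_eq_mul, smul_eq_mul]
    have := hr0 i
    have := hr0 j
    field_simp
  · simp

/-- The value of a combination of basis elements at a basis element. -/
theorem sum_smul_single {E : Type*} [Fintype E] {a b : List Bool}
    (Φ : E → Σ i j : V, EPath V a i j × EPath V b i j) (hΦ : Function.Injective Φ) (y : E → ℂ)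
    (z : E) {i j : V} (p : EPath V a i j) (q : EPath V b i j) (hz : Φ z = ⟨i, j, p, q⟩) :
    (∑ z, y z • GHom.single (Φ z).2.2.1 (Φ z).2.2.2 : GHom V a b) i j p q = y z := by
  classical
  simp only [Finset.sum_apply, Pi.smul_apply, smul_eq_mul, GHom.single]
  rw [Finset.sum_eq_single z]
  · rw [if_pos hz, mul_one]
  · intro z' _ h
    rw [if_neg, mul_zero]
    exact fun h' => h (hΦ (h'.trans hz.symm))
  · simp

theorem sum_smul_single_eq_zero {E : Type*} [Fintype E] {a b : List Bool}
    (Φ : E → Σ i j : V, EPath V a i j × EPath V b i j) (y : E → ℂ)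
    {i j : V} (p : EPath V a i j) (q : EPath V b i j) (hz : ∀ z, Φ z ≠ ⟨i, j, p, q⟩) :
    (∑ z, y z • GHom.single (Φ z).2.2.1 (Φ z).2.2.2 : GHom V a b) i j p q = 0 := by
  classical
  simp only [Finset.sum_apply, Pi.smul_apply, smul_eq_mul, GHom.single]
  refine Finset.sum_eq_zero fun z _ => ?_
  rw [if_neg, mul_zero]
  exact hz z

variable [Fintype V] [∀ i j : V, Finite (i ⟶ j)]

/-- `P` lists the pairs of paths that occur in a duality morphism. It is injective, so coefficients
can be read off, and they vanish at all other pairs. -/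
theorem sum_edges_single {a b : List Bool}
    (P : ∀ {i j : V}, (i ⟶ j) → Σ i j : V, EPath V a i j × EPath V b i j)
    (hP : ∀ {i j i' j' : V} (e : i ⟶ j) (e' : i' ⟶ j'), P e = P e' →
      (⟨i, j, e⟩ : Σ i j : V, (i ⟶ j)) = ⟨i', j', e'⟩) (y : V → V → ℂ) {A : GHom V a b}
    (hA : A = ∑ i : V, ∑ j : V, ∑ e : i ⟶ j, y i j • GHom.single (P e).2.2.1 (P e).2.2.2) :
    (∀ {i j : V} (e : i ⟶ j), A (P e).1 (P e).2.1 (P e).2.2.1 (P e).2.2.2 = y i j) ∧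
      ∀ {i j : V} (p : EPath V a i j) (q : EPath V b i j),
        (∀ {i' j' : V} (e : i' ⟶ j'), P e ≠ ⟨i, j, p, q⟩) → A i j p q = 0 := by
  let Φ : (Σ i j : V, (i ⟶ j)) → Σ i j : V, EPath V a i j × EPath V b i j := fun z => P z.2.2
  have hA : A = ∑ z, y z.1 z.2.1 • GHom.single (Φ z).2.2.1 (Φ z).2.2.2 := by
    rw [hA, Fintype.sum_sigma]
    refine Finset.sum_congr rfl fun i _ => ?_
    rw [Fintype.sum_sigma]
  rw [hA]
  refine ⟨fun e => ?_, fun p q h => ?_⟩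
  · exact sum_smul_single Φ (fun z z' h => hP _ _ h) (fun z => y z.1 z.2.1) ⟨_, _, e⟩ _ _ rfl
  · exact sum_smul_single_eq_zero Φ (fun z => y z.1 z.2.1) p q fun z => h z.2.2

variable (r : V → ℂ)

open Classical in
theorem oGPA_ev_true {i j : V} (e e' : i ⟶ j) :
    ((oGPA V r).ev true : GHom V [false, true] []) j j
      (.cons (a := false) (i := j) (j := i) e' (.cons (a := true) (i := i) (j := j) e (.nil j)))
      (.nil j) = if e = e' then r i / r j else 0 := by
  obtain ⟨h1, h2⟩ := sum_edges_single (V := V)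
    (fun {i j} e => ⟨j, j, EPath.roundTripRev e, EPath.nil j⟩)
    (by rintro i j i' j' e e' h; cases h; rfl) (fun i j => r i / r j)
    (A := (oGPA V r).ev true) rfl
  split_ifs with h
  · subst h; exact h1 e
  · exact h2 _ _ (by rintro i' j' f hf; cases hf; exact h rfl)

open Classical in
theorem oGPA_ev_false {i j : V} (e e' : i ⟶ j) :
    ((oGPA V r).ev false : GHom V [true, false] []) i i
      (.cons (a := true) (i := i) (j := j) e (.cons (a := false) (i := j) (j := i) e' (.nil i)))
      (.nil i) = if e = e' then r j / r i else 0 := by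
  obtain ⟨h1, h2⟩ := sum_edges_single (V := V)
    (fun {i j} e => ⟨i, i, EPath.roundTrip e, EPath.nil i⟩)
    (by rintro i j i' j' e e' h; cases h; rfl) (fun i j => r j / r i)
    (A := (oGPA V r).ev false) rfl
  split_ifs with h
  · subst h; exact h1 e
  · exact h2 _ _ (by rintro i' j' f hf; cases hf; exact h rfl)

open Classical in
theorem oGPA_coev_true {i j : V} (e e' : i ⟶ j) :
    ((oGPA V r).coev true : GHom V [] [true, false]) i i (.nil i)
      (.cons (a := true) (i := i) (j := j) e (.cons (a := false) (i := j) (j := i) e' (.nil i))) =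
      if e = e' then r j / r i else 0 := by
  obtain ⟨h1, h2⟩ := sum_edges_single (V := V)
    (fun {i j} e => ⟨i, i, EPath.nil i, EPath.roundTrip e⟩)
    (by rintro i j i' j' e e' h; cases h; rfl) (fun i j => r j / r i)
    (A := (oGPA V r).coev true) rfl
  split_ifs with h
  · subst h; exact h1 e
  · exact h2 _ _ (by rintro i' j' f hf; cases hf; exact h rfl)

open Classical in
theorem oGPA_coev_false {i j : V} (e e' : i ⟶ j) :
    ((oGPA V r).coev false : GHom V [] [false, true]) j j (.nil j)
      (.cons (a := false) (i := j) (j := i) e' (.cons (a := true) (i := i) (j := j) e (.nil j))) =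
      if e = e' then r i / r j else 0 := by
  obtain ⟨h1, h2⟩ := sum_edges_single (V := V)
    (fun {i j} e => ⟨j, j, EPath.nil j, EPath.roundTripRev e⟩)
    (by rintro i j i' j' e e' h; cases h; rfl) (fun i j => r i / r j)
    (A := (oGPA V r).coev false) rfl
  split_ifs with h
  · subst h; exact h1 e
  · exact h2 _ _ (by rintro i' j' f hf; cases hf; exact h rfl)

omit [Abelian C] [Linear ℂ C] [Duality C] in
-- Words end in a factor `𝟙_ C`; this removes it, so that evaluations on words of length two become
-- contractions.
theorem contract_pair {D : Type uD} [Category.{vD} D] [MonoidalLeftAction C D] {c d : C}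
    (ε : d ⊗ c ⟶ 𝟙_ C) {m n n' : D} (g : n' ⟶ d ⊙ₗ m) (f : m ⟶ c ⊙ₗ n) :
    (g ≫ d ⊴ₗ (f ≫ c ⊴ₗ (λₗ[C] n).inv ≫ (αₗ _ _ _).inv) ≫ (αₗ _ _ _).inv) ≫
      (d ◁ (ρ_ c).hom ≫ ε) ⊵ₗ n = contract ε g f ≫ (λₗ[C] _).inv := by
  simp only [contract, comp_actionHomLeft,
    whiskerLeft_actionHomLeft, rightUnitor_actionHom, Category.assoc, actionHomRight_comp,
    Iso.inv_hom_id_assoc, Iso.hom_inv_id, Category.comp_id]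
  simp only [← actionHomRight_comp_assoc, ← actionHomRight_comp, Iso.inv_hom_id_assoc,
    Iso.inv_hom_id, actionHomRight_id, Category.id_comp]

theorem pathMorphism_ev (β : EdgeMorphisms M X) {i j k : V} (e' : i ⟶ j) (e : i ⟶ k) :
    pathMorphism β (.cons (a := false) (i := j) (j := i) e'
        (.cons (a := true) (i := i) (j := k) e (.nil k))) ≫
      (dual X ◁ (ρ_ X).hom ≫ OrientedGPA.ev X) ⊵ₗ M.simple k =
      contract (OrientedGPA.ev X) (β false j i e') (β true i k e) ≫ (λₗ[C] _).inv := by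
  exact contract_pair _ _ _

theorem pathMorphism_evR (β : EdgeMorphisms M X) {i j k : V} (e : i ⟶ j) (e' : k ⟶ j) :
    pathMorphism β (.cons (a := true) (i := i) (j := j) e
        (.cons (a := false) (i := j) (j := k) e' (.nil k))) ≫
      (X ◁ (ρ_ (dual X)).hom ≫ OrientedGPA.evR X) ⊵ₗ M.simple k =
      contract (OrientedGPA.evR X) (β true i j e) (β false j k e') ≫ (λₗ[C] _).inv := by
  exact contract_pair _ _ _

end EdgePairing

end WeightTrace

/-! ### Evaluations and coevaluations as matrices -/

section EdgePairingMatrices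

open MonoidalLeftAction

theorem EPath.subsingleton_nil {V : Type w} [Quiver.{x} V] (i j : V) :
    Subsingleton (EPath V [] i j) := ⟨by rintro ⟨⟩ ⟨⟩; rfl⟩

theorem EPath.sum_nil_self {V : Type w} [Quiver.{x} V] [Fintype V] [∀ i j : V, Finite (i ⟶ j)]
    {A : Type*} [AddCommMonoid A] (i : V) (F : EPath V [] i i → A) :
    ∑ p, F p = F (.nil i) :=
  have := EPath.subsingleton_nil i i
  Fintype.sum_subsingleton _ _

variable {C : Type u} [Category.{v} C] [Abelian C] [Linear ℂ C] [MonoidalCategory C]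
variable {V : Type w} {M : SemisimpleModule.{v, u, vD, uD} C V}

/-- The copairing is determined by the pairing, so it is the canonical element of any dual bases.
Both sides have the same contraction with `ε`, which is checked on the basis `G` and determines them
by `insertPair_contract`. -/
theorem insertPair_eq_sum [Fintype V] {c d : C} {ε : d ⊗ c ⟶ 𝟙_ C} {η : 𝟙_ C ⟶ c ⊗ d}
    (h1 : d ◁ η ≫ (α_ _ _ _).inv ≫ ε ▷ d = (ρ_ d).hom ≫ (λ_ d).inv)
    (h2 : η ▷ c ≫ (α_ _ _ _).hom ≫ c ◁ ε = (λ_ c).hom ≫ (ρ_ c).inv)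
    (i : V) {E : V → Type*} [∀ j, Fintype (E j)] [∀ j, DecidableEq (E j)]
    {F : ∀ j, E j → (M.simple i ⟶ c ⊙ₗ M.simple j)}
    {G : ∀ j, E j → (M.simple j ⟶ d ⊙ₗ M.simple i)}
    (hG : ∀ j, Submodule.span ℂ (Set.range (G j)) = ⊤) {t : V → ℂ} (ht : ∀ j, t j ≠ 0)
    (hFG : ∀ j e e', contract ε (G j e') (F j e) = if e = e' then t j • 𝟙 _ else 0) :
    insertPair η (M.simple i) = ∑ j, ∑ e, (t j)⁻¹ • F j e ≫ c ⊴ₗ G j e := by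
  have key : ∀ u : M.simple i ⟶ c ⊙ₗ d ⊙ₗ M.simple i,
      u = insertPair η _ ≫ c ⊴ₗ contract ε (𝟙 _) u := fun u => (insertPair_contract h2 u).symm
  suffices h : contract ε (𝟙 _) (insertPair η (M.simple i)) =
      contract ε (𝟙 _) (∑ j, ∑ e, (t j)⁻¹ • F j e ≫ c ⊴ₗ G j e) by
    rw [key (∑ j, ∑ e, (t j)⁻¹ • F j e ≫ c ⊴ₗ G j e), ← h, ← key]
  refine M.reps.hom_ext fun j x => ?_
  rw [← contract_eq, ← contract_eq, contract_insertPair h1]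
  obtain ⟨z, rfl⟩ : ∃ z : E j → ℂ, ∑ e, z e • G j e = x := by
    have : x ∈ Submodule.span ℂ (Set.range (G j)) := by rw [hG]; trivial
    exact (Submodule.mem_span_range_iff_exists_fun ℂ).1 this
  rw [sum_contract]
  refine Finset.sum_congr rfl fun e' _ => ?_
  rw [smul_contract, contract_sum]
  congr 1
  symm
  simp only [contract_sum, contract_smul, contract_comp_right]
  rw [Finset.sum_eq_single j]
  · simp only [hFG]
    rw [Finset.sum_eq_single e']
    · simp [ht]
    · intro e _ h
      simp [h]
    · simp
  · intro k _ hk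
    refine Finset.sum_eq_zero fun e _ => ?_
    rw [M.reps.hom_eq_zero hk.symm (contract ε _ _), zero_comp, smul_zero]
  · simp

omit [Abelian C] [Linear ℂ C] in
theorem unit_copair {D : Type uD} [Category.{vD} D] [MonoidalLeftAction C D] {c d : C}
    (η : 𝟙_ C ⟶ c ⊗ d) (n : D) : (λₗ[C] n).inv ≫ (η ≫ c ◁ (ρ_ d).inv) ⊵ₗ n =
      insertPair η n ≫ c ⊴ₗ (d ⊴ₗ (λₗ[C] n).inv ≫ (αₗ _ _ _).inv) ≫ (αₗ _ _ _).inv := by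
  simp [insertPair, rightUnitor_inv_act, assoc_inv_associator_hom]

omit [Abelian C] [Linear ℂ C] in
theorem copair_path {D : Type uD} [Category.{vD} D] [MonoidalLeftAction C D] {c d : C}
    {m n n' : D} (f : m ⟶ c ⊙ₗ n) (g : n ⟶ d ⊙ₗ n') :
    (f ≫ c ⊴ₗ g) ≫ c ⊴ₗ (d ⊴ₗ (λₗ[C] n').inv ≫ (αₗ _ _ _).inv) ≫ (αₗ _ _ _).inv =
      f ≫ c ⊴ₗ (g ≫ d ⊴ₗ (λₗ[C] n').inv ≫ (αₗ _ _ _).inv) ≫ (αₗ _ _ _).inv := by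
  simp

theorem copair_sum [Fintype V] {c d : C} {i k : V} {E : V → Type*} [∀ j, Fintype (E j)] (t : V → ℂ)
    (F : ∀ j, E j → (M.simple i ⟶ c ⊙ₗ M.simple j))
    (G : ∀ j, E j → (M.simple j ⟶ d ⊙ₗ M.simple k)) :
    (∑ j, ∑ e, t j • F j e ≫ c ⊴ₗ G j e) ≫
      c ⊴ₗ (d ⊴ₗ (λₗ[C] (M.simple k)).inv ≫ (αₗ _ _ _).inv) ≫ (αₗ _ _ _).inv =
      ∑ j, ∑ e, t j • (F j e ≫ c ⊴ₗ (G j e ≫ d ⊴ₗ (λₗ[C] (M.simple k)).inv ≫ (αₗ _ _ _).inv) ≫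
        (αₗ _ _ _).inv) := by
  simp only [Preadditive.sum_comp, ← copair_path, Linear.smul_comp]

theorem scalar_comp_unit_inv {n : M.carrier} {f : n ⟶ n} {z : ℂ} {P : Prop} [Decidable P]
    (h : f = if P then z • 𝟙 n else 0) :
    f ≫ (λₗ[C] n).inv = (if P then z else 0) • (λₗ[C] n).inv := by
  rw [h]
  split_ifs <;> simp

variable [Duality C] {X : C} [Quiver.{x} V] [Fintype V] [∀ i j : V, Finite (i ⟶ j)]

theorem IsActionMatrix.isEdgePairing {β : EdgeMorphisms M X} {r : V → ℂ}
    {φ : ∀ a b : List Bool, (planarAlgebraOf X).Hom a b → GHom V a b} (h : IsActionMatrix β φ)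
    (hev : ∀ s, φ _ _ ((planarAlgebraOf X).ev s) = (oGPA V r).ev s) : IsEdgePairing β r where
  ev_eq {i j} e e' := by
    classical
    have h1 := h _ _ ((planarAlgebraOf X).ev true) j j
      (.cons (a := false) (i := j) (j := i) e' (.cons (a := true) (i := i) (j := j) e (.nil j)))
    rw [hev, EPath.sum_nil_self, oGPA_ev_true] at h1
    have h2 := (pathMorphism_ev β e' e).symm.trans h1
    rw [← cancel_mono (λₗ[C] (M.simple j)).inv, h2]
    exact (scalar_comp_unit_inv rfl).symm
  evR_eq {i j} e e' := by
    classical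
    have h1 := h _ _ ((planarAlgebraOf X).ev false) i i
      (.cons (a := true) (i := i) (j := j) e (.cons (a := false) (i := j) (j := i) e' (.nil i)))
    rw [hev, EPath.sum_nil_self, oGPA_ev_false] at h1
    have h2 := (pathMorphism_evR β e e').symm.trans h1
    rw [← cancel_mono (λₗ[C] (M.simple i)).inv, h2]
    exact (scalar_comp_unit_inv rfl).symm

theorem IsEdgePairing.actionMatrix_ev {β : EdgeMorphisms M X} (hβ : IsEdgeBasis β) {r : V → ℂ}
    (h : IsEdgePairing β r) (s : Bool) :
    actionMatrix β hβ ((planarAlgebraOf X).ev s) = (oGPA V r).ev s := by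
  classical
  symm
  refine eq_actionMatrix _ _ _ _ fun i k p => ?_
  cases s
  · obtain ⟨⟨j, e, p⟩, rfl⟩ := (EPath.consEquiv V _ _ _ _).surjective p
    obtain ⟨⟨k', e', p⟩, rfl⟩ := (EPath.consEquiv V _ _ _ _).surjective p
    cases p
    refine (pathMorphism_evR β e e').trans ?_
    by_cases hk : i = k
    · subst hk
      rw [EPath.sum_nil_self]
      refine Eq.trans ?_ (congrArg (· • _) (oGPA_ev_false r e e')).symm
      exact scalar_comp_unit_inv (h.evR_eq e e')
    · refine (congrArg (· ≫ _) (M.reps.hom_eq_zero hk _)).trans (zero_comp.trans ?_)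
      symm
      refine Finset.sum_eq_zero fun q _ => ?_
      cases q
      exact absurd rfl hk
  · obtain ⟨⟨j, e', p⟩, rfl⟩ := (EPath.consEquiv V _ _ _ _).surjective p
    obtain ⟨⟨k', e, p⟩, rfl⟩ := (EPath.consEquiv V _ _ _ _).surjective p
    cases p
    refine (pathMorphism_ev β e' e).trans ?_
    by_cases hk : i = k
    · subst hk
      rw [EPath.sum_nil_self]
      refine Eq.trans ?_ (congrArg (· • _) (oGPA_ev_true r e e')).symm
      exact scalar_comp_unit_inv (h.ev_eq e e')
    · refine (congrArg (· ≫ _) (M.reps.hom_eq_zero hk _)).trans (zero_comp.trans ?_)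
      symm
      refine Finset.sum_eq_zero fun q _ => ?_
      cases q
      exact absurd rfl hk

open Classical in
-- In the canonical element the factor r_i/r_j of the pairing is inverted to r_j/r_i. This is the
-- coefficient prescribed in the graph planar algebra, so coevaluations impose no further condition
-- on the bases.
theorem IsEdgePairing.actionMatrix_coev {β : EdgeMorphisms M X} (hβ : IsEdgeBasis β) {r : V → ℂ}
    (h : IsEdgePairing β r) (hr : ∀ i, r i ≠ 0) (s : Bool) :
    actionMatrix β hβ ((planarAlgebraOf X).coev s) = (oGPA V r).coev s := by
  symm
  refine eq_actionMatrix _ _ _ _ fun i k p => ?_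
  cases p
  cases s
  · refine (unit_copair (coevR X) (M.simple i)).trans ?_
    have h1 := insertPair_eq_sum (M := M) (evR_coevR_zigzag X) (coevR_evR_zigzag X) i
      (E := fun j => SEdge V false i j) (F := fun j e => β false i j e)
      (G := fun j e => β true j i e) (fun j => (hβ true j i).2) (t := fun j => r i / r j)
      (fun j => div_ne_zero (hr i) (hr j))
      (fun j e e' => (h.evR_eq e' e).trans (if_congr eq_comm rfl rfl))
    refine (congrArg (· ≫ _) h1).trans ((copair_sum _ _ _).trans ?_)
    symm
    rw [EPath.sum_cons_fixed]
    refine Finset.sum_congr rfl fun j _ => Finset.sum_congr rfl fun e _ => ?_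
    rw [EPath.sum_cons_fixed]
    refine (Finset.sum_eq_single i ?_ ?_).trans ?_
    · intro k _ hk
      refine Finset.sum_eq_zero fun e' _ => Finset.sum_eq_zero fun p _ => ?_
      cases p
      exact absurd rfl hk
    · simp
    · refine (Finset.sum_eq_single e ?_ ?_).trans ?_
      · intro e' _ he
        rw [EPath.sum_nil_self]
        exact (congrArg (· • _) ((oGPA_coev_false r e' e).trans (if_neg he))).trans
          (zero_smul _ _)
      · exact fun h => absurd (Finset.mem_univ _) h
      · rw [EPath.sum_nil_self]
        exact congrArg (· • _)
          ((oGPA_coev_false r e e).trans ((if_pos rfl).trans (inv_div _ _).symm))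
  · refine (unit_copair (coev X) (M.simple i)).trans ?_
    have h1 := insertPair_eq_sum (M := M) (ev_coev_zigzag X) (coev_ev_zigzag X) i
      (E := fun j => SEdge V true i j) (F := fun j e => β true i j e)
      (G := fun j e => β false j i e) (fun j => (hβ false j i).2) (t := fun j => r i / r j)
      (fun j => div_ne_zero (hr i) (hr j))
      (fun j e e' => h.ev_eq e e')
    refine (congrArg (· ≫ _) h1).trans ((copair_sum _ _ _).trans ?_)
    symm
    rw [EPath.sum_cons_fixed]
    refine Finset.sum_congr rfl fun j _ => Finset.sum_congr rfl fun e _ => ?_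
    rw [EPath.sum_cons_fixed]
    refine (Finset.sum_eq_single i ?_ ?_).trans ?_
    · intro k _ hk
      refine Finset.sum_eq_zero fun e' _ => Finset.sum_eq_zero fun p _ => ?_
      cases p
      exact absurd rfl hk
    · simp
    · refine (Finset.sum_eq_single e ?_ ?_).trans ?_
      · intro e' _ he
        rw [EPath.sum_nil_self]
        exact (congrArg (· • _) ((oGPA_coev_true r e e').trans (if_neg (Ne.symm he)))).trans
          (zero_smul _ _)
      · exact fun h => absurd (Finset.mem_univ _) h
      · rw [EPath.sum_nil_self]
        exact congrArg (· • _)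
          ((oGPA_coev_true r e e).trans ((if_pos rfl).trans (inv_div _ _).symm))

end EdgePairingMatrices

/-! ### From a module trace to dual edge bases -/

section PivotalToPlanar

open MonoidalLeftAction

variable {C : Type u} [Category.{v} C] [Abelian C] [Linear ℂ C] [MonoidalCategory C]
variable [Duality C] {X : C} {V : Type w} {M : SemisimpleModule.{v, u, vD, uD} C V}

variable (X M) in
/-- The pairing of `Hom(Mⱼ, X* ⊗ Mᵢ)` with `Hom(Mᵢ, X ⊗ Mⱼ)`. -/
def evPairing (i j : V) : (M.simple j ⟶ dual X ⊙ₗ M.simple i) →ₗ[ℂ]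
    (M.simple i ⟶ X ⊙ₗ M.simple j) →ₗ[ℂ] ℂ :=
  LinearMap.mk₂ ℂ (fun g f => M.reps.scal j (contract (ev X) g f))
    (fun g g' f => by rw [← map_add]; simp [contract])
    (fun z g f => by rw [smul_contract, map_smul])
    (fun g f f' => by rw [← map_add]; simp [contract, M.act_add])
    (fun z g f => by rw [contract_smul, map_smul])

theorem evPairing_apply {i j : V} (g : M.simple j ⟶ dual X ⊙ₗ M.simple i)
    (f : M.simple i ⟶ X ⊙ₗ M.simple j) :
    evPairing X M i j g f = M.reps.scal j (contract (ev X) g f) := rfl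

variable {Θ : ∀ m : M.carrier, (m ⟶ m) →ₗ[ℂ] ℂ}

theorem trace_simple {mu : V → ℂ} (hmu : ∀ i, Θ _ (𝟙 (M.simple i)) = mu i) (i : V)
    (f : M.simple i ⟶ M.simple i) : Θ _ f = mu i * M.reps.scal i f := by
  conv_lhs => rw [← M.reps.scal_smul_id i f, map_smul, hmu, smul_eq_mul, mul_comm]

theorem evPairing_flip_injective (i j : V) : Function.Injective (evPairing X M i j).flip := by
  rw [injective_iff_map_eq_zero]
  intro f hf
  rw [← insertPair_contract (coev_ev_zigzag X) f]
  have : contract (ev X) (𝟙 _) f = 0 := by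
    refine M.reps.hom_ext fun k x => ?_
    rw [← contract_eq, comp_zero]
    by_cases hk : k = j
    · subst hk
      have := LinearMap.congr_fun hf x
      simpa [evPairing_apply] using this
    · exact M.reps.hom_eq_zero hk _
  rw [this, M.act_zero, comp_zero]

/-- A zigzag recovers `g` from its contraction with `evR X`, whereas the pairing uses `ev X`. The
trace passes from one to the other, at the price of nonzero weights. -/
theorem evPairing_injective (hΘ : IsModuleTrace C Θ) {mu : V → ℂ}
    (hmu : ∀ i, Θ _ (𝟙 (M.simple i)) = mu i) (hmu0 : ∀ i, mu i ≠ 0) (i j : V) :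
    Function.Injective (evPairing X M i j) := by
  rw [injective_iff_map_eq_zero]
  intro g hg
  rw [← insertPair_contract (coevR_evR_zigzag X) g]
  have : contract (evR X) (𝟙 _) g = 0 := by
    refine M.reps.hom_ext fun k x => ?_
    rw [← contract_eq, comp_zero]
    by_cases hk : k = i
    · subst hk
      have h1 := LinearMap.congr_fun hg x
      rw [evPairing_apply, LinearMap.zero_apply] at h1
      have h2 := hΘ.isTraceDual X _ _ x g
      rw [trace_simple hmu, trace_simple hmu, h1, mul_zero] at h2
      have h3 := (mul_eq_zero.1 h2.symm).resolve_left (hmu0 k)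
      simpa using h3
    · exact M.reps.hom_eq_zero hk _
  rw [this, M.act_zero, comp_zero]

open Classical in
theorem linearIndependent_span_of_evPairing (hΘ : IsModuleTrace C Θ) {mu : V → ℂ}
    (hmu : ∀ i, Θ _ (𝟙 (M.simple i)) = mu i) (hmu0 : ∀ i, mu i ≠ 0) {i j : V} {E : Type*}
    [Fintype E] {F : E → (M.simple i ⟶ X ⊙ₗ M.simple j)}
    {G : E → (M.simple j ⟶ dual X ⊙ₗ M.simple i)} (hF : Submodule.span ℂ (Set.range F) = ⊤)
    {t : ℂ} (ht : t ≠ 0)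
    (h : ∀ e e', evPairing X M i j (G e') (F e) = if e = e' then t else 0) :
    LinearIndependent ℂ G ∧ Submodule.span ℂ (Set.range G) = ⊤ := by
  constructor
  · rw [Fintype.linearIndependent_iff]
    intro z hz e
    have h1 := LinearMap.congr_fun (congrArg (evPairing X M i j) hz) (F e)
    simpa [h, ht] using h1
  · rw [Submodule.eq_top_iff']
    intro g
    have : g = ∑ e, (evPairing X M i j g (F e) / t) • G e := by
      apply evPairing_injective hΘ hmu hmu0
      refine LinearMap.ext_on hF ?_
      rintro _ ⟨e, rfl⟩
      simp [h, ht]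
    rw [this]
    exact Submodule.sum_mem _ fun e _ => Submodule.smul_mem _ _
      (Submodule.subset_span (Set.mem_range_self e))

variable [Quiver.{x} V] [∀ i j : V, Finite (i ⟶ j)]

open Classical in
-- Only the values at `ev X` have to be arranged; the trace forces those at `evR X`. The hypothesis
-- `hr` relates `mu` and the squares of `r` only along edges, which is all that is available in the
-- unitary case.
theorem isEdgeBasis_isEdgePairing_of_ev (hΘ : IsModuleTrace C Θ) {mu r : V → ℂ}
    (hmu : ∀ i, Θ _ (𝟙 (M.simple i)) = mu i) (hmu0 : ∀ i, mu i ≠ 0) (hr0 : ∀ i, r i ≠ 0)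
    (hr : ∀ {i j : V}, (i ⟶ j) → mu j * r i ^ 2 = mu i * r j ^ 2) {β : EdgeMorphisms M X}
    (hβ : ∀ i j : V, LinearIndependent ℂ (β true i j) ∧
      Submodule.span ℂ (Set.range (β true i j)) = ⊤)
    (hev : ∀ {i j : V} (e e' : i ⟶ j), evPairing X M i j (β false j i e') (β true i j e) =
      if e = e' then r i / r j else 0) : IsEdgeBasis β ∧ IsEdgePairing β r := by
  refine ⟨fun a i j => ?_, fun {i j} e e' => ?_, fun {i j} e e' => ?_⟩
  · cases a
    · exact linearIndependent_span_of_evPairing hΘ hmu hmu0 (hβ j i).2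
        (div_ne_zero (hr0 j) (hr0 i)) hev
    · exact hβ i j
  · refine (M.reps.scal_smul_id j _).symm.trans ?_
    refine (congrArg (· • _) (hev e e')).trans ?_
    split_ifs <;> simp
  · refine (M.reps.scal_smul_id i _).symm.trans ?_
    have h2 := hΘ.isTraceDual X _ _ (β true i j e) (β false j i e')
    rw [trace_simple hmu, trace_simple hmu] at h2
    have h3 : mu j * (if e = e' then r i / r j else 0) = _ :=
      (congrArg (mu j * ·) (hev e e')).symm.trans h2
    have h4 : M.reps.scal i (contract (evR X) (β true i j e) (β false j i e')) =
        if e = e' then r j / r i else 0 := by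
      apply mul_left_cancel₀ (hmu0 i)
      refine h3.symm.trans ?_
      split_ifs
      · have := hr e
        have := hr0 i
        have := hr0 j
        field_simp
        linear_combination hr e
      · simp
    refine (congrArg (· • _) h4).trans ?_
    split_ifs <;> simp

theorem exists_isEdgePairing (hM : M.HasFusionGraph X) (hΘ : IsModuleTrace C Θ) {mu r : V → ℂ}
    (hmu : ∀ i, Θ _ (𝟙 (M.simple i)) = mu i) (hmu0 : ∀ i, mu i ≠ 0) (hr : ∀ i, r i ^ 2 = mu i) :
    ∃ β : EdgeMorphisms M X, IsEdgeBasis β ∧ IsEdgePairing β r := by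
  classical
  have hr0 : ∀ i, r i ≠ 0 := fun i h0 => hmu0 i (by rw [← hr, h0]; simp)
  have B : ∀ i j : V, Module.Basis (i ⟶ j) ℂ (M.simple i ⟶ X ⊙ₗ M.simple j) := fun i j => by
    have := M.reps.finite (M.simple i) (X ⊙ₗ M.simple j)
    exact (Module.finBasis ℂ _).reindex
      (Fintype.equivOfCardEq (by rw [Fintype.card_fin, hM i j, Nat.card_eq_fintype_card]))
  have hG : ∀ (i j : V) (e' : i ⟶ j), ∃ g, ∀ e, evPairing X M i j g (B i j e) =
      if e = e' then r i / r j else 0 := fun i j e' => by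
    have := M.reps.finite (M.simple j) (dual X ⊙ₗ M.simple i)
    -- In finite dimension, injectivity on both sides makes the pairing perfect, so the scaled dual
    -- basis for `X*` exists for an arbitrary basis for `X`.
    have hp := LinearMap.IsPerfPair.of_injective (evPairing_injective (X := X) hΘ hmu hmu0 i j)
      (evPairing_flip_injective i j)
    obtain ⟨g, hg⟩ := hp.bijective_left.2 ((B i j).constr ℂ fun e => if e = e' then r i / r j else 0)
    exact ⟨g, fun e => by rw [hg, Module.Basis.constr_basis]⟩
  choose G hG using hG
  let β : EdgeMorphisms M X := fun a => match a with
    | true => fun i j e => B i j e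
    | false => fun j i e => G i j e
  refine ⟨β, isEdgeBasis_isEdgePairing_of_ev hΘ hmu hmu0 hr0
    (fun {i j} _ => by rw [hr, hr, mul_comm]) (fun i j => ⟨(B i j).linearIndependent, (B i j).span_eq⟩)
    fun {i j} e e' => hG i j e' e⟩

end PivotalToPlanar

/-! ### The embedding defined by a module category -/

section PlanarEmbeddingOfModule

variable {C : Type u} [Category.{v} C] [Abelian C] [Linear ℂ C] [MonoidalCategory C]
variable [MonoidalPreadditive C] [MonoidalLinear ℂ C] [PivotalCategory C]
variable {X : C} {V : Type w} [Quiver.{x} V] [Fintype V] [Nonempty V] [∀ i j : V, Finite (i ⟶ j)]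
variable {M : SemisimpleModule.{v, u, vD, uD} C V}

/-- The embedding of planar algebras given by the action on a module category. -/
def planarEmbeddingOf (hC : IsFusion C) {β : EdgeMorphisms M X} (hβ : IsEdgeBasis β) {r : V → ℂ}
    (hr : ∀ i, r i ≠ 0) (h : IsEdgePairing β r) :
    PlanarEmbedding (planarAlgebraOf X) (oGPA V r).toPlanarData where
  map {a b} :=
    { toFun := fun f => actionMatrix β hβ f
      map_add' := fun f g => actionMatrix_add β hβ f g
      map_smul' := fun z f => actionMatrix_smul β hβ z f }
  map_id a := actionMatrix_id hβ a
  map_comp f g := actionMatrix_comp β hβ hβ f g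
  map_tens f g := actionMatrix_tens β hβ f g
  map_ev s := h.actionMatrix_ev hβ s
  map_coev s := h.actionMatrix_coev hβ hr s
  injective a b := by
    rw [injective_iff_map_eq_zero]
    intro (f : word X a ⟶ word X b) hf
    have hf : actionMatrix β hβ f = 0 := hf
    -- Faithfulness of the action on one simple object suffices, hence the graph has to be
    -- non-empty.
    obtain ⟨i⟩ := ‹Nonempty V›
    refine M.act_injective hC i f (M.reps.hom_ext fun k x => ?_)
    rw [← pathSum_pathCoord hβ x, pathSum_apply, comp_zero]
    simp only [Preadditive.sum_comp, Category.assoc, MonoidalLeftAction.action_exchange]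
    refine Finset.sum_eq_zero fun j _ => Finset.sum_eq_zero fun p _ => ?_
    rw [← Category.assoc, ← sum_actionMatrix β hβ f p, hf]
    simp

theorem isActionMatrix_planarEmbeddingOf (hC : IsFusion C) {β : EdgeMorphisms M X}
    (hβ : IsEdgeBasis β) {r : V → ℂ} (hr : ∀ i, r i ≠ 0) (h : IsEdgePairing β r) :
    IsActionMatrix β fun _ _ f => (planarEmbeddingOf hC hβ hr h).map f :=
  fun _ _ f _ _ p => (sum_actionMatrix β hβ f p).symm

theorem PivotalModule.exists_corresponds (hC : IsFusion C) {lam r : V → ℂ} (hlam : ∀ i, lam i ≠ 0)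
    (hr : ∀ i, r i ^ 2 = lam i) (M : PivotalModule.{v, u, vD, uD} X V lam) :
    ∃ φ : PlanarEmbedding (planarAlgebraOf X) (oGPA V r).toPlanarData,
      Corresponds (X := X) M.toSemisimpleModule fun _ _ f => φ.map f := by
  obtain ⟨Θ, hΘ, hmu⟩ := M.pivotal
  obtain ⟨β, hβ, h⟩ := exists_isEdgePairing M.fusionGraph hΘ hmu hlam hr
  have hr0 : ∀ i, r i ≠ 0 := fun i h0 => hlam i (by rw [← hr, h0]; simp)
  exact ⟨planarEmbeddingOf hC hβ hr0 h, β, hβ, isActionMatrix_planarEmbeddingOf hC hβ hr0 h⟩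

/-- A module category corresponding to a morphism of planar algebras is pivotal. -/
theorem Corresponds.exists_moduleTrace (hX : IsTensorGenerator X) {lam r : V → ℂ}
    (hlam : ∀ i, lam i ≠ 0) (hr : ∀ i, r i ^ 2 = lam i)
    (φ : PlanarMorphism (planarAlgebraOf X) (oGPA V r).toPlanarData)
    (h : Corresponds (X := X) M fun _ _ f => φ.map f) : IsModuleTrace C (weightTrace M lam) := by
  obtain ⟨β, hβ, hφ⟩ := h
  exact isModuleTrace_weightTrace hlam hX
    ((hφ.isEdgePairing φ.map_ev).isTraceDual hβ hlam hr)

end PlanarEmbeddingOfModule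

/-! ### Representations of the planar algebra on families of vector spaces -/

section PathVectors

variable {V : Type w} [Quiver.{x} V]

/-- `W`-valued functions on the `a`-paths starting at `i`. -/
abbrev PathVec (W : V → Type t) (a : List Bool) (i : V) := ∀ k, EPath V a i k → W k

/-- Cutting a path in two. -/
def EPath.appendEquiv (V : Type w) [Quiver.{x} V] (a b : List Bool) (i j : V) :
    (Σ k : V, EPath V a i k × EPath V b k j) ≃ EPath V (a ++ b) i j :=
  Equiv.ofBijective (fun z => z.2.1.append z.2.2)
    ⟨fun z z' h => EPath.append_inj z.2.1 z.2.2 z'.2.1 z'.2.2 h, fun P => by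
      obtain ⟨k, p, q, rfl⟩ := EPath.exists_append P
      exact ⟨⟨k, p, q⟩, rfl⟩⟩

/-- A function on pairs of composable paths as a function of their concatenation. -/
def PathVec.join {W : V → Type t} {a b : List Bool} {i : V}
    (y : PathVec (fun k => PathVec W b k) a i) : PathVec W (a ++ b) i :=
  fun j P => let z := (EPath.appendEquiv V a b i j).symm P; y z.1 z.2.1 j z.2.2

theorem PathVec.join_append {W : V → Type t} {a b : List Bool} {i j k : V}
    (y : PathVec (fun k => PathVec W b k) a i) (p : EPath V a i k) (q : EPath V b k j) :
    y.join j (p.append q) = y k p j q := by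
  have h : (EPath.appendEquiv V a b i j).symm (p.append q) = ⟨k, p, q⟩ :=
    (Equiv.symm_apply_eq _).2 rfl
  simp only [PathVec.join]
  rw [h]

theorem PathVec.ext_append {W : V → Type t} {a b : List Bool} {i : V} {y z : PathVec W (a ++ b) i}
    (h : ∀ k (p : EPath V a i k) j (q : EPath V b k j),
      y j (p.append q) = z j (p.append q)) : y = z := by
  funext j P
  obtain ⟨k, p, q, rfl⟩ := EPath.exists_append P
  exact h k p j q

/-- The function on the trivial path. -/
def PathVec.single {W : V → Type t} {i : V} (y : W i) : PathVec W [] i := fun _ p =>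
  match p with
  | .nil _ => y

theorem PathVec.ext_nil {W : V → Type t} {i : V} {y z : PathVec W [] i}
    (h : y i (.nil i) = z i (.nil i)) : y = z := by
  funext j p
  cases p
  exact h

variable [Fintype V] [∀ i j : V, Finite (i ⟶ j)]
variable {W : V → Type t} [∀ k, AddCommGroup (W k)] [∀ k, Module ℂ (W k)]

/-- The action of matrices on functions of paths. -/
def push {a b : List Bool} (A : GHom V a b) {i : V} : PathVec W a i →ₗ[ℂ] PathVec W b i where
  toFun y k q := ∑ p, A i k p q • y k p
  map_add' y z := by
    funext k q
    simp only [Pi.add_apply, smul_add, Finset.sum_add_distrib]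
  map_smul' z y := by
    funext k q
    simp only [Pi.smul_apply, smul_comm _ z, Finset.smul_sum, RingHom.id_apply]

theorem push_apply {a b : List Bool} (A : GHom V a b) {i : V} (y : PathVec W a i) (k : V)
    (q : EPath V b i k) : push A y k q = ∑ p, A i k p q • y k p := rfl

theorem push_one {a : List Bool} {i : V} (y : PathVec W a i) : push (GHom.one V a) y = y := by
  classical
  funext k q
  simp [push_apply, GHom.one]

theorem push_mul {a b c : List Bool} (A : GHom V a b) (B : GHom V b c) {i : V}
    (y : PathVec W a i) : push (GHom.mul A B) y = push B (push A y) := by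
  funext k q
  simp only [push_apply, GHom.mul, Finset.sum_smul, Finset.smul_sum, smul_smul]
  rw [Finset.sum_comm]
  simp only [mul_comm]

theorem push_add_left {a b : List Bool} (A B : GHom V a b) {i : V} (y : PathVec W a i) :
    push (A + B) y = push A y + push B y := by
  funext k q
  simp only [push_apply, Pi.add_apply, add_smul, Finset.sum_add_distrib]

theorem push_smul_left {a b : List Bool} (z : ℂ) (A : GHom V a b) {i : V} (y : PathVec W a i) :
    push (z • A) y = z • push A y := by
  funext k q
  simp only [push_apply, Pi.smul_apply, smul_assoc, Finset.smul_sum]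

theorem push_map {W' : V → Type*} [∀ k, AddCommGroup (W' k)] [∀ k, Module ℂ (W' k)]
    (s : ∀ k, W k →ₗ[ℂ] W' k) {a b : List Bool} (A : GHom V a b) {i : V} (y : PathVec W a i)
    (k : V) (q : EPath V b i k) :
    push A (fun k p => s k (y k p) : PathVec W' a i) k q = s k (push A y k q) := by
  simp only [push_apply, _root_.map_sum, _root_.map_smul]

theorem PathVec.sum_apply {ι : Type*} (s : Finset ι) {a : List Bool} {i : V}
    (y : ι → PathVec W a i) (k : V) (p : EPath V a i k) :
    (∑ l ∈ s, y l) k p = ∑ l ∈ s, y l k p := by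
  rw [Finset.sum_apply, Finset.sum_apply]

theorem sum_push {ι : Type*} (s : Finset ι) {a b : List Bool} (A : GHom V a b) {i : V}
    (y : ι → PathVec W a i) (k : V) (q : EPath V b i k) :
    ∑ l ∈ s, push A (y l) k q = push A (fun k p => ∑ l ∈ s, y l k p) k q := by
  simp only [push_apply, Finset.smul_sum]
  exact Finset.sum_comm

theorem push_tensor_join {a b c d : List Bool} (A : GHom V a b) (B : GHom V c d) {i : V}
    (y : PathVec (fun k => PathVec W c k) a i) :
    push (GHom.tensor A B) y.join =
      PathVec.join (push A fun k p => push B (y k p) : PathVec (fun k => PathVec W d k) b i) := by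
  refine PathVec.ext_append fun k q j q' => ?_
  rw [PathVec.join_append, push_apply, EPath.sum_append_fixed, Finset.sum_eq_single k]
  · simp only [GHom.tensor_append, PathVec.join_append, push_apply, Finset.sum_apply, Pi.smul_apply,
      Finset.smul_sum, smul_smul]
  · intro k' _ h
    refine Finset.sum_eq_zero fun _ _ => Finset.sum_eq_zero fun _ _ => ?_
    rw [GHom.tensor_append_of_ne _ _ h, zero_smul]
  · simp

end PathVectors

/-! ### Associativity of concatenation -/

section WordAssoc

variable {C : Type u} [Category.{v} C] [MonoidalCategory C] [Duality C] {X : C}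
variable {V : Type w} [Quiver.{x} V]

/-- Morphisms from `c` to words, together with a path along the word. -/
abbrev WordPath (X : C) (V : Type w) [Quiver.{x} V] (c : C) (i j : V) :=
  Σ a : List Bool, (c ⟶ word X a) × EPath V a i j

/-- The lists `(a ++ b) ++ c` and `a ++ (b ++ c)` are equal, though not definitionally. Bundling the
list with a morphism and a path allows an equation free of transports, and functions of the bundle
can be rewritten along it. -/
theorem wordPath_assoc {a b c : List Bool} {i j k l : V} (p : EPath V a i j) (q : EPath V b j k)
    (r : EPath V c k l) :
    (⟨(a ++ b) ++ c, (wordMul X a b).hom ▷ word X c ≫ (wordMul X (a ++ b) c).hom,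
        (p.append q).append r⟩ : WordPath X V _ i l) =
      ⟨a ++ (b ++ c), (α_ _ _ _).hom ≫ word X a ◁ (wordMul X b c).hom ≫ (wordMul X a (b ++ c)).hom,
        p.append (q.append r)⟩ := by
  induction p with
  | nil i =>
    refine Sigma.ext rfl (heq_of_eq (Prod.ext ?_ rfl))
    change (λ_ _).hom ▷ _ ≫ _ = (α_ _ _ _).hom ≫ _ ◁ _ ≫ (λ_ _).hom
    rw [leftUnitor_naturality]
    simp
  | @cons s a i i' j e p ih =>
    let F : WordPath X V ((word X a ⊗ word X b) ⊗ word X c) i' l →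
        WordPath X V (((signed X s ⊗ word X a) ⊗ word X b) ⊗ word X c) i l := fun z =>
      ⟨s :: z.1, (α_ _ _ _).hom ▷ _ ≫ (α_ _ _ _).hom ≫ signed X s ◁ z.2.1, .cons e z.2.2⟩
    refine Eq.trans ?_ ((congrArg F (ih q)).trans ?_)
    · refine Sigma.ext rfl (heq_of_eq (Prod.ext ?_ rfl))
      change ((α_ _ _ _).hom ≫ signed X s ◁ (wordMul X a b).hom) ▷ _ ≫ (α_ _ _ _).hom ≫
        signed X s ◁ (wordMul X (a ++ b) c).hom = _
      simp only [F, comp_whiskerRight, whisker_assoc, Category.assoc, Iso.inv_hom_id_assoc,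
        MonoidalCategory.whiskerLeft_comp]
      rfl
    · refine Sigma.ext rfl (heq_of_eq (Prod.ext ?_ rfl))
      change _ = (α_ _ _ _).hom ≫ (signed X s ⊗ word X a) ◁ (wordMul X b c).hom ≫
        (α_ _ _ _).hom ≫ signed X s ◁ (wordMul X a (b ++ c)).hom
      simp only [F, Category.assoc, MonoidalCategory.whiskerLeft_comp, tensor_whiskerLeft,
        Iso.inv_hom_id_assoc]
      exact pentagon_assoc _ _ _ _ _

theorem wordPath_nil {a : List Bool} {i j : V} (p : EPath V a i j) :
    (⟨a ++ [], (wordMul X a []).hom, p.append (.nil j)⟩ : WordPath X V _ i j) =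
      ⟨a, (ρ_ (word X a)).hom, p⟩ := by
  induction p with
  | nil i =>
    refine Sigma.ext rfl (heq_of_eq (Prod.ext ?_ rfl))
    exact unitors_equal
  | @cons s a i i' j e p ih =>
    let F : WordPath X V (word X a ⊗ 𝟙_ C) i' j →
        WordPath X V ((signed X s ⊗ word X a) ⊗ 𝟙_ C) i j := fun z =>
      ⟨s :: z.1, (α_ _ _ _).hom ≫ signed X s ◁ z.2.1, .cons e z.2.2⟩
    refine (congrArg F ih).trans (Sigma.ext rfl (heq_of_eq (Prod.ext ?_ rfl)))
    change (α_ _ _ _).hom ≫ signed X s ◁ (ρ_ (word X a)).hom = (ρ_ (signed X s ⊗ word X a)).hom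
    simp

end WordAssoc

theorem tensorHom_smul {C : Type u} [Category.{v} C] [Preadditive C] [Linear ℂ C]
    [MonoidalCategory C] [MonoidalPreadditive C] [MonoidalLinear ℂ C] {c c' d d' : C} (z : ℂ)
    (f : c ⟶ c') (g : d ⟶ d') : f ⊗ₘ (z • g) = z • (f ⊗ₘ g) := by
  simp [MonoidalCategory.tensorHom_def]

theorem smul_tensorHom {C : Type u} [Category.{v} C] [Preadditive C] [Linear ℂ C]
    [MonoidalCategory C] [MonoidalPreadditive C] [MonoidalLinear ℂ C] {c c' d d' : C} (z : ℂ)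
    (f : c ⟶ c') (g : d ⟶ d') : (z • f) ⊗ₘ g = z • (f ⊗ₘ g) := by
  simp [MonoidalCategory.tensorHom_def]

/-! ### Objects acting through natural families -/

section NaturalFamilies

variable {C : Type u} [Category.{v} C] [Abelian C] [Linear ℂ C] [MonoidalCategory C]
variable [MonoidalPreadditive C] [MonoidalLinear ℂ C] [Duality C]

/-- A linear strict monoidal functor from the category of words in the generator `X` and its dual to
the graph planar algebra. -/
structure MatrixRep (X : C) (V : Type w) [Quiver.{x} V] [Fintype V]
    [∀ i j : V, Finite (i ⟶ j)] where
  generates : IsTensorGenerator X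
  map {a b : List Bool} : (word X a ⟶ word X b) →ₗ[ℂ] GHom V a b
  map_id (a : List Bool) : map (𝟙 (word X a)) = GHom.one V a
  map_comp {a b c : List Bool} (f : word X a ⟶ word X b) (g : word X b ⟶ word X c) :
    map (f ≫ g) = GHom.mul (map f) (map g)
  map_tens {a b c d : List Bool} (f : word X a ⟶ word X b) (g : word X c ⟶ word X d) :
    map ((wordMul X a c).inv ≫ (f ⊗ₘ g) ≫ (wordMul X b d).hom) = GHom.tensor (map f) (map g)

variable {X : C} {V : Type w} [Quiver.{x} V] [Fintype V] [∀ i j : V, Finite (i ⟶ j)]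

/-- The value at `i` of the action of `c` on the family `W`: functions of the morphisms from `c` to
words and of paths along these words, natural in the words. -/
def natFam (ρ : MatrixRep X V) (c : C) (W : V → Type t) [∀ k, AddCommGroup (W k)]
    [∀ k, Module ℂ (W k)] (i : V) :
    Submodule ℂ (∀ a : List Bool, (c ⟶ word X a) →ₗ[ℂ] PathVec W a i) where
  carrier := {τ | ∀ (a b : List Bool) (g : c ⟶ word X a) (h : word X a ⟶ word X b),
    τ b (g ≫ h) = push (ρ.map h) (τ a g)}
  add_mem' hτ hσ a b g h := by
    simp only [Pi.add_apply, LinearMap.add_apply, hτ a b g h, hσ a b g h, map_add]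
  zero_mem' a b g h := by simp
  smul_mem' z τ hτ a b g h := by
    simp only [Pi.smul_apply, LinearMap.smul_apply, hτ a b g h, map_smul]

namespace natFam

variable {ρ : MatrixRep X V} {c c' : C} {W : V → Type t} [∀ k, AddCommGroup (W k)]
  [∀ k, Module ℂ (W k)] {i : V}

omit [MonoidalPreadditive C] [MonoidalLinear ℂ C] in
theorem ext {τ σ : natFam ρ c W i}
    (h : ∀ a (g : c ⟶ word X a) k (p : EPath V a i k), τ.1 a g k p = σ.1 a g k p) : τ = σ :=
  Subtype.ext (funext fun a => LinearMap.ext fun g => funext fun k => funext fun p => h a g k p)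

omit [MonoidalPreadditive C] [MonoidalLinear ℂ C] in
theorem nat (τ : natFam ρ c W i) {a b : List Bool} (g : c ⟶ word X a)
    (h : word X a ⟶ word X b) : τ.1 b (g ≫ h) = push (ρ.map h) (τ.1 a g) := τ.2 a b g h

/-- Evaluation at a morphism. -/
def eval (ρ : MatrixRep X V) (W : V → Type t) [∀ k, AddCommGroup (W k)] [∀ k, Module ℂ (W k)]
    {a : List Bool} (g : c ⟶ word X a) (i : V) : natFam ρ c W i →ₗ[ℂ] PathVec W a i where
  toFun τ := τ.1 a g
  map_add' _ _ := rfl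
  map_smul' _ _ := rfl

/-- Functoriality in the acting object. -/
def left (ρ : MatrixRep X V) (f : c ⟶ c') (W : V → Type t) [∀ k, AddCommGroup (W k)]
    [∀ k, Module ℂ (W k)] (i : V) : natFam ρ c W i →ₗ[ℂ] natFam ρ c' W i where
  toFun τ := ⟨fun a => τ.1 a ∘ₗ Linear.leftComp ℂ _ f, fun a b g h => by
    change τ.1 b (f ≫ g ≫ h) = push (ρ.map h) (τ.1 a (f ≫ g))
    rw [← Category.assoc, nat τ]⟩
  map_add' _ _ := rfl
  map_smul' _ _ := rfl

theorem left_apply (f : c ⟶ c') (τ : natFam ρ c W i) {a : List Bool} (g : c' ⟶ word X a) :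
    (left ρ f W i τ).1 a g = τ.1 a (f ≫ g) := rfl

/-- Functoriality in the family of spaces. -/
def right (ρ : MatrixRep X V) (c : C) {W : V → Type t} [∀ k, AddCommGroup (W k)]
    [∀ k, Module ℂ (W k)] {W' : V → Type*} [∀ k, AddCommGroup (W' k)] [∀ k, Module ℂ (W' k)]
    (s : ∀ k, W k →ₗ[ℂ] W' k) (i : V) : natFam ρ c W i →ₗ[ℂ] natFam ρ c W' i where
  toFun τ := ⟨fun a =>
    { toFun := fun g k p => s k (τ.1 a g k p)
      map_add' := fun g g' => by
        funext k p
        simp only [map_add, Pi.add_apply]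
      map_smul' := fun z g => by
        funext k p
        simp only [map_smul, Pi.smul_apply, RingHom.id_apply] }, fun a b g h => by
    funext k q
    change s k (τ.1 b (g ≫ h) k q) = _
    rw [nat τ, ← push_map]
    rfl⟩
  map_add' τ σ := ext fun a g k p => map_add (s k) _ _
  map_smul' z τ := ext fun a g k p => _root_.map_smul (s k) z _

end natFam

/-- The matrices of the morphisms from the unit object to words. -/
def MatrixRep.mapUnit (ρ : MatrixRep X V) (a : List Bool) : (𝟙_ C ⟶ word X a) →ₗ[ℂ] GHom V [] a :=
  (ρ.map : (word X [] ⟶ word X a) →ₗ[ℂ] GHom V [] a)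

theorem MatrixRep.mapUnit_comp (ρ : MatrixRep X V) {a b : List Bool} (g : 𝟙_ C ⟶ word X a)
    (h : word X a ⟶ word X b) :
    ρ.mapUnit b (g ≫ h) = GHom.mul (ρ.mapUnit a g) (ρ.map h) := ρ.map_comp (a := []) g h

theorem MatrixRep.mapUnit_id (ρ : MatrixRep X V) : ρ.mapUnit [] (𝟙 (𝟙_ C)) = GHom.one V [] :=
  ρ.map_id []

namespace natFam

variable {ρ : MatrixRep X V} {c c' : C} {W : V → Type t} [∀ k, AddCommGroup (W k)]
  [∀ k, Module ℂ (W k)] {i : V}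

theorem nat_unit (τ : natFam ρ (𝟙_ C) W i) {a : List Bool} (g : 𝟙_ C ⟶ word X a) :
    τ.1 a g = push (ρ.mapUnit a g) (τ.1 [] (𝟙 (𝟙_ C))) :=
  (congrArg (τ.1 a) (Category.id_comp g).symm).trans (nat τ (a := []) (𝟙 (𝟙_ C)) g)

/-- The element of the action of the unit defined by a vector. -/
def ofUnit (ρ : MatrixRep X V) {W : V → Type t} [∀ k, AddCommGroup (W k)] [∀ k, Module ℂ (W k)]
    {i : V} (y : W i) : natFam ρ (𝟙_ C) W i :=
  ⟨fun a =>
    { toFun := fun g => push (ρ.mapUnit a g) (PathVec.single y)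
      map_add' := fun g g' => by rw [map_add, push_add_left]
      map_smul' := fun z g => by rw [map_smul, push_smul_left, RingHom.id_apply] }, fun a b g h => by
    change push (ρ.mapUnit b (g ≫ h)) _ = push _ (push (ρ.mapUnit a g) _)
    rw [ρ.mapUnit_comp, push_mul]⟩

/-- The action of the unit. -/
def unit (ρ : MatrixRep X V) (W : V → Type t) [∀ k, AddCommGroup (W k)] [∀ k, Module ℂ (W k)]
    (i : V) : natFam ρ (𝟙_ C) W i ≃ₗ[ℂ] W i where
  toFun τ := τ.1 [] (𝟙 (𝟙_ C)) i (.nil i)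
  map_add' _ _ := rfl
  map_smul' _ _ := rfl
  invFun y := ofUnit ρ y
  left_inv τ := ext fun a g k p => by
    have h : PathVec.single (τ.1 [] (𝟙 (𝟙_ C)) i (.nil i)) = τ.1 [] (𝟙 (𝟙_ C)) :=
      PathVec.ext_nil rfl
    change push (ρ.mapUnit a g) (PathVec.single (τ.1 [] (𝟙 (𝟙_ C)) i (.nil i))) k p = _
    rw [h, nat_unit τ g]
  right_inv y := by
    change push (ρ.mapUnit [] (𝟙 (𝟙_ C))) (PathVec.single y) i (.nil i) = y
    rw [ρ.mapUnit_id, push_one]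
    rfl

/-- Naturality of `τ` at the tensor product of `h` and `h'`, whose matrix acts separately on the two
halves of a path. -/
theorem append_comp (τ : natFam ρ (c ⊗ c') W i) {a a' b b' : List Bool} (g : c ⟶ word X a)
    (g' : c' ⟶ word X b) (h : word X a ⟶ word X a') (h' : word X b ⟶ word X b') {j k : V}
    (p : EPath V a' i k) (q : EPath V b' k j) :
    τ.1 (a' ++ b') (((g ≫ h) ⊗ₘ (g' ≫ h')) ≫ (wordMul X a' b').hom) j (p.append q) =
      push (ρ.map h) (fun k p => push (ρ.map h') fun j q =>
        τ.1 (a ++ b) ((g ⊗ₘ g') ≫ (wordMul X a b).hom) j (p.append q) :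
          PathVec (fun k => PathVec W b' k) a i) k p j q := by
  have h1 : ((g ≫ h) ⊗ₘ (g' ≫ h')) ≫ (wordMul X a' b').hom =
      ((g ⊗ₘ g') ≫ (wordMul X a b).hom) ≫
        ((wordMul X a b).inv ≫ (h ⊗ₘ h') ≫ (wordMul X a' b').hom) := by
    simp
  have h2 : τ.1 (a ++ b) ((g ⊗ₘ g') ≫ (wordMul X a b).hom) = PathVec.join fun k p j q =>
      τ.1 (a ++ b) ((g ⊗ₘ g') ≫ (wordMul X a b).hom) j (p.append q) :=
    PathVec.ext_append fun k p j q => (PathVec.join_append (fun k p j q =>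
      τ.1 (a ++ b) ((g ⊗ₘ g') ≫ (wordMul X a b).hom) j (p.append q)) p q).symm
  rw [h1, nat τ, ρ.map_tens, h2, push_tensor_join, PathVec.join_append]
  simp only [PathVec.join_append]

theorem append_comp_left (τ : natFam ρ (c ⊗ c') W i) {a a' b : List Bool} (g : c ⟶ word X a)
    (g' : c' ⟶ word X b) (h : word X a ⟶ word X a') {j k : V}
    (p : EPath V a' i k) (q : EPath V b k j) :
    τ.1 (a' ++ b) (((g ≫ h) ⊗ₘ g') ≫ (wordMul X a' b).hom) j (p.append q) =
      push (ρ.map h) (fun k p j q =>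
        τ.1 (a ++ b) ((g ⊗ₘ g') ≫ (wordMul X a b).hom) j (p.append q) :
          PathVec (fun k => PathVec W b k) a i) k p j q := by
  have h1 := append_comp τ g g' h (𝟙 _) p q
  simpa only [Category.comp_id, ρ.map_id, push_one] using h1

theorem append_comp_right (τ : natFam ρ (c ⊗ c') W i) {a b b' : List Bool} (g : c ⟶ word X a)
    (g' : c' ⟶ word X b) (h' : word X b ⟶ word X b') {j k : V}
    (p : EPath V a i k) (q : EPath V b' k j) :
    τ.1 (a ++ b') ((g ⊗ₘ (g' ≫ h')) ≫ (wordMul X a b').hom) j (p.append q) =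
      push (ρ.map h') (fun j q =>
        τ.1 (a ++ b) ((g ⊗ₘ g') ≫ (wordMul X a b).hom) j (p.append q)) j q := by
  have h1 := append_comp τ g g' (𝟙 _) h' p q
  simpa only [Category.comp_id, ρ.map_id, push_one] using h1

/-- The value of a family for `c ⊗ c'` at a morphism from `c` and a path. -/
def assocAt (τ : natFam ρ (c ⊗ c') W i) {a : List Bool} (g : c ⟶ word X a) {k : V}
    (p : EPath V a i k) : natFam ρ c' W k :=
  ⟨fun b =>
    { toFun := fun g' j q => τ.1 (a ++ b) ((g ⊗ₘ g') ≫ (wordMul X a b).hom) j (p.append q)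
      map_add' := fun g' g'' => by
        funext j q
        simp only [MonoidalPreadditive.tensor_add, Preadditive.add_comp, map_add, Pi.add_apply]
      map_smul' := fun z g' => by
        funext j q
        simp only [tensorHom_smul, Linear.smul_comp, map_smul, Pi.smul_apply,
          RingHom.id_apply] }, fun b b' g' h' => by
    funext j q
    exact append_comp_right τ g g' h' p q⟩

/-- The comparison of the action of a tensor product with the iterated action. -/
def assocHom (ρ : MatrixRep X V) (c c' : C) (W : V → Type t) [∀ k, AddCommGroup (W k)]
    [∀ k, Module ℂ (W k)] (i : V) :
    natFam ρ (c ⊗ c') W i →ₗ[ℂ] natFam ρ c (fun k => natFam ρ c' W k) i where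
  toFun τ := ⟨fun a =>
    { toFun := fun g k p => assocAt τ g p
      map_add' := fun g g'' => by
        funext k p
        refine ext fun b g' j q => ?_
        change τ.1 (a ++ b) _ j _ = τ.1 (a ++ b) _ j _ + τ.1 (a ++ b) _ j _
        simp only [MonoidalPreadditive.add_tensor, Preadditive.add_comp, map_add, Pi.add_apply]
      map_smul' := fun z g => by
        funext k p
        refine ext fun b g' j q => ?_
        change τ.1 (a ++ b) _ j _ = z • τ.1 (a ++ b) _ j _
        simp only [smul_tensorHom, Linear.smul_comp, map_smul, Pi.smul_apply] },
    fun a a' g h => by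
      funext k p
      refine ext fun b g' j q => ?_
      refine (append_comp_left τ g g' h p q).trans ?_
      exact congrFun (congrFun (push_map (W := fun k => natFam ρ c' W k)
        (W' := fun k => PathVec W b k) (fun k => eval ρ W g' k) (ρ.map h)
        (fun k p => assocAt τ g p) k p) j) q⟩
  map_add' _ _ := rfl
  map_smul' _ _ := rfl

theorem assocHom_apply (τ : natFam ρ (c ⊗ c') W i) {a b : List Bool} (g : c ⟶ word X a)
    (g' : c' ⟶ word X b) {k j : V} (p : EPath V a i k) (q : EPath V b k j) :
    ((assocHom ρ c c' W i τ).1 a g k p).1 b g' j q =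
      τ.1 (a ++ b) ((g ⊗ₘ g') ≫ (wordMul X a b).hom) j (p.append q) := rfl

/-- As `X` generates, the identities of `c` and `c'` are sums of morphisms through words. By
naturality a family on `c ⊗ c'` is then determined by its values at products of morphisms to words.
-/
theorem assocHom_injective : Function.Injective (assocHom ρ c c' W i) := by
  obtain ⟨n, y, a, b, hab⟩ := ρ.generates.exists_sum c
  obtain ⟨n', y', a', b', hab'⟩ := ρ.generates.exists_sum c'
  intro τ σ h
  refine Subtype.ext (funext fun u => LinearMap.ext fun g => ?_)
  have hg : g = ∑ l, ∑ l', ((a l ⊗ₘ a' l') ≫ (wordMul X (y l) (y' l')).hom) ≫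
      (wordMul X (y l) (y' l')).inv ≫ (b l ⊗ₘ b' l') ≫ g := by
    have h1 : ((∑ l, a l ≫ b l) ⊗ₘ ∑ l, a' l ≫ b' l) ≫ g = g := by
      rw [hab, hab', MonoidalCategory.id_tensorHom_id, Category.id_comp]
    rw [sum_tensor, Preadditive.sum_comp] at h1
    simp only [tensor_sum, Preadditive.sum_comp] at h1
    simpa using h1.symm
  rw [hg]
  simp only [_root_.map_sum, nat τ, nat σ]
  refine Finset.sum_congr rfl fun l _ => Finset.sum_congr rfl fun l' _ => congrArg _ ?_
  refine PathVec.ext_append fun k p j q => ?_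
  rw [← assocHom_apply, h, assocHom_apply]

/-- A preimage is defined by expanding a morphism out of `c ⊗ c'` through products of words and
pushing forward the values of `σ` there. Naturality of `σ` then undoes the two expansions. -/
theorem assocHom_surjective : Function.Surjective (assocHom ρ c c' W i) := by
  obtain ⟨n, y, a, b, hab⟩ := ρ.generates.exists_sum c
  obtain ⟨n', y', a', b', hab'⟩ := ρ.generates.exists_sum c'
  intro σ
  -- The values that `σ` prescribes at the product of `a l` and `a' l'`.
  let s : ∀ l l', PathVec W (y l ++ y' l') i := fun l l' =>
    PathVec.join (fun k p => (σ.1 _ (a l) k p).1 _ (a' l'))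
  -- The matrix of the component of `g` on the word that belongs to `(l, l')`.
  let m : ∀ {u} (g : c ⊗ c' ⟶ word X u) l l', GHom V (y l ++ y' l') u := fun {u} g l l' =>
    ρ.map ((wordMul X (y l) (y' l')).inv ≫ (b l ⊗ₘ b' l') ≫ g)
  refine ⟨⟨fun u =>
    { toFun := fun g => ∑ l, ∑ l', push (m g l l') (s l l')
      map_add' := fun g g' => by
        simp only [m, Preadditive.comp_add, map_add, push_add_left, Finset.sum_add_distrib]
      map_smul' := fun z g => by
        simp only [m, Linear.comp_smul, map_smul, push_smul_left, Finset.smul_sum,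
          RingHom.id_apply] }, fun u u' g h => ?_⟩, ?_⟩
  · change ∑ l, ∑ l', push (m (g ≫ h) l l') (s l l') =
      push (ρ.map h) (∑ l, ∑ l', push (m g l l') (s l l'))
    simp only [_root_.map_sum, ← push_mul, m, ← ρ.map_comp, Category.assoc]
  · refine ext fun u g k p => ext fun u' g' j q => ?_
    change (∑ l, ∑ l', push (m ((g ⊗ₘ g') ≫ (wordMul X u u').hom) l l') (s l l')) j (p.append q) = _
    have hm : ∀ l l', m ((g ⊗ₘ g') ≫ (wordMul X u u').hom) l l' =
        GHom.tensor (ρ.map (b l ≫ g)) (ρ.map (b' l' ≫ g')) := fun l l' => by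
      simp only [m]
      rw [← ρ.map_tens, ← MonoidalCategory.tensorHom_comp_tensorHom, Category.assoc]
    simp only [hm, s, push_tensor_join, ← nat, Finset.sum_apply, PathVec.join_append]
    -- The expansion of the identity of `c'` is summed away inside the values of `σ` (`h1`, `h2`),
    -- then that of `c` (`h4`).
    have h1 : ∀ l (k : V) (p : EPath V (y l) i k), ∑ l', (σ.1 _ (a l) k p).1 _ (a' l' ≫ b' l' ≫ g') =
        (σ.1 _ (a l) k p).1 _ g' := fun l k p => by
      rw [← _root_.map_sum]
      simp only [← Category.assoc, ← Preadditive.sum_comp, hab', Category.id_comp]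
    have h2 : ∀ l, ∑ l', push (ρ.map (b l ≫ g)) (fun k p => (σ.1 _ (a l) k p).1 _
        (a' l' ≫ b' l' ≫ g') : PathVec (fun k => PathVec W u' k) (y l) i) k p =
          (σ.1 u (a l ≫ b l ≫ g) k p).1 u' g' := fun l => by
      have h3 := push_map (W := fun k => natFam ρ c' W k) (W' := fun k => PathVec W u' k)
        (fun k => eval ρ W g' k) (ρ.map (b l ≫ g)) (σ.1 _ (a l)) k p
      rw [← nat σ] at h3
      refine ((sum_push (W := fun k => PathVec W u' k) Finset.univ (ρ.map (b l ≫ g)) _ k p).trans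
        ?_).trans h3
      simp only [h1]
      rfl
    have h4 : ∑ l, (σ.1 u (a l ≫ b l ≫ g) k p) = σ.1 u g k p := by
      have h5 : ∑ l, σ.1 u (a l ≫ b l ≫ g) = σ.1 u g := by
        rw [← _root_.map_sum]
        simp only [← Category.assoc, ← Preadditive.sum_comp, hab, Category.id_comp]
      exact (PathVec.sum_apply (W := fun k => natFam ρ c' W k) Finset.univ _ k p).symm.trans (congrFun (congrFun h5 k) p)
    have h6 := congrArg (fun z => eval ρ W g' k z j q) h4
    refine Eq.trans ?_ h6
    simp only [_root_.map_sum, Finset.sum_apply]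
    refine Finset.sum_congr rfl fun l _ => ?_
    exact (PathVec.sum_apply (W := W) Finset.univ _ j q).symm.trans (congrFun (congrFun (h2 l) j) q)

end natFam

end NaturalFamilies

/-! ### Families of vector spaces as a module category -/

section FamilyCategory

variable {C : Type u} [Category.{v} C] [Abelian C] [Linear ℂ C] [MonoidalCategory C]
variable [MonoidalPreadditive C] [MonoidalLinear ℂ C] [Duality C]
variable {X : C} {V : Type w} [Quiver.{x} V] [Fintype V] [∀ i j : V, Finite (i ⟶ j)]

/-- Families of vector spaces indexed by the vertices. -/
structure Fam (ρ : MatrixRep X V) where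
  obj : V → Type (max v w x t)
  [addCommGroup : ∀ i, AddCommGroup (obj i)]
  [module : ∀ i, Module ℂ (obj i)]

attribute [instance] Fam.addCommGroup Fam.module

variable {ρ : MatrixRep X V}

instance : Category (Fam.{v, u, x, w, t} ρ) where
  Hom W W' := ∀ i, W.obj i →ₗ[ℂ] W'.obj i
  id W i := LinearMap.id
  comp f g i := g i ∘ₗ f i

instance : Preadditive (Fam.{v, u, x, w, t} ρ) where
  homGroup W W' := inferInstanceAs (AddCommGroup (∀ i, W.obj i →ₗ[ℂ] W'.obj i))
  add_comp _ _ _ _ _ _ := funext fun _ => LinearMap.comp_add _ _ _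
  comp_add _ _ _ _ _ _ := funext fun _ => LinearMap.add_comp _ _ _

instance : Linear ℂ (Fam.{v, u, x, w, t} ρ) where
  homModule W W' := inferInstanceAs (Module ℂ (∀ i, W.obj i →ₗ[ℂ] W'.obj i))
  smul_comp _ _ _ _ _ _ := funext fun _ => LinearMap.comp_smul _ _ _
  comp_smul _ _ _ _ _ _ := funext fun _ => LinearMap.smul_comp _ _ _

namespace Fam

theorem hom_ext {W W' : Fam.{v, u, x, w, t} ρ} {f g : W ⟶ W'} (h : ∀ i y, f i y = g i y) : f = g :=
  funext fun i => LinearMap.ext (h i)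

theorem comp_apply {W W' W'' : Fam.{v, u, x, w, t} ρ} (f : W ⟶ W') (g : W' ⟶ W'') (i : V)
    (y : W.obj i) : (f ≫ g) i y = g i (f i y) := rfl

theorem id_apply (W : Fam.{v, u, x, w, t} ρ) (i : V) (y : W.obj i) :
    (𝟙 W : W ⟶ W) i y = y := rfl

/-- Isomorphisms of families from families of isomorphisms. -/
def isoOfEquiv {W W' : Fam.{v, u, x, w, t} ρ} (e : ∀ i, W.obj i ≃ₗ[ℂ] W'.obj i) : W ≅ W' where
  hom i := e i
  inv i := (e i).symm
  hom_inv_id := hom_ext fun i y => (e i).symm_apply_apply y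
  inv_hom_id := hom_ext fun i y => (e i).apply_symm_apply y

/-- The components of an isomorphism of families. -/
def equivOfIso {W W' : Fam.{v, u, x, w, t} ρ} (e : W ≅ W') (i : V) : W.obj i ≃ₗ[ℂ] W'.obj i :=
  LinearEquiv.ofLinearMap (e.hom i) (e.inv i) (congrFun e.inv_hom_id i) (congrFun e.hom_inv_id i)

/-- The action of an object of `C` on a family. -/
def act (c : C) (W : Fam.{v, u, x, w, t} ρ) : Fam.{v, u, x, w, t} ρ where
  obj i := natFam ρ c W.obj i

/-- The associativity isomorphism of the action on families. -/
def actAssoc (c c' : C) (W : Fam.{v, u, x, w, t} ρ) :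
    act (c ⊗ c') W ≅ act c (act c' W) :=
  isoOfEquiv fun i => LinearEquiv.ofBijective (natFam.assocHom ρ c c' W.obj i)
    ⟨natFam.assocHom_injective, natFam.assocHom_surjective⟩

/-- The unit isomorphism of the action on families. -/
def actUnit (W : Fam.{v, u, x, w, t} ρ) : act (𝟙_ C) W ≅ W :=
  isoOfEquiv fun i => natFam.unit ρ W.obj i

theorem wordPath_eval {c : C} {W : V → Type*} [∀ k, AddCommGroup (W k)] [∀ k, Module ℂ (W k)]
    {i j : V} (τ : natFam ρ c W i) {z z' : WordPath X V c i j} (h : z = z') :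
    τ.1 z.1 z.2.1 j z.2.2 = τ.1 z'.1 z'.2.1 j z'.2.2 := by rw [h]

instance : MonoidalLeftActionStruct C (Fam.{v, u, x, w, t} ρ) where
  actionObj c W := act c W
  actionHomLeft f W i := natFam.left ρ f W.obj i
  actionHomRight c _ _ s i := natFam.right ρ c s i
  actionAssocIso c c' W := actAssoc c c' W
  actionUnitIso W := actUnit W

/-- After evaluation at morphisms and paths the axioms are identities between morphisms to words.
Only those for the associator and the right unitor compare different lists, and they use
`wordPath_assoc` and `wordPath_nil`. -/
instance : MonoidalLeftAction C (Fam.{v, u, x, w, t} ρ) where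
  actionHom_def _ _ := rfl
  actionHomRight_id _ _ := rfl
  id_actionHomLeft c W := hom_ext fun i τ => natFam.ext fun a g k p => by
    change τ.1 a (𝟙 c ≫ g) k p = τ.1 a g k p
    rw [Category.id_comp]
  actionHom_comp f₁ f₂ g₁ g₂ := hom_ext fun i τ => natFam.ext fun a g k p => by
    change g₂ k (g₁ k (τ.1 a ((f₁ ≫ f₂) ≫ g) k p)) = g₂ k (g₁ k (τ.1 a (f₁ ≫ f₂ ≫ g) k p))
    rw [Category.assoc]
  actionAssocIso_hom_naturality {c₁ c₂ c₃ c₄ W W'} f f' s :=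
    hom_ext fun i τ => natFam.ext fun a g k p => natFam.ext fun b g' j q => by
    change s j (τ.1 (a ++ b) ((f ⊗ₘ f') ≫ (g ⊗ₘ g') ≫ (wordMul X a b).hom) j (p.append q)) =
      s j (τ.1 (a ++ b) ((f ≫ g ⊗ₘ f' ≫ g') ≫ (wordMul X a b).hom) j (p.append q))
    rw [← MonoidalCategory.tensorHom_comp_tensorHom, Category.assoc]
  actionUnitIso_hom_naturality _ := rfl
  whiskerLeft_actionHomLeft c {c' c''} f W := by
    rw [← Category.assoc, Iso.eq_comp_inv]
    refine hom_ext fun i τ => natFam.ext fun a g k p => natFam.ext fun b g' j q => ?_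
    change τ.1 (a ++ b) (c ◁ f ≫ (g ⊗ₘ g') ≫ (wordMul X a b).hom) j (p.append q) =
      τ.1 (a ++ b) ((g ⊗ₘ f ≫ g') ≫ (wordMul X a b).hom) j (p.append q)
    simp [MonoidalCategory.tensorHom_def']
  whiskerRight_actionHomLeft {c c'} c'' f W := by
    rw [← Category.assoc, Iso.eq_comp_inv]
    refine hom_ext fun i τ => natFam.ext fun a g k p => natFam.ext fun b g' j q => ?_
    change τ.1 (a ++ b) (f ▷ c'' ≫ (g ⊗ₘ g') ≫ (wordMul X a b).hom) j (p.append q) =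
      τ.1 (a ++ b) ((f ≫ g ⊗ₘ g') ≫ (wordMul X a b).hom) j (p.append q)
    simp [MonoidalCategory.tensorHom_def]
  associator_actionHom c₁ c₂ c₃ W :=
    hom_ext fun i τ => natFam.ext fun a₁ g₁ k₁ p₁ => natFam.ext fun a₂ g₂ k₂ p₂ =>
      natFam.ext fun a₃ g₃ j p₃ => by
    let F : WordPath X V ((word X a₁ ⊗ word X a₂) ⊗ word X a₃) i j →
      WordPath X V ((c₁ ⊗ c₂) ⊗ c₃) i j := fun z => ⟨z.1, ((g₁ ⊗ₘ g₂) ⊗ₘ g₃) ≫ z.2.1, z.2.2⟩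
    have h := wordPath_eval τ (congrArg F (wordPath_assoc (X := X) p₁ p₂ p₃))
    change τ.1 (a₁ ++ (a₂ ++ a₃)) ((α_ c₁ c₂ c₃).hom ≫ (g₁ ⊗ₘ (g₂ ⊗ₘ g₃) ≫ (wordMul X a₂ a₃).hom) ≫
      (wordMul X a₁ (a₂ ++ a₃)).hom) j (p₁.append (p₂.append p₃)) =
        τ.1 ((a₁ ++ a₂) ++ a₃) (((g₁ ⊗ₘ g₂) ≫ (wordMul X a₁ a₂).hom ⊗ₘ g₃) ≫
          (wordMul X (a₁ ++ a₂) a₃).hom) j ((p₁.append p₂).append p₃)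
    refine Eq.trans ?_ (h.symm.trans ?_)
    · refine congrFun (congrFun (congrArg (τ.1 _) ?_) _) _
      simp [F, MonoidalCategory.tensorHom_def]
    · refine congrFun (congrFun (congrArg (τ.1 _) ?_) _) _
      simp [F, MonoidalCategory.tensorHom_def']
  leftUnitor_actionHom c W := hom_ext fun i τ => natFam.ext fun a g k p => by
    change τ.1 a ((λ_ c).hom ≫ g) k p =
      τ.1 a ((𝟙 (𝟙_ C) ⊗ₘ g) ≫ (λ_ (word X a)).hom) k p
    simp
  rightUnitor_actionHom c W := hom_ext fun i τ => natFam.ext fun a g k p => by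
    let F : WordPath X V (word X a ⊗ 𝟙_ C) i k → WordPath X V (c ⊗ 𝟙_ C) i k := fun z =>
      ⟨z.1, g ▷ 𝟙_ C ≫ z.2.1, z.2.2⟩
    have h := wordPath_eval τ (congrArg F (wordPath_nil (X := X) p))
    change τ.1 a ((ρ_ c).hom ≫ g) k p =
      τ.1 (a ++ []) ((g ⊗ₘ 𝟙 (𝟙_ C)) ≫ (wordMul X a []).hom) k (p.append (.nil k))
    refine Eq.trans ?_ (h.symm.trans ?_)
    · simp [F]
    · refine congrFun (congrFun (congrArg (τ.1 _) ?_) _) _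
      simp [F]

end Fam

end FamilyCategory

/-! ### Linear structures on functors and transport of actions -/

section LinearStructures

open MonoidalLeftAction Functor

variable {C : Type u} [Category.{v} C] [MonoidalCategory C]

section

variable {D D' : Type*} [Category* D] [Category* D'] [MonoidalLeftAction C D]
  [MonoidalLeftAction C D']

/-- The structure of a module functor from invertible lax structure morphisms. -/
abbrev leftLinearOfIso (F : D ⥤ D') (mu : ∀ (c : C) (d : D), c ⊙ₗ F.obj d ≅ F.obj (c ⊙ₗ d))
    (h1 : ∀ {c c' : C} (f : c ⟶ c') (d : D),
      f ⊵ₗ F.obj d ≫ (mu c' d).hom = (mu c d).hom ≫ F.map (f ⊵ₗ d))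
    (h2 : ∀ (c : C) {d d' : D} (f : d ⟶ d'),
      c ⊴ₗ F.map f ≫ (mu c d').hom = (mu c d).hom ≫ F.map (c ⊴ₗ f))
    (h3 : ∀ (c c' : C) (d : D), (mu (c ⊗ c') d).hom ≫ F.map (αₗ _ _ _).hom =
      (αₗ c c' (F.obj d)).hom ≫ c ⊴ₗ (mu c' d).hom ≫ (mu c (c' ⊙ₗ d)).hom)
    (h4 : ∀ d : D, (λₗ[C] (F.obj d)).hom = (mu (𝟙_ C) d).hom ≫ F.map (λₗ[C] d).hom) :
    F.LeftLinear C where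
  μₗ c d := (mu c d).hom
  μₗ_naturality_left := h1
  μₗ_naturality_right := h2
  μₗ_associativity := h3
  μₗ_unitality := h4
  δₗ c d := (mu c d).inv
  δₗ_naturality_left f d := by rw [Iso.comp_inv_eq, Category.assoc, h1, Iso.inv_hom_id_assoc]
  δₗ_naturality_right c d d' f := by
    rw [Iso.comp_inv_eq, Category.assoc, h2, Iso.inv_hom_id_assoc]
  δₗ_associativity c c' d := by
    rw [Iso.inv_comp_eq]
    have h := h3 c c' d
    rw [← cancel_mono (c ⊴ₗ (mu c' d).hom ≫ (mu c (c' ⊙ₗ d)).hom), ← h]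
    simp
  δₗ_unitality_inv d := by
    rw [← cancel_mono (mu (𝟙_ C) d).hom, Category.assoc, Iso.inv_hom_id, Category.comp_id,
      ← cancel_mono (F.map (λₗ[C] d).hom), Category.assoc, ← h4, Iso.inv_hom_id, ← F.map_comp,
      Iso.inv_hom_id, F.map_id]
  μₗ_comp_δₗ c d := (mu c d).hom_inv_id
  δₗ_comp_μₗ c d := (mu c d).inv_hom_id

end

/-- The structure of a module functor on `J`, where the compatibilities of the action on the source
of `J` are not required. -/
structure LinearStructure (C : Type u) [Category.{v} C] [MonoidalCategory C] {S : Type*}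
    [Category* S] [MonoidalLeftActionStruct C S] {E : Type*} [Category* E] [MonoidalLeftAction C E]
    (J : S ⥤ E) where
  iso (c : C) (s : S) : J.obj (c ⊙ₗ s) ≅ c ⊙ₗ J.obj s
  left {c c' : C} (f : c ⟶ c') (s : S) : J.map (f ⊵ₗ s) ≫ (iso c' s).hom =
    (iso c s).hom ≫ f ⊵ₗ J.obj s
  right (c : C) {s s' : S} (f : s ⟶ s') : J.map (c ⊴ₗ f) ≫ (iso c s').hom =
    (iso c s).hom ≫ c ⊴ₗ J.map f
  assoc (c c' : C) (s : S) : J.map (αₗ c c' s).hom ≫ (iso c (c' ⊙ₗ s)).hom ≫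
    c ⊴ₗ (iso c' s).hom = (iso (c ⊗ c') s).hom ≫ (αₗ c c' (J.obj s)).hom
  unit (s : S) : J.map (λₗ[C] s).hom = (iso (𝟙_ C) s).hom ≫ (λₗ[C] (J.obj s)).hom

namespace LinearStructure

section Transport

variable {S : Type*} [Category* S] [MonoidalLeftActionStruct C S] {E : Type*} [Category* E]
  [MonoidalLeftAction C E] {J : S ⥤ E}

theorem left_assoc (δ : LinearStructure C J) {c c' : C} (f : c ⟶ c') (s : S) {Z : E}
    (h : c' ⊙ₗ J.obj s ⟶ Z) : J.map (f ⊵ₗ s) ≫ (δ.iso c' s).hom ≫ h =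
      (δ.iso c s).hom ≫ f ⊵ₗ J.obj s ≫ h := by
  simpa only [Category.assoc] using δ.left f s =≫ h

theorem right_assoc (δ : LinearStructure C J) (c : C) {s s' : S} (f : s ⟶ s') {Z : E}
    (h : c ⊙ₗ J.obj s' ⟶ Z) : J.map (c ⊴ₗ f) ≫ (δ.iso c s').hom ≫ h =
      (δ.iso c s).hom ≫ c ⊴ₗ J.map f ≫ h := by
  simpa only [Category.assoc] using δ.right c f =≫ h

theorem assoc_assoc (δ : LinearStructure C J) (c c' : C) (s : S) {Z : E}
    (h : c ⊙ₗ c' ⊙ₗ J.obj s ⟶ Z) : J.map (αₗ c c' s).hom ≫ (δ.iso c (c' ⊙ₗ s)).hom ≫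
      c ⊴ₗ (δ.iso c' s).hom ≫ h = (δ.iso (c ⊗ c') s).hom ≫ (αₗ c c' (J.obj s)).hom ≫ h := by
  simpa only [Category.assoc] using δ.assoc c c' s =≫ h

theorem right_iso (δ : LinearStructure C J) (c c' c'' : C) (s : S) :
    J.map (c ⊴ₗ (αₗ c' c'' s).hom) ≫ (δ.iso c _).hom ≫ c ⊴ₗ (δ.iso c' _).hom ≫
      c ⊴ₗ c' ⊴ₗ (δ.iso c'' s).hom =
        (δ.iso c _).hom ≫ c ⊴ₗ (δ.iso (c' ⊗ c'') s).hom ≫ c ⊴ₗ (αₗ c' c'' (J.obj s)).hom := by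
  rw [δ.right_assoc, ← actionHomRight_comp, ← actionHomRight_comp, ← actionHomRight_comp, δ.assoc]

theorem map_actionHom (δ : LinearStructure C J) {c c' : C} {s s' : S} (f : c ⟶ c') (g : s ⟶ s') :
    J.map (f ⊵ₗ s ≫ c' ⊴ₗ g) ≫ (δ.iso c' s').hom = (δ.iso c s).hom ≫ (f ⊙ₗₘ J.map g) := by
  rw [J.map_comp, Category.assoc, δ.right, δ.left_assoc, actionHom_def]

theorem left_act (δ : LinearStructure C J) {c c' : C} (c'' : C) (f : c ⟶ c') (s : S) :
    J.map (f ⊵ₗ (c'' ⊙ₗ s)) ≫ (δ.iso c' _).hom ≫ c' ⊴ₗ (δ.iso c'' s).hom =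
      (δ.iso c _).hom ≫ c ⊴ₗ (δ.iso c'' s).hom ≫ f ⊵ₗ (c'' ⊙ₗ J.obj s) := by
  rw [δ.left_assoc, action_exchange]

/-- A category with a faithful module functor to a module category is a module category. -/
abbrev action (δ : LinearStructure C J) [J.Faithful]
    (hdef : ∀ {c c' : C} {s s' : S} (f : c ⟶ c') (g : s ⟶ s'), f ⊙ₗₘ g = f ⊵ₗ s ≫ c' ⊴ₗ g) :
    MonoidalLeftAction C S where
  actionHom_def := hdef
  -- Each axiom is checked after applying the faithful functor `J` and composing with structure
  -- isomorphisms, where it becomes an axiom of the action on `E`.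
  actionHomRight_id c s := J.map_injective <| by
    rw [← cancel_mono (δ.iso c s).hom, δ.right]
    simp
  id_actionHomLeft c s := J.map_injective <| by
    rw [← cancel_mono (δ.iso c s).hom, δ.left]
    simp
  actionHom_comp f₁ f₂ g₁ g₂ := J.map_injective <| by
    rw [← cancel_mono (δ.iso _ _).hom]
    simp only [hdef, J.map_comp, Category.assoc, δ.left_assoc, δ.right, δ.right_assoc, δ.left]
    simp only [comp_actionHomLeft, actionHomRight_comp, Category.assoc]
    rw [← action_exchange_assoc]
  actionAssocIso_hom_naturality f g h := J.map_injective <| by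
    rw [← cancel_mono ((δ.iso _ _).hom ≫ _ ⊴ₗ (δ.iso _ _).hom)]
    have h1 : ∀ {c c' : C} {s s' : S} (f : c ⟶ c') (g : s ⟶ s'), J.map (f ⊙ₗₘ g) ≫
        (δ.iso c' s').hom = (δ.iso c s).hom ≫ (f ⊙ₗₘ J.map g) := fun f g => by
      rw [hdef, δ.map_actionHom]
    rw [J.map_comp, J.map_comp, Category.assoc, Category.assoc, δ.assoc, reassoc_of% h1,
      actionAssocIso_hom_naturality, reassoc_of% h1, ← δ.assoc_assoc, ← id_actionHom,
      ← actionHom_comp, ← id_actionHom, ← actionHom_comp, h1, Category.comp_id, Category.id_comp]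
  actionUnitIso_hom_naturality f := J.map_injective <| by
    simp only [J.map_comp, δ.unit, Category.assoc, δ.right_assoc, actionUnitIso_hom_naturality]
  whiskerLeft_actionHomLeft c {c' c''} f s := by
    rw [← Category.assoc, Iso.eq_comp_inv]
    refine J.map_injective ?_
    rw [← cancel_mono ((δ.iso _ _).hom ≫ _ ⊴ₗ (δ.iso _ _).hom)]
    simp only [J.map_comp, Category.assoc, δ.assoc, δ.left_assoc, δ.right_assoc]
    rw [← actionHomRight_comp, δ.left, actionHomRight_comp, δ.assoc_assoc]
    simp
  whiskerRight_actionHomLeft {c c'} c'' f s := by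
    rw [← Category.assoc, Iso.eq_comp_inv]
    refine J.map_injective ?_
    rw [← cancel_mono ((δ.iso _ _).hom ≫ _ ⊴ₗ (δ.iso _ _).hom)]
    rw [J.map_comp, J.map_comp, Category.assoc, Category.assoc, δ.assoc, δ.left_assoc, δ.left_act,
      δ.assoc_assoc, actionHomLeft_action]
    simp
  associator_actionHom c₁ c₂ c₃ s := J.map_injective <| by
    rw [← cancel_mono ((δ.iso _ _).hom ≫ _ ⊴ₗ (δ.iso _ _).hom ≫ _ ⊴ₗ _ ⊴ₗ (δ.iso _ _).hom)]
    simp only [J.map_comp, Category.assoc, δ.right_iso, δ.assoc_assoc, δ.left_assoc,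
      associator_actionHom]
    have h := tensor_actionHomRight_assoc c₁ c₂ (δ.iso c₃ s).hom (αₗ c₁ c₂ _).hom
    rw [Iso.inv_hom_id, Category.comp_id] at h
    rw [← h, δ.assoc_assoc]
  leftUnitor_actionHom c s := J.map_injective <| by
    rw [← cancel_mono (δ.iso _ _).hom]
    simp only [J.map_comp, δ.unit, Category.assoc, δ.left, leftUnitor_actionHom,
      actionUnitIso_hom_naturality, δ.assoc_assoc]
  rightUnitor_actionHom c s := J.map_injective <| by
    rw [← cancel_mono (δ.iso _ _).hom]
    simp only [J.map_comp, Category.assoc, δ.left, δ.right, rightUnitor_actionHom, δ.unit,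
      actionHomRight_comp, δ.assoc_assoc]

end Transport

section TransportStruct

variable {S : Type*} [Category* S] {E : Type*} [Category* E] [MonoidalLeftAction C E] (J : S ⥤ E)
  [J.Full] [J.Faithful] (K : C → S → S) (κ : ∀ c s, J.obj (K c s) ≅ c ⊙ₗ J.obj s)

/-- The image of an isomorphism under the action. -/
abbrev actIso (c : C) {m m' : E} (e : m ≅ m') : c ⊙ₗ m ≅ c ⊙ₗ m' where
  hom := c ⊴ₗ e.hom
  inv := c ⊴ₗ e.inv

/-- Transport of the data of an action along a fully faithful functor. -/
abbrev transportStruct : MonoidalLeftActionStruct C S where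
  actionObj := K
  actionHomLeft {c c'} f s := J.preimage ((κ c s).hom ≫ f ⊵ₗ J.obj s ≫ (κ c' s).inv)
  actionHomRight c _ _ f := J.preimage ((κ c _).hom ≫ c ⊴ₗ J.map f ≫ (κ c _).inv)
  actionAssocIso c c' s := J.preimageIso (κ (c ⊗ c') s ≪≫ αₗ c c' (J.obj s) ≪≫
    (actIso c (κ c' s)).symm ≪≫ (κ c (K c' s)).symm)
  actionUnitIso s := J.preimageIso (κ (𝟙_ C) s ≪≫ λₗ[C] (J.obj s))

omit [J.Full] [J.Faithful] in
theorem comp_inv_comp_hom {c : C} {a b b' d : E} (f : a ⟶ c ⊙ₗ b) (e : b' ≅ b)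
    (g : d ≅ c ⊙ₗ b') : (f ≫ c ⊴ₗ e.inv ≫ g.inv) ≫ g.hom ≫ c ⊴ₗ e.hom = f := by
  simp

/-- A fully faithful functor is a module functor for the transported action. -/
def transportLinearStructure :
    letI := transportStruct J K κ
    LinearStructure C J :=
  letI := transportStruct J K κ
  { iso := κ
    left := fun f s => by simp [MonoidalLeftActionStruct.actionHomLeft]
    right := fun c s s' f => by simp [MonoidalLeftActionStruct.actionHomRight]
    assoc := fun c c' s => by
      refine (congrArg (· ≫ (κ c (K c' s)).hom ≫ c ⊴ₗ (κ c' s).hom) (J.map_preimage _)).trans ?_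
      refine Eq.trans ?_ (comp_inv_comp_hom ((κ (c ⊗ c') s).hom ≫ (αₗ c c' (J.obj s)).hom)
        (κ c' s) (κ c (K c' s)))
      simp only [Iso.trans_hom, Iso.symm_hom, Category.assoc]
    unit := fun s => by simp [MonoidalLeftActionStruct.actionUnitIso] }

end TransportStruct

section Lift

variable {M M' E : Type*} [Category* M] [Category* M'] [Category* E]

/-- The lift of a functor along a fully faithful functor. -/
def liftFunctor (J : M ⥤ E) {J' : M' ⥤ E} [J'.Full] [J'.Faithful] (Fo : M → M')
    (θ : ∀ m, J'.obj (Fo m) ≅ J.obj m) : M ⥤ M' where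
  obj := Fo
  map f := J'.preimage ((θ _).hom ≫ J.map f ≫ (θ _).inv)
  map_id m := J'.map_injective (by simp)
  map_comp f g := J'.map_injective (by simp)

theorem map_liftFunctor (J : M ⥤ E) {J' : M' ⥤ E} [J'.Full] [J'.Faithful] (Fo : M → M')
    (θ : ∀ m, J'.obj (Fo m) ≅ J.obj m) {m n : M} (f : m ⟶ n) :
    J'.map ((liftFunctor J Fo θ).map f) = (θ m).hom ≫ J.map f ≫ (θ n).inv := by
  simp [liftFunctor]

variable [MonoidalLeftAction C M] [MonoidalLeftAction C M'] [MonoidalLeftAction C E]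
  {J : M ⥤ E} {J' : M' ⥤ E} (δ : LinearStructure C J) (δ' : LinearStructure C J') [J'.Full]
  [J'.Faithful] (F : M ⥤ M') (θ : ∀ m, J'.obj (F.obj m) ≅ J.obj m)

/-- The structure isomorphism of a lift. -/
def liftIso (c : C) (m : M) : c ⊙ₗ F.obj m ≅ F.obj (c ⊙ₗ m) :=
  J'.preimageIso (δ'.iso c (F.obj m) ≪≫ actIso c (θ m) ≪≫ (δ.iso c m).symm ≪≫ (θ (c ⊙ₗ m)).symm)

theorem map_liftIso (c : C) (m : M) : J'.map (liftIso δ δ' F θ c m).hom =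
    (δ'.iso c (F.obj m)).hom ≫ c ⊴ₗ (θ m).hom ≫ (δ.iso c m).inv ≫ (θ (c ⊙ₗ m)).inv := by
  simp [liftIso]

variable (hθ : ∀ {m n : M} (f : m ⟶ n), J'.map (F.map f) = (θ m).hom ≫ J.map f ≫ (θ n).inv)

/-- The lift of a module functor along a fully faithful module functor is a module functor. -/
abbrev liftLinear : F.LeftLinear C :=
  leftLinearOfIso F (liftIso δ δ' F θ)
    (fun {c c'} f m => J'.map_injective <| by
      rw [← cancel_mono ((θ _).hom ≫ (δ.iso _ _).hom), J'.map_comp, J'.map_comp, hθ]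
      simp only [Category.assoc, map_liftIso, Iso.inv_hom_id_assoc, δ.left, δ'.left_assoc,
        Iso.inv_hom_id, Category.comp_id]
      rw [action_exchange])
    (fun c m m' f => J'.map_injective <| by
      rw [← cancel_mono ((θ _).hom ≫ (δ.iso _ _).hom), J'.map_comp, J'.map_comp, hθ]
      simp only [Category.assoc, map_liftIso, Iso.inv_hom_id_assoc, δ.right, δ'.right_assoc,
        Iso.inv_hom_id, Category.comp_id, hθ, actionHomRight_comp, actionHomRight_inv_hom])
    (fun c c' m => J'.map_injective <| by
      rw [← cancel_mono ((θ _).hom ≫ (δ.iso _ _).hom ≫ _ ⊴ₗ (δ.iso _ _).hom), J'.map_comp,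
        J'.map_comp, J'.map_comp, hθ]
      simp only [Category.assoc, map_liftIso, Iso.inv_hom_id_assoc, δ.assoc, δ'.right_assoc,
        actionHomRight_comp, δ'.assoc_assoc, actionHomRight_inv_hom_assoc, actionHomRight_inv_hom]
      simp)
    (fun m => J'.map_injective <| by
      rw [← cancel_mono (θ _).hom, J'.map_comp, hθ]
      simp only [Category.assoc, map_liftIso, Iso.inv_hom_id_assoc, Iso.inv_hom_id,
        Category.comp_id, δ.unit, δ'.unit, ← actionUnitIso_hom_naturality])

include hθ in
-- Full faithfulness is inherited from `J` and `J'` through `hθ`; the hypothesis on the objects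
-- reached by `J` gives essential surjectivity.
theorem isEquivalence_lift [J.Full] [J.Faithful]
    (h : ∀ m' : M', ∃ m, Nonempty (J'.obj m' ≅ J.obj m)) : F.IsEquivalence where
  faithful := ⟨fun {m n} f g h => J.map_injective <| by
    have h1 := congrArg J'.map h
    rw [hθ, hθ] at h1
    simpa using h1⟩
  full := ⟨fun {m n} f => ⟨J.preimage ((θ m).inv ≫ J'.map f ≫ (θ n).hom), J'.map_injective <| by
    rw [hθ]
    simp⟩⟩
  essSurj := ⟨fun m' => by
    obtain ⟨m, ⟨e⟩⟩ := h m'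
    exact ⟨m, ⟨J'.preimageIso (θ m ≪≫ e.symm)⟩⟩⟩

end Lift

end LinearStructure

end LinearStructures

attribute [local instance] Abelian.hasFiniteBiproducts

/-! ### Objects with prescribed multiplicities -/

section Multiplicities

variable {D : Type uD} [Category.{vD} D] [Abelian D] [Linear ℂ D]
variable {V : Type w} {S : V → D}

/-- Morphisms into a finite direct sum. -/
def homBiproduct {ι : Type} [Fintype ι] (A : D) (Y : ι → D) :
    (A ⟶ ⨁ Y) ≃ₗ[ℂ] ∀ k, A ⟶ Y k where
  toFun f k := f ≫ biproduct.π Y k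
  map_add' f g := by funext k; simp
  map_smul' z f := by funext k; simp
  invFun y := biproduct.lift y
  left_inv f := by ext; simp
  right_inv y := by funext k; simp

namespace IsSimpleReps

open Classical in
theorem finrank_simple (hS : IsSimpleReps S) (i j : V) :
    Module.finrank ℂ (S i ⟶ S j) = if i = j then 1 else 0 := by
  split_ifs with h
  · subst h
    rw [(hS.scal i).finrank_eq, Module.finrank_self]
  · have : Subsingleton (S i ⟶ S j) :=
      ⟨fun f g => by rw [hS.hom_eq_zero h f, hS.hom_eq_zero h g]⟩
    exact Module.finrank_zero_of_subsingleton

theorem exists_finrank_eq [Finite V] (hS : IsSimpleReps S) (d : V → ℕ) :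
    ∃ m : D, ∀ i, Module.finrank ℂ (S i ⟶ m) = d i := by
  classical
  obtain ⟨N, ⟨e⟩⟩ := Finite.exists_equiv_fin V
  let Y : (Σ k : Fin N, Fin (d (e.symm k))) → D := fun k => S (e.symm k.1)
  refine ⟨⨁ Y, fun i => ?_⟩
  have := fun k => hS.finite (S i) (Y k)
  rw [(homBiproduct (S i) Y).finrank_eq, Module.finrank_pi_fintype]
  simp only [Y, hS.finrank_simple]
  rw [Fintype.sum_sigma, Finset.sum_eq_single (e i)]
  · simp
  · intro k _ h
    have h2 : i ≠ e.symm k := fun h2 => h (by rw [h2, e.apply_symm_apply])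
    simp [h2]
  · simp

end IsSimpleReps

end Multiplicities

/-! ### Coordinates of morphisms into `c ⊙ₗ m` -/

section Coordinates

open MonoidalLeftAction

variable {C : Type u} [Category.{v} C] [Abelian C] [Linear ℂ C] [MonoidalCategory C]
variable [MonoidalPreadditive C] [MonoidalLinear ℂ C] [Duality C]
variable {X : C} {V : Type w} [Quiver.{x} V] [Fintype V] [∀ i j : V, Finite (i ⟶ j)]
variable {M : SemisimpleModule.{v, u, vD, uD} C V}
variable {β : EdgeMorphisms M X} (hβ : IsEdgeBasis β) {ρ : MatrixRep X V}

omit [MonoidalPreadditive C] [MonoidalLinear ℂ C] in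
theorem pathSum_comp (β : EdgeMorphisms M X) {a : List Bool} {i : V} {m n : M.carrier}
    (y : ∀ k, EPath V a i k → (M.simple k ⟶ m)) (f : m ⟶ n) :
    pathSum β a i m y ≫ word X a ⊴ₗ f = pathSum β a i n fun k p => y k p ≫ f := by
  simp only [pathSum_apply, Preadditive.sum_comp, Category.assoc, actionHomRight_comp]

omit [MonoidalPreadditive C] [MonoidalLinear ℂ C] in
theorem pathCoord_comp {a : List Bool} {i : V} {m n : M.carrier}
    (g : M.simple i ⟶ word X a ⊙ₗ m) (f : m ⟶ n) :
    pathCoord hβ a i n (g ≫ word X a ⊴ₗ f) = fun k p => pathCoord hβ a i m g k p ≫ f := by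
  rw [← pathCoord_pathSum hβ fun k p => pathCoord hβ a i m g k p ≫ f, ← pathSum_comp,
    pathSum_pathCoord]

omit [MonoidalPreadditive C] [MonoidalLinear ℂ C] in
theorem pathSum_act {a b : List Bool} (f : word X a ⟶ word X b) (i : V) {m : M.carrier}
    (y : ∀ k, EPath V a i k → (M.simple k ⟶ m)) :
    pathSum β a i m y ≫ f ⊵ₗ m =
      pathSum β b i m (push (W := fun k => M.simple k ⟶ m) (actionMatrix β hβ f) y) := by
  simp only [pathSum_apply, Preadditive.sum_comp, Category.assoc, action_exchange]
  refine Finset.sum_congr rfl fun k _ => ?_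
  have h : ∀ p : EPath V a i k, pathMorphism β p ≫ f ⊵ₗ M.simple k ≫ word X b ⊴ₗ y k p =
      ∑ q, actionMatrix β hβ f i k p q • (pathMorphism β q ≫ word X b ⊴ₗ y k p) := fun p => by
    rw [← Category.assoc, ← sum_actionMatrix β hβ f p, Preadditive.sum_comp]
    simp only [Linear.smul_comp]
  simp only [h, push_apply, M.act_sum, M.act_smul, Preadditive.comp_sum, Linear.comp_smul]
  exact Finset.sum_comm

omit [MonoidalPreadditive C] [MonoidalLinear ℂ C] in
theorem pathCoord_act {a b : List Bool} (f : word X a ⟶ word X b) (i : V) {m : M.carrier}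
    (g : M.simple i ⟶ word X a ⊙ₗ m) :
    pathCoord hβ b i m (g ≫ f ⊵ₗ m) =
      push (W := fun k => M.simple k ⟶ m) (actionMatrix β hβ f) (pathCoord hβ a i m g) := by
  conv_lhs => rw [← pathSum_pathCoord hβ g]
  rw [pathSum_act hβ, pathCoord_pathSum]

omit [MonoidalPreadditive C] [MonoidalLinear ℂ C] in
theorem pathSum_append (β : EdgeMorphisms M X) {a b : List Bool} {i : V} {m : M.carrier}
    (y : ∀ k, EPath V a i k → ∀ j, EPath V b k j → (M.simple j ⟶ m)) :
    pathSum β (a ++ b) i m (PathVec.join y) =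
      pathSum β a i _ (fun k p => pathSum β b k m (y k p)) ≫ (αₗ (word X a) (word X b) m).inv ≫
        (wordMul X a b).hom ⊵ₗ m := by
  simp only [pathSum_apply]
  rw [EPath.sum_append i fun j P => pathMorphism β P ≫ word X (a ++ b) ⊴ₗ PathVec.join y j P]
  simp only [M.act_sum, Preadditive.comp_sum, Preadditive.sum_comp, PathVec.join_append]
  refine Finset.sum_congr rfl fun k _ => Finset.sum_congr rfl fun p _ =>
    Finset.sum_congr rfl fun j _ => Finset.sum_congr rfl fun q _ => ?_
  rw [pathMorphism_append]
  simp only [Category.assoc]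
  rw [← action_exchange, tensor_actionHomRight]
  simp

omit [MonoidalPreadditive C] [MonoidalLinear ℂ C] in
theorem pathCoord_append {a b : List Bool} {i : V} {m : M.carrier}
    (g : M.simple i ⟶ word X a ⊙ₗ word X b ⊙ₗ m) {k j : V} (p : EPath V a i k)
    (q : EPath V b k j) :
    pathCoord hβ (a ++ b) i m (g ≫ (αₗ (word X a) (word X b) m).inv ≫ (wordMul X a b).hom ⊵ₗ m) j
      (p.append q) = pathCoord hβ b k m (pathCoord hβ a i _ g k p) j q := by
  have h := pathSum_append β (m := m) fun k p => pathCoord hβ b k m (pathCoord hβ a i _ g k p)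
  simp only [pathSum_pathCoord] at h
  rw [← h, pathCoord_pathSum, PathVec.join_append]

/-- The coordinates of `x : Mᵢ ⟶ c ⊗ m`: those of the morphisms `(g ⊗ m) ∘ x` along the paths, for
all morphisms `g` from `c` to words. -/
def coords (hρ : ∀ (a b : List Bool) (f : word X a ⟶ word X b), ρ.map f = actionMatrix β hβ f)
    (c : C) (i : V) (m : M.carrier) :
    (M.simple i ⟶ c ⊙ₗ m) →ₗ[ℂ] natFam ρ c (fun k => M.simple k ⟶ m) i where
  toFun x := ⟨fun a =>
    { toFun := fun g => pathCoord hβ a i m (x ≫ g ⊵ₗ m)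
      map_add' := fun g g' => by rw [M.add_act, Preadditive.comp_add, map_add]
      map_smul' := fun z g => by rw [M.smul_act, Linear.comp_smul, _root_.map_smul, RingHom.id_apply] },
    fun a b g h => by
      change pathCoord hβ b i m (x ≫ (g ≫ h) ⊵ₗ m) = push _ (pathCoord hβ a i m (x ≫ g ⊵ₗ m))
      rw [hρ, comp_actionHomLeft, ← Category.assoc]
      exact pathCoord_act hβ h i (x ≫ g ⊵ₗ m)⟩
  map_add' f g := natFam.ext fun a h k p => by
    change pathCoord hβ a i m ((f + g) ≫ h ⊵ₗ m) k p = _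
    rw [Preadditive.add_comp, map_add]
    rfl
  map_smul' z f := natFam.ext fun a h k p => by
    change pathCoord hβ a i m ((z • f) ≫ h ⊵ₗ m) k p = _
    rw [Linear.smul_comp, _root_.map_smul]
    rfl

variable (hρ : ∀ (a b : List Bool) (f : word X a ⟶ word X b), ρ.map f = actionMatrix β hβ f)

omit [MonoidalPreadditive C] [MonoidalLinear ℂ C] in
theorem coords_apply {c : C} {i : V} {m : M.carrier} (y : M.simple i ⟶ c ⊙ₗ m) {a : List Bool}
    (g : c ⟶ word X a) :
    (coords hβ hρ c i m y).1 a g = pathCoord hβ a i m (y ≫ g ⊵ₗ m) := rfl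

omit [MonoidalPreadditive C] [MonoidalLinear ℂ C] in
-- For words, the coordinates are those in the path basis. A general `c` is a summand of a sum of
-- words: the morphisms `a l` detect a morphism into `c ⊙ₗ m`, and the `b l` reassemble one from a
-- natural family.
theorem coords_bijective (c : C) (i : V) (m : M.carrier) :
    Function.Bijective (coords hβ hρ c i m) := by
  obtain ⟨n, y, a, b, hab⟩ := ρ.generates.exists_sum c
  have hx : ∀ z : M.simple i ⟶ c ⊙ₗ m, ∑ l, z ≫ a l ⊵ₗ m ≫ b l ⊵ₗ m = z := fun z => by
    simp only [← comp_actionHomLeft, ← Preadditive.comp_sum, ← M.sum_act, hab, id_actionHomLeft,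
      Category.comp_id]
  constructor
  · intro z z' h
    rw [← hx z, ← hx z']
    refine Finset.sum_congr rfl fun l _ => ?_
    have h1 : pathCoord hβ (y l) i m (z ≫ a l ⊵ₗ m) = pathCoord hβ (y l) i m (z' ≫ a l ⊵ₗ m) := by
      rw [← coords_apply hβ hρ, h, coords_apply]
    rw [← Category.assoc, (pathCoord hβ (y l) i m).injective h1, Category.assoc]
  · intro τ
    refine ⟨∑ l, pathSum β (y l) i m (τ.1 _ (a l)) ≫ b l ⊵ₗ m, natFam.ext fun u g k p => ?_⟩
    rw [coords_apply]
    have h1 : pathCoord hβ u i m ((∑ l, pathSum β (y l) i m (τ.1 _ (a l)) ≫ b l ⊵ₗ m) ≫ g ⊵ₗ m) =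
        ∑ l, τ.1 u (a l ≫ b l ≫ g) := by
      rw [Preadditive.sum_comp, _root_.map_sum]
      refine Finset.sum_congr rfl fun l _ => ?_
      rw [Category.assoc, ← comp_actionHomLeft, natFam.nat τ, hρ]
      exact (pathCoord_act hβ (b l ≫ g) i _).trans (by rw [pathCoord_pathSum])
    rw [h1, ← _root_.map_sum]
    simp only [← Category.assoc, ← Preadditive.sum_comp, hab, Category.id_comp]

/-- The functor from a module category to families of vector spaces given by multiplicity spaces. -/
def homFam (M : SemisimpleModule.{v, u, vD, uD} C V) (ρ : MatrixRep X V) :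
    M.carrier ⥤ Fam.{v, u, x, w, vD} ρ where
  obj m := { obj := fun i => ULift.{max v w x} (M.simple i ⟶ m) }
  map f i := ULift.moduleEquiv.symm.toLinearMap ∘ₗ Linear.rightComp ℂ _ f ∘ₗ
    ULift.moduleEquiv.toLinearMap
  map_id m := Fam.hom_ext fun i y => congrArg ULift.up (Category.comp_id y.down)
  map_comp f g := Fam.hom_ext fun i y => congrArg ULift.up (Category.assoc y.down f g).symm

end Coordinates

/-! ### Multiplicity spaces as a module functor -/

section HomFunctor

open MonoidalLeftAction

variable {C : Type u} [Category.{v} C] [Abelian C] [Linear ℂ C] [MonoidalCategory C]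
variable [MonoidalPreadditive C] [MonoidalLinear ℂ C] [Duality C]
variable {X : C} {V : Type w} [Quiver.{x} V] [Fintype V] [∀ i j : V, Finite (i ⟶ j)]
variable (M : SemisimpleModule.{v, u, vD, uD} C V) (ρ : MatrixRep X V)

instance : (homFam M ρ).Faithful where
  map_injective {m n f g} h := M.reps.hom_ext fun i y => by
    have h1 := congrArg ULift.down (LinearMap.congr_fun (congrFun h i) (ULift.up y))
    exact h1

instance : (homFam M ρ).Full where
  map_surjective {m n} t := by
    obtain ⟨f, hf⟩ := M.reps.exists_hom fun i =>
      ULift.moduleEquiv.toLinearMap ∘ₗ t i ∘ₗ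
        (ULift.moduleEquiv (R := ℂ) (M := M.simple i ⟶ m)).symm.toLinearMap
    exact ⟨f, Fam.hom_ext fun i y => congrArg ULift.up (hf i y.down)⟩

variable {M ρ} {β : EdgeMorphisms M X} (hβ : IsEdgeBasis β)
variable (hρ : ∀ (a b : List Bool) (f : word X a ⟶ word X b), ρ.map f = actionMatrix β hβ f)

/-- The comparison of the multiplicity spaces of `c ⊗ m` with the action of `c` on those of `m`. -/
def homFamEquiv (c : C) (m : M.carrier) (i : V) :
    ((homFam M ρ).obj (c ⊙ₗ m)).obj i ≃ₗ[ℂ] natFam ρ c ((homFam M ρ).obj m).obj i :=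
  ULift.moduleEquiv.trans ((LinearEquiv.ofBijective _ (coords_bijective hβ hρ c i m)).trans
    { natFam.right ρ c (fun k =>
        (ULift.moduleEquiv (R := ℂ) (M := M.simple k ⟶ m)).symm.toLinearMap) i with
      invFun := natFam.right ρ c (fun k => (ULift.moduleEquiv
        (R := ℂ) (M := M.simple k ⟶ m)).toLinearMap) i
      left_inv := fun _ => rfl
      right_inv := fun _ => rfl })

theorem pathCoord_nil {i : V} {m : M.carrier} (y : M.simple i ⟶ 𝟙_ C ⊙ₗ m) :
    y ≫ (λₗ[C] m).hom = pathCoord hβ [] i m (y ≫ 𝟙 (𝟙_ C) ⊵ₗ m : M.simple i ⟶ 𝟙_ C ⊙ₗ m) i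
      (.nil i) := by
  have h := (pathSum_pathCoord hβ (w := []) y).symm.trans
    (pathSum_nil β i m (pathCoord hβ [] i m y))
  rw [id_actionHomLeft, Category.comp_id, ← cancel_mono (λₗ[C] m).inv, Category.assoc,
    Iso.hom_inv_id, Category.comp_id]
  exact h

/-- The functor of multiplicity spaces is a module functor. -/
def homFamLinear : LinearStructure C (homFam M ρ) where
  iso c m := Fam.isoOfEquiv (homFamEquiv hβ hρ c m)
  left {c c'} f m := Fam.hom_ext fun i y => natFam.ext fun a g k p => by
    refine congrArg ULift.up ?_
    change pathCoord hβ a i m ((y.down ≫ f ⊵ₗ m) ≫ g ⊵ₗ m) k p =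
      pathCoord hβ a i m (y.down ≫ (f ≫ g) ⊵ₗ m) k p
    rw [comp_actionHomLeft, Category.assoc]
  right c {m n} f := Fam.hom_ext fun i y => natFam.ext fun a g k p => by
    refine congrArg ULift.up ?_
    change pathCoord hβ a i n ((y.down ≫ c ⊴ₗ f) ≫ g ⊵ₗ n) k p =
      pathCoord hβ a i m (y.down ≫ g ⊵ₗ m) k p ≫ f
    rw [Category.assoc, action_exchange, ← Category.assoc, pathCoord_comp]
  assoc c c' m := Fam.hom_ext fun i y => natFam.ext fun a g k p => natFam.ext fun b g' j q => by
    refine congrArg ULift.up ?_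
    change pathCoord hβ b k m (pathCoord hβ a i _ ((y.down ≫ (αₗ c c' m).hom) ≫
      g ⊵ₗ (c' ⊙ₗ m)) k p ≫ g' ⊵ₗ m) j q =
        pathCoord hβ (a ++ b) i m (y.down ≫ ((g ⊗ₘ g') ≫ (wordMul X a b).hom) ⊵ₗ m) j (p.append q)
    have h := congrFun (congrFun (pathCoord_comp hβ
      ((y.down ≫ (αₗ c c' m).hom) ≫ g ⊵ₗ (c' ⊙ₗ m)) (g' ⊵ₗ m)) k) p
    rw [← h, ← pathCoord_append]
    refine congrFun (congrFun (congrArg _ ?_) _) _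
    simp [MonoidalCategory.tensorHom_def]
  unit m := Fam.hom_ext fun i y => by
    refine congrArg ULift.up ?_
    exact pathCoord_nil hβ y.down

end HomFunctor

/-! ### Uniqueness of the module category -/

section Uniqueness

variable {C : Type u} [Category.{v} C] [Abelian C] [Linear ℂ C] [MonoidalCategory C]
variable [MonoidalPreadditive C] [MonoidalLinear ℂ C] [Duality C]
variable {X : C} {V : Type w} [Quiver.{x} V] [Fintype V] [∀ i j : V, Finite (i ⟶ j)]
variable {M M' : SemisimpleModule.{v, u, vD, uD} C V} {ρ : MatrixRep X V}

/-- Objects with multiplicity spaces of equal dimensions have isomorphic multiplicity spaces. -/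
theorem nonempty_homFam_iso {m : M.carrier} {m' : M'.carrier}
    (h : ∀ i, Module.finrank ℂ (M'.simple i ⟶ m') = Module.finrank ℂ (M.simple i ⟶ m)) :
    Nonempty ((homFam M' ρ).obj m' ≅ (homFam M ρ).obj m) := by
  have h1 := fun i => M.reps.finite (M.simple i) m
  have h2 := fun i => M'.reps.finite (M'.simple i) m'
  exact ⟨Fam.isoOfEquiv fun i => ULift.moduleEquiv.trans
    ((LinearEquiv.ofFinrankEq _ _ (h i)).trans ULift.moduleEquiv.symm)⟩

/-- Families of finite-dimensional spaces are classified by their dimensions, and every module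
category with simple objects labelled by `V` realises all of them. The two functors of multiplicity
spaces thus reach the same families up to isomorphism. -/
theorem exists_homFam_iso (m : M.carrier) :
    ∃ m' : M'.carrier, Nonempty ((homFam M' ρ).obj m' ≅ (homFam M ρ).obj m) := by
  obtain ⟨m', h⟩ := M'.reps.exists_finrank_eq fun i => Module.finrank ℂ (M.simple i ⟶ m)
  exact ⟨m', nonempty_homFam_iso h⟩

/-- The representation of words on paths given by a functor to the graph planar algebra. -/
def PlanarMorphism.matrixRep (hX : IsTensorGenerator X) {r : V → ℂ}
    (φ : PlanarMorphism (planarAlgebraOf X) (oGPA V r).toPlanarData) : MatrixRep X V where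
  generates := hX
  map := φ.map
  map_id := φ.map_id
  map_comp := φ.map_comp
  map_tens := φ.map_tens

/-- The isomorphisms `θ` may be chosen independently for each object: both functors to families are
fully faithful, so the choices determine a functor and its module structure. -/
theorem isModuleEquivalence_lift {δ : LinearStructure C (homFam M ρ)}
    {δ' : LinearStructure C (homFam M' ρ)} (Fo : M.carrier → M'.carrier)
    (θ : ∀ m, (homFam M' ρ).obj (Fo m) ≅ (homFam M ρ).obj m) :
    letI := LinearStructure.liftLinear δ δ' (LinearStructure.liftFunctor (homFam M ρ) Fo θ) θ
      (fun f => LinearStructure.map_liftFunctor (homFam M ρ) Fo θ f)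
    IsModuleEquivalence (LinearStructure.liftFunctor (homFam M ρ) Fo θ) :=
  letI := LinearStructure.liftLinear δ δ' (LinearStructure.liftFunctor (homFam M ρ) Fo θ) θ
      (fun f => LinearStructure.map_liftFunctor (homFam M ρ) Fo θ f)
  { isEquivalence := LinearStructure.isEquivalence_lift
      (LinearStructure.liftFunctor (homFam M ρ) Fo θ) θ
      (fun f => LinearStructure.map_liftFunctor (homFam M ρ) Fo θ f) fun m' => by
        obtain ⟨m, ⟨e⟩⟩ := exists_homFam_iso (M := M') (M' := M) (ρ := ρ) m'
        exact ⟨m, ⟨e.symm⟩⟩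
    map_add := fun {m n} f g => (homFam M' ρ).map_injective <| by
      have h : ∀ {k l : M'.carrier} (f g : k ⟶ l), (homFam M' ρ).map (f + g) =
        (homFam M' ρ).map f + (homFam M' ρ).map g := fun f g => Fam.hom_ext fun i y =>
          congrArg ULift.up (Preadditive.comp_add _ _ _ y.down f g)
      have h' : (homFam M ρ).map (f + g) =
        (homFam M ρ).map f + (homFam M ρ).map g := Fam.hom_ext fun i y =>
          congrArg ULift.up (Preadditive.comp_add _ _ _ y.down f g)
      rw [h, LinearStructure.map_liftFunctor, LinearStructure.map_liftFunctor,
        LinearStructure.map_liftFunctor, h', Preadditive.add_comp, Preadditive.comp_add]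
      rfl
    map_smul := fun {m n} z f => (homFam M' ρ).map_injective <| by
      have h : ∀ {k l : M'.carrier} (f : k ⟶ l), (homFam M' ρ).map (z • f) =
        z • (homFam M' ρ).map f := fun f => Fam.hom_ext fun i y =>
          congrArg ULift.up (Linear.comp_smul _ _ _ y.down z f)
      have h' : (homFam M ρ).map (z • f) = z • (homFam M ρ).map f := Fam.hom_ext fun i y =>
          congrArg ULift.up (Linear.comp_smul _ _ _ y.down z f)
      rw [h, LinearStructure.map_liftFunctor, LinearStructure.map_liftFunctor, h',
        Linear.smul_comp, Linear.comp_smul]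
      rfl }

/-- By Schur's lemma the multiplicities of the simple object labelled `j` are 1 at `j` and 0
elsewhere, in either category. -/
theorem respectsLabels_lift (Fo : M.carrier → M'.carrier)
    (θ : ∀ m, (homFam M' ρ).obj (Fo m) ≅ (homFam M ρ).obj m) :
    RespectsLabels (LinearStructure.liftFunctor (homFam M ρ) Fo θ) := fun j => by
  obtain ⟨e⟩ := nonempty_homFam_iso (M := M) (M' := M') (ρ := ρ) (m := M.simple j)
    (m' := M'.simple j) fun i => by rw [M.reps.finrank_simple, M'.reps.finrank_simple]
  exact ⟨(homFam M' ρ).preimageIso (θ (M.simple j) ≪≫ e.symm)⟩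

/-- Module categories that correspond to the same morphism of planar algebras are equivalent. -/
theorem Corresponds.labelledModuleEquivalent (hX : IsTensorGenerator X) {r : V → ℂ}
    (φ : PlanarMorphism (planarAlgebraOf X) (oGPA V r).toPlanarData)
    (h : Corresponds (X := X) M fun _ _ f => φ.map f)
    (h' : Corresponds (X := X) M' fun _ _ f => φ.map f) : LabelledModuleEquivalent M M' := by
  obtain ⟨β, hβ, hφ⟩ := h
  obtain ⟨β', hβ', hφ'⟩ := h'
  choose Fo θ using exists_homFam_iso (M := M) (M' := M') (ρ := φ.matrixRep hX)
  exact ⟨_, _, isModuleEquivalence_lift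
    (δ := homFamLinear (ρ := φ.matrixRep hX) hβ fun _ _ f => hφ.eq hβ f)
    (δ' := homFamLinear (ρ := φ.matrixRep hX) hβ' fun _ _ f => hφ'.eq hβ' f)
    Fo (fun m => (θ m).some), respectsLabels_lift _ _⟩

end Uniqueness

/-! ### Words acting on families -/

section WordFamilies

variable {C : Type u} [Category.{v} C] [Abelian C] [Linear ℂ C] [MonoidalCategory C]
variable [MonoidalPreadditive C] [MonoidalLinear ℂ C] [Duality C]
variable {X : C} {V : Type w} [Quiver.{x} V] [Fintype V] [∀ i j : V, Finite (i ⟶ j)]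

namespace natFam

variable {ρ : MatrixRep X V} {W : V → Type t} [∀ k, AddCommGroup (W k)] [∀ k, Module ℂ (W k)] {i : V}

/-- The action of a word: functions of the paths along the word. -/
def ofWord (ρ : MatrixRep X V) {W : V → Type t} [∀ k, AddCommGroup (W k)] [∀ k, Module ℂ (W k)]
    (a : List Bool) (i : V) : PathVec W a i ≃ₗ[ℂ] natFam ρ (word X a) W i where
  toFun y := ⟨fun b =>
    { toFun := fun g => push (ρ.map g) y
      map_add' := fun g g' => by rw [map_add, push_add_left]
      map_smul' := fun z g => by rw [map_smul, push_smul_left, RingHom.id_apply] }, fun b b' g h => by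
    change push (ρ.map (g ≫ h)) _ = push _ (push (ρ.map g) _)
    rw [ρ.map_comp, push_mul]⟩
  map_add' y z := ext fun b g k p => by
    change push (ρ.map g) (y + z) k p = _
    rw [map_add]
    rfl
  map_smul' c y := ext fun b g k p => by
    change push (ρ.map g) (c • y) k p = _
    rw [_root_.map_smul]
    rfl
  invFun τ := τ.1 a (𝟙 _)
  left_inv y := by
    change push (ρ.map (𝟙 _)) y = y
    rw [ρ.map_id, push_one]
  right_inv τ := ext fun b g k p => by
    change push (ρ.map g) (τ.1 a (𝟙 _)) k p = _
    rw [← nat τ, Category.id_comp]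

theorem ofWord_apply {a b : List Bool} (y : PathVec W a i) (g : word X a ⟶ word X b) :
    (ofWord ρ a i y).1 b g = push (ρ.map g) y := rfl

theorem ofWord_id {a : List Bool} (y : PathVec W a i) : (ofWord ρ a i y).1 a (𝟙 _) = y :=
  (ofWord ρ a i).left_inv y

theorem ofWord_symm (a : List Bool) (τ : natFam ρ (word X a) W i) :
    (ofWord ρ a i).symm τ = τ.1 a (𝟙 _) := rfl

/-- The action of an object is finite-dimensional. -/
theorem finiteDimensional (c : C) [∀ k, FiniteDimensional ℂ (W k)] :
    FiniteDimensional ℂ (natFam ρ c W i) := by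
  obtain ⟨n, y, a, b, hab⟩ := ρ.generates.exists_sum c
  let F : natFam ρ c W i →ₗ[ℂ] ∀ l, PathVec W (y l) i := LinearMap.pi fun l => eval ρ W (a l) i
  refine FiniteDimensional.of_injective F fun τ σ h => Subtype.ext (funext fun u => LinearMap.ext fun g => ?_)
  have hg : g = ∑ l, a l ≫ b l ≫ g := by
    simp only [← Category.assoc, ← Preadditive.sum_comp, hab, Category.id_comp]
  rw [hg, _root_.map_sum, _root_.map_sum]
  refine Finset.sum_congr rfl fun l _ => ?_
  rw [nat τ, nat σ]
  exact congrArg _ (congrFun h l)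

end natFam

end WordFamilies

/-! ### A skeleton of families of Hilbert spaces -/

section Skeleton

/-- Finite families of finite-dimensional Hilbert spaces; the second field records the universe of
the morphisms. -/
structure Skel.{a, b} (N : ℕ) : Type b where
  dim : Fin N → ℕ
  inhabited : _root_.Nonempty PUnit.{a + 1} := ⟨⟨⟩⟩

namespace Skel

variable {N : ℕ}

/-- The spaces of the family. -/
abbrev space (s : Skel.{vD, uD} N) (a : Fin N) : Type := EuclideanSpace ℂ (Fin (s.dim a))

instance : Category.{vD} (Skel.{vD, uD} N) where
  Hom s t := ULift.{vD} (∀ a, s.space a →ₗ[ℂ] t.space a)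
  id s := ⟨fun _ => LinearMap.id⟩
  comp f g := ⟨fun a => g.down a ∘ₗ f.down a⟩

/-- Morphisms from families of linear maps. -/
def ofMaps {s t : Skel.{vD, uD} N} (f : ∀ a, s.space a →ₗ[ℂ] t.space a) : s ⟶ t := ⟨f⟩

/-- The linear maps of a morphism. -/
def maps {s t : Skel.{vD, uD} N} (f : s ⟶ t) (a : Fin N) : s.space a →ₗ[ℂ] t.space a := f.down a

@[simp]
theorem maps_ofMaps {s t : Skel.{vD, uD} N} (f : ∀ a, s.space a →ₗ[ℂ] t.space a) (a : Fin N) :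
    maps (ofMaps f) a = f a := rfl

@[simp]
theorem maps_id (s : Skel.{vD, uD} N) (a : Fin N) : maps (𝟙 s) a = LinearMap.id := rfl

@[simp]
theorem maps_comp {s t r : Skel.{vD, uD} N} (f : s ⟶ t) (g : t ⟶ r) (a : Fin N) :
    maps (f ≫ g) a = maps g a ∘ₗ maps f a := rfl

theorem hom_ext {s t : Skel.{vD, uD} N} {f g : s ⟶ t} (h : ∀ a, maps f a = maps g a) : f = g :=
  congrArg ULift.up (funext h)

instance : Preadditive (Skel.{vD, uD} N) where
  homGroup s t := inferInstanceAs (AddCommGroup (ULift.{vD} (∀ a, s.space a →ₗ[ℂ] t.space a)))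
  add_comp _ _ _ _ _ _ := hom_ext fun _ => LinearMap.comp_add _ _ _
  comp_add _ _ _ _ _ _ := hom_ext fun _ => LinearMap.add_comp _ _ _

instance : Linear ℂ (Skel.{vD, uD} N) where
  homModule s t := inferInstanceAs (Module ℂ (ULift.{vD} (∀ a, s.space a →ₗ[ℂ] t.space a)))
  smul_comp _ _ _ _ _ _ := hom_ext fun _ => LinearMap.comp_smul _ _ _
  comp_smul _ _ _ _ _ _ := hom_ext fun _ => LinearMap.smul_comp _ _ _

/-- The linear maps of a morphism, as a linear equivalence. -/
def mapsEquiv (s t : Skel.{vD, uD} N) : (s ⟶ t) ≃ₗ[ℂ] ∀ a, s.space a →ₗ[ℂ] t.space a :=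
  ULift.moduleEquiv

theorem maps_sum {ι : Type*} (S : Finset ι) {s t : Skel.{vD, uD} N} (f : ι → (s ⟶ t)) (a : Fin N) :
    maps (∑ k ∈ S, f k) a = ∑ k ∈ S, maps (f k) a := by
  have h := congrFun (map_sum (mapsEquiv s t) f S) a
  rw [Finset.sum_apply] at h
  exact h

/-- Families of Hilbert spaces as families of vector spaces. -/
def toModules : Skel.{vD, uD} N ⥤ (Discrete (Fin N) ⥤ FGModuleCat.{0} ℂ) where
  obj s := Discrete.functor fun a => FGModuleCat.of ℂ (s.space a)
  map f := Discrete.natTrans fun a => FGModuleCat.ofHom (maps f a.as)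
  map_id s := by
    ext a : 2
    rfl
  map_comp f g := by
    ext a : 2
    rfl

instance : (toModules : Skel.{vD, uD} N ⥤ _).Faithful where
  map_injective {s t f g} h := hom_ext fun a => by
    have h1 : (toModules.map f).app ⟨a⟩ = (toModules.map g).app ⟨a⟩ := by rw [h]
    exact congrArg (fun z : FGModuleCat.of ℂ (s.space a) ⟶ FGModuleCat.of ℂ (t.space a) => z.hom.hom) h1

instance : (toModules : Skel.{vD, uD} N ⥤ _).Full where
  map_surjective {s t} f := ⟨ofMaps fun a => (f.app ⟨a⟩).hom.hom, by
    ext a : 2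
    rfl⟩

instance : (toModules : Skel.{vD, uD} N ⥤ _).EssSurj where
  mem_essImage F := by
    let s : Skel.{vD, uD} N := { dim := fun a => Module.finrank ℂ (F.obj ⟨a⟩) }
    have e : ∀ a : Fin N, s.space a ≃ₗ[ℂ] F.obj ⟨a⟩ := fun a =>
      LinearEquiv.ofFinrankEq _ _ (by simp [s, space])
    exact ⟨s, ⟨Discrete.natIso fun a => (e a.as).toFGModuleCatIso⟩⟩

instance : (toModules : Skel.{vD, uD} N ⥤ _).IsEquivalence where

instance : HasFiniteProducts (Skel.{vD, uD} N) :=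
  ⟨fun _ => Adjunction.hasLimitsOfShape_of_equivalence toModules⟩

/-- The abelian structure is imported from families of finite-dimensional vector spaces; the
equivalence `toModules` exists for this purpose. -/
instance : Abelian (Skel.{vD, uD} N) := abelianOfEquivalence toModules

end Skel

end Skeleton

attribute [local instance] Abelian.hasFiniteBiproducts

/-! ### Adjoints and simple objects in the skeleton -/

section SkeletonSimples

/-- The adjoint of `f` composed with `f` is a positive operator on `E`, and positive elements of a
C*-algebra have the form star g · g. This supplies the axiom `positive`. -/
theorem exists_adjoint_comp_self_eq {E F : Type*} [NormedAddCommGroup E] [InnerProductSpace ℂ E]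
    [FiniteDimensional ℂ E] [NormedAddCommGroup F] [InnerProductSpace ℂ F] [FiniteDimensional ℂ F]
    (f : E →ₗ[ℂ] F) : ∃ g : E →ₗ[ℂ] E, LinearMap.adjoint f ∘ₗ f = LinearMap.adjoint g ∘ₗ g := by
  have := FiniteDimensional.complete ℂ E
  have := FiniteDimensional.complete ℂ F
  let f' : E →L[ℂ] F := f.toContinuousLinearMap
  have hf : 0 ≤ ContinuousLinearMap.adjoint f' ∘L f' :=
    (ContinuousLinearMap.nonneg_iff_isPositive _).2
      (ContinuousLinearMap.isPositive_adjoint_comp_self f')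
  obtain ⟨g, hg⟩ := CStarAlgebra.nonneg_iff_eq_star_mul_self.1 hf
  refine ⟨g.toLinearMap, LinearMap.ext fun y => ?_⟩
  have h1 : ContinuousLinearMap.adjoint f' (f' y) = ContinuousLinearMap.adjoint g (g y) :=
    congrArg (fun T : E →L[ℂ] E => T y) hg
  exact h1

namespace Skel

variable {N : ℕ}

instance : CStarCategory (Skel.{vD, uD} N) where
  dag f := ofMaps fun a => LinearMap.adjoint (maps f a)
  dag_dag f := hom_ext fun a => LinearMap.adjoint_adjoint _
  dag_id m := hom_ext fun a => LinearMap.adjoint_id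
  dag_comp f g := hom_ext fun a => LinearMap.adjoint_comp _ _
  dag_add f g := hom_ext fun a => map_add _ _ _
  dag_smul z f := hom_ext fun a => by
    change LinearMap.adjoint (z • maps f a) = conj z • LinearMap.adjoint (maps f a)
    rw [map_smulₛₗ]
  definite {s t} f h := hom_ext fun a => LinearMap.ext fun y => by
    have h1 : LinearMap.adjoint (maps f a) (maps f a y) = 0 := LinearMap.congr_fun (congrArg (maps · a) h) y
    have h2 : inner ℂ (maps f a y) (maps f a y) = 0 := by
      rw [← LinearMap.adjoint_inner_right, h1, inner_zero_right]
    exact inner_self_eq_zero.1 h2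
  positive {s t} f := by
    have h := fun a => exists_adjoint_comp_self_eq (maps f a)
    choose g hg using h
    exact ⟨ofMaps g, hom_ext hg⟩

@[simp]
theorem maps_dag {s t : Skel.{vD, uD} N} (f : s ⟶ t) (a : Fin N) :
    maps (dag f) a = LinearMap.adjoint (maps f a) := rfl

/-- The family with a one-dimensional space at `a` only. -/
def delta (a : Fin N) : Skel.{vD, uD} N := { dim := fun b => if b = a then 1 else 0 }

/-- The vector with coordinates `1`. -/
def ones (s : Skel.{vD, uD} N) (b : Fin N) : s.space b := WithLp.toLp 2 fun _ => 1

/-- Vectors as morphisms. -/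
def ofVector {s : Skel.{vD, uD} N} {a : Fin N} (y : s.space a) : delta a ⟶ s :=
  ofMaps fun b => (innerₛₗ ℂ (ones (delta.{vD, uD} a) b)).smulRight (Pi.single (M := s.space) a y b)

theorem maps_ofVector {s : Skel.{vD, uD} N} {a : Fin N} (y : s.space a) (b : Fin N)
    (z : (delta.{vD, uD} a).space b) : maps (ofVector y) b z =
      inner ℂ (ones (delta.{vD, uD} a) b) z • Pi.single (M := s.space) a y b := rfl

/-- The space of `delta a` at `b` has dimension `if b = a then 1 else 0`, which does not reduce. The
vector `ones` spans it in both cases and plays the part of a basis. -/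
theorem eq_smul_ones {a b : Fin N} (z : (delta.{vD, uD} a).space b) :
    z = inner ℂ (ones (delta.{vD, uD} a) b) z • ones (delta.{vD, uD} a) b := by
  have : Subsingleton (Fin ((delta.{vD, uD} a).dim b)) := by
    simp only [delta]
    split <;> infer_instance
  ext k
  simp [ones, PiLp.inner_apply, Fintype.sum_subsingleton _ k]

theorem inner_ones (a b : Fin N) : inner ℂ (ones (delta.{vD, uD} a) b) (ones (delta.{vD, uD} a) b) =
    if b = a then 1 else 0 := by
  rw [PiLp.inner_apply]
  simp only [ones, inner_self_eq_norm_sq_to_K, norm_one, RCLike.ofReal_one, one_pow, Finset.sum_const,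
    Finset.card_univ, Fintype.card_fin, nsmul_eq_mul, mul_one]
  simp [delta]

/-- The vector of a morphism. -/
def toVector {s : Skel.{vD, uD} N} {a : Fin N} (f : delta a ⟶ s) : s.space a := maps f a (ones _ a)

theorem toVector_ofVector {s : Skel.{vD, uD} N} {a : Fin N} (y : s.space a) :
    toVector (ofVector y) = y := by
  rw [toVector, maps_ofVector, inner_ones, if_pos rfl, one_smul, Pi.single_eq_same]

theorem toVector_comp {s t : Skel.{vD, uD} N} {a : Fin N} (f : delta a ⟶ s) (g : s ⟶ t) :
    toVector (f ≫ g) = maps g a (toVector f) := rfl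

theorem toVector_injective {s : Skel.{vD, uD} N} {a : Fin N} {f g : delta a ⟶ s}
    (h : toVector f = toVector g) : f = g := by
  refine hom_ext fun b => LinearMap.ext fun z => ?_
  by_cases hb : b = a
  · subst hb
    rw [eq_smul_ones z, _root_.map_smul, _root_.map_smul]
    exact congrArg _ h
  · have hz : z = 0 := by
      have : IsEmpty (Fin ((delta.{vD, uD} a).dim b)) := by
        simp only [delta, if_neg hb]
        infer_instance
      ext k
      exact this.elim k
    rw [hz, map_zero, map_zero]

theorem ofVector_toVector {s : Skel.{vD, uD} N} {a : Fin N} (f : delta a ⟶ s) :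
    ofVector (toVector f) = f := toVector_injective (toVector_ofVector _)

/-- Morphisms from `delta a` are vectors. -/
def vectorEquiv (a : Fin N) (s : Skel.{vD, uD} N) : (delta a ⟶ s) ≃ₗ[ℂ] s.space a where
  toFun := toVector
  map_add' _ _ := rfl
  map_smul' _ _ := rfl
  invFun := ofVector
  left_inv := ofVector_toVector
  right_inv := toVector_ofVector

theorem id_delta_ne_zero (a : Fin N) : 𝟙 (delta.{vD, uD} a) ≠ 0 := fun h => by
  have h1 := inner_ones.{vD, uD} a a
  have h2 : ones (delta.{vD, uD} a) a = 0 := LinearMap.congr_fun (congrArg (maps · a) h) _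
  rw [h2, inner_zero_left, if_pos rfl] at h1
  exact zero_ne_one h1

theorem hom_delta_eq_zero {a b : Fin N} (h : a ≠ b) (f : delta.{vD, uD} a ⟶ delta b) : f = 0 := by
  refine toVector_injective ?_
  have h1 := eq_smul_ones (toVector f)
  have h2 : ones (delta.{vD, uD} b) a = 0 := inner_self_eq_zero.1 ((inner_ones b a).trans (if_neg h))
  rw [h2, smul_zero] at h1
  exact h1

theorem exists_smul_id_delta {a : Fin N} (f : delta.{vD, uD} a ⟶ delta a) :
    ∃ z : ℂ, f = z • 𝟙 _ :=
  ⟨inner ℂ (ones (delta.{vD, uD} a) a) (toVector f), toVector_injective (eq_smul_ones _)⟩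

theorem exists_vector_ne_zero {s t : Skel.{vD, uD} N} {f : s ⟶ t} (h : f ≠ 0) :
    ∃ a, ∃ g : delta a ⟶ s, g ≫ f ≠ 0 := by
  by_contra! hc
  refine h (hom_ext fun a => LinearMap.ext fun y => ?_)
  have h1 := congrArg toVector (hc a (ofVector y))
  rwa [toVector_comp, toVector_ofVector] at h1

/-- A nonzero monomorphism `f` into `delta a` stays nonzero after some vector `g` of its source.
That vector must lie at `a`, and the composite is a nonzero scalar, so `f` is also split epi. -/
instance simple_delta (a : Fin N) : Simple (delta.{vD, uD} a) where
  mono_isIso_iff_nonzero {Y} f _ := by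
    constructor
    · rintro hf rfl
      refine id_delta_ne_zero a ?_
      rw [← IsIso.inv_hom_id (0 : Y ⟶ delta.{vD, uD} a), Limits.comp_zero]
    · intro hf
      obtain ⟨b, g, hg⟩ := exists_vector_ne_zero hf
      obtain rfl : b = a := by
        by_contra hb
        exact hg (hom_delta_eq_zero.{vD, uD} hb _)
      obtain ⟨z, hz⟩ := exists_smul_id_delta (g ≫ f)
      have hz0 : z ≠ 0 := by
        rintro rfl
        exact hg (by rw [hz, zero_smul])
      have : IsSplitEpi f := ⟨⟨⟨z⁻¹ • g, by rw [Linear.smul_comp, hz, inv_smul_smul₀ hz0]⟩⟩⟩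
      exact isIso_of_mono_of_isSplitEpi f

theorem delta_injective {a b : Fin N} (h : _root_.Nonempty (delta.{vD, uD} a ≅ delta b)) : a = b := by
  obtain ⟨e⟩ := h
  by_contra hab
  refine id_delta_ne_zero a ?_
  rw [← e.hom_inv_id, hom_delta_eq_zero hab e.hom, Limits.zero_comp]

theorem exists_iso_delta (s : Skel.{vD, uD} N) [Simple s] : ∃ a, _root_.Nonempty (s ≅ delta a) := by
  obtain ⟨a, g, hg⟩ := exists_vector_ne_zero (id_nonzero s)
  rw [Category.comp_id] at hg
  have := isIso_of_hom_simple hg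
  exact ⟨a, ⟨(asIso g).symm⟩⟩

theorem adjoint_ofVector {s : Skel.{vD, uD} N} {a : Fin N} (y : s.space a) (b : Fin N)
    (z : s.space b) : maps (dag (ofVector y)) b z =
      inner ℂ (Pi.single (M := s.space) a y b) z • ones _ b := by
  refine ext_inner_left ℂ fun u => ?_
  rw [maps_dag, LinearMap.adjoint_inner_right, maps_ofVector, inner_smul_left, inner_smul_right,
    inner_conj_symm, mul_comm]

/-- The standard basis as morphisms. -/
def basisHom (s : Skel.{vD, uD} N) (k : Σ a, Fin (s.dim a)) : delta k.1 ⟶ s :=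
  ofVector (EuclideanSpace.single k.2 (1 : ℂ))

theorem sum_dag_basisHom_comp (s : Skel.{vD, uD} N) :
    ∑ k, dag (basisHom s k) ≫ basisHom s k = 𝟙 s := by
  refine hom_ext fun b => LinearMap.ext fun z => ?_
  rw [maps_sum, LinearMap.sum_apply, Fintype.sum_sigma, Finset.sum_eq_single b]
  · simp only [maps_comp, LinearMap.comp_apply, basisHom, adjoint_ofVector, _root_.map_smul,
      maps_ofVector, inner_ones, Pi.single_eq_same, if_pos, one_smul]
    ext l
    simp [EuclideanSpace.inner_single_left, Pi.single_apply]
  · intro a _ hab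
    refine Finset.sum_eq_zero fun k _ => ?_
    rw [maps_comp, LinearMap.comp_apply, basisHom, adjoint_ofVector, Pi.single_eq_of_ne hab.symm,
      inner_zero_left, zero_smul, map_zero]
  · simp

theorem basisHom_comp_dag_self (s : Skel.{vD, uD} N) (k : Σ a, Fin (s.dim a)) :
    basisHom s k ≫ dag (basisHom s k) = 𝟙 _ := by
  refine toVector_injective ?_
  rw [toVector_comp, basisHom, toVector_ofVector, adjoint_ofVector, Pi.single_eq_same,
    EuclideanSpace.inner_single_left]
  simp
  rfl

theorem basisHom_comp_dag_of_ne (s : Skel.{vD, uD} N) {k l : Σ a, Fin (s.dim a)} (h : k ≠ l) :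
    basisHom s k ≫ dag (basisHom s l) = 0 := by
  refine toVector_injective ?_
  rw [toVector_comp, basisHom, basisHom, toVector_ofVector, adjoint_ofVector]
  obtain ⟨a, k⟩ := k
  obtain ⟨b, l⟩ := l
  by_cases hab : a = b
  · subst hab
    have hkl : l ≠ k := fun e => h (by rw [e])
    simp only [Pi.single_eq_same, EuclideanSpace.inner_single_left]
    simp [hkl]
    rfl
  · simp [Pi.single_eq_of_ne hab]
    rfl

theorem isSemisimple : IsSemisimple (Skel.{vD, uD} N) where
  finiteDimensional s t := (mapsEquiv s t).symm.finiteDimensional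
  semisimple s := by
    let e := Fintype.equivFin (Σ a, Fin (s.dim a))
    refine ⟨_, fun l => delta (e.symm l).1, fun _ => simple_delta _, ⟨?_⟩⟩
    refine
      { hom := biproduct.lift fun l => dag (basisHom s (e.symm l))
        inv := biproduct.desc fun l => basisHom s (e.symm l)
        hom_inv_id := ?_
        inv_hom_id := ?_ }
    · rw [biproduct.lift_desc, ← sum_dag_basisHom_comp s]
      exact e.symm.sum_comp fun k => dag (basisHom s k) ≫ basisHom s k
    · refine biproduct.hom_ext' _ _ fun l => biproduct.hom_ext _ _ fun l' => ?_
      rw [Category.assoc, Category.assoc, biproduct.lift_π, biproduct.ι_desc_assoc, Category.comp_id]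
      by_cases hl : l = l'
      · subst hl
        rw [biproduct.ι_π_self, basisHom_comp_dag_self]
      · rw [biproduct.ι_π_ne _ hl, basisHom_comp_dag_of_ne _ fun h => hl (e.symm.injective h)]

end Skel

end SkeletonSimples

/-! ### Reading off the correspondence from a functor to families of vector spaces -/

section FamilyModels

open MonoidalLeftAction

variable {C : Type u} [Category.{v} C] [Abelian C] [Linear ℂ C] [MonoidalCategory C]
variable [MonoidalPreadditive C] [MonoidalLinear ℂ C] [Duality C]
variable {X : C} {V : Type w} [Quiver.{x} V] [Fintype V] [∀ i j : V, Finite (i ⟶ j)]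

open Classical in
/-- The function of the paths that is concentrated at one path. -/
def PathVec.at {W : V → Type t} [∀ k, AddCommGroup (W k)] {a : List Bool} {i j : V}
    (p : EPath V a i j) (y : W j) : PathVec W a i := fun k q =>
  if (⟨j, p⟩ : Σ k, EPath V a i k) = ⟨k, q⟩ then Pi.single j y k else 0

theorem PathVec.at_self {W : V → Type t} [∀ k, AddCommGroup (W k)] {a : List Bool} {i j : V}
    (p : EPath V a i j) (y : W j) : PathVec.at p y j p = y := by
  simp [PathVec.at]

theorem PathVec.at_of_ne {W : V → Type t} [∀ k, AddCommGroup (W k)] {a : List Bool} {i j k : V}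
    {p : EPath V a i j} {q : EPath V a i k} (h : (⟨j, p⟩ : Σ k, EPath V a i k) ≠ ⟨k, q⟩) (y : W j) :
    PathVec.at p y k q = 0 := if_neg h

theorem push_at {W : V → Type t} [∀ k, AddCommGroup (W k)] [∀ k, Module ℂ (W k)]
    {a b : List Bool} (A : GHom V a b) {i j : V} (p : EPath V a i j) (y : W j) :
    push A (PathVec.at p y) = ∑ q, A i j p q • PathVec.at q y := by
  classical
  funext k q
  rw [push_apply, PathVec.sum_apply]
  by_cases hk : j = k
  · subst hk
    rw [Finset.sum_eq_single p, Finset.sum_eq_single q]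
    · rw [PathVec.at_self]
      exact (congrArg (A i j p q • ·) (PathVec.at_self q y)).symm
    · intro q' _ h
      refine (congrArg (A i j p q' • ·) (PathVec.at_of_ne ?_ y)).trans (smul_zero _)
      intro h'
      cases h'
      exact h rfl
    · simp
    · intro p' _ h
      rw [PathVec.at_of_ne, smul_zero]
      intro h'
      cases h'
      exact h rfl
    · simp
  · rw [Finset.sum_eq_zero, Finset.sum_eq_zero]
    · intro q' _
      refine (congrArg (A i j p q' • ·) (PathVec.at_of_ne ?_ y)).trans (smul_zero _)
      intro h'
      exact hk (congrArg Sigma.fst h')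
    · intro p' _
      rw [PathVec.at_of_ne, smul_zero]
      intro h'
      exact hk (congrArg Sigma.fst h')

variable {ρ : MatrixRep X V}

/-- A functor from a module category to families of vector spaces under which morphisms from the
simple objects become vectors. -/
structure FamModel (M : SemisimpleModule.{v, u, vD, uD} C V) (ρ : MatrixRep X V) where
  functor : M.carrier ⥤ Fam.{v, u, x, w, t} ρ
  linear : LinearStructure C functor
  vec (i : V) (m : M.carrier) : (M.simple i ⟶ m) ≃ₗ[ℂ] (functor.obj m).obj i
  vec_comp {i : V} {m n : M.carrier} (f : M.simple i ⟶ m) (g : m ⟶ n) :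
    vec i n (f ≫ g) = functor.map g i (vec i m f)

namespace FamModel

variable {M : SemisimpleModule.{v, u, vD, uD} C V} (J : FamModel.{v, u, vD, uD, x, w, t} M ρ)

/-- The element of the action on families that belongs to a morphism to `c ⊗ n`. -/
def actVec (c : C) (i : V) (n : M.carrier) :
    (M.simple i ⟶ c ⊙ₗ n) ≃ₗ[ℂ] natFam ρ c (J.functor.obj n).obj i :=
  J.vec i (c ⊙ₗ n) ≪≫ₗ Fam.equivOfIso (J.linear.iso c n) i

theorem actVec_apply {c : C} {i : V} {n : M.carrier} (f : M.simple i ⟶ c ⊙ₗ n) :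
    J.actVec c i n f = (J.linear.iso c n).hom i (J.vec i _ f) := rfl

theorem actVec_act {c c' : C} {i : V} {n : M.carrier} (f : M.simple i ⟶ c ⊙ₗ n) (g : c ⟶ c') :
    J.actVec c' i n (f ≫ g ⊵ₗ n) = natFam.left ρ g _ i (J.actVec c i n f) := by
  rw [actVec_apply, vec_comp]
  exact LinearMap.congr_fun (congrFun (J.linear.left g n) i) _

theorem actVec_comp {c : C} {i : V} {n n' : M.carrier} (f : M.simple i ⟶ c ⊙ₗ n) (g : n ⟶ n') :
    J.actVec c i n' (f ≫ c ⊴ₗ g) = natFam.right ρ c (J.functor.map g) i (J.actVec c i n f) := by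
  rw [actVec_apply, vec_comp]
  exact LinearMap.congr_fun (congrFun (J.linear.right c g) i) _

theorem unit_actVec (i : V) : natFam.unit ρ _ i (J.actVec (𝟙_ C) i _ (λₗ[C] (M.simple i)).inv) =
    J.vec i _ (𝟙 (M.simple i)) := by
  have h := LinearMap.congr_fun (congrFun (J.linear.unit (M.simple i)) i)
    (J.vec i _ (λₗ[C] (M.simple i)).inv)
  rw [← vec_comp, Iso.inv_hom_id] at h
  exact h.symm

theorem assoc_actVec {c c' : C} {i : V} {n : M.carrier} (f : M.simple i ⟶ c ⊙ₗ c' ⊙ₗ n) :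
    natFam.assocHom ρ c c' _ i (J.actVec (c ⊗ c') i n (f ≫ (αₗ c c' n).inv)) =
      natFam.right ρ c (J.linear.iso c' n).hom i (J.actVec c i _ f) := by
  have h := LinearMap.congr_fun (congrFun (J.linear.assoc c c' n) i)
    (J.vec i _ (f ≫ (αₗ c c' n).inv))
  have h1 : J.functor.map (αₗ c c' n).hom i (J.vec i _ (f ≫ (αₗ c c' n).inv)) = J.vec i _ f := by
    rw [← vec_comp, Category.assoc, Iso.inv_hom_id, Category.comp_id]
  refine h.symm.trans ?_
  exact congrArg (fun z => (c ⊴ₗ (J.linear.iso c' n).hom : _ ⟶ _) i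
    ((J.linear.iso c (c' ⊙ₗ n)).hom i z)) h1

theorem actVec_assoc_apply {c c' : C} {i : V} {n n' : M.carrier} (f : M.simple i ⟶ c ⊙ₗ n')
    (h : n' ⟶ c' ⊙ₗ n) {a b : List Bool} (g : c ⟶ word X a) (g' : c' ⟶ word X b) {k j : V}
    (p : EPath V a i k) (q : EPath V b k j) :
    (J.actVec (c ⊗ c') i n (f ≫ c ⊴ₗ h ≫ (αₗ c c' n).inv)).1 (a ++ b)
        ((g ⊗ₘ g') ≫ (wordMul X a b).hom) j (p.append q) =
      ((J.linear.iso c' n).hom k (J.functor.map h k ((J.actVec c i n' f).1 a g k p)) :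
        natFam ρ c' (J.functor.obj n).obj k).1 b g' j q := by
  have h1 := (J.assoc_actVec (f ≫ c ⊴ₗ h)).trans
    (congrArg (natFam.right ρ c (J.linear.iso c' n).hom i) (J.actVec_comp f h))
  have h2 : (f ≫ c ⊴ₗ h) ≫ (αₗ c c' n).inv = f ≫ c ⊴ₗ h ≫ (αₗ c c' n).inv := Category.assoc _ _ _
  have h3 := (congrArg (fun z => natFam.assocHom ρ c c' _ i (J.actVec (c ⊗ c') i n z)) h2).symm.trans h1
  exact congrArg (fun τ : natFam ρ c (fun k => natFam ρ c' (J.functor.obj n).obj k) i =>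
    (τ.1 a g k p).1 b g' j q) h3

theorem _root_.OrientedGPA.EPath.single_injective {a : Bool} {i j : V} {e e' : SEdge V a i j}
    (h : EPath.single e = EPath.single e') : e = e' := by
  cases h
  rfl

theorem _root_.OrientedGPA.EPath.exists_edge {a : Bool} {i j : V} (p : EPath V [a] i j) :
    ∃ e : SEdge V a i j, p = EPath.single e := by
  cases p with
  | cons e p => cases p; exact ⟨e, rfl⟩

/-- Words of length one. -/
def _root_.OrientedGPA.wordSingle (X : C) (a : Bool) : word X [a] ≅ signed X a := ρ_ (signed X a)

/-- The action of an object of sign `a`: functions of the edges of sign `a`. -/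
def signedVec (a : Bool) (i : V) (n : M.carrier) :
    PathVec (J.functor.obj n).obj [a] i ≃ₗ[ℂ] (M.simple i ⟶ signed X a ⊙ₗ n) :=
  natFam.ofWord ρ [a] i ≪≫ₗ (J.actVec (word X [a]) i n).symm ≪≫ₗ
    Linear.homCongr ℂ (Iso.refl _)
      { hom := (wordSingle X a).hom ⊵ₗ n
        inv := (wordSingle X a).inv ⊵ₗ n
        hom_inv_id := by rw [← comp_actionHomLeft, Iso.hom_inv_id, id_actionHomLeft]
        inv_hom_id := by rw [← comp_actionHomLeft, Iso.inv_hom_id, id_actionHomLeft] }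

theorem actVec_signedVec {a : Bool} {i : V} {n : M.carrier}
    (y : PathVec (J.functor.obj n).obj [a] i) :
    (J.actVec (signed X a) i n (J.signedVec a i n y)).1 [a] (wordSingle X a).inv = y := by
  have h1 : J.signedVec a i n y =
      (J.actVec (word X [a]) i n).symm (natFam.ofWord ρ [a] i y) ≫ (wordSingle X a).hom ⊵ₗ n := by
    simp [signedVec, Linear.homCongr]
  rw [h1, actVec_act, LinearEquiv.apply_symm_apply, natFam.left_apply, Iso.hom_inv_id,
    natFam.ofWord_id]

/-- The edge morphisms. -/
def edges : EdgeMorphisms M X := fun a i j e =>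
  J.signedVec a i _ (PathVec.at (EPath.single e) (J.vec j _ (𝟙 (M.simple j))))

omit [MonoidalPreadditive C] [MonoidalLinear ℂ C] in
theorem word_id (a : Bool) (l : List Bool) :
    ((wordSingle X a).inv ⊗ₘ 𝟙 (word X l)) ≫ (wordMul X [a] l).hom = 𝟙 (word X (a :: l)) := by
  change ((ρ_ (signed X a)).inv ⊗ₘ 𝟙 (word X l)) ≫ (α_ (signed X a) (𝟙_ C) (word X l)).hom ≫
    signed X a ◁ (λ_ (word X l)).hom = 𝟙 (signed X a ⊗ word X l)
  simp

theorem actVec_cons_apply {s : Bool} {l : List Bool} {i : V} {n n' : M.carrier}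
    (f : M.simple i ⟶ signed X s ⊙ₗ n') (h : n' ⟶ word X l ⊙ₗ n) {k j : V} (e : SEdge V s i k)
    (p : EPath V l k j) :
    (J.actVec (word X (s :: l)) i n (f ≫ signed X s ⊴ₗ h ≫ (αₗ (signed X s) (word X l) n).inv)).1
        (s :: l) (𝟙 _) j (.cons e p) =
      ((J.linear.iso (word X l) n).hom k (J.functor.map h k
        ((J.actVec (signed X s) i n' f).1 [s] (wordSingle X s).inv k (EPath.single e))) :
        natFam ρ (word X l) (J.functor.obj n).obj k).1 l (𝟙 _) j p := by
  refine Eq.trans ?_ (J.actVec_assoc_apply f h (wordSingle X s).inv (𝟙 (word X l)) (EPath.single e) p)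
  exact congrFun (congrFun (congrArg ((J.actVec (signed X s ⊗ word X l) i n
    (f ≫ signed X s ⊴ₗ h ≫ (αₗ (signed X s) (word X l) n).inv)).1 (s :: l))
      (word_id s l).symm) j) (.cons e p)

theorem _root_.OrientedGPA.natFam.unit_ofWord {W : V → Type t} [∀ k, AddCommGroup (W k)]
    [∀ k, Module ℂ (W k)] {i : V} (y : PathVec W [] i) :
    natFam.unit ρ W i (natFam.ofWord ρ [] i y) = y i (.nil i) :=
  congrFun (congrFun (natFam.ofWord_id (ρ := ρ) (a := []) y) i) (.nil i)

/-- The edge morphisms are by definition the functions concentrated at one edge. Composing along a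
path gives the function concentrated at that path; by Yoneda the comparison may be made at the
identity of the word. -/
theorem actVec_pathMorphism {a : List Bool} {i j : V} (p : EPath V a i j) :
    J.actVec (word X a) i _ (pathMorphism J.edges p) =
      natFam.ofWord ρ a i (PathVec.at p (J.vec j _ (𝟙 (M.simple j)))) := by
  induction p with
  | nil i =>
    refine (natFam.unit ρ _ i).injective ((J.unit_actVec i).trans ?_)
    exact ((natFam.unit_ofWord _).trans (PathVec.at_self _ _)).symm
  | @cons s l i j k e p ih =>
    rw [← LinearEquiv.symm_apply_eq, natFam.ofWord_symm]
    funext k' P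
    obtain ⟨j', e', p', rfl⟩ : ∃ (j' : V) (e' : SEdge V s i j') (p' : EPath V l j' k'),
        P = .cons e' p' := by
      cases P with
      | cons e' p' => exact ⟨_, e', p', rfl⟩
    refine (J.actVec_cons_apply _ _ e' p').trans ?_
    rw [edges, actVec_signedVec]
    -- The value vanishes unless the first edges agree; if they do, the induction hypothesis deals
    -- with the remaining paths.
    by_cases hj : (⟨j, EPath.single e⟩ : Σ j, EPath V [s] i j) = ⟨j', EPath.single e'⟩
    · obtain rfl : j = j' := congrArg Sigma.fst hj
      obtain rfl : e = e' := EPath.single_injective (eq_of_heq (Sigma.mk.inj hj).2)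
      rw [PathVec.at_self, ← vec_comp, Category.id_comp, ← actVec_apply, ih, natFam.ofWord_id]
      by_cases hk : (⟨k, p⟩ : Σ j, EPath V l _ j) = ⟨k', p'⟩
      · cases hk
        rw [PathVec.at_self, PathVec.at_self]
      · rw [PathVec.at_of_ne hk, PathVec.at_of_ne]
        intro h
        cases h
        exact hk rfl
    · rw [PathVec.at_of_ne hj, PathVec.at_of_ne, map_zero, map_zero]
      · rfl
      · intro h
        cases h
        exact hj rfl

/-- On the natural family of a word, `f` acts by the matrix `ρ.map f`, and `push_at` expands the
result at a function concentrated at one path. -/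
theorem isActionMatrix_edges : IsActionMatrix J.edges fun _ _ f => ρ.map f := by
  intro a b f i j p
  refine (J.actVec (word X b) i _).injective ?_
  rw [_root_.map_sum, actVec_act, actVec_pathMorphism]
  simp only [_root_.map_smul, actVec_pathMorphism]
  simp only [← _root_.map_smul, ← _root_.map_sum]
  rw [← LinearEquiv.symm_apply_eq, natFam.ofWord_symm, natFam.left_apply]
  refine Eq.trans ?_ (push_at (ρ.map f) p _)
  refine (congrArg _ (Category.comp_id f)).trans ?_
  exact natFam.ofWord_apply _ f

theorem vec_id_ne_zero (i : V) : J.vec i _ (𝟙 (M.simple i)) ≠ 0 := fun h =>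
  M.reps.id_ne_zero i ((J.vec i _).injective (h.trans (map_zero _).symm))

/-- Under `signedVec` the morphisms from `M.simple i` into the product are functions on the edges
with values in Hom(M_k, M_j), which is a line for k = j and zero otherwise. -/
theorem isEdgeBasis_edges : IsEdgeBasis J.edges := by
  classical
  intro a i j
  have := SEdge.finite (V := V) a i j
  have := Fintype.ofFinite (SEdge V a i j)
  constructor
  · rw [Fintype.linearIndependent_iff]
    intro z hz e
    have h1 : ∑ e, z e • PathVec.at (EPath.single e) (J.vec j _ (𝟙 (M.simple j))) = 0 := by
      refine (J.signedVec a i _).injective ?_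
      rw [_root_.map_sum, map_zero, ← hz]
      exact Finset.sum_congr rfl fun e _ => _root_.map_smul _ _ _
    have h2 := congrFun (congrFun h1 j) (EPath.single e)
    rw [PathVec.sum_apply, Finset.sum_eq_single e] at h2
    · have h3 : z e • J.vec j _ (𝟙 (M.simple j)) = 0 :=
        (congrArg (z e • ·) (PathVec.at_self (EPath.single e) _).symm).trans h2
      exact (smul_eq_zero.1 h3).resolve_right (J.vec_id_ne_zero j)
    · intro e' _ he
      refine (congrArg (z e' • ·) (PathVec.at_of_ne ?_ _)).trans (smul_zero _)
      intro h
      exact he (EPath.single_injective (eq_of_heq (Sigma.mk.inj h).2))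
    · simp
  · rw [eq_top_iff]
    intro f _
    obtain ⟨y, rfl⟩ := (J.signedVec a i _).surjective f
    have hy : ∀ e : SEdge V a i j, ∃ z : ℂ, y j (EPath.single e) = z • J.vec j _ (𝟙 (M.simple j)) := fun e => by
      obtain ⟨g, hg⟩ := (J.vec j (M.simple j)).surjective (y j (EPath.single e))
      obtain ⟨z, rfl⟩ := M.reps.exists_scalar j g
      exact ⟨z, by rw [← hg, _root_.map_smul]⟩
    choose z hz using hy
    have h1 : y = ∑ e, z e • PathVec.at (EPath.single e) (J.vec j _ (𝟙 (M.simple j))) := by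
      funext k P
      obtain ⟨e, rfl⟩ := P.exists_edge
      rw [PathVec.sum_apply]
      by_cases hk : j = k
      · subst hk
        rw [Finset.sum_eq_single e, hz]
        · exact (congrArg (z e • ·) (PathVec.at_self (EPath.single e) _)).symm
        · intro e' _ he
          refine (congrArg (z e' • ·) (PathVec.at_of_ne ?_ _)).trans (smul_zero _)
          intro h
          exact he (EPath.single_injective (eq_of_heq (Sigma.mk.inj h).2))
        · simp
      · obtain ⟨g, hg⟩ := (J.vec k (M.simple j)).surjective (y k (EPath.single e))
        rw [← hg, M.reps.hom_eq_zero (Ne.symm hk) g, map_zero]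
        refine (Finset.sum_eq_zero fun e' _ => ?_).symm
        refine (congrArg (z e' • ·) (PathVec.at_of_ne ?_ _)).trans (smul_zero _)
        intro h
        exact hk (congrArg Sigma.fst h)
    rw [h1, _root_.map_sum]
    refine Submodule.sum_mem _ fun e _ => ?_
    rw [_root_.map_smul]
    exact Submodule.smul_mem _ _ (Submodule.subset_span ⟨e, rfl⟩)

include J in
theorem corresponds : Corresponds M fun _ _ f => ρ.map f :=
  ⟨J.edges, J.isEdgeBasis_edges, J.isActionMatrix_edges⟩

end FamModel

end FamilyModels

/-! ### The action transported to the skeleton -/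

section SkeletonModule

open MonoidalLeftAction LinearStructure

variable {C : Type u} [Category.{v} C] [Abelian C] [Linear ℂ C] [MonoidalCategory C]
variable [MonoidalPreadditive C] [MonoidalLinear ℂ C] [Duality C]
variable {X : C} {V : Type w} [Quiver.{x} V] [Fintype V] [∀ i j : V, Finite (i ⟶ j)]

namespace Fam

variable {ρ : MatrixRep X V}

theorem add_act {c c' : C} (f g : c ⟶ c') (W : Fam.{v, u, x, w, t} ρ) :
    (f + g) ⊵ₗ W = f ⊵ₗ W + g ⊵ₗ W := hom_ext fun i τ => natFam.ext fun a h k p => by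
  change τ.1 a ((f + g) ≫ h) k p = _
  rw [Preadditive.add_comp, map_add]
  rfl

theorem smul_act {c c' : C} (z : ℂ) (f : c ⟶ c') (W : Fam.{v, u, x, w, t} ρ) :
    (z • f) ⊵ₗ W = z • f ⊵ₗ W := hom_ext fun i τ => natFam.ext fun a h k p => by
  change τ.1 a ((z • f) ≫ h) k p = _
  rw [Linear.smul_comp, _root_.map_smul]
  rfl

theorem act_add (c : C) {W W' : Fam.{v, u, x, w, t} ρ} (f g : W ⟶ W') :
    c ⊴ₗ (f + g) = c ⊴ₗ f + c ⊴ₗ g := rfl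

theorem act_smul (c : C) {W W' : Fam.{v, u, x, w, t} ρ} (z : ℂ) (f : W ⟶ W') :
    c ⊴ₗ (z • f) = z • c ⊴ₗ f := rfl

end Fam

namespace Skel

variable {N : ℕ} (ρ : MatrixRep X V) (e : V ≃ Fin N)

/-- Families of Hilbert spaces as families of vector spaces indexed by the vertices. -/
def toFam : Skel.{vD, uD} N ⥤ Fam.{v, u, x, w, 0} ρ where
  obj s := { obj := fun i => ULift.{max v w x} (s.space (e i)) }
  map f i := ULift.moduleEquiv.symm.toLinearMap ∘ₗ maps f (e i) ∘ₗ ULift.moduleEquiv.toLinearMap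

theorem toFam_map_apply {s t : Skel.{vD, uD} N} (f : s ⟶ t) (i : V)
    (y : ((toFam ρ e).obj s).obj i) : (toFam ρ e).map f i y = ULift.up (maps f (e i) y.down) := rfl

theorem toFam_map_add {s t : Skel.{vD, uD} N} (f g : s ⟶ t) :
    (toFam ρ e).map (f + g) = (toFam ρ e).map f + (toFam ρ e).map g := rfl

theorem toFam_map_smul {s t : Skel.{vD, uD} N} (z : ℂ) (f : s ⟶ t) :
    (toFam ρ e).map (z • f) = z • (toFam ρ e).map f := rfl

instance : (toFam ρ e : Skel.{vD, uD} N ⥤ _).Faithful where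
  map_injective {s t f g} h := hom_ext fun a => by
    obtain ⟨i, rfl⟩ := e.surjective a
    refine LinearMap.ext fun y => ?_
    exact congrArg ULift.down (LinearMap.congr_fun (congrFun h i) (ULift.up y))

instance : (toFam ρ e : Skel.{vD, uD} N ⥤ _).Full where
  map_surjective {s t} f := by
    let g : ∀ i, s.space (e i) →ₗ[ℂ] t.space (e i) := fun i =>
      ULift.moduleEquiv.toLinearMap ∘ₗ f i ∘ₗ ULift.moduleEquiv.symm.toLinearMap
    have hg : ∀ i, Equiv.piCongrLeft (fun a => s.space a →ₗ[ℂ] t.space a) e g (e i) = g i :=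
      fun i => Equiv.piCongrLeft_apply_apply _ _ _ _
    refine ⟨ofMaps (Equiv.piCongrLeft _ e g), Fam.hom_ext fun i y => ?_⟩
    rw [toFam_map_apply, maps_ofMaps, hg]
    rfl

variable (K : C → Skel.{vD, uD} N → Skel.{vD, uD} N)
  (κ : ∀ c s, (toFam ρ e).obj (K c s) ≅ c ⊙ₗ (toFam ρ e).obj s)

/-- The module category of families of Hilbert spaces. -/
def module : SemisimpleModule.{v, u, vD, uD} C V :=
  letI := transportStruct (toFam ρ e) K κ
  letI := (transportLinearStructure (toFam ρ e) K κ).action fun _ _ => rfl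
  { carrier := Skel.{vD, uD} N
    isSemisimple := isSemisimple
    add_act := fun {c c'} f g s => (toFam ρ e).map_injective <| by
      have h (h : c ⟶ c') : (toFam ρ e).map (h ⊵ₗ s) =
        (κ c s).hom ≫ h ⊵ₗ (toFam ρ e).obj s ≫ (κ c' s).inv := (toFam ρ e).map_preimage _
      rw [toFam_map_add, h, h, h, Fam.add_act, Preadditive.add_comp, Preadditive.comp_add]
    smul_act := fun {c c'} z f s => (toFam ρ e).map_injective <| by
      have h (h : c ⟶ c') : (toFam ρ e).map (h ⊵ₗ s) =
        (κ c s).hom ≫ h ⊵ₗ (toFam ρ e).obj s ≫ (κ c' s).inv := (toFam ρ e).map_preimage _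
      rw [toFam_map_smul, h, h, Fam.smul_act, Linear.smul_comp, Linear.comp_smul]
    act_add := fun c {s s'} f g => (toFam ρ e).map_injective <| by
      have h (h : s ⟶ s') : (toFam ρ e).map (c ⊴ₗ h) =
        (κ c s).hom ≫ c ⊴ₗ (toFam ρ e).map h ≫ (κ c s').inv := (toFam ρ e).map_preimage _
      rw [toFam_map_add, h, h, h, toFam_map_add, Fam.act_add, Preadditive.add_comp, Preadditive.comp_add]
    act_smul := fun c {s s'} z f => (toFam ρ e).map_injective <| by
      have h (h : s ⟶ s') : (toFam ρ e).map (c ⊴ₗ h) =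
        (κ c s).hom ≫ c ⊴ₗ (toFam ρ e).map h ≫ (κ c s').inv := (toFam ρ e).map_preimage _
      rw [toFam_map_smul, h, h, toFam_map_smul, Fam.act_smul, Linear.smul_comp, Linear.comp_smul]
    simple := fun i => delta (e i)
    simple_simple := fun i => simple_delta (e i)
    simple_inj := fun i j h => e.injective (delta_injective h)
    simple_surj := fun s _ => by
      obtain ⟨a, h⟩ := exists_iso_delta s
      exact ⟨e.symm a, by rwa [e.apply_symm_apply]⟩ }

/-- The functor from the module category to families of vector spaces indexed by the vertices. -/
def model : FamModel (Skel.module ρ e K κ) ρ where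
  functor := toFam ρ e
  linear := transportLinearStructure (toFam ρ e) K κ
  vec i s := vectorEquiv (e i) s ≪≫ₗ ULift.moduleEquiv.symm
  vec_comp f g := rfl

/-- The dimensions of the action. -/
def actObj (c : C) (s : Skel.{vD, uD} N) : Skel.{vD, uD} N where
  dim a := Module.finrank ℂ (natFam ρ c ((toFam ρ e).obj s).obj (e.symm a))

instance (s : Skel.{vD, uD} N) (i : V) : FiniteDimensional ℂ (((toFam ρ e).obj s).obj i) :=
  inferInstanceAs (FiniteDimensional ℂ (ULift.{max v w x} (s.space (e i))))

theorem finrank_actObj (c : C) (s : Skel.{vD, uD} N) (i : V) :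
    Module.finrank ℂ (((toFam ρ e).obj (actObj ρ e c s)).obj i) =
      Module.finrank ℂ (natFam ρ c ((toFam ρ e).obj s).obj i) := by
  change Module.finrank ℂ (ULift.{max v w x} ((actObj ρ e c s).space (e i))) = _
  rw [finrank_ulift, finrank_euclideanSpace, Fintype.card_fin]
  change Module.finrank ℂ (natFam ρ c ((toFam ρ e).obj s).obj (e.symm (e i))) = _
  rw [e.symm_apply_apply]

/-- The action of an object is isomorphic to every space of the same dimension. -/
def _root_.OrientedGPA.natFam.equivOfFinrankEq {ρ : MatrixRep X V} {W : V → Type t}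
    [∀ k, AddCommGroup (W k)] [∀ k, Module ℂ (W k)] [∀ k, FiniteDimensional ℂ (W k)] {c : C} {i : V}
    {E : Type*} [AddCommGroup E] [Module ℂ E] [FiniteDimensional ℂ E]
    (h : Module.finrank ℂ E = Module.finrank ℂ (natFam ρ c W i)) : E ≃ₗ[ℂ] natFam ρ c W i :=
  have := natFam.finiteDimensional (ρ := ρ) (W := W) (i := i) c
  have : Module.Free ℂ (natFam ρ c W i) := by
    have h := Module.Free.of_divisionRing ℂ (natFam ρ c W i)
    exact h
  LinearEquiv.ofFinrankEq _ _ h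

/-- A choice of structure isomorphisms. -/
def actIso (c : C) (s : Skel.{vD, uD} N) :
    (toFam ρ e).obj (actObj ρ e c s) ≅ c ⊙ₗ (toFam ρ e).obj s :=
  Fam.isoOfEquiv fun i =>
    natFam.equivOfFinrankEq (finrank_actObj ρ e c s i)

end Skel

end SkeletonModule

/-! ### Existence of the module category -/

section Existence

variable {C : Type u} [Category.{v} C] [Abelian C] [Linear ℂ C] [MonoidalCategory C]
variable [MonoidalPreadditive C] [MonoidalLinear ℂ C] [PivotalCategory C]
variable {X : C} {V : Type w} [Quiver.{x} V] [Fintype V] [Nonempty V] [∀ i j : V, Finite (i ⟶ j)]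

/-- Every morphism of planar algebras corresponds to a module category. -/
theorem PlanarMorphism.exists_corresponds (hX : IsTensorGenerator X) {lam r : V → ℂ}
    (hlam : ∀ i, lam i ≠ 0) (hr : ∀ i, r i ^ 2 = lam i)
    (φ : PlanarMorphism (planarAlgebraOf X) (oGPA V r).toPlanarData) :
    ∃ M : PivotalModule.{v, u, vD, uD} X V lam,
      Corresponds (X := X) M.toSemisimpleModule fun _ _ f => φ.map f := by
  let M := Skel.module.{v, u, vD, uD} (φ.matrixRep hX) (Fintype.equivFin V)
    (Skel.actObj _ _) (Skel.actIso _ _)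
  have h : Corresponds (X := X) M fun _ _ f => φ.map f :=
    (Skel.model (φ.matrixRep hX) (Fintype.equivFin V) (Skel.actObj _ _) (Skel.actIso _ _)).corresponds
  obtain ⟨β, hβ, hφ⟩ := id h
  exact ⟨{ toSemisimpleModule := M
           fusionGraph := SemisimpleModule.hasFusionGraph_of_isEdgeBasis hβ
           pivotal := ⟨_, h.exists_moduleTrace hX hlam hr φ, fun i => weightTrace_id i⟩ }, h⟩

end Existence

/-! ### The bijections in the pivotal case -/

section PivotalBijection

variable {C : Type u} [Category.{v} C] [Abelian C] [Linear ℂ C] [MonoidalCategory C]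

theorem moduleEquivalent_relabel {V : Type w} (M : SemisimpleModule.{v, u, vD, uD} C V) (σ : V ≃ V) :
    ModuleEquivalent M (M.relabel σ) :=
  letI : (𝟭 M.carrier).LeftLinear C :=
    leftLinearOfIso _ (fun _ _ => Iso.refl _) (by simp) (by simp) (by simp) (by simp)
  ⟨𝟭 M.carrier, this,
    ⟨inferInstanceAs (𝟭 M.carrier).IsEquivalence, fun _ _ => rfl, fun _ _ => rfl⟩⟩

theorem RespectsLabels.relabel_symm {V : Type w} {M M' : SemisimpleModule.{v, u, vD, uD} C V}
    {F : M.carrier ⥤ M'.carrier} {σ : V ≃ V} (h : RespectsLabels (M := M) (M' := M'.relabel σ) F) :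
    RespectsLabels (M := M.relabel σ.symm) (M' := M') F := fun i => by
  obtain ⟨a⟩ := h (σ.symm i)
  exact ⟨a ≪≫ eqToIso (congrArg M'.simple (σ.apply_symm_apply i))⟩

theorem IsModuleEquivalence.relabel {V : Type w} {M M' : SemisimpleModule.{v, u, vD, uD} C V}
    {F : M.carrier ⥤ M'.carrier} [F.LeftLinear C] (h : IsModuleEquivalence F) (σ τ : V ≃ V) :
    IsModuleEquivalence (M := M.relabel σ) (M' := M'.relabel τ) F :=
  ⟨h.isEquivalence, h.map_add, h.map_smul⟩

variable [MonoidalPreadditive C] [MonoidalLinear ℂ C] [PivotalCategory C]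
variable {X : C} {V : Type w} [Quiver.{x} V] [Fintype V] [Nonempty V] [∀ i j : V, Finite (i ⟶ j)]
variable {lam r : V → ℂ}

theorem inducesBijection_labelled (hC : IsFusion C) (hX : IsTensorGenerator X)
    (hlam : ∀ i, lam i ≠ 0) (hr : ∀ i, r i ^ 2 = lam i) :
    InducesBijection
      (fun M M' : PivotalModule.{v, u, vD, uD} X V lam =>
        LabelledModuleEquivalent M.toSemisimpleModule M'.toSemisimpleModule)
      (fun φ ψ : PlanarEmbedding (planarAlgebraOf X) (oGPA V r).toPlanarData =>
        NatIsomorphic (fun _ _ f => φ.map f) (fun _ _ f => ψ.map f))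
      (fun M φ => Corresponds (X := X) M.toSemisimpleModule (fun _ _ f => φ.map f)) := by
  refine inducesBijection_of (fun M => M.exists_corresponds hC hlam hr)
    (fun φ => φ.exists_corresponds hX hlam hr) ?_ ?_
  · intro M φ h M'
    constructor
    · rintro ⟨F, _, hF, hL⟩
      exact (corresponds_iff_of_equivalence F hF hL _).1 h
    · exact fun h' => h.labelledModuleEquivalent hX φ.toPlanarMorphism h'
  · exact fun M φ h ψ => ⟨h.of_natIsomorphic r, h.natIsomorphic r⟩

/-- This turns the unlabelled relation into a labelled one for a relabelling of the same `M`. No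
module trace of `M` is needed for the converse: the one with weights `lam` for the new labels is
obtained from `φ`. -/
theorem exists_corresponds_relabel_iff (hX : IsTensorGenerator X)
    (hlam : ∀ i, lam i ≠ 0) (hr : ∀ i, r i ^ 2 = lam i)
    (φ : PlanarMorphism (planarAlgebraOf X) (oGPA V r).toPlanarData)
    (M : SemisimpleModule.{v, u, vD, uD} C V) :
    (∃ M' : PivotalModule.{v, u, vD, uD} X V lam, ModuleEquivalent M M'.toSemisimpleModule ∧
      Corresponds (X := X) M'.toSemisimpleModule (fun _ _ f => φ.map f)) ↔
        ∃ σ : V ≃ V, Corresponds (X := X) (M.relabel σ) (fun _ _ f => φ.map f) := by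
  constructor
  · rintro ⟨M', ⟨F, _, hF⟩, h⟩
    obtain ⟨σ, hσ⟩ := exists_respectsLabels_relabel F hF
    exact ⟨σ.symm, (corresponds_iff_of_equivalence (M := M.relabel σ.symm) F
      ⟨hF.isEquivalence, hF.map_add, hF.map_smul⟩ hσ.relabel_symm _).2 h⟩
  · rintro ⟨σ, h⟩
    obtain ⟨β, hβ, hφ⟩ := id h
    exact ⟨{ toSemisimpleModule := M.relabel σ
             fusionGraph := SemisimpleModule.hasFusionGraph_of_isEdgeBasis hβ
             pivotal := ⟨_, h.exists_moduleTrace hX hlam hr φ, fun i => weightTrace_id i⟩ },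
      moduleEquivalent_relabel M σ, h⟩

/-- By `exists_corresponds_relabel_iff` everything happens for relabellings. Two of them that both
correspond to embeddings differ by a graph automorphism, which accounts for the action of
automorphisms on embeddings. -/
theorem inducesBijection_unlabelled (hC : IsFusion C) (hX : IsTensorGenerator X)
    (hlam : ∀ i, lam i ≠ 0) (hr : ∀ i, r i ^ 2 = lam i) :
    InducesBijection
      (fun M M' : PivotalModule.{v, u, vD, uD} X V lam =>
        ModuleEquivalent M.toSemisimpleModule M'.toSemisimpleModule)
      (fun φ ψ : PlanarEmbedding (planarAlgebraOf X) (oGPA V r).toPlanarData =>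
        ∃ σ : GraphAut V, NatIsomorphic (P := planarAlgebraOf X) (Q := (oGPA V r).toPlanarData)
          (fun _ _ f => σ.pull (φ.map f)) (fun _ _ f => ψ.map f))
      (fun M φ => ∃ M' : PivotalModule.{v, u, vD, uD} X V lam,
        ModuleEquivalent M.toSemisimpleModule M'.toSemisimpleModule ∧
          Corresponds (X := X) M'.toSemisimpleModule (fun _ _ f => φ.map f)) := by
  have hR := fun (M : PivotalModule.{v, u, vD, uD} X V lam)
      (φ : PlanarEmbedding (planarAlgebraOf X) (oGPA V r).toPlanarData) =>
    exists_corresponds_relabel_iff hX hlam hr φ.toPlanarMorphism M.toSemisimpleModule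
  refine inducesBijection_of (fun M => ?_) (fun φ => ?_) (fun M φ h M' => ?_) (fun M φ h ψ => ?_)
  · obtain ⟨φ, h⟩ := M.exists_corresponds hC hlam hr
    exact ⟨φ, (hR M φ).2 ⟨Equiv.refl V, h⟩⟩
  · obtain ⟨M, h⟩ := φ.exists_corresponds hX hlam hr
    exact ⟨M, (hR M φ).2 ⟨Equiv.refl V, h⟩⟩
  · rw [hR M' φ]
    obtain ⟨σ, h⟩ := (hR M φ).1 h
    constructor
    · rintro ⟨F, _, hF⟩
      have hF' := hF.relabel σ (Equiv.refl V)
      obtain ⟨τ, hτ⟩ := exists_respectsLabels_relabel (M := M.relabel σ) F hF'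
      exact ⟨τ, (corresponds_iff_of_equivalence (M := M.relabel σ) (M' := M'.relabel τ) F
        (hF.relabel σ τ) hτ _).1 h⟩
    · rintro ⟨τ, h'⟩
      obtain ⟨F, i, hF, -⟩ := h.labelledModuleEquivalent hX φ.toPlanarMorphism h'
      exact ⟨F, i, ⟨hF.isEquivalence, hF.map_add, hF.map_smul⟩⟩
  · rw [hR M ψ]
    obtain ⟨σ, h⟩ := (hR M φ).1 h
    constructor
    · rintro ⟨g, hg⟩
      exact ⟨_, (h.relabel g rfl).of_natIsomorphic r hg⟩
    · rintro ⟨τ, h'⟩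
      obtain ⟨β, hβ, -⟩ := id h
      obtain ⟨β', hβ', -⟩ := id h'
      obtain ⟨g, hg⟩ := exists_graphAut (SemisimpleModule.hasFusionGraph_of_isEdgeBasis hβ)
        (SemisimpleModule.hasFusionGraph_of_isEdgeBasis hβ')
      exact ⟨g, (h.relabel g hg).natIsomorphic r h'⟩

end PivotalBijection

/-! ### Hermitian forms -/

section HermitianForms

/-- Positive definite Hermitian forms, conjugate-linear in the first argument. -/
abbrev HermForm (E : Type*) [AddCommGroup E] [Module ℂ E] := InnerProductSpace.Core ℂ E

namespace HermForm

variable {E F : Type*} [AddCommGroup E] [Module ℂ E] [AddCommGroup F] [Module ℂ F]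

theorem add_right (h : HermForm E) (y z z' : E) :
    h.inner y (z + z') = h.inner y z + h.inner y z' := by
  rw [← h.conj_inner_symm, h.add_left, map_add, h.conj_inner_symm, h.conj_inner_symm]

theorem smul_right (h : HermForm E) (c : ℂ) (y z : E) : h.inner y (c • z) = c * h.inner y z := by
  rw [← h.conj_inner_symm, h.smul_left, map_mul, h.conj_inner_symm, RingHomCompTriple.comp_apply]
  rfl

theorem zero_right (h : HermForm E) (y : E) : h.inner y 0 = 0 := by
  rw [← zero_smul ℂ (0 : E), h.smul_right, zero_mul]

theorem zero_left (h : HermForm E) (y : E) : h.inner 0 y = 0 := by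
  rw [← h.conj_inner_symm, h.zero_right, map_zero]

theorem sum_right (h : HermForm E) {ι : Type*} (s : Finset ι) (y : E) (z : ι → E) :
    h.inner y (∑ k ∈ s, z k) = ∑ k ∈ s, h.inner y (z k) := by
  classical
  induction s using Finset.induction_on with
  | empty => simp [h.zero_right]
  | insert a s ha ih => rw [Finset.sum_insert ha, Finset.sum_insert ha, h.add_right, ih]

theorem sum_left (h : HermForm E) {ι : Type*} (s : Finset ι) (y : ι → E) (z : E) :
    h.inner (∑ k ∈ s, y k) z = ∑ k ∈ s, h.inner (y k) z := by
  rw [← h.conj_inner_symm, h.sum_right, map_sum]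
  exact Finset.sum_congr rfl fun k _ => h.conj_inner_symm _ _

theorem ext_left (h : HermForm E) {y y' : E} (H : ∀ z, h.inner z y = h.inner z y') : y = y' := by
  rw [← sub_eq_zero]
  refine h.definite _ ?_
  have h1 : y - y' = y + (-1 : ℂ) • y' := by rw [neg_one_smul, sub_eq_add_neg]
  rw [h1, h.add_right, h.smul_right, H]
  ring

/-- Restriction of a form along an injective linear map. -/
@[reducible]
def comap (h : HermForm F) (f : E →ₗ[ℂ] F) (hf : Function.Injective f) : HermForm E where
  inner y z := h.inner (f y) (f z)
  conj_inner_symm y z := h.conj_inner_symm _ _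
  re_inner_nonneg y := h.re_inner_nonneg _
  add_left y z z' := by rw [map_add, h.add_left]
  smul_left y z c := by rw [_root_.map_smul, h.smul_left]
  definite y hy := hf ((h.definite _ hy).trans (map_zero f).symm)

/-- The form of an inner product space. -/
@[reducible]
def std (E : Type*) [NormedAddCommGroup E] [InnerProductSpace ℂ E] : HermForm E where
  inner y z := inner ℂ y z
  conj_inner_symm y z := inner_conj_symm y z
  re_inner_nonneg y := inner_self_nonneg
  add_left := inner_add_left
  smul_left y z c := inner_smul_left y z c
  definite y hy := inner_self_eq_zero.1 hy

theorem exists_basis (h : HermForm E) [FiniteDimensional ℂ E] {n : ℕ} (hn : Module.finrank ℂ E = n) :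
    ∃ b : Module.Basis (Fin n) ℂ E, ∀ k l, h.inner (b k) (b l) = if k = l then 1 else 0 := by
  let _ := h.toNormedAddCommGroup
  let _ := InnerProductSpace.ofCore h.toCore
  let b := (stdOrthonormalBasis ℂ E).reindex (finCongr hn)
  refine ⟨b.toBasis, fun k l => ?_⟩
  rw [OrthonormalBasis.coe_toBasis]
  exact orthonormal_iff_ite.1 b.orthonormal k l

theorem inner_basis (h : HermForm E) {ι : Type*} [Fintype ι] [DecidableEq ι]
    {b : Module.Basis ι ℂ E} (hb : ∀ k l, h.inner (b k) (b l) = if k = l then 1 else 0) (y z : E) :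
    h.inner y z = ∑ k, conj (b.repr y k) * b.repr z k := by
  conv_lhs => rw [← b.sum_repr y, ← b.sum_repr z]
  simp only [h.sum_left, h.sum_right, h.smul_left, h.smul_right, hb, mul_ite, mul_one, mul_zero,
    Finset.sum_ite_eq, Finset.mem_univ, if_true]

theorem inner_self (h : HermForm E) (y : E) : h.inner y y = (RCLike.re (h.inner y y) : ℝ) :=
  (RCLike.conj_eq_iff_re.1 (h.conj_inner_symm y y)).symm

/-- The orthogonal direct sum of forms. -/
@[reducible]
def pi {ι : Type*} [Fintype ι] {E : ι → Type*} [∀ k, AddCommGroup (E k)] [∀ k, Module ℂ (E k)]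
    (h : ∀ k, HermForm (E k)) : HermForm (∀ k, E k) where
  inner y z := ∑ k, (h k).inner (y k) (z k)
  conj_inner_symm y z := by
    rw [map_sum]
    exact Finset.sum_congr rfl fun k _ => (h k).conj_inner_symm _ _
  re_inner_nonneg y := by
    rw [map_sum]
    exact Finset.sum_nonneg fun k _ => (h k).re_inner_nonneg _
  add_left y z z' := by
    rw [← Finset.sum_add_distrib]
    exact Finset.sum_congr rfl fun k _ => (h k).add_left _ _ _
  smul_left y z c := by
    rw [Finset.mul_sum]
    exact Finset.sum_congr rfl fun k _ => (h k).smul_left _ _ _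
  definite y hy := funext fun k => (h k).definite _ <| by
    have h1 := congrArg RCLike.re hy
    rw [map_sum, map_zero, Finset.sum_eq_zero_iff_of_nonneg fun k _ => (h k).re_inner_nonneg _] at h1
    rw [inner_self, h1 k (Finset.mem_univ _)]
    rfl

/-- Maps preserving the forms. -/
def IsIsometry (h : HermForm E) (h' : HermForm F) (f : E → F) : Prop :=
  ∀ y z, h'.inner (f y) (f z) = h.inner y z

theorem exists_isometry (h : HermForm E) (h' : HermForm F) [FiniteDimensional ℂ E]
    [FiniteDimensional ℂ F] (H : Module.finrank ℂ E = Module.finrank ℂ F) :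
    ∃ f : E ≃ₗ[ℂ] F, h.IsIsometry h' f := by
  obtain ⟨b, hb⟩ := h.exists_basis H
  obtain ⟨b', hb'⟩ := h'.exists_basis rfl
  refine ⟨b.equiv b' (Equiv.refl _), fun y z => ?_⟩
  rw [h.inner_basis hb, h'.inner_basis hb']
  simp [Module.Basis.equiv]

theorem IsIsometry.inner_eq {h : HermForm E} {h' : HermForm F} {f : E → F} (hf : h.IsIsometry h' f)
    (y z : E) : h'.inner (f y) (f z) = h.inner y z := hf y z

theorem IsIsometry.comp {G : Type*} [AddCommGroup G] [Module ℂ G] {h : HermForm E} {h' : HermForm F}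
    {h'' : HermForm G} {f : E → F} {g : F → G} (hg : h'.IsIsometry h'' g)
    (hf : h.IsIsometry h' f) : h.IsIsometry h'' (g ∘ f) := fun _ _ => (hg _ _).trans (hf _ _)

theorem IsIsometry.of_rightInverse {h : HermForm E} {h' : HermForm F} {f : E → F}
    (hf : h.IsIsometry h' f) {g : F → E} (hfg : ∀ y, f (g y) = y) : h'.IsIsometry h g :=
  fun y z => by rw [← hf, hfg, hfg]

end HermForm

end HermitianForms

/-! ### Forms on functions of paths -/

section PathForms

variable {V : Type w} [Quiver.{x} V] [Fintype V] [∀ i j : V, Finite (i ⟶ j)]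
variable {W : V → Type t} [∀ k, AddCommGroup (W k)] [∀ k, Module ℂ (W k)]

/-- The form on functions of paths. -/
@[reducible]
def pathForm (h : ∀ k, HermForm (W k)) (a : List Bool) (i : V) : HermForm (PathVec W a i) :=
  HermForm.pi fun k => HermForm.pi fun _ => h k

theorem pathForm_inner (h : ∀ k, HermForm (W k)) {a : List Bool} {i : V} (y z : PathVec W a i) :
    (pathForm h a i).inner y z = ∑ k, ∑ p, (h k).inner (y k p) (z k p) := rfl

theorem pathForm_inner_append (h : ∀ k, HermForm (W k)) {a b : List Bool} {i : V}
    (y z : PathVec W (a ++ b) i) : (pathForm h (a ++ b) i).inner y z =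
      ∑ k, ∑ p : EPath V a i k, (pathForm h b k).inner (fun j q => y j (p.append q))
        (fun j q => z j (p.append q)) := by
  rw [pathForm_inner, EPath.sum_append i fun j P => (h j).inner (y j P) (z j P)]
  rfl

/-- The conjugate transpose. -/
def GHom.dag {a b : List Bool} (A : GHom V a b) : GHom V b a := fun i j p q => conj (A i j q p)

theorem pathForm_push (h : ∀ k, HermForm (W k)) {a b : List Bool} {i : V} (A : GHom V a b)
    (y : PathVec W a i) (z : PathVec W b i) :
    (pathForm h b i).inner (push A y) z = (pathForm h a i).inner y (push A.dag z) := by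
  rw [pathForm_inner, pathForm_inner]
  refine Finset.sum_congr rfl fun k _ => ?_
  simp only [push_apply, HermForm.sum_left, HermForm.sum_right, HermForm.smul_right]
  rw [Finset.sum_comm]
  refine Finset.sum_congr rfl fun p _ => Finset.sum_congr rfl fun q _ => ?_
  exact (h k).smul_left _ _ _

end PathForms

/-! ### The form on the action of an object -/

section NaturalForms

open MonoidalLeftAction

variable {C : Type u} [Category.{v} C] [Abelian C] [Linear ℂ C] [MonoidalCategory C]
variable [MonoidalPreadditive C] [MonoidalLinear ℂ C] [CStarCategory C] [Duality C]

/-- Matrices for the morphisms between words that are compatible with `†`, with a presentation of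
each object as an orthogonal summand of a sum of words. -/
structure StarRep (X : C) (V : Type w) [Quiver.{x} V] [Fintype V] [∀ i j : V, Finite (i ⟶ j)]
    extends MatrixRep X V where
  map_dag {a b : List Bool} (f : word X a ⟶ word X b) : map (dag f) = (map f).dag
  num : C → ℕ
  wd (c : C) : Fin (num c) → List Bool
  proj (c : C) (l : Fin (num c)) : c ⟶ word X (wd c l)
  sum_proj (c : C) : ∑ l, proj c l ≫ dag (proj c l) = 𝟙 c
  unitary : IsUnitaryPivotal C

variable {X : C} {V : Type w} [Quiver.{x} V] [Fintype V] [∀ i j : V, Finite (i ⟶ j)]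
variable {S : StarRep X V} {W : V → Type t} [∀ k, AddCommGroup (W k)] [∀ k, Module ℂ (W k)] {i : V}

/-- Both sides are expanded through the orthogonal presentations of `c` and `c'`; the matrices that
appear are conjugate transposes of each other because `S.map` preserves adjoints. For `f` the
identity this says that the form does not depend on the presentation. -/
theorem natFam.inner_adjoint (h : ∀ k, HermForm (W k)) {c c' : C} {L L' : Type*} [Fintype L]
    [Fintype L'] {y : L → List Bool} {y' : L' → List Bool} {a : ∀ l, c ⟶ word X (y l)}
    {a' : ∀ l, c' ⟶ word X (y' l)} (ha : ∑ l, a l ≫ dag (a l) = 𝟙 c)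
    (ha' : ∑ l, a' l ≫ dag (a' l) = 𝟙 c') (f : c ⟶ c') (τ : natFam S.toMatrixRep c W i)
    (σ : natFam S.toMatrixRep c' W i) :
    ∑ l, (pathForm h (y' l) i).inner (τ.1 _ (f ≫ a' l)) (σ.1 _ (a' l)) =
      ∑ l, (pathForm h (y l) i).inner (τ.1 _ (a l)) (σ.1 _ (dag f ≫ a l)) := by
  have h1 : ∀ l', τ.1 _ (f ≫ a' l') = ∑ l, push (S.map (dag (a l) ≫ f ≫ a' l')) (τ.1 _ (a l)) :=
    fun l' => by
      simp only [← natFam.nat τ, ← _root_.map_sum]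
      refine congrArg _ ?_
      conv_lhs => rw [← Category.id_comp (f ≫ a' l'), ← ha]
      simp only [Preadditive.sum_comp, Category.assoc]
  have h2 : ∀ l, σ.1 _ (dag f ≫ a l) =
      ∑ l', push (S.map (dag (a l) ≫ f ≫ a' l')).dag (σ.1 _ (a' l')) := fun l => by
    simp only [← S.map_dag, ← natFam.nat σ, ← _root_.map_sum]
    refine congrArg _ ?_
    conv_lhs => rw [← Category.id_comp (dag f ≫ a l), ← ha']
    simp only [Preadditive.sum_comp, Category.assoc, dag_comp, dag_dag]
  simp only [h1, h2, HermForm.sum_left, HermForm.sum_right, pathForm_push]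
  exact Finset.sum_comm

instance (ρ : MatrixRep X V) (c : C) (i : V) : AddCommGroup (natFam ρ c W i) := inferInstance

/-- The form on the action of an object. -/
@[reducible]
def natForm (S : StarRep X V) (h : ∀ k, HermForm (W k)) (c : C) (i : V) :
    HermForm (natFam S.toMatrixRep c W i) :=
  (HermForm.pi fun l => pathForm h (S.wd c l) i).comap
    (LinearMap.pi fun l => natFam.eval S.toMatrixRep W (S.proj c l) i) fun τ σ H =>
      Subtype.ext <| funext fun u => LinearMap.ext fun g => by
        have hg : g = ∑ l, S.proj c l ≫ dag (S.proj c l) ≫ g := by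
          simp only [← Category.assoc, ← Preadditive.sum_comp, S.sum_proj, Category.id_comp]
        rw [hg, _root_.map_sum, _root_.map_sum]
        refine Finset.sum_congr rfl fun l _ => ?_
        rw [natFam.nat τ, natFam.nat σ]
        exact congrArg _ (congrFun H l)

namespace IsUnitaryPivotal

theorem dag_whiskerLeft (hU : IsUnitaryPivotal C) (c : C) {d d' : C} (f : d ⟶ d') :
    dag (c ◁ f) = c ◁ dag f := by
  rw [← id_tensorHom, hU.dag_tensor, dag_id, id_tensorHom]

theorem dag_associator_comp (hU : IsUnitaryPivotal C) {c c' c'' d : C} (e : c' ⊗ c'' ≅ d)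
    (he : dag e.hom = e.inv) :
    dag ((α_ c c' c'').hom ≫ c ◁ e.hom) = c ◁ e.inv ≫ (α_ c c' c'').inv := by
  rw [dag_comp, hU.dag_whiskerLeft, hU.dag_associator, he]

theorem dag_wordMul (hU : IsUnitaryPivotal C) (X : C) (a b : List Bool) :
    dag (wordMul X a b).hom = (wordMul X a b).inv := by
  induction a with
  | nil => exact hU.dag_leftUnitor _
  | cons s a ih => exact hU.dag_associator_comp _ ih

theorem sum_tensor_comp_dag (hU : IsUnitaryPivotal C) {c c' : C} {L L' : Type*} [Fintype L]
    [Fintype L'] {y : L → List Bool} {y' : L' → List Bool} {a : ∀ l, c ⟶ word X (y l)}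
    {a' : ∀ l, c' ⟶ word X (y' l)} (ha : ∑ l, a l ≫ dag (a l) = 𝟙 c)
    (ha' : ∑ l, a' l ≫ dag (a' l) = 𝟙 c') :
    ∑ l : L × L', ((a l.1 ⊗ₘ a' l.2) ≫ (wordMul X (y l.1) (y' l.2)).hom) ≫
      dag ((a l.1 ⊗ₘ a' l.2) ≫ (wordMul X (y l.1) (y' l.2)).hom) = 𝟙 (c ⊗ c') := by
  have h : ∀ l : L × L', ((a l.1 ⊗ₘ a' l.2) ≫ (wordMul X (y l.1) (y' l.2)).hom) ≫
      dag ((a l.1 ⊗ₘ a' l.2) ≫ (wordMul X (y l.1) (y' l.2)).hom) =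
      (a l.1 ≫ dag (a l.1)) ⊗ₘ (a' l.2 ≫ dag (a' l.2)) := fun l => by
    rw [dag_comp, Category.assoc, hU.dag_wordMul, Iso.hom_inv_id_assoc, hU.dag_tensor,
      MonoidalCategory.tensorHom_comp_tensorHom]
  rw [Fintype.sum_congr _ _ h, Fintype.sum_prod_type,
    ← MonoidalCategory.id_tensorHom_id, ← ha, ← ha', sum_tensor]
  exact Finset.sum_congr rfl fun l _ =>
    (tensor_sum Finset.univ (a l ≫ dag (a l)) fun l' => a' l' ≫ dag (a' l')).symm

end IsUnitaryPivotal

namespace natForm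

theorem inner_left (h : ∀ k, HermForm (W k)) {c c' : C} (f : c ⟶ c')
    (τ : natFam S.toMatrixRep c W i) (σ : natFam S.toMatrixRep c' W i) :
    (natForm S h c' i).inner (natFam.left S.toMatrixRep f W i τ) σ =
      (natForm S h c i).inner τ (natFam.left S.toMatrixRep (dag f) W i σ) :=
  natFam.inner_adjoint h (S.sum_proj c) (S.sum_proj c') f τ σ

theorem inner_eq (h : ∀ k, HermForm (W k)) {c : C} {L : Type*} [Fintype L] {y : L → List Bool}
    {a : ∀ l, c ⟶ word X (y l)} (ha : ∑ l, a l ≫ dag (a l) = 𝟙 c)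
    (τ σ : natFam S.toMatrixRep c W i) : (natForm S h c i).inner τ σ =
      ∑ l, (pathForm h (y l) i).inner (τ.1 _ (a l)) (σ.1 _ (a l)) := by
  have h1 := natFam.inner_adjoint h ha (S.sum_proj c) (𝟙 c) τ σ
  simp only [dag_id, Category.id_comp] at h1
  exact h1

theorem inner_ofWord (h : ∀ k, HermForm (W k)) {a : List Bool} (y z : PathVec W a i) :
    (natForm S h (word X a) i).inner (natFam.ofWord S.toMatrixRep a i y)
      (natFam.ofWord S.toMatrixRep a i z) = (pathForm h a i).inner y z := by
  rw [inner_eq h (L := Unit) (y := fun _ => a) (a := fun _ => 𝟙 _) (by simp [dag_id]),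
    Fintype.sum_unique, natFam.ofWord_id, natFam.ofWord_id]

theorem isIsometry_unit (h : ∀ k, HermForm (W k)) : (natForm S h (𝟙_ C) i).IsIsometry (h i)
    (natFam.unit S.toMatrixRep W i) := fun τ σ => by
  have h1 := inner_ofWord (S := S) h (a := []) (i := i) (τ.1 [] (𝟙 (𝟙_ C))) (σ.1 [] (𝟙 (𝟙_ C)))
  have h2 : ∀ τ : natFam S.toMatrixRep (𝟙_ C) W i,
      natFam.ofWord S.toMatrixRep [] i (τ.1 [] (𝟙 (𝟙_ C))) = τ := fun τ =>
    (natFam.ofWord S.toMatrixRep [] i).apply_symm_apply τ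
  rw [h2, h2] at h1
  refine Eq.trans ?_ h1.symm
  rw [pathForm_inner, EPath.sum_nil i fun k p =>
    (h k).inner (τ.1 [] (𝟙 (𝟙_ C)) k p) (σ.1 [] (𝟙 (𝟙_ C)) k p)]
  rfl

theorem isIsometry_right {W' : V → Type*} [∀ k, AddCommGroup (W' k)] [∀ k, Module ℂ (W' k)]
    {h : ∀ k, HermForm (W k)} {h' : ∀ k, HermForm (W' k)} (c : C) {s : ∀ k, W k →ₗ[ℂ] W' k}
    (hs : ∀ k, (h k).IsIsometry (h' k) (s k)) : (natForm S h c i).IsIsometry (natForm S h' c i)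
      (natFam.right S.toMatrixRep c s i) := fun τ σ =>
  Finset.sum_congr rfl fun _ _ => Finset.sum_congr rfl fun k _ => Finset.sum_congr rfl fun _ _ =>
    hs k _ _

theorem inner_right {W' : V → Type*} [∀ k, AddCommGroup (W' k)] [∀ k, Module ℂ (W' k)]
    {h : ∀ k, HermForm (W k)} {h' : ∀ k, HermForm (W' k)} (c : C) {s : ∀ k, W k →ₗ[ℂ] W' k}
    {s' : ∀ k, W' k →ₗ[ℂ] W k} (hs : ∀ k y z, (h' k).inner (s k y) z = (h k).inner y (s' k z))
    (τ : natFam S.toMatrixRep c W i) (σ : natFam S.toMatrixRep c W' i) :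
    (natForm S h' c i).inner (natFam.right S.toMatrixRep c s i τ) σ =
      (natForm S h c i).inner τ (natFam.right S.toMatrixRep c s' i σ) :=
  Finset.sum_congr rfl fun _ _ => Finset.sum_congr rfl fun k _ => Finset.sum_congr rfl fun _ _ =>
    hs k _ _

/-- The form may be computed with any orthogonal presentation of `c ⊗ c'`. For the product of the
presentations of the factors, paths split into halves and the iterated form appears. -/
theorem inner_assocHom (h : ∀ k, HermForm (W k)) (c c' : C) (τ σ : natFam S.toMatrixRep (c ⊗ c') W i) :
    (natForm S h (c ⊗ c') i).inner τ σ = ∑ l, ∑ k, ∑ p : EPath V (S.wd c l) i k,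
      (natForm S h c' k).inner (natFam.assocAt τ (S.proj c l) p)
        (natFam.assocAt σ (S.proj c l) p) := by
  rw [inner_eq h (S.unitary.sum_tensor_comp_dag (S.sum_proj c) (S.sum_proj c'))
    τ σ]
  rw [Fintype.sum_prod_type]
  refine Finset.sum_congr rfl fun l _ => ?_
  simp only [pathForm_inner_append]
  rw [Finset.sum_comm]
  refine Finset.sum_congr rfl fun k _ => ?_
  rw [Finset.sum_comm]
  rfl

theorem inner_nested (h : ∀ k, HermForm (W k)) (c c' : C)
    (τ σ : natFam S.toMatrixRep c (fun k => natFam S.toMatrixRep c' W k) i) :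
    (natForm S (fun k => natForm S h c' k) c i).inner τ σ =
      ∑ l, ∑ k, ∑ p : EPath V (S.wd c l) i k,
        (natForm S h c' k).inner (τ.1 _ (S.proj c l) k p) (σ.1 _ (S.proj c l) k p) := rfl

theorem isIsometry_assocHom (h : ∀ k, HermForm (W k)) (c c' : C) :
    (natForm S h (c ⊗ c') i).IsIsometry (natForm S (fun k => natForm S h c' k) c i)
      (natFam.assocHom S.toMatrixRep c c' W i) := by
  unfold HermForm.IsIsometry
  intro τ σ
  exact (inner_nested h c c' _ _).trans (inner_assocHom h c c' τ σ).symm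

end natForm

end NaturalForms

/-! ### Unitarity detected by forms -/

section UnitaryModels

open MonoidalLeftAction LinearStructure

variable {C : Type u} [Category.{v} C] [Abelian C] [Linear ℂ C] [MonoidalCategory C]
variable [MonoidalPreadditive C] [MonoidalLinear ℂ C] [CStarCategory C] [Duality C]
variable {X : C} {V : Type w} [Quiver.{x} V] [Fintype V] [∀ i j : V, Finite (i ⟶ j)]
variable {S : StarRep X V}

section

variable {D : Type*} [Category* D] [Preadditive D] [Linear ℂ D] [CStarCategory D]
  [MonoidalLeftAction C D]

/-- A functor to families of vector spaces with forms, compatible with `†` and with isometric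
structure isomorphisms. -/
structure IsUnitaryModel {J : D ⥤ Fam.{v, u, x, w, t} S.toMatrixRep} (δ : LinearStructure C J)
    (h : ∀ m i, HermForm ((J.obj m).obj i)) : Prop where
  adjoint {m n : D} (f : m ⟶ n) (i : V) (y : (J.obj m).obj i) (z : (J.obj n).obj i) :
    (h n i).inner (J.map f i y) z = (h m i).inner y (J.map (dag f) i z)
  isometry (c : C) (m : D) (i : V) : (h (c ⊙ₗ m) i).IsIsometry (natForm S (h m) c i) ((δ.iso c m).hom i)

namespace IsUnitaryModel

variable {J : D ⥤ Fam.{v, u, x, w, t} S.toMatrixRep} {δ : LinearStructure C J}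
    {h : ∀ m i, HermForm ((J.obj m).obj i)} (hJ : IsUnitaryModel δ h)

include hJ

/-- Adjoints for positive definite forms are unique and `J` is faithful. Unitarity of the action
thus reduces to adjointness and isometry statements about natural families. -/
theorem dag_eq [J.Faithful] {m n : D} {f : m ⟶ n} {g : n ⟶ m} (H : ∀ i y z,
    (h n i).inner (J.map f i y) z = (h m i).inner y (J.map g i z)) : dag f = g :=
  J.map_injective <| Fam.hom_ext fun i z => (h m i).ext_left fun y => by rw [← hJ.adjoint, H]

theorem dag_hom [J.Faithful] {m n : D} (e : m ≅ n)
    (H : ∀ i, (h m i).IsIsometry (h n i) (J.map e.hom i)) : dag e.hom = e.inv :=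
  hJ.dag_eq fun i y z => by
    have h1 : J.map e.hom i (J.map e.inv i z) = z := by
      rw [← Fam.comp_apply, ← J.map_comp, e.inv_hom_id, J.map_id, Fam.id_apply]
    conv_lhs => rw [← h1]
    exact H i _ _

theorem dag_act [J.Faithful] {c c' : C} (f : c ⟶ c') (m : D) : dag (f ⊵ₗ m) = dag f ⊵ₗ m :=
  hJ.dag_eq fun i y z => by
    have h1 : ∀ {c c' : C} (f : c ⟶ c') y, (δ.iso c' m).hom i (J.map (f ⊵ₗ m) i y) =
      natFam.left S.toMatrixRep f _ i ((δ.iso c m).hom i y) := fun f y =>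
        LinearMap.congr_fun (congrFun (δ.left f m) i) y
    have h2 := natForm.inner_left (h m) f ((δ.iso c m).hom i y) ((δ.iso c' m).hom i z)
    rw [← hJ.isometry, ← hJ.isometry]
    exact ((congrArg (fun a => (natForm S (h m) c' i).inner a ((δ.iso c' m).hom i z)) (h1 f y)).trans
      h2).trans (congrArg _ (h1 (dag f) z).symm)

theorem act_dag [J.Faithful] (c : C) {m m' : D} (f : m ⟶ m') : dag (c ⊴ₗ f) = c ⊴ₗ dag f :=
  hJ.dag_eq fun i y z => by
    have h1 : ∀ {m m' : D} (f : m ⟶ m') y, (δ.iso c m').hom i (J.map (c ⊴ₗ f) i y) =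
      natFam.right S.toMatrixRep c (J.map f) i ((δ.iso c m).hom i y) := fun f y =>
        LinearMap.congr_fun (congrFun (δ.right c f) i) y
    have h2 := natForm.inner_right (S := S) (h := h m) (h' := h m') c (s := J.map f)
      (s' := J.map (dag f)) (fun k => hJ.adjoint f k) ((δ.iso c m).hom i y) ((δ.iso c m').hom i z)
    rw [← hJ.isometry, ← hJ.isometry]
    exact ((congrArg (fun a => (natForm S (h m') c i).inner a ((δ.iso c m').hom i z)) (h1 f y)).trans
      h2).trans (congrArg _ (h1 (dag f) z).symm)

theorem isIsometry_right {m : D} {W : Fam.{v, u, x, w, t} S.toMatrixRep} {hW : ∀ i, HermForm (W.obj i)}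
    (c : C) {f : J.obj m ⟶ W} (hf : ∀ i, (h m i).IsIsometry (hW i) (f i)) (i : V) :
    (natForm S (h m) c i).IsIsometry (natForm S hW c i) ((c ⊴ₗ f : c ⊙ₗ J.obj m ⟶ c ⊙ₗ W) i) :=
  natForm.isIsometry_right c hf

theorem dag_assoc [J.Faithful] (c c' : C) (m : D) : dag (αₗ c c' m).hom = (αₗ c c' m).inv :=
  hJ.dag_hom _ fun i y z => by
    have h1 : ∀ y, (c ⊴ₗ (δ.iso c' m).hom : c ⊙ₗ J.obj (c' ⊙ₗ m) ⟶ c ⊙ₗ c' ⊙ₗ J.obj m) i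
      ((δ.iso c (c' ⊙ₗ m)).hom i (J.map (αₗ c c' m).hom i y)) =
        natFam.assocHom S.toMatrixRep c c' _ i ((δ.iso (c ⊗ c') m).hom i y) := fun y =>
      LinearMap.congr_fun (congrFun (δ.assoc c c' m) i) y
    have h2 := (natForm.isIsometry_assocHom (S := S) (i := i) (h m) c c').inner_eq
      ((δ.iso (c ⊗ c') m).hom i y) ((δ.iso (c ⊗ c') m).hom i z)
    have h3 := (natForm.isIsometry_right (S := S) (i := i) (h := h (c' ⊙ₗ m))
      (h' := fun k => natForm S (h m) c' k) c (fun k => hJ.isometry c' m k)).inner_eq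
      ((δ.iso c (c' ⊙ₗ m)).hom i (J.map (αₗ c c' m).hom i y))
      ((δ.iso c (c' ⊙ₗ m)).hom i (J.map (αₗ c c' m).hom i z))
    refine ((hJ.isometry c (c' ⊙ₗ m) i).inner_eq _ _).symm.trans (h3.symm.trans ?_)
    refine Eq.trans ?_ (h2.trans ((hJ.isometry (c ⊗ c') m i).inner_eq y z))
    exact congrArg₂ (natForm S (fun k => natForm S (h m) c' k) c i).inner (h1 y) (h1 z)

theorem dag_unit [J.Faithful] (m : D) : dag (λₗ[C] m).hom = (λₗ[C] m).inv :=
  hJ.dag_hom _ fun i y z => by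
    have h1 : ∀ y, J.map (λₗ[C] m).hom i y = natFam.unit S.toMatrixRep _ i ((δ.iso (𝟙_ C) m).hom i y) :=
      fun y => LinearMap.congr_fun (congrFun (δ.unit m) i) y
    rw [h1, h1, ← hJ.isometry]
    exact natForm.isIsometry_unit (h m) _ _

end IsUnitaryModel

end

end UnitaryModels

/-! ### Positivity of the weighted trace -/

section PositiveTraces

theorem HermForm.trace_eq {E : Type*} [AddCommGroup E] [Module ℂ E] (h : HermForm E) {n : ℕ}
    {b : Module.Basis (Fin n) ℂ E} (hb : ∀ k l, h.inner (b k) (b l) = if k = l then 1 else 0)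
    (f : E →ₗ[ℂ] E) : LinearMap.trace ℂ E f = ∑ k, h.inner (b k) (f (b k)) := by
  rw [LinearMap.trace_eq_matrix_trace ℂ b, Matrix.trace]
  refine Finset.sum_congr rfl fun k _ => ?_
  rw [h.inner_basis hb, Matrix.diag_apply, LinearMap.toMatrix_apply, Finset.sum_eq_single k]
  · simp
  · intro l _ hl
    simp [Finsupp.single_eq_of_ne hl]
  · simp

namespace IsSimpleReps

variable {D : Type uD} [Category.{vD} D] [Abelian D] [Linear ℂ D] [CStarCategory D] {V : Type w}
  {S : V → D}

/-- The form on the morphisms from a simple object. -/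
@[reducible]
def hermForm (hS : IsSimpleReps S) (i : V) (m : D) : HermForm (S i ⟶ m) where
  inner y z := hS.form z y
  conj_inner_symm y z := hS.conj_form y z
  re_inner_nonneg y := by
    obtain ⟨t, ht, h, -⟩ := hS.form_self y
    rw [h]
    simpa using ht
  add_left y z z' := by simp [form, dag_add]
  smul_left y z c := hS.form_smul_right c z y
  definite y hy := by
    obtain ⟨t, -, h, h0⟩ := hS.form_self y
    exact h0 (Complex.ofReal_injective (h.symm.trans hy))

theorem hermForm_inner (hS : IsSimpleReps S) {i : V} {m : D} (y z : S i ⟶ m) :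
    (hS.hermForm i m).inner y z = hS.form z y := rfl

end IsSimpleReps

variable {C : Type u} [Category.{v} C] [Abelian C] [Linear ℂ C] [MonoidalCategory C]
variable {V : Type w} [Fintype V] {M : SemisimpleModule.{v, u, vD, uD} C V} [CStarCategory M.carrier]

/-- In orthonormal bases b of the spaces Hom(M_i, m) the trace is the sum of λ_i ‖b ≫ f‖². If it
vanishes, `f` kills every morphism from a simple object. -/
theorem weightTrace_comp_dag_pos {lam : V → ℝ} (hlam : ∀ i, 0 < lam i) {m n : M.carrier}
    (f : m ⟶ n) (hf : f ≠ 0) :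
    ∃ z : ℝ, 0 < z ∧ weightTrace M (fun i => (lam i : ℂ)) m (f ≫ dag f) = z := by
  have hb := fun i =>
    have := M.reps.finite (M.simple i) m
    (M.reps.hermForm i m).exists_basis rfl
  choose b hb using hb
  have hform := fun i k => M.reps.form_self (b i k ≫ f)
  choose z hz0 hz hz1 using hform
  have h1 : weightTrace M (fun i => (lam i : ℂ)) m (f ≫ dag f) = (∑ i, lam i * ∑ k, z i k : ℝ) := by
    rw [weightTrace_apply]
    push_cast
    refine Finset.sum_congr rfl fun i _ => congrArg _ ?_
    rw [(M.reps.hermForm i m).trace_eq (hb i)]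
    refine Finset.sum_congr rfl fun k _ => ?_
    rw [← hz]
    change M.reps.form (b i k ≫ f ≫ dag f) (b i k) = _
    rw [← Category.assoc, M.reps.form_dag_right, dag_dag]
  refine ⟨_, ?_, h1⟩
  have h2 : ∀ i, 0 ≤ lam i * ∑ k, z i k := fun i =>
    mul_nonneg (hlam i).le (Finset.sum_nonneg fun k _ => hz0 i k)
  refine lt_of_le_of_ne (Finset.sum_nonneg fun i _ => h2 i) fun h3 => hf ?_
  have h4 : ∀ i k, z i k = 0 := fun i k => by
    have h5 := (Finset.sum_eq_zero_iff_of_nonneg fun i _ => h2 i).1 h3.symm i (Finset.mem_univ _)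
    have h6 := (mul_eq_zero.1 h5).resolve_left (hlam i).ne'
    exact (Finset.sum_eq_zero_iff_of_nonneg fun k _ => hz0 i k).1 h6 k (Finset.mem_univ _)
  refine M.reps.hom_ext fun i y => ?_
  rw [comp_zero, ← (b i).sum_repr y, Preadditive.sum_comp]
  exact Finset.sum_eq_zero fun k _ => by rw [Linear.smul_comp, hz1 i k (h4 i k), smul_zero]

end PositiveTraces

/-! ### An isometric action on the skeleton -/

section UnitarySkeleton

open MonoidalLeftAction LinearStructure

variable {C : Type u} [Category.{v} C] [Abelian C] [Linear ℂ C] [MonoidalCategory C]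
variable [MonoidalPreadditive C] [MonoidalLinear ℂ C] [CStarCategory C] [Duality C]
variable {X : C} {V : Type w} [Quiver.{x} V] [Fintype V] [∀ i j : V, Finite (i ⟶ j)]

namespace Skel

variable {N : ℕ} (S : StarRep X V) (e : V ≃ Fin N)

/-- The forms on families of Hilbert spaces. -/
@[reducible]
def form (s : Skel.{vD, uD} N) (i : V) : HermForm (((toFam S.toMatrixRep e).obj s).obj i) :=
  (HermForm.std (s.space (e i))).comap ULift.moduleEquiv.toLinearMap ULift.moduleEquiv.injective

theorem exists_isometry_actObj (c : C) (s : Skel.{vD, uD} N) (i : V) :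
    ∃ f : ((toFam S.toMatrixRep e).obj (actObj S.toMatrixRep e c s)).obj i ≃ₗ[ℂ]
        natFam S.toMatrixRep c ((toFam S.toMatrixRep e).obj s).obj i,
      (form S e (actObj S.toMatrixRep e c s) i).IsIsometry (natForm S (form S e s) c i) f := by
  have := natFam.finiteDimensional (ρ := S.toMatrixRep)
    (W := ((toFam S.toMatrixRep e).obj s).obj) (i := i) c
  exact HermForm.exists_isometry _ _ (finrank_actObj S.toMatrixRep e c s i)

/-- A choice of isometric structure isomorphisms. -/
def unitaryActIso (c : C) (s : Skel.{vD, uD} N) :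
    (toFam S.toMatrixRep e).obj (actObj S.toMatrixRep e c s) ≅ c ⊙ₗ (toFam S.toMatrixRep e).obj s :=
  Fam.isoOfEquiv fun i => ((exists_isometry_actObj S e c s i).choose :
    ((toFam S.toMatrixRep e).obj (actObj S.toMatrixRep e c s)).obj i ≃ₗ[ℂ]
        natFam S.toMatrixRep c ((toFam S.toMatrixRep e).obj s).obj i)

/-- The module category of families of Hilbert spaces with isometric structure isomorphisms. -/
abbrev unitaryModule : SemisimpleModule.{v, u, vD, uD} C V :=
  Skel.module S.toMatrixRep e (actObj S.toMatrixRep e) (unitaryActIso S e)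

instance : CStarCategory (unitaryModule.{v, u, vD, uD} S e).carrier :=
  inferInstanceAs (CStarCategory (Skel.{vD, uD} N))

theorem isUnitaryModel : IsUnitaryModel (S := S) (D := (unitaryModule.{v, u, vD, uD} S e).carrier)
    (model S.toMatrixRep e (actObj S.toMatrixRep e) (unitaryActIso S e)).linear (form S e) where
  adjoint f i y z := (LinearMap.adjoint_inner_right (maps f (e i)) y.down z.down).symm
  isometry c s i := (exists_isometry_actObj S e c s i).choose_spec

end Skel

end UnitarySkeleton

/-! ### Orthonormality of the reconstructed edges -/

section OrthonormalEdges

open MonoidalLeftAction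

variable {C : Type u} [Category.{v} C] [Abelian C] [Linear ℂ C] [MonoidalCategory C]
variable [MonoidalPreadditive C] [MonoidalLinear ℂ C] [CStarCategory C] [Duality C]
variable {X : C} {V : Type w} [Quiver.{x} V] [Fintype V] [∀ i j : V, Finite (i ⟶ j)]

open Classical in
theorem pathForm_inner_at {W : V → Type t} [∀ k, AddCommGroup (W k)] [∀ k, Module ℂ (W k)]
    (h : ∀ k, HermForm (W k)) {a : List Bool} {i j : V} (p q : EPath V a i j) (y z : W j) :
    (pathForm h a i).inner (PathVec.at p y) (PathVec.at q z) =
      if p = q then (h j).inner y z else 0 := by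
  rw [pathForm_inner, Finset.sum_eq_single j, Finset.sum_eq_single p, PathVec.at_self]
  · by_cases hp : p = q
    · rw [if_pos hp, ← hp, PathVec.at_self]
    · rw [if_neg hp, PathVec.at_of_ne, HermForm.zero_right]
      intro h'
      cases h'
      exact hp rfl
  · intro p' _ hp
    rw [PathVec.at_of_ne, HermForm.zero_left]
    intro h'
    cases h'
    exact hp rfl
  · simp
  · intro k _ hk
    refine Finset.sum_eq_zero fun p' _ => ?_
    rw [PathVec.at_of_ne, HermForm.zero_left]
    intro h'
    exact hk (congrArg Sigma.fst h').symm
  · simp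

namespace FamModel

variable {S : StarRep X V} {M : SemisimpleModule.{v, u, vD, uD} C V} [CStarCategory M.carrier]
  {J : FamModel.{v, u, vD, uD, x, w, t} M S.toMatrixRep}
  {h : ∀ m i, HermForm ((J.functor.obj m).obj i)}

theorem inner_vec (hJ : IsUnitaryModel J.linear h)
    (hu : ∀ i, (h _ i).inner (J.vec i _ (𝟙 (M.simple i))) (J.vec i _ (𝟙 (M.simple i))) = 1)
    {i : V} {m : M.carrier} (f g : M.simple i ⟶ m) :
    (h m i).inner (J.vec i m f) (J.vec i m g) = M.reps.form g f := by
  have h1 : J.vec i m f = J.functor.map f i (J.vec i _ (𝟙 (M.simple i))) := by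
    rw [← J.vec_comp, Category.id_comp]
  have h2 : g ≫ dag f = M.reps.form g f • 𝟙 _ := (M.reps.scal_smul_id i _).symm
  rw [h1, hJ.adjoint, ← J.vec_comp, h2, _root_.map_smul, HermForm.smul_right, hu, mul_one]

theorem inner_actVec (hJ : IsUnitaryModel J.linear h)
    (hu : ∀ i, (h _ i).inner (J.vec i _ (𝟙 (M.simple i))) (J.vec i _ (𝟙 (M.simple i))) = 1)
    {c : C} {i : V} {n : M.carrier} (f g : M.simple i ⟶ c ⊙ₗ n) :
    (natForm S (h n) c i).inner (J.actVec c i n f) (J.actVec c i n g) = M.reps.form g f :=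
  (hJ.isometry c n i _ _).trans (inner_vec hJ hu f g)

theorem signedVec_eq {a : Bool} {i : V} {n : M.carrier} (y : PathVec (J.functor.obj n).obj [a] i) :
    J.actVec (signed X a) i n (J.signedVec a i n y) =
      natFam.left S.toMatrixRep (wordSingle X a).hom _ i (natFam.ofWord S.toMatrixRep [a] i y) := by
  have h1 : J.signedVec a i n y = (J.actVec (word X [a]) i n).symm
      (natFam.ofWord S.toMatrixRep [a] i y) ≫ (wordSingle X a).hom ⊵ₗ n := by
    simp [signedVec, Linear.homCongr]
  rw [h1, actVec_act, LinearEquiv.apply_symm_apply]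

theorem dag_wordSingle (hU : IsUnitaryPivotal C) (a : Bool) :
    dag (wordSingle X a).hom = (wordSingle X a).inv := hU.dag_rightUnitor _

open Classical in
-- Functions concentrated at different edges are orthogonal, those built on the unit vector of `hu`
-- have norm 1, and the unitor that relates a one-letter word to its letter is unitary.
theorem edges_comp_dag (hJ : IsUnitaryModel J.linear h)
    (hu : ∀ i, (h _ i).inner (J.vec i _ (𝟙 (M.simple i))) (J.vec i _ (𝟙 (M.simple i))) = 1)
    {a : Bool} {i j : V} (e e' : SEdge V a i j) :
    J.edges a i j e ≫ dag (J.edges a i j e') = if e = e' then 𝟙 (M.simple i) else 0 := by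
  have h1 : M.reps.form (J.edges a i j e) (J.edges a i j e') = if e = e' then 1 else 0 := by
    rw [← inner_actVec hJ hu, edges, edges, signedVec_eq, signedVec_eq, natForm.inner_left]
    have h2 : ∀ τ : natFam S.toMatrixRep (word X [a]) (J.functor.obj (M.simple j)).obj i,
        natFam.left S.toMatrixRep (dag (wordSingle X a).hom) _ i
          (natFam.left S.toMatrixRep (wordSingle X a).hom _ i τ) = τ := fun τ =>
      natFam.ext fun b g k p => by
        rw [natFam.left_apply, natFam.left_apply, dag_wordSingle S.unitary, Iso.hom_inv_id_assoc]
    rw [h2, natForm.inner_ofWord, pathForm_inner_at, hu]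
    refine if_congr ⟨fun h => (EPath.single_injective h).symm, fun h => by rw [h]⟩ rfl rfl
  rw [← M.reps.scal_smul_id i (_ ≫ _)]
  refine (congrArg (· • 𝟙 (M.simple i)) h1).trans ?_
  split <;> simp

end FamModel

end OrthonormalEdges

/-! ### Orthogonal presentations by words -/

section OrthogonalPresentations

variable {C : Type u} [Category.{v} C] [Abelian C] [Linear ℂ C] [CStarCategory C]

namespace IsSimpleReps

variable {V : Type w} {S : V → C}

theorem exists_comp_dag_self_eq_id (hS : IsSimpleReps S) {i : V} {m : C} (f : S i ⟶ m) (hf : f ≠ 0) :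
    ∃ g : S i ⟶ m, g ≫ dag g = 𝟙 (S i) := by
  obtain ⟨t, ht, h1, h2⟩ := hS.form_self f
  have ht0 : t ≠ 0 := fun h => hf (h2 h)
  let s : ℂ := ((Real.sqrt t : ℝ) : ℂ)
  have hs : s * s = t := by simp only [s]; rw [← Complex.ofReal_mul, Real.mul_self_sqrt ht]
  have hs0 : s ≠ 0 := fun h => ht0 (by rw [h] at hs; simpa using hs.symm)
  have hcs : conj s = s := Complex.conj_ofReal _
  refine ⟨s⁻¹ • f, ?_⟩
  rw [← hS.scal_smul_id i (_ ≫ _)]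
  have h3 : hS.scal i ((s⁻¹ • f) ≫ dag (s⁻¹ • f)) = 1 := by
    change hS.form (s⁻¹ • f) (s⁻¹ • f) = 1
    rw [form_smul_left, form_smul_right, h1, map_inv₀, hcs, ← hs]
    field_simp
  rw [h3, one_smul]

theorem exists_sum_dag_comp_eq_id [Finite V] (hS : IsSimpleReps S) (c : C) :
    ∃ (n : ℕ) (idx : Fin n → V) (b : ∀ k, S (idx k) ⟶ c), ∑ k, dag (b k) ≫ b k = 𝟙 c := by
  have := Fintype.ofFinite V
  have hb := fun i =>
    have := hS.finite (S i) c
    (hS.hermForm i c).exists_basis rfl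
  choose b hb using hb
  let e := Fintype.equivFin (Σ i, Fin (Module.finrank ℂ (S i ⟶ c)))
  refine ⟨_, fun k => (e.symm k).1, fun k => b _ (e.symm k).2, ?_⟩
  rw [Equiv.sum_comp e.symm fun k : Σ i, Fin (Module.finrank ℂ (S i ⟶ c)) =>
    dag (b k.1 k.2) ≫ b k.1 k.2, Fintype.sum_sigma]
  refine hS.hom_ext fun j y => ?_
  rw [Category.comp_id, Preadditive.comp_sum, Finset.sum_eq_single j]
  · rw [Preadditive.comp_sum]
    conv_rhs => rw [← (b j).sum_repr y]
    refine Finset.sum_congr rfl fun k _ => ?_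
    rw [← Category.assoc, hS.comp_eq_smul]
    congr 1
    have h1 : hS.scal j (y ≫ dag (b j k)) = (hS.hermForm j c).inner (b j k) y := rfl
    rw [h1, (hS.hermForm j c).inner_basis (hb j), Finset.sum_eq_single k]
    · simp
    · intro l _ hl
      simp [Finsupp.single_eq_of_ne hl]
    · simp
  · intro i _ hi
    rw [Preadditive.comp_sum]
    refine Finset.sum_eq_zero fun k _ => ?_
    rw [← Category.assoc, hS.hom_eq_zero hi.symm (y ≫ dag (b i k)), zero_comp]
  · simp

end IsSimpleReps

/-- The given list may contain repetitions and non-simple objects. Isomorphism classes of simple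
objects inject into it by picking an entry for each. -/
theorem IsSemisimple.exists_isSimpleReps (hC : IsSemisimple C)
    (h : ∃ (n : ℕ) (Y : Fin n → C), ∀ A : C, Simple A → ∃ i, Nonempty (A ≅ Y i)) :
    ∃ (V : Type u) (_ : Finite V) (S : V → C), IsSimpleReps S := by
  let s : Setoid {A : C // Simple A} :=
    { r := fun A B => Nonempty (A.1 ≅ B.1)
      iseqv := ⟨fun A => ⟨Iso.refl _⟩, fun ⟨e⟩ => ⟨e.symm⟩, fun ⟨e⟩ ⟨e'⟩ => ⟨e ≪≫ e'⟩⟩ }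
  obtain ⟨n, Y, hY⟩ := h
  choose f hf using fun A : {A : C // Simple A} => hY A.1 A.2
  refine ⟨Quotient s, ?_, fun q => q.out.1, hC, fun q => q.out.2, fun q q' ⟨e⟩ => ?_, fun m hm => ?_⟩
  · refine Finite.of_injective (fun q : Quotient s => f q.out) fun q q' h => ?_
    obtain ⟨e⟩ := hf q.out
    obtain ⟨e'⟩ := hf q'.out
    rw [← q.out_eq, ← q'.out_eq]
    exact Quotient.sound ⟨e ≪≫ eqToIso (congrArg Y h) ≪≫ e'.symm⟩
  · rw [← q.out_eq, ← q'.out_eq]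
    exact Quotient.sound ⟨e⟩
  · obtain ⟨e⟩ := Quotient.mk_out (s := s) ⟨m, hm⟩
    exact ⟨Quotient.mk s ⟨m, hm⟩, ⟨e.symm⟩⟩

/-- Retracts by words need not be orthogonal. But a simple object has a nonzero morphism to some
word, which rescales to an isometry, and every object decomposes orthogonally into simple ones. -/
theorem IsTensorGenerator.exists_sum_comp_dag [MonoidalCategory C] [Duality C] {X : C}
    (hX : IsTensorGenerator X) {V : Type w} [Finite V] {S : V → C} (hS : IsSimpleReps S) (c : C) :
    ∃ (n : ℕ) (y : Fin n → List Bool) (a : ∀ k, c ⟶ word X (y k)), ∑ k, a k ≫ dag (a k) = 𝟙 c := by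
  have h : ∀ i, ∃ (y : List Bool) (u : S i ⟶ word X y), u ≫ dag u = 𝟙 (S i) := fun i => by
    obtain ⟨n, y, a, b, hab⟩ := hX.exists_sum (S i)
    by_contra! h
    refine hS.id_ne_zero i (hab.symm.trans (Finset.sum_eq_zero fun k _ => ?_))
    have h1 : a k = 0 := by
      by_contra h1
      obtain ⟨g, hg⟩ := hS.exists_comp_dag_self_eq_id (a k) h1
      exact h _ g hg
    rw [h1, zero_comp]
  choose y u hu using h
  obtain ⟨n, idx, b, hb⟩ := hS.exists_sum_dag_comp_eq_id c
  refine ⟨n, fun k => y (idx k), fun k => dag (b k) ≫ u (idx k), ?_⟩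
  rw [← hb]
  refine Finset.sum_congr rfl fun k _ => ?_
  rw [dag_comp, dag_dag, Category.assoc, ← Category.assoc (u _), hu, Category.id_comp]

end OrthogonalPresentations

/-! ### Existence in the unitary case -/

section UnitaryExistence

open MonoidalLeftAction

variable {C : Type u} [Category.{v} C] [Abelian C] [Linear ℂ C] [MonoidalCategory C]
variable [MonoidalPreadditive C] [MonoidalLinear ℂ C] [CStarCategory C] [PivotalCategory C]
variable {X : C} {V : Type w} [Quiver.{x} V] [Fintype V] [∀ i j : V, Finite (i ⟶ j)]

/-- Morphisms of unitary planar algebras to the graph planar algebra give representations of words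
that are compatible with `†`. -/
theorem StarPlanarEmbedding.exists_starRep (hC : IsFusion C) (hX : IsTensorGenerator X)
    (hU : IsUnitaryPivotal C) {r : V → ℂ} (φ : StarPlanarEmbedding (starPlanarAlgebraOf X) (oGPA V r)) :
    ∃ S : StarRep X V, S.toMatrixRep = φ.toPlanarMorphism.matrixRep hX := by
  obtain ⟨W, _, Y, hY⟩ := hC.toIsSemisimple.exists_isSimpleReps hC.finite_simples
  choose n y a ha using fun c : C => hX.exists_sum_comp_dag hY c
  exact ⟨{ toMatrixRep := φ.toPlanarMorphism.matrixRep hX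
           map_dag := φ.map_dag
           num := n
           wd := y
           proj := a
           sum_proj := ha
           unitary := hU }, rfl⟩

/-- The module category of families of Hilbert spaces, with its functor to families of vector
spaces. -/
theorem StarRep.exists_isUnitaryModel (S : StarRep X V) :
    ∃ (M : SemisimpleModule.{v, u, vD, uD} C V) (_ : CStarCategory M.carrier)
      (J : FamModel.{v, u, vD, uD, x, w, 0} M S.toMatrixRep) (_ : J.functor.Faithful)
      (h : ∀ m i, HermForm ((J.functor.obj m).obj i)), IsUnitaryModel J.linear h ∧
      ∀ i, (h _ i).inner (J.vec i _ (𝟙 (M.simple i))) (J.vec i _ (𝟙 (M.simple i))) = 1 :=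
  let e := Fintype.equivFin V
  ⟨Skel.unitaryModule S e, inferInstanceAs (CStarCategory (Skel.{vD, uD} (Fintype.card V))),
    Skel.model S.toMatrixRep e (Skel.actObj S.toMatrixRep e) (Skel.unitaryActIso S e),
    inferInstanceAs (Skel.toFam S.toMatrixRep e).Faithful, Skel.form S e, Skel.isUnitaryModel S e,
    fun i => (Skel.inner_ones.{vD, uD} (e i) (e i)).trans (if_pos rfl)⟩

/-- A semisimple module category with a unitary model is a unitary module category. -/
@[reducible]
def IsUnitaryModel.toUnitaryModule {S : StarRep X V} {M : SemisimpleModule.{v, u, vD, uD} C V}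
    [CStarCategory M.carrier] {J : FamModel.{v, u, vD, uD, x, w, t} M S.toMatrixRep} [J.functor.Faithful]
    {h : ∀ m i, HermForm ((J.functor.obj m).obj i)} (hJ : IsUnitaryModel J.linear h) {lam : V → ℝ}
    (hlam : ∀ i, 0 < lam i) (hΘ : IsModuleTrace C (weightTrace M fun i => (lam i : ℂ))) :
    UnitaryModule.{v, u, vD, uD} X V where
  toSemisimpleModule := M
  dag_act := hJ.dag_act
  act_dag := hJ.act_dag
  dag_assoc := hJ.dag_assoc
  dag_unit := hJ.dag_unit
  fusionGraph := SemisimpleModule.hasFusionGraph_of_isEdgeBasis J.isEdgeBasis_edges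
  pivotal := ⟨_, hΘ, weightTrace_comp_dag_pos hlam⟩

theorem StarPlanarEmbedding.exists_unitarilyCorresponds [Nonempty V] (hC : IsFusion C)
    (hX : IsTensorGenerator X) (hU : IsUnitaryPivotal C) {lam : V → ℝ} (hlam : ∀ i, 0 < lam i)
    (φ : StarPlanarEmbedding (starPlanarAlgebraOf X) (oGPA V fun i => (Real.sqrt (lam i) : ℂ))) :
    ∃ M : UnitaryModule.{v, u, vD, uD} X V, UnitarilyCorresponds M fun _ _ f => φ.map f := by
  obtain ⟨S, hS⟩ := φ.exists_starRep hC hX hU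
  obtain ⟨M, _, J, _, h, hJ, hu⟩ := S.exists_isUnitaryModel
  have hφ : IsActionMatrix J.edges fun _ _ f => φ.map f := by
    have h1 : (fun (a b : List Bool) (f : word X a ⟶ word X b) => S.map f) = fun _ _ f => φ.map f := by
      rw [hS]
      rfl
    exact h1 ▸ J.isActionMatrix_edges
  have hΘ := Corresponds.exists_moduleTrace hX (lam := fun i => (lam i : ℂ))
    (fun i => Complex.ofReal_ne_zero.2 (hlam i).ne')
    (fun i => by rw [← Complex.ofReal_pow, Real.sq_sqrt (hlam i).le]) φ.toPlanarMorphism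
      ⟨_, J.isEdgeBasis_edges, hφ⟩
  exact ⟨hJ.toUnitaryModule hlam hΘ, J.edges, J.isEdgeBasis_edges,
    fun a i j z z' => FamModel.edges_comp_dag hJ hu z z', hφ⟩

end UnitaryExistence

/-! ### Orthonormal edge bases and unitary matrices -/

section OrthonormalBases

open MonoidalLeftAction

variable {C : Type u} [Category.{v} C] [Abelian C] [Linear ℂ C] [MonoidalCategory C]
variable [CStarCategory C] [Duality C] {X : C} {V : Type w} [Quiver.{x} V]

namespace UnitaryModule

variable (M : UnitaryModule.{v, u, vD, uD} X V)

theorem dag_unit_inv (m : M.carrier) : dag (λₗ[C] m).inv = (λₗ[C] m).hom := by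
  rw [← M.dag_unit, dag_dag]

theorem dag_assoc_inv (c c' : C) (m : M.carrier) : dag (αₗ c c' m).inv = (αₗ c c' m).hom := by
  rw [← M.dag_assoc, dag_dag]

end UnitaryModule

variable {M : UnitaryModule.{v, u, vD, uD} X V}

theorem UnitaryModule.comp_act_assoc_inv_comp_dag {c c' : C} {m n n' k : M.carrier}
    (f : m ⟶ c ⊙ₗ n) (f' : m ⟶ c ⊙ₗ n') (g : n ⟶ c' ⊙ₗ k) (g' : n' ⟶ c' ⊙ₗ k) :
    (f ≫ c ⊴ₗ g ≫ (αₗ c c' k).inv) ≫ dag (f' ≫ c ⊴ₗ g' ≫ (αₗ c c' k).inv) =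
      f ≫ c ⊴ₗ (g ≫ dag g') ≫ dag f' := by
  rw [dag_comp, dag_comp, M.act_dag, M.dag_assoc_inv]
  simp

open Classical in
-- Induction on the path: the tails compose to an identity or to zero, and then the first edges are
-- compared. Tails from different vertices compose to zero by Schur's lemma.
theorem IsOrthonormal.pathMorphism_comp_dag {β : EdgeMorphisms M.toSemisimpleModule X}
    (hβ : IsOrthonormal β) {a : List Bool} {i j : V} (p q : EPath V a i j) :
    pathMorphism β p ≫ dag (pathMorphism β q) = if p = q then 𝟙 (M.simple i) else 0 := by
  induction p with
  | nil i =>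
    cases q
    rw [if_pos rfl]
    exact (congrArg (fun f => (λₗ[C] (M.simple i)).inv ≫ f) (M.dag_unit_inv _)).trans
      (Iso.inv_hom_id _)
  | @cons s l i j k e p ih =>
    cases q with
    | @cons _ _ _ j' _ e' q =>
    rw [pathMorphism, pathMorphism]
    refine (UnitaryModule.comp_act_assoc_inv_comp_dag _ _ _ _).trans ?_
    by_cases hj : j = j'
    · subst hj
      rw [ih]
      by_cases hp : p = q
      · rw [if_pos hp, actionHomRight_id, Category.id_comp]
        refine (hβ s i j e e').trans (if_congr ⟨fun h => by rw [h, hp], fun h => ?_⟩ rfl rfl)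
        cases h
        rfl
      · rw [if_neg hp, M.act_zero, zero_comp, comp_zero, if_neg]
        intro h
        cases h
        exact hp rfl
    · rw [M.reps.hom_eq_zero hj (_ ≫ _), M.act_zero, zero_comp, comp_zero, if_neg]
      intro h
      cases h
      exact hj rfl

open Classical in
theorem IsOrthonormal.form_pathMorphism {β : EdgeMorphisms M.toSemisimpleModule X}
    (hβ : IsOrthonormal β) {a : List Bool} {i j : V} (p q : EPath V a i j) :
    M.reps.form (pathMorphism β p) (pathMorphism β q) = if p = q then 1 else 0 := by
  rw [IsSimpleReps.form, hβ.pathMorphism_comp_dag]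
  split <;> simp

variable [Fintype V] [∀ i j : V, Finite (i ⟶ j)]

theorem IsOrthonormal.actionMatrix_eq {β β' : EdgeMorphisms M.toSemisimpleModule X}
    (h : IsOrthonormal β) (hβ : IsEdgeBasis β) {a b : List Bool} (f : word X a ⟶ word X b) {i j : V}
    (p : EPath V a i j) (q : EPath V b i j) : actionMatrix β' hβ f i j p q =
      M.reps.form (pathMorphism β' p ≫ f ⊵ₗ M.simple j) (pathMorphism β q) := by
  rw [← sum_actionMatrix β' hβ f p, M.reps.form_sum_left, Finset.sum_eq_single q]
  · rw [M.reps.form_smul_left, h.form_pathMorphism, if_pos rfl, mul_one]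
  · intro q' _ hq
    rw [M.reps.form_smul_left, h.form_pathMorphism, if_neg hq, mul_zero]
  · simp

/-- Matrix entries are inner products with orthonormal path morphisms. With one basis this shows
that the embedding preserves †, with two bases and `f` the identity that changes of basis are
unitary. -/
theorem IsOrthonormal.dag_actionMatrix {β β' : EdgeMorphisms M.toSemisimpleModule X}
    (h : IsOrthonormal β) (h' : IsOrthonormal β') (hβ : IsEdgeBasis β) (hβ' : IsEdgeBasis β')
    {a b : List Bool} (f : word X a ⟶ word X b) :
    (actionMatrix β' hβ f).dag = actionMatrix β hβ' (dag f) := by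
  funext i j q p
  rw [GHom.dag, h.actionMatrix_eq hβ, h'.actionMatrix_eq hβ', M.reps.conj_form,
    M.reps.form_dag_right, ← M.dag_act, dag_dag]

variable (r : V → ℂ) {φ ψ : ∀ a b : List Bool, (planarAlgebraOf X).Hom a b → GHom V a b}

theorem UnitarilyCorresponds.unitarilyNatIsomorphic (h : UnitarilyCorresponds M φ)
    (h' : UnitarilyCorresponds M ψ) :
    UnitarilyNatIsomorphic (P := planarAlgebraOf X) (Q := oGPA V r) φ ψ := by
  obtain ⟨β, hβ, ho, hφ⟩ := h
  obtain ⟨β', hβ', ho', hψ⟩ := h'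
  refine ⟨_, isMonoidalNat_actionMatrix r hβ hφ hβ' hψ, fun a => ?_⟩
  have h1 : (actionMatrix β hβ' (𝟙 (word X a))).dag = actionMatrix β' hβ (𝟙 (word X a)) := by
    rw [ho'.dag_actionMatrix ho hβ' hβ, dag_id]
  exact ⟨(congrArg (GHom.mul _) h1).trans (actionMatrix_id_comp_id hβ hβ' a),
    (congrArg (fun A => GHom.mul A _) h1).trans (actionMatrix_id_comp_id hβ' hβ a)⟩

theorem IsOrthonormal.transformEdges {η θ : ∀ a, GHom V a a} (hη : ∀ a, (θ a).dag = η a)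
    (h : ∀ a, GHom.mul (θ a) (η a) = GHom.one V a)
    {β : EdgeMorphisms M.toSemisimpleModule X} (hβ : IsOrthonormal β) :
    IsOrthonormal (OrientedGPA.transformEdges θ β) := by
  classical
  intro a i j e e'
  have h1 : ∑ m, θ [a] i j (.single e) (.single m) * conj (θ [a] i j (.single e') (.single m)) =
      if e = e' then 1 else 0 := by
    have := congrFun (congrFun (congrFun (congrFun (h [a]) i) j) (.single e)) (.single e')
    simp only [GHom.mul, GHom.one, EPath.sum_single, ← hη] at this
    refine Eq.trans this ?_
    exact if_congr ⟨fun h => EPath.single_injective h, fun h => by rw [h]⟩ rfl rfl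
  have h2 : M.reps.form (OrientedGPA.transformEdges θ β a i j e)
      (OrientedGPA.transformEdges θ β a i j e') = if e = e' then 1 else 0 := by
    rw [← h1, OrientedGPA.transformEdges, OrientedGPA.transformEdges, M.reps.form_sum_left]
    refine Finset.sum_congr rfl fun m _ => ?_
    rw [M.reps.form_sum_right, Finset.sum_eq_single m]
    · rw [M.reps.form_smul_left, M.reps.form_smul_right, IsSimpleReps.form, hβ a i j m m, if_pos rfl,
        M.reps.scal_id, mul_one]
    · intro m' _ hm
      rw [M.reps.form_smul_left, M.reps.form_smul_right, IsSimpleReps.form, hβ a i j m m',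
        if_neg hm.symm, map_zero, mul_zero, mul_zero]
    · simp
  rw [← M.reps.scal_smul_id i (_ ≫ _)]
  refine (congrArg (· • 𝟙 (M.simple i)) h2).trans ?_
  split <;> simp

theorem UnitarilyCorresponds.of_unitarilyNatIsomorphic (h : UnitarilyCorresponds M φ)
    (h' : UnitarilyNatIsomorphic (P := planarAlgebraOf X) (Q := oGPA V r) φ ψ) :
    UnitarilyCorresponds M ψ := by
  obtain ⟨β, hβ, ho, hφ⟩ := h
  obtain ⟨η, hη, h⟩ := h'
  refine ⟨OrientedGPA.transformEdges (fun a => (η a : GHom V a a).dag) β,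
    isEdgeBasis_transformEdges (η := η) (fun a => (h a).1) hβ,
    ho.transformEdges (η := η) (fun a => ?_) (fun a => (h a).2),
    isActionMatrix_transformEdges r hη (fun a => h a) hφ⟩
  funext i j p q
  exact Complex.conj_conj _

end OrthonormalBases

/-! ### Transport along unitary module functors -/

section UnitaryTransport

open MonoidalLeftAction Functor

variable {C : Type u} [Category.{v} C] [Abelian C] [Linear ℂ C] [MonoidalCategory C]
variable [CStarCategory C] [Duality C] {X : C} {V : Type w} [Quiver.{x} V]
variable {M M' : UnitaryModule.{v, u, vD, uD} X V}
variable (F : M.carrier ⥤ M'.carrier) [F.LeftLinear C]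

theorem transportHom_comp_dag (hF : IsUnitaryModuleFunctor F)
    (e : ∀ i, F.obj (M.simple i) ≅ M'.simple i) (he : ∀ i, dag (e i).hom = (e i).inv) {c : C} {i j : V}
    (f g : M.simple i ⟶ c ⊙ₗ M.simple j) :
    transportHom (M := M.toSemisimpleModule) (M' := M'.toSemisimpleModule) F e f ≫
      dag (transportHom (M := M.toSemisimpleModule) (M' := M'.toSemisimpleModule) F e g) =
        (e i).inv ≫ F.map (f ≫ dag g) ≫ (e i).hom := by
  have h1 : dag (OplaxLeftLinear.δₗ F c (M.simple j)) = LaxLeftLinear.μₗ F c (M.simple j) := by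
    rw [← hF.dag_lineator, dag_dag]
  have h2 : dag (e i).inv = (e i).hom := by rw [← he, dag_dag]
  rw [transportHom, transportHom, dag_comp, dag_comp, dag_comp, M'.act_dag, he, h1, h2, ← hF.map_dag,
    F.map_comp]
  simp

theorem isOrthonormal_transportEdges
    (hF : IsModuleEquivalence (M := M.toSemisimpleModule) (M' := M'.toSemisimpleModule) F)
    (hU : IsUnitaryModuleFunctor F) (e : ∀ i, F.obj (M.simple i) ≅ M'.simple i)
    (he : ∀ i, dag (e i).hom = (e i).inv) (β : EdgeMorphisms M.toSemisimpleModule X) :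
    IsOrthonormal (M := M') (transportEdges (M := M.toSemisimpleModule)
      (M' := M'.toSemisimpleModule) F e β) ↔ IsOrthonormal β := by
  classical
  have := hF.isEquivalence
  have h0 : ∀ i, F.map (0 : M.simple i ⟶ M.simple i) = 0 := fun i => by
    simp
  refine forall_congr' fun a => forall_congr' fun i => forall_congr' fun j => forall_congr' fun z =>
    forall_congr' fun z' => ?_
  have h1 := transportHom_comp_dag F hU e he (β a i j z) (β a i j z')
  have h2 : (if z = z' then 𝟙 (M'.simple i) else 0) =
      (e i).inv ≫ F.map (if z = z' then 𝟙 (M.simple i) else 0) ≫ (e i).hom := by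
    split
    · rw [F.map_id, Category.id_comp, Iso.inv_hom_id]
    · rw [h0, zero_comp, comp_zero]
  constructor
  · intro h
    have h3 := h1.symm.trans (h.trans h2)
    exact F.map_injective ((cancel_mono (e i).hom).1 ((cancel_epi (e i).inv).1 h3))
  · intro h
    exact (h1.trans (congrArg (fun f => (e i).inv ≫ F.map f ≫ (e i).hom) h)).trans h2.symm

theorem unitarilyCorresponds_iff_of_equivalence [Fintype V] [∀ i j : V, Finite (i ⟶ j)]
    (hF : IsModuleEquivalence (M := M.toSemisimpleModule) (M' := M'.toSemisimpleModule) F)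
    (hL : RespectsLabels (M := M.toSemisimpleModule) (M' := M'.toSemisimpleModule) F)
    (hU : IsUnitaryModuleFunctor F)
    (φ : ∀ a b : List Bool, (planarAlgebraOf X).Hom a b → GHom V a b) :
    UnitarilyCorresponds M φ ↔ UnitarilyCorresponds M' φ := by
  have := hF.isEquivalence
  -- Label isomorphisms are replaced by unitary ones, so that transported bases remain orthonormal.
  choose e he using fun i => M'.reps.exists_unitary (hL i).some
  constructor
  · rintro ⟨β, h1, h2, h3⟩
    exact ⟨_, (isEdgeBasis_transportEdges F e hF β).2 h1,
      (isOrthonormal_transportEdges F hF hU e he β).2 h2,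
      (isActionMatrix_transportEdges F e hF β φ).2 h3⟩
  · rintro ⟨β', h1, h2, h3⟩
    obtain ⟨β, rfl⟩ := transportEdges_surjective (M := M.toSemisimpleModule) F e β'
    exact ⟨β, (isEdgeBasis_transportEdges F e hF β).1 h1,
      (isOrthonormal_transportEdges F hF hU e he β).1 h2,
      (isActionMatrix_transportEdges F e hF β φ).1 h3⟩

end UnitaryTransport

/-! ### Isometric multiplicity functors and their lifts -/

section UnitaryLifts

open MonoidalLeftAction LinearStructure

variable {C : Type u} [Category.{v} C] [Abelian C] [Linear ℂ C] [MonoidalCategory C]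
variable [MonoidalPreadditive C] [MonoidalLinear ℂ C] [CStarCategory C] [Duality C]
variable {X : C} {V : Type w} [Quiver.{x} V] [Fintype V] [∀ i j : V, Finite (i ⟶ j)]
variable {S : StarRep X V}

namespace IsUnitaryModel

variable {D D' : Type*} [Category* D] [Preadditive D] [Linear ℂ D] [CStarCategory D]
  [MonoidalLeftAction C D] [Category* D'] [Preadditive D'] [Linear ℂ D'] [CStarCategory D']
  [MonoidalLeftAction C D'] {J : D ⥤ Fam.{v, u, x, w, t} S.toMatrixRep}
  {J' : D' ⥤ Fam.{v, u, x, w, t} S.toMatrixRep} {δ : LinearStructure C J}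
  {δ' : LinearStructure C J'} {h : ∀ m i, HermForm ((J.obj m).obj i)}
  {h' : ∀ m i, HermForm ((J'.obj m).obj i)} (hJ : IsUnitaryModel δ h) (hJ' : IsUnitaryModel δ' h')

theorem _root_.OrientedGPA.Fam.isIsometry_inv {W W' : Fam.{v, u, x, w, t} S.toMatrixRep} {i : V}
    {k : HermForm (W.obj i)} {k' : HermForm (W'.obj i)} (e : W ≅ W')
    (H : k.IsIsometry k' (e.hom i)) : k'.IsIsometry k (e.inv i) :=
  H.of_rightInverse fun y => LinearMap.congr_fun (congrFun e.inv_hom_id i) y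

variable {F : D ⥤ D'} {θ : ∀ m, J'.obj (F.obj m) ≅ J.obj m}
  (H : ∀ m i, (h' (F.obj m) i).IsIsometry (h m i) ((θ m).hom i))
  (hθ : ∀ {m n : D} (f : m ⟶ n), J'.map (F.map f) = (θ m).hom ≫ J.map f ≫ (θ n).inv)

include hJ hJ' H hθ in
theorem map_dag_lift [J'.Faithful] {m n : D} (f : m ⟶ n) : F.map (dag f) = dag (F.map f) := by
  refine (hJ'.dag_eq fun i y z => ?_).symm
  have h1 : ∀ {m n : D} (f : m ⟶ n) (y : (J'.obj (F.obj m)).obj i), J'.map (F.map f) i y =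
      (θ n).inv i (J.map f i ((θ m).hom i y)) := fun f y => LinearMap.congr_fun (congrFun (hθ f) i) y
  have h2 : ∀ {m : D} (y : (J.obj m).obj i), (θ m).hom i ((θ m).inv i y) = y := fun {m} y =>
    LinearMap.congr_fun (congrFun (θ m).inv_hom_id i) y
  rw [h1, h1, ← H n i, h2, hJ.adjoint, ← H m i _ ((θ m).inv i _), h2]

include hJ hJ' H in
-- The structure isomorphism of a lift is mapped by `J'` to a composite of four isometries.
theorem dag_liftIso [J'.Full] [J'.Faithful] (c : C) (m : D) :
    dag (liftIso δ δ' F θ c m).hom = (liftIso δ δ' F θ c m).inv := by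
  refine hJ'.dag_hom _ fun i => ?_
  have h1 := hJ'.isometry c (F.obj m) i
  have h2 := hJ'.isIsometry_right (hW := h m) c (H m) i
  have h3 := Fam.isIsometry_inv (δ.iso c m) (hJ.isometry c m i)
  have h4 := Fam.isIsometry_inv (θ (c ⊙ₗ m)) (H (c ⊙ₗ m) i)
  rw [map_liftIso]
  exact h4.comp (h3.comp (h2.comp h1))

end IsUnitaryModel

/-- The forms on the multiplicity spaces. -/
@[reducible]
def homForm (M : SemisimpleModule.{v, u, vD, uD} C V) [CStarCategory M.carrier] (ρ : MatrixRep X V)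
    (m : M.carrier) (i : V) : HermForm (((homFam M ρ).obj m).obj i) :=
  (M.reps.hermForm i m).comap ULift.moduleEquiv.toLinearMap ULift.moduleEquiv.injective

variable {M M' : UnitaryModule.{v, u, vD, uD} X V}

/-- Parseval's identity: the contributions of different paths are orthogonal. -/
theorem IsOrthonormal.form_pathSum {β : EdgeMorphisms M.toSemisimpleModule X} (ho : IsOrthonormal β)
    {a : List Bool} {i : V} {m : M.carrier} (y z : ∀ k, EPath V a i k → (M.simple k ⟶ m)) :
    M.reps.form (pathSum β a i m y) (pathSum β a i m z) =
      ∑ k, ∑ p, M.reps.form (y k p) (z k p) := by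
  classical
  have key : ∀ k (p : EPath V a i k) k' (q : EPath V a i k'),
      M.reps.form (pathMorphism β p ≫ word X a ⊴ₗ y k p) (pathMorphism β q ≫ word X a ⊴ₗ z k' q) =
        if (⟨k, p⟩ : Σ k, EPath V a i k) = ⟨k', q⟩ then M.reps.form (y k p) (z k p) else 0 := by
    intro k p k' q
    rw [M.reps.form_dag_right, Category.assoc, M.act_dag, ← actionHomRight_comp]
    by_cases hk : k = k'
    · subst hk
      have h1 : z k q ≫ dag (y k p) = M.reps.form (z k q) (y k p) • 𝟙 _ :=
        (M.reps.scal_smul_id k _).symm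
      rw [h1, M.act_smul, actionHomRight_id, Linear.comp_smul, Category.comp_id,
        M.reps.form_smul_right, ho.form_pathMorphism, M.reps.conj_form]
      by_cases hp : p = q
      · subst hp
        simp
      · rw [if_neg hp, mul_zero, if_neg]
        intro h
        cases h
        exact hp rfl
    · rw [M.reps.hom_eq_zero (Ne.symm hk) (_ ≫ _), M.act_zero, comp_zero, if_neg]
      · rw [← zero_smul ℂ (0 : M.simple i ⟶ word X a ⊙ₗ M.simple k), M.reps.form_smul_right, map_zero,
          zero_mul]
      · intro h
        exact hk (congrArg Sigma.fst h)
  rw [pathSum_apply, pathSum_apply, M.reps.form_sum_left]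
  refine Finset.sum_congr rfl fun k _ => ?_
  rw [M.reps.form_sum_left]
  refine Finset.sum_congr rfl fun p _ => ?_
  rw [M.reps.form_sum_right, Finset.sum_eq_single k, M.reps.form_sum_right, Finset.sum_eq_single p,
    key, if_pos rfl]
  · intro q _ hq
    rw [key, if_neg]
    intro h
    cases h
    exact hq rfl
  · simp
  · intro k' _ hk
    rw [M.reps.form_sum_right]
    refine Finset.sum_eq_zero fun q _ => ?_
    rw [key, if_neg]
    intro h
    exact hk (congrArg Sigma.fst h).symm
  · simp

theorem IsOrthonormal.form_eq_sum_pathCoord {β : EdgeMorphisms M.toSemisimpleModule X}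
    (ho : IsOrthonormal β) (hβ : IsEdgeBasis β) {a : List Bool} {i : V} {m : M.carrier}
    (f g : M.simple i ⟶ word X a ⊙ₗ m) : M.reps.form f g =
      ∑ k, ∑ p, M.reps.form (pathCoord hβ a i m f k p) (pathCoord hβ a i m g k p) := by
  rw [← ho.form_pathSum, pathSum_pathCoord, pathSum_pathCoord]

/-- The structure maps are isometric: Parseval's identity sums over paths along each word of the
presentation of `c`, and `S.sum_proj` then removes the presentation. -/
theorem IsOrthonormal.isUnitaryModel {β : EdgeMorphisms M.toSemisimpleModule X}
    (ho : IsOrthonormal β) (hβ : IsEdgeBasis β)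
    (hS : ∀ (a b : List Bool) (f : word X a ⟶ word X b), S.map f = actionMatrix β hβ f) :
    IsUnitaryModel (homFamLinear (ρ := S.toMatrixRep) hβ hS)
      (homForm M.toSemisimpleModule S.toMatrixRep) where
  adjoint {m n} f i y z := by
    change M.reps.form z.down (y.down ≫ f) = M.reps.form (z.down ≫ dag f) y.down
    rw [M.reps.form_dag_right, dag_dag]
  isometry c m i y z := by
    change ∑ l, ∑ k, ∑ p, M.reps.form
      (pathCoord hβ (S.wd c l) i m (z.down ≫ S.proj c l ⊵ₗ m) k p)
      (pathCoord hβ (S.wd c l) i m (y.down ≫ S.proj c l ⊵ₗ m) k p) = M.reps.form z.down y.down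
    simp only [← ho.form_eq_sum_pathCoord hβ]
    have h : ∀ l, M.reps.form (z.down ≫ S.proj c l ⊵ₗ m) (y.down ≫ S.proj c l ⊵ₗ m) =
        M.reps.form z.down (y.down ≫ (S.proj c l ≫ dag (S.proj c l)) ⊵ₗ m) := fun l => by
      rw [M.reps.form_dag_right, M.dag_act, Category.assoc, comp_actionHomLeft]
    simp only [h]
    rw [← M.reps.form_sum_right, ← Preadditive.comp_sum, ← M.sum_act, S.sum_proj, id_actionHomLeft,
      Category.comp_id]

theorem exists_isometric_homFam_iso (m : M.carrier) :
    ∃ (m' : M'.carrier) (θ : (homFam M'.toSemisimpleModule S.toMatrixRep).obj m' ≅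
      (homFam M.toSemisimpleModule S.toMatrixRep).obj m),
      ∀ i, (homForm M'.toSemisimpleModule S.toMatrixRep m' i).IsIsometry
        (homForm M.toSemisimpleModule S.toMatrixRep m i) (θ.hom i) := by
  obtain ⟨m', h⟩ := M'.reps.exists_finrank_eq fun i => Module.finrank ℂ (M.simple i ⟶ m)
  have h1 := fun i => M.reps.finite (M.simple i) m
  have h2 := fun i => M'.reps.finite (M'.simple i) m'
  choose f hf using fun i => (M'.reps.hermForm i m').exists_isometry (M.reps.hermForm i m) (h i)
  exact ⟨m', Fam.isoOfEquiv fun i => ULift.moduleEquiv.trans ((f i).trans ULift.moduleEquiv.symm),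
    fun i y z => hf i y.down z.down⟩

end UnitaryLifts

/-! ### Uniqueness in the unitary case -/

section UnitaryUniqueness

open MonoidalLeftAction LinearStructure

variable {C : Type u} [Category.{v} C] [Abelian C] [Linear ℂ C] [MonoidalCategory C]
variable [MonoidalPreadditive C] [MonoidalLinear ℂ C] [CStarCategory C] [PivotalCategory C]
variable {X : C} {V : Type w} [Quiver.{x} V] [Fintype V] [∀ i j : V, Finite (i ⟶ j)]
variable {M M' : UnitaryModule.{v, u, vD, uD} X V}

theorem UnitarilyCorresponds.labelledUnitaryModuleEquivalent (hC : IsFusion C)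
    (hX : IsTensorGenerator X) (hU : IsUnitaryPivotal C) {r : V → ℂ}
    (φ : StarPlanarEmbedding (starPlanarAlgebraOf X) (oGPA V r))
    (h : UnitarilyCorresponds M fun _ _ f => φ.map f)
    (h' : UnitarilyCorresponds M' fun _ _ f => φ.map f) : LabelledUnitaryModuleEquivalent M M' := by
  obtain ⟨β, hβ, ho, hφ⟩ := h
  obtain ⟨β', hβ', ho', hφ'⟩ := h'
  obtain ⟨S, hS⟩ := φ.exists_starRep hC hX hU
  have h1 : ∀ (a b : List Bool) (f : word X a ⟶ word X b), S.map f = φ.map f := by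
    intro a b f
    rw [hS]
    rfl
  have h2 : ∀ (a b : List Bool) (f : word X a ⟶ word X b), S.map f = actionMatrix β hβ f :=
    fun a b f => (h1 a b f).trans (hφ.eq hβ f)
  have h2' : ∀ (a b : List Bool) (f : word X a ⟶ word X b), S.map f = actionMatrix β' hβ' f :=
    fun a b f => (h1 a b f).trans (hφ'.eq hβ' f)
  choose Fo θ hθ using exists_isometric_homFam_iso (M := M) (M' := M') (S := S)
  have hJ := ho.isUnitaryModel hβ h2
  have hJ' := ho'.isUnitaryModel hβ' h2'
  refine ⟨_, _, isModuleEquivalence_lift (δ := homFamLinear (ρ := S.toMatrixRep) hβ h2)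
    (δ' := homFamLinear (ρ := S.toMatrixRep) hβ' h2') Fo θ, respectsLabels_lift _ _, ?_⟩
  let _ := liftLinear (homFamLinear (ρ := S.toMatrixRep) hβ h2)
    (homFamLinear (ρ := S.toMatrixRep) hβ' h2') (liftFunctor _ Fo θ) θ
    (fun f => map_liftFunctor _ Fo θ f)
  exact
    { map_dag := fun f => hJ.map_dag_lift hJ' hθ (fun f => map_liftFunctor _ Fo θ f) f
      dag_lineator := fun c m => hJ.dag_liftIso hJ' (F := liftFunctor _ Fo θ) hθ c m }

end UnitaryUniqueness

/-! ### Positive eigenvectors -/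

section PerronFrobenius

/-- No connectedness is assumed. Since `mu` is a left and a right eigenvector, the sum of A_ij mu_i
mu_j (lam_i/mu_i − lam_j/mu_j)² expands to multiples of ∑ lam_k² that cancel, so each of its
nonnegative terms is zero. -/
theorem mul_eq_mul_of_eigenvectors {V : Type*} [Fintype V] {A : V → V → ℝ} (hA : ∀ i j, 0 ≤ A i j)
    {mu lam : V → ℝ} (hmu : ∀ i, 0 < mu i) (hlam : ∀ i, 0 < lam i) {d d' D : ℝ}
    (h1 : ∀ j, ∑ i, A i j * mu i = d * mu j) (h2 : ∀ i, ∑ j, A i j * mu j = d' * mu i)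
    (h3 : ∀ i, ∑ j, A i j * lam j = D * lam i) {i j : V} (hij : 0 < A i j) :
    lam i * mu j = lam j * mu i := by
  -- Pairing with the positive left eigenvector forces the eigenvalue of every positive right
  -- eigenvector to be `d`.
  have swap : ∀ y : V → ℝ, ∑ i, mu i * ∑ j, A i j * y j = d * ∑ j, mu j * y j := fun y => by
    simp only [Finset.mul_sum]
    rw [Finset.sum_comm]
    refine Finset.sum_congr rfl fun j _ => ?_
    rw [← mul_assoc, ← h1, Finset.sum_mul]
    exact Finset.sum_congr rfl fun i _ => by ring
  have hd : d' = d := by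
    have h := swap mu
    simp only [h2, mul_left_comm _ d', ← Finset.mul_sum] at h
    exact mul_right_cancel₀ (Finset.sum_pos (fun i _ => mul_pos (hmu i) (hmu i)) ⟨i, Finset.mem_univ i⟩).ne' h
  have hD : D = d := by
    have h := swap lam
    simp only [h3, mul_left_comm _ D, ← Finset.mul_sum] at h
    exact mul_right_cancel₀ (Finset.sum_pos (fun i _ => mul_pos (hmu i) (hlam i)) ⟨i, Finset.mem_univ i⟩).ne' h
  have h0 : ∀ i j, 0 ≤ A i j * (lam i * mu j - lam j * mu i) ^ 2 / (mu i * mu j) := fun i j =>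
    div_nonneg (mul_nonneg (hA i j) (sq_nonneg _)) (mul_pos (hmu i) (hmu j)).le
  have e1 : ∀ i j, A i j * (lam i * mu j - lam j * mu i) ^ 2 / (mu i * mu j) =
      lam i ^ 2 / mu i * (A i j * mu j) + lam j ^ 2 / mu j * (A i j * mu i) -
        2 * (lam i * (A i j * lam j)) := fun i j => by
    have := (hmu i).ne'
    have := (hmu j).ne'
    field_simp
    ring
  have hS : ∑ i, ∑ j, A i j * (lam i * mu j - lam j * mu i) ^ 2 / (mu i * mu j) = 0 := by
    simp only [e1, Finset.sum_sub_distrib, Finset.sum_add_distrib, ← Finset.mul_sum, h2, h3]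
    rw [Finset.sum_comm (f := fun i j => lam j ^ 2 / mu j * (A i j * mu i))]
    simp only [← Finset.mul_sum, h1, hd, hD]
    rw [Finset.mul_sum, ← Finset.sum_add_distrib, ← Finset.sum_sub_distrib]
    refine Finset.sum_eq_zero fun k _ => ?_
    have := (hmu k).ne'
    field_simp
    ring
  have h4 := (Finset.sum_eq_zero_iff_of_nonneg fun i _ => Finset.sum_nonneg fun j _ => h0 i j).1 hS i
    (Finset.mem_univ _)
  have h5 := (Finset.sum_eq_zero_iff_of_nonneg fun j _ => h0 i j).1 h4 j (Finset.mem_univ _)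
  have h6 := (div_eq_zero_iff.1 h5).resolve_right (mul_pos (hmu i) (hmu j)).ne'
  exact sub_eq_zero.1 (pow_eq_zero_iff two_ne_zero |>.1 ((mul_eq_zero.1 h6).resolve_left hij.ne'))

end PerronFrobenius

/-! ### Weights of a module trace as eigenvectors -/

section TraceWeights

open MonoidalLeftAction

variable {C : Type u} [Category.{v} C] [Abelian C] [Linear ℂ C] [MonoidalCategory C]
variable {V : Type w} [Fintype V] {M : SemisimpleModule.{v, u, vD, uD} C V}
variable {Θ : ∀ m : M.carrier, (m ⟶ m) →ₗ[ℂ] ℂ} {mu : V → ℂ}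

/-- A trace on a semisimple category is determined by its values at the simple objects. -/
theorem eq_weightTrace (hΘ : ∀ {m n : M.carrier} (f : m ⟶ n) (g : n ⟶ m), Θ m (f ≫ g) = Θ n (g ≫ f))
    (hmu : ∀ i, Θ _ (𝟙 (M.simple i)) = mu i) (m : M.carrier) (f : m ⟶ m) :
    Θ m f = weightTrace M mu m f := by
  obtain ⟨n, idx, π, ι, h⟩ := M.reps.exists_decomposition m
  have h1 : f = ∑ k, (f ≫ π k) ≫ ι k := by
    simp only [Category.assoc, ← Preadditive.comp_sum, h, Category.comp_id]
  rw [h1, _root_.map_sum, _root_.map_sum]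
  refine Finset.sum_congr rfl fun k _ => ?_
  rw [hΘ, weightTrace_cyclic, ← M.reps.scal_smul_id _ (ι k ≫ f ≫ π k), _root_.map_smul,
    _root_.map_smul, hmu, weightTrace_id]

theorem weightTrace_id_eq_sum (m : M.carrier) :
    weightTrace M mu m (𝟙 m) = ∑ i, mu i * (Module.finrank ℂ (M.simple i ⟶ m) : ℂ) := by
  rw [weightTrace_apply]
  refine Finset.sum_congr rfl fun i _ => congrArg _ ?_
  have := M.reps.finite (M.simple i) m
  have h1 : Linear.rightComp ℂ (M.simple i) (𝟙 m) = LinearMap.id :=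
    LinearMap.ext fun y => Category.comp_id y
  rw [h1, LinearMap.trace_id]

/-- The trace of the identity of `c ⊙ₗ M.simple j` is computed by decomposition and by partial
trace; the latter gives the scalar `coevR c ≫ ev c` times the weight. -/
theorem IsModuleTrace.exists_sum_finrank_mul [Duality C] (hC : Simple (𝟙_ C))
    [FiniteDimensional ℂ (𝟙_ C ⟶ 𝟙_ C)] (hΘ : IsModuleTrace C Θ)
    (hmu : ∀ i, Θ _ (𝟙 (M.simple i)) = mu i) (c : C) :
    ∃ d : ℂ, ∀ j, ∑ i, mu i * (Module.finrank ℂ (M.simple i ⟶ c ⊙ₗ M.simple j) : ℂ) = d * mu j := by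
  obtain ⟨d, hd⟩ := endomorphism_simple_eq_smul_id ℂ (coevR c ≫ ev c)
  refine ⟨d, fun j => ?_⟩
  rw [← weightTrace_id_eq_sum, ← eq_weightTrace hΘ.cyclic hmu, hΘ.partialTrace]
  have h1 : OrientedGPA.partialTrace c (M.simple j) (𝟙 (c ⊙ₗ M.simple j)) = d • 𝟙 (M.simple j) := by
    rw [OrientedGPA.partialTrace, actionHomRight_id, Category.id_comp, Iso.hom_inv_id_assoc,
      ← comp_actionHomLeft_assoc, ← hd, M.smul_act, id_actionHomLeft]
    simp
  rw [h1, _root_.map_smul, hmu, smul_eq_mul]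

end TraceWeights

/-! ### Orthonormal dual edge bases -/

section UnitaryToPlanar

open MonoidalLeftAction

variable {C : Type u} [Category.{v} C] [Abelian C] [Linear ℂ C] [MonoidalCategory C]
variable [CStarCategory C] [Duality C] {X : C} {V : Type w} [Quiver.{x} V]
variable {M : UnitaryModule.{v, u, vD, uD} X V}
variable {Θ : ∀ m : M.carrier, (m ⟶ m) →ₗ[ℂ] ℂ} {mu : V → ℂ}

/-- The morphism `Mⱼ ⟶ X* ⊗ Mᵢ` dual to `f : Mᵢ ⟶ X ⊗ Mⱼ`. -/
def conjugateHom {i j : V} (f : M.simple i ⟶ X ⊙ₗ M.simple j) :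
    M.simple j ⟶ dual X ⊙ₗ M.simple i :=
  insertPair (coevR X) (M.simple j) ≫ dual X ⊴ₗ dag f

theorem conjugateHom_comp_dag (hU : IsUnitaryPivotal C) {i j : V}
    (f g : M.simple i ⟶ X ⊙ₗ M.simple j) :
    conjugateHom f ≫ dag (conjugateHom g) = contract (ev X) (conjugateHom f) g := by
  have h1 : dag (coevR X ⊵ₗ M.simple j) = ev X ⊵ₗ M.simple j := by
    rw [M.dag_act, ← hU.dag_ev, dag_dag]
  conv_lhs => rw [conjugateHom, conjugateHom]
  rw [dag_comp, insertPair, dag_comp, dag_comp, M.act_dag, dag_dag, M.dag_unit_inv, h1, M.dag_assoc,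
    contract, conjugateHom, insertPair]
  simp only [Category.assoc]

/-- The contraction is the partial trace of `dag f ≫ g`. By the trace property and cyclicity, its
trace is mu_i times the inner product of `g` with `f`, while that of a scalar on `M.simple j`
carries mu_j. -/
theorem evPairing_conjugateHom (hΘ : IsModuleTrace C Θ) (hmu : ∀ i, Θ _ (𝟙 (M.simple i)) = mu i)
    (hmu0 : ∀ i, mu i ≠ 0) {i j : V} (f g : M.simple i ⟶ X ⊙ₗ M.simple j) :
    evPairing X M.toSemisimpleModule i j (conjugateHom f) g = mu i / mu j * M.reps.form g f := by
  rw [div_mul_eq_mul_div, eq_div_iff (hmu0 j), mul_comm, evPairing_apply, ← trace_simple hmu, conjugateHom, contract_comp_middle, ← partialTrace_eq,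
    ← hΘ.partialTrace, hΘ.cyclic, trace_simple hmu]
  rfl

variable [Fintype V] [∀ i j : V, Finite (i ⟶ j)]

theorem UnitaryModule.exists_pos_weights (M : UnitaryModule.{v, u, vD, uD} X V) :
    ∃ (Θ : ∀ m : M.carrier, (m ⟶ m) →ₗ[ℂ] ℂ) (mu : V → ℝ), IsModuleTrace C Θ ∧
      (∀ i, 0 < mu i) ∧ ∀ i, Θ _ (𝟙 (M.simple i)) = mu i := by
  obtain ⟨Θ, hΘ, h⟩ := M.pivotal
  choose mu hmu h using fun i => h (𝟙 (M.simple i)) (M.reps.id_ne_zero i)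
  exact ⟨Θ, mu, hΘ, hmu, fun i => by rw [← h, dag_id, Category.comp_id]⟩

open Classical in
theorem UnitaryModule.exists_orthonormal_basis (M : UnitaryModule.{v, u, vD, uD} X V) (i j : V) :
    ∃ b : Module.Basis (i ⟶ j) ℂ (M.simple i ⟶ X ⊙ₗ M.simple j),
      ∀ e e', M.reps.form (b e) (b e') = if e = e' then 1 else 0 := by
  have := M.reps.finite (M.simple i) (X ⊙ₗ M.simple j)
  obtain ⟨b, hb⟩ := (M.reps.hermForm i (X ⊙ₗ M.simple j)).exists_basis rfl
  let e : Fin (Module.finrank ℂ (M.simple i ⟶ X ⊙ₗ M.simple j)) ≃ (i ⟶ j) :=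
    Fintype.equivOfCardEq (by rw [Fintype.card_fin, M.fusionGraph i j, Nat.card_eq_fintype_card])
  refine ⟨b.reindex e, fun k l => ?_⟩
  rw [Module.Basis.reindex_apply, Module.Basis.reindex_apply, ← M.reps.hermForm_inner, hb]
  exact if_congr (e.symm.injective.eq_iff.trans eq_comm) rfl rfl

theorem UnitaryModule.finrank_dual (hΘ : IsModuleTrace C Θ)
    (hmu : ∀ i, Θ _ (𝟙 (M.simple i)) = mu i) (hmu0 : ∀ i, mu i ≠ 0) (i j : V) :
    Module.finrank ℂ (M.simple j ⟶ dual X ⊙ₗ M.simple i) = Nat.card (i ⟶ j) := by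
  classical
  obtain ⟨b, hb⟩ := M.exists_orthonormal_basis i j
  obtain ⟨h1, h2⟩ := linearIndependent_span_of_evPairing (X := X) hΘ hmu hmu0 (i := i) (j := j)
    (F := b) (G := fun e => conjugateHom (b e)) b.span_eq (div_ne_zero (hmu0 i) (hmu0 j))
    fun e e' => by
      rw [evPairing_conjugateHom hΘ hmu hmu0, hb, mul_ite, mul_one, mul_zero]
  rw [Nat.card_eq_fintype_card]
  exact Module.finrank_eq_card_basis (Module.Basis.mk h1 h2.ge)

/-- The weights are a left eigenvector of the adjacency matrix by the trace property for `X`, and a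
right eigenvector by the one for `X*`, whose multiplicity matrix is the transpose by
`UnitaryModule.finrank_dual`. -/
theorem UnitaryModule.mul_eq_mul (hC : Simple (𝟙_ C)) [FiniteDimensional ℂ (𝟙_ C ⟶ 𝟙_ C)]
    (hΘ : IsModuleTrace C Θ) {mu : V → ℝ} (hmu : ∀ i, Θ _ (𝟙 (M.simple i)) = mu i)
    (hmu0 : ∀ i, 0 < mu i) {lam : V → ℝ} (hlam : IsFrobeniusPerron lam) {i j : V} (e : i ⟶ j) :
    lam i * mu j = lam j * mu i := by
  obtain ⟨hlam0, D, hD⟩ := hlam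
  obtain ⟨d, hd⟩ := hΘ.exists_sum_finrank_mul hC hmu X
  obtain ⟨d', hd'⟩ := hΘ.exists_sum_finrank_mul hC hmu (dual X)
  have hr : ∀ (k : ℕ) (y : ℝ), ((y : ℂ) * (k : ℂ)).re = k * y := fun k y => by
    rw [← Complex.ofReal_natCast, ← Complex.ofReal_mul, Complex.ofReal_re, mul_comm]
  refine mul_eq_mul_of_eigenvectors (A := fun i j => (Nat.card (i ⟶ j) : ℝ)) (d := d.re) (d' := d'.re)
    (fun _ _ => Nat.cast_nonneg _) hmu0 hlam0 (fun j => ?_) (fun i => ?_) hD ?_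
  · have h := congrArg Complex.re (hd j)
    rw [Complex.re_sum, Complex.re_mul_ofReal] at h
    rw [← h]
    refine Finset.sum_congr rfl fun k _ => ?_
    rw [hr, M.fusionGraph k j]
  · have h := congrArg Complex.re (hd' i)
    rw [Complex.re_sum, Complex.re_mul_ofReal] at h
    rw [← h]
    refine Finset.sum_congr rfl fun k _ => ?_
    rw [hr, UnitaryModule.finrank_dual hΘ hmu (fun i => Complex.ofReal_ne_zero.2 (hmu0 i).ne')]
  · exact Nat.cast_pos.2 (Nat.card_pos_iff.2 ⟨⟨e⟩, inferInstance⟩)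

/-- Conjugates of an orthonormal basis of Hom(M_i, X ⊗ M_j) are orthogonal of squared norm
mu_i/mu_j. Scaling by √(mu_j/mu_i) makes them orthonormal and their pairing with the basis equal to
√(mu_i/mu_j), which is √lam_i/√lam_j by proportionality along edges. -/
theorem UnitaryModule.exists_isOrthonormal_isEdgePairing (hC : Simple (𝟙_ C))
    [FiniteDimensional ℂ (𝟙_ C ⟶ 𝟙_ C)] (hU : IsUnitaryPivotal C)
    (M : UnitaryModule.{v, u, vD, uD} X V) {lam : V → ℝ} (hlam : IsFrobeniusPerron lam) :
    ∃ β : EdgeMorphisms M.toSemisimpleModule X, IsEdgeBasis β ∧ IsOrthonormal β ∧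
      IsEdgePairing β fun i => (Real.sqrt (lam i) : ℂ) := by
  classical
  obtain ⟨Θ, mu, hΘ, hmu0, hmu⟩ := M.exists_pos_weights
  have hrat := fun {i j : V} (e : i ⟶ j) => UnitaryModule.mul_eq_mul hC hΘ hmu hmu0 hlam e
  choose b hb using M.exists_orthonormal_basis
  let β : EdgeMorphisms M.toSemisimpleModule X := fun a => match a with
    | true => fun i j e => b i j e
    | false => fun j i e => (Real.sqrt (mu j / mu i) : ℂ) • conjugateHom (b i j e)
  have hs : ∀ {i j : V}, (i ⟶ j) → (Real.sqrt (mu j / mu i)) * (mu i / mu j) =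
      Real.sqrt (lam i) / Real.sqrt (lam j) := fun {i j} e => by
    have h1 := hmu0 i
    have h2 := hmu0 j
    have h3 := hlam.1 i
    have h4 := hlam.1 j
    have h5 : lam i / lam j = mu i / mu j := by
      rw [div_eq_div_iff h4.ne' h2.ne']
      linear_combination hrat e
    rw [← Real.sqrt_div h3.le, h5]
    have h6 : ∀ q : ℝ, 0 < q → Real.sqrt q⁻¹ * q = Real.sqrt q := fun q hq => by
      have h7 := (Real.sqrt_pos.2 hq).ne'
      rw [Real.sqrt_inv, inv_mul_eq_iff_eq_mul₀ h7, Real.mul_self_sqrt hq.le]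
    rw [← inv_div, h6 _ (div_pos h1 h2)]
  have hpair : ∀ {i j : V} (e e' : i ⟶ j), evPairing X M.toSemisimpleModule i j
      (conjugateHom (b i j e')) (b i j e) = if e = e' then (mu i / mu j : ℂ) else 0 :=
    fun {i j} e e' => by
      rw [evPairing_conjugateHom hΘ hmu (fun i => Complex.ofReal_ne_zero.2 (hmu0 i).ne'), hb, mul_ite,
        mul_one, mul_zero]
  have key := isEdgeBasis_isEdgePairing_of_ev (X := X) hΘ hmu
    (fun i => Complex.ofReal_ne_zero.2 (hmu0 i).ne') (r := fun i => (Real.sqrt (lam i) : ℂ)) (β := β)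
    (fun i => Complex.ofReal_ne_zero.2 (Real.sqrt_pos.2 (hlam.1 i)).ne')
    (fun {i j} e => by
      rw [← Complex.ofReal_pow, ← Complex.ofReal_pow, Real.sq_sqrt (hlam.1 i).le,
        Real.sq_sqrt (hlam.1 j).le, ← Complex.ofReal_mul, ← Complex.ofReal_mul]
      exact congrArg _ (by linear_combination hrat e))
    (fun i j => ⟨(b i j).linearIndependent, (b i j).span_eq⟩)
    (fun {i j} e e' => by
      change evPairing X M.toSemisimpleModule i j
        ((Real.sqrt (mu j / mu i) : ℂ) • conjugateHom (b i j e')) (b i j e) = _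
      rw [_root_.map_smul, LinearMap.smul_apply, hpair, smul_eq_mul, mul_ite, mul_zero]
      refine if_congr Iff.rfl ?_ rfl
      have h := hs e
      exact_mod_cast h)
  refine ⟨β, key.1, fun a i j e e' => ?_, key.2⟩
  have hscal : ∀ {i : V} (f : M.simple i ⟶ M.simple i), M.reps.scal i f = (if e = e' then 1 else 0) →
      f = if e = e' then 𝟙 (M.simple i) else 0 := fun {i} f h => by
    rw [← M.reps.scal_smul_id i f, h]
    split <;> simp
  refine hscal _ ?_
  cases a with
  | true => exact hb i j e e'
  | false =>
    have h1 : M.reps.scal i (conjugateHom (b j i e) ≫ dag (conjugateHom (b j i e'))) =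
        if e = e' then (mu j / mu i : ℂ) else 0 := by
      rw [conjugateHom_comp_dag hU]
      exact (hpair e' e).trans (if_congr eq_comm rfl rfl)
    change M.reps.form ((Real.sqrt (mu i / mu j) : ℂ) • conjugateHom (b j i e))
      ((Real.sqrt (mu i / mu j) : ℂ) • conjugateHom (b j i e')) = _
    rw [M.reps.form_smul_left, M.reps.form_smul_right, IsSimpleReps.form, h1, Complex.conj_ofReal,
      ← mul_assoc, ← Complex.ofReal_mul, Real.mul_self_sqrt (div_pos (hmu0 i) (hmu0 j)).le, mul_ite,
      mul_zero]
    refine if_congr Iff.rfl ?_ rfl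
    have h2 : (mu i : ℂ) ≠ 0 := Complex.ofReal_ne_zero.2 (hmu0 i).ne'
    have h3 : (mu j : ℂ) ≠ 0 := Complex.ofReal_ne_zero.2 (hmu0 j).ne'
    push_cast
    field_simp

end UnitaryToPlanar

/-! ### The bijections in the unitary case -/

section UnitaryBijection

open MonoidalLeftAction

section Relabelling

variable {C : Type u} [Category.{v} C] [Abelian C] [Linear ℂ C] [MonoidalCategory C]
variable [CStarCategory C] [Duality C] {X : C} {V : Type w} [Quiver.{x} V]

/-- A unitary module category with its simple objects relabelled. -/
abbrev UnitaryModule.relabel (M : UnitaryModule.{v, u, vD, uD} X V) (σ : V ≃ V)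
    (h : (M.toSemisimpleModule.relabel σ).HasFusionGraph X) : UnitaryModule.{v, u, vD, uD} X V where
  toSemisimpleModule := M.toSemisimpleModule.relabel σ
  cstar := M.cstar
  dag_act := M.dag_act
  act_dag := M.act_dag
  dag_assoc := M.dag_assoc
  dag_unit := M.dag_unit
  fusionGraph := h
  pivotal := M.pivotal

theorem unitaryModuleEquivalent_relabel (M : UnitaryModule.{v, u, vD, uD} X V) (σ : V ≃ V)
    (h : (M.toSemisimpleModule.relabel σ).HasFusionGraph X) :
    UnitaryModuleEquivalent M (M.relabel σ h) :=
  letI inst : (𝟭 M.carrier).LeftLinear C :=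
    leftLinearOfIso _ (fun _ _ => Iso.refl _) (by simp) (by simp) (by simp) (by simp)
  ⟨𝟭 M.carrier, inst,
    ⟨inferInstanceAs (𝟭 M.carrier).IsEquivalence, fun _ _ => rfl, fun _ _ => rfl⟩,
    ⟨fun _ => rfl, fun _ _ => dag_id (D := M.carrier) _⟩⟩

variable [Fintype V] [∀ i j : V, Finite (i ⟶ j)]
variable {φ : ∀ a b : List Bool, (planarAlgebraOf X).Hom a b → GHom V a b}

theorem UnitarilyCorresponds.corresponds {M : UnitaryModule.{v, u, vD, uD} X V}
    (h : UnitarilyCorresponds M φ) : Corresponds M.toSemisimpleModule φ := by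
  obtain ⟨β, hβ, -, hφ⟩ := h
  exact ⟨β, hβ, hφ⟩

theorem UnitarilyCorresponds.relabel {M : UnitaryModule.{v, u, vD, uD} X V} {σ τ : V ≃ V}
    {hσ : (M.toSemisimpleModule.relabel σ).HasFusionGraph X}
    {hτ : (M.toSemisimpleModule.relabel τ).HasFusionGraph X}
    (h : UnitarilyCorresponds (M.relabel σ hσ) φ) (ρ : GraphAut V) (hρ : τ = ρ.vert.trans σ) :
    UnitarilyCorresponds (M.relabel τ hτ) fun a b f => ρ.pull (φ a b f) := by
  classical
  subst hρ
  obtain ⟨β, h1, h2, h3⟩ := h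
  refine ⟨relabelEdges β ρ, isEdgeBasis_relabelEdges h1 ρ, fun a i j e e' => ?_,
    isActionMatrix_relabelEdges ρ h3⟩
  refine (h2 a (ρ.vert i) (ρ.vert j) (ρ.sedge e) (ρ.sedge e')).trans ?_
  exact if_congr (ρ.sedge_bijective a i j).1.eq_iff rfl rfl

end Relabelling

variable {C : Type u} [Category.{v} C] [Abelian C] [Linear ℂ C] [MonoidalCategory C]
variable [MonoidalPreadditive C] [MonoidalLinear ℂ C] [CStarCategory C] [PivotalCategory C]
variable {X : C} {V : Type w} [Quiver.{x} V] [Fintype V] [Nonempty V] [∀ i j : V, Finite (i ⟶ j)]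

theorem UnitaryModule.exists_unitarilyCorresponds (hC : IsFusion C) (hU : IsUnitaryPivotal C)
    {lam : V → ℝ} (hlam : IsFrobeniusPerron lam) (M : UnitaryModule.{v, u, vD, uD} X V) :
    ∃ φ : StarPlanarEmbedding (starPlanarAlgebraOf X) (oGPA V fun i => (Real.sqrt (lam i) : ℂ)),
      UnitarilyCorresponds M fun _ _ f => φ.map f := by
  have := hC.finiteDimensional (𝟙_ C) (𝟙_ C)
  obtain ⟨β, hβ, ho, h⟩ := M.exists_isOrthonormal_isEdgePairing hC.simple_unit hU hlam
  have hr : ∀ i, (Real.sqrt (lam i) : ℂ) ≠ 0 := fun i =>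
    Complex.ofReal_ne_zero.2 (Real.sqrt_pos.2 (hlam.1 i)).ne'
  exact ⟨{ toPlanarEmbedding := planarEmbeddingOf hC hβ hr h
           map_dag := fun f => (ho.dag_actionMatrix ho hβ hβ f).symm },
    β, hβ, ho, isActionMatrix_planarEmbeddingOf hC hβ hr h⟩

variable {lam : V → ℝ}

theorem inducesBijection_labelled_unitary (hC : IsFusion C) (hX : IsTensorGenerator X)
    (hU : IsUnitaryPivotal C) (hlam : IsFrobeniusPerron lam) :
    InducesBijection
      (fun M M' : UnitaryModule.{v, u, vD, uD} X V => LabelledUnitaryModuleEquivalent M M')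
      (fun φ ψ : StarPlanarEmbedding (starPlanarAlgebraOf X)
          (oGPA V fun i => (Real.sqrt (lam i) : ℂ)) =>
        UnitarilyNatIsomorphic (P := planarAlgebraOf X)
          (Q := oGPA V fun i => (Real.sqrt (lam i) : ℂ))
          (fun _ _ f => φ.map f) (fun _ _ f => ψ.map f))
      (fun M φ => UnitarilyCorresponds M (fun _ _ f => φ.map f)) := by
  refine inducesBijection_of (fun M => M.exists_unitarilyCorresponds hC hU hlam)
    (fun φ => φ.exists_unitarilyCorresponds hC hX hU hlam.1) ?_ ?_
  · intro M φ h M'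
    constructor
    · rintro ⟨F, _, hF, hL, hF'⟩
      exact (unitarilyCorresponds_iff_of_equivalence F hF hL hF' _).1 h
    · exact fun h' => h.labelledUnitaryModuleEquivalent hC hX hU φ h'
  · exact fun M φ h ψ => ⟨h.of_unitarilyNatIsomorphic _, h.unitarilyNatIsomorphic _⟩

omit [Nonempty V] in
theorem exists_unitarilyCorresponds_relabel_iff
    {φ : ∀ a b : List Bool, (planarAlgebraOf X).Hom a b → GHom V a b}
    (M : UnitaryModule.{v, u, vD, uD} X V) :
    (∃ M' : UnitaryModule.{v, u, vD, uD} X V, UnitaryModuleEquivalent M M' ∧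
      UnitarilyCorresponds M' φ) ↔
        ∃ σ hσ, UnitarilyCorresponds (M.relabel σ hσ) φ := by
  constructor
  · rintro ⟨M', ⟨F, _, hF, hF'⟩, h⟩
    obtain ⟨σ, hσ⟩ := exists_respectsLabels_relabel F hF
    -- A relabelling is a unitary module in the present sense only if its fusion graph is the given
    -- one. The plain correspondence, transported first, provides this.
    have h1 := (corresponds_iff_of_equivalence (M := M.toSemisimpleModule.relabel σ.symm) F
      ⟨hF.isEquivalence, hF.map_add, hF.map_smul⟩ hσ.relabel_symm φ).2 h.corresponds
    obtain ⟨β, hβ, -⟩ := id h1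
    have hG := SemisimpleModule.hasFusionGraph_of_isEdgeBasis hβ
    exact ⟨σ.symm, hG, (unitarilyCorresponds_iff_of_equivalence (M := M.relabel σ.symm hG) F
      ⟨hF.isEquivalence, hF.map_add, hF.map_smul⟩ hσ.relabel_symm
      ⟨hF'.map_dag, hF'.dag_lineator⟩ φ).2 h⟩
  · rintro ⟨σ, hσ, h⟩
    exact ⟨M.relabel σ hσ, unitaryModuleEquivalent_relabel M σ hσ, h⟩

theorem inducesBijection_unlabelled_unitary (hC : IsFusion C) (hX : IsTensorGenerator X)
    (hU : IsUnitaryPivotal C) (hlam : IsFrobeniusPerron lam) :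
    InducesBijection
      (fun M M' : UnitaryModule.{v, u, vD, uD} X V => UnitaryModuleEquivalent M M')
      (fun φ ψ : StarPlanarEmbedding (starPlanarAlgebraOf X)
          (oGPA V fun i => (Real.sqrt (lam i) : ℂ)) =>
        ∃ σ : GraphAut V, UnitarilyNatIsomorphic (P := planarAlgebraOf X)
          (Q := oGPA V fun i => (Real.sqrt (lam i) : ℂ))
          (fun _ _ f => σ.pull (φ.map f)) (fun _ _ f => ψ.map f))
      (fun M φ => ∃ M' : UnitaryModule.{v, u, vD, uD} X V, UnitaryModuleEquivalent M M' ∧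
        UnitarilyCorresponds M' (fun _ _ f => φ.map f)) := by
  have hR := fun (M : UnitaryModule.{v, u, vD, uD} X V)
      (φ : StarPlanarEmbedding (starPlanarAlgebraOf X) (oGPA V fun i => (Real.sqrt (lam i) : ℂ))) =>
    exists_unitarilyCorresponds_relabel_iff (φ := fun _ _ f => φ.map f) M
  refine inducesBijection_of (fun M => ?_) (fun φ => ?_) (fun M φ h M' => ?_) (fun M φ h ψ => ?_)
  · obtain ⟨φ, h⟩ := M.exists_unitarilyCorresponds hC hU hlam
    exact ⟨φ, (hR M φ).2 ⟨Equiv.refl V, M.fusionGraph, h⟩⟩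
  · obtain ⟨M, h⟩ := φ.exists_unitarilyCorresponds hC hX hU hlam.1
    exact ⟨M, (hR M φ).2 ⟨Equiv.refl V, M.fusionGraph, h⟩⟩
  · rw [hR M' φ]
    obtain ⟨σ, hσ, h⟩ := (hR M φ).1 h
    constructor
    · rintro ⟨F, _, hF, hF'⟩
      have hr := hF.relabel σ (Equiv.refl V)
      obtain ⟨τ, hτ⟩ := exists_respectsLabels_relabel (M := M.toSemisimpleModule.relabel σ) F hr
      have h1 := (corresponds_iff_of_equivalence (M := M.toSemisimpleModule.relabel σ)
        (M' := M'.toSemisimpleModule.relabel τ) F (hF.relabel σ τ) hτ _).1 h.corresponds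
      obtain ⟨β, hβ, -⟩ := id h1
      have hG := SemisimpleModule.hasFusionGraph_of_isEdgeBasis hβ
      exact ⟨τ, hG, (unitarilyCorresponds_iff_of_equivalence (M := M.relabel σ hσ)
        (M' := M'.relabel τ hG) F (hF.relabel σ τ) hτ ⟨hF'.map_dag, hF'.dag_lineator⟩ _).1 h⟩
    · rintro ⟨τ, hτ, h'⟩
      obtain ⟨F, i, hF, -, hF'⟩ := h.labelledUnitaryModuleEquivalent hC hX hU φ h'
      exact ⟨F, i, ⟨hF.isEquivalence, hF.map_add, hF.map_smul⟩, ⟨hF'.map_dag, hF'.dag_lineator⟩⟩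
  · rw [hR M ψ]
    obtain ⟨σ, hσ, h⟩ := (hR M φ).1 h
    constructor
    · rintro ⟨g, hg⟩
      have h1 := h.corresponds.relabel g rfl
      obtain ⟨β, hβ, -⟩ := id h1
      have hG := SemisimpleModule.hasFusionGraph_of_isEdgeBasis hβ
      exact ⟨_, hG, (h.relabel g rfl).of_unitarilyNatIsomorphic _ hg⟩
    · rintro ⟨τ, hτ, h'⟩
      obtain ⟨g, hg⟩ := exists_graphAut hσ hτ
      exact ⟨g, (h.relabel (hτ := hτ) g hg).unitarilyNatIsomorphic _ h'⟩

end UnitaryBijection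

end OrientedGPA

end

theorem mainTheorem3 {C : Type u} [Category.{v} C] [Abelian C] [Linear ℂ C] [MonoidalCategory C]
    [MonoidalPreadditive C] [MonoidalLinear ℂ C] [PivotalCategory C] (hC : IsFusion C)
    (X : C) (hX : IsTensorGenerator X)
    (V : Type w) [Fintype V] [Nonempty V] [Quiver.{x} V] [∀ i j : V, Finite (i ⟶ j)] :
    -- pivotal module categories with trace weights `lam`
    (∀ (lam r : V → ℂ), (∀ i, lam i ≠ 0) → (∀ i, r i ^ 2 = lam i) →
      -- simple objects identified with the vertices of the graph
      InducesBijection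
        (fun M M' : PivotalModule.{v, u, vD, uD} X V lam =>
          LabelledModuleEquivalent M.toSemisimpleModule M'.toSemisimpleModule)
        (fun φ ψ : PlanarEmbedding (planarAlgebraOf X) (oGPA V r).toPlanarData =>
          NatIsomorphic (fun _ _ f => φ.map f) (fun _ _ f => ψ.map f))
        (fun M φ => Corresponds (X := X) M.toSemisimpleModule (fun _ _ f => φ.map f)) ∧
      -- without identification, modulo automorphisms of the graph
      InducesBijection
        (fun M M' : PivotalModule.{v, u, vD, uD} X V lam =>
          ModuleEquivalent M.toSemisimpleModule M'.toSemisimpleModule)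
        (fun φ ψ : PlanarEmbedding (planarAlgebraOf X) (oGPA V r).toPlanarData =>
          ∃ σ : GraphAut V, NatIsomorphic (P := planarAlgebraOf X) (Q := (oGPA V r).toPlanarData)
            (fun _ _ f => σ.pull (φ.map f)) (fun _ _ f => ψ.map f))
        (fun M φ => ∃ M' : PivotalModule.{v, u, vD, uD} X V lam,
          ModuleEquivalent M.toSemisimpleModule M'.toSemisimpleModule ∧
            Corresponds (X := X) M'.toSemisimpleModule (fun _ _ f => φ.map f))) ∧
    -- the unitary case
    (∀ [CStarCategory C], IsUnitaryPivotal C → ∀ lam : V → ℝ, IsFrobeniusPerron lam →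
      -- simple objects identified with the vertices of the graph
      InducesBijection
        (fun M M' : UnitaryModule.{v, u, vD, uD} X V => LabelledUnitaryModuleEquivalent M M')
        (fun φ ψ : StarPlanarEmbedding (starPlanarAlgebraOf X)
            (oGPA V fun i => (Real.sqrt (lam i) : ℂ)) =>
          UnitarilyNatIsomorphic (P := planarAlgebraOf X)
            (Q := oGPA V fun i => (Real.sqrt (lam i) : ℂ))
            (fun _ _ f => φ.map f) (fun _ _ f => ψ.map f))
        (fun M φ => UnitarilyCorresponds M (fun _ _ f => φ.map f)) ∧
      -- without identification, modulo automorphisms of the graph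
      InducesBijection
        (fun M M' : UnitaryModule.{v, u, vD, uD} X V => UnitaryModuleEquivalent M M')
        (fun φ ψ : StarPlanarEmbedding (starPlanarAlgebraOf X)
            (oGPA V fun i => (Real.sqrt (lam i) : ℂ)) =>
          ∃ σ : GraphAut V, UnitarilyNatIsomorphic (P := planarAlgebraOf X)
            (Q := oGPA V fun i => (Real.sqrt (lam i) : ℂ))
            (fun _ _ f => σ.pull (φ.map f)) (fun _ _ f => ψ.map f))
        (fun M φ => ∃ M' : UnitaryModule.{v, u, vD, uD} X V, UnitaryModuleEquivalent M M' ∧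
          UnitarilyCorresponds M' (fun _ _ f => φ.map f))) := by
  refine ⟨fun lam r hlam hr => ⟨inducesBijection_labelled hC hX hlam hr,
    inducesBijection_unlabelled hC hX hlam hr⟩, ?_⟩
  intro _ hU lam hlam
  exact ⟨inducesBijection_labelled_unitary hC hX hU hlam,
    inducesBijection_unlabelled_unitary hC hX hU hlam⟩
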